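/- **Setting.** For a bipartite graph $G=(V,E)$, a fractional matching is a vector $x\in\mathbb R_{\ge 0}^E$ with $x(v)=\sum_{e\ni v}x_e\le 1$ for all $v\in V$. Write $\|x\|=\sum_e x_e$, $\mathrm{supp}(x)=\{e: x_e>0\}$, $x_{\min}=\min_{e\in\mathrm{supp}(x)}x_e$, and $\mathrm{supp}_i(x)=\{e:\lfloor 2^i x_e\rfloor \text{ is odd}\}$ (the edges whose $i$-th binary digit is $1$). A dynamic bipartite matching rounding algorithm is initialized by $\mathrm{init}(G,x,\varepsilon)$ with $\varepsilon\in(0,1)$ and then processes a sequence of operations $\mathrm{update}(e,\nu)$, each of which sets $x_e\gets\nu$, under the promise that $x$ always is a fractional matching of $G$; after each operation it must hold a matching $M\subseteq\mathrm{supp}(x)$ with $|M|\ge(1-\varepsilon)\|x\|$. Let $\delta\in(0,1]$ be known to the algorithm, under the promise that $x_{\min}\ge\delta$ after each operation. **Subroutine.** $\mathrm{degree\text{-}split}$ partitions a multigraph with $m$ edges and edge multiplicities at most two into two simple edge sets $E_1,E_2$ with $|E_1|=\lceil m/2\rceil$, $|E_2|=\lfloor m/2\rfloor$, in each of which every vertex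 $v$ of degree $d(v)$ has degree within $1$ of $d(v)/2$, and, if the multigraph is bipartite, degree in $[\lfloor d(v)/2\rfloor,\lceil d(v)/2\rceil]$. **Algorithm** (accuracy parameter $\eta$, lower bound $\delta$). It stores $x$, sets $E_i,F_i\subseteq E$ and counters $c_i$ for $0\le i\le L$, where $L=1+\lceil\log_2(\eta^{-1}\delta^{-1})\rceil$. Its output is always $M=E_0\cup F_0$. * $\mathrm{init}$: store $x$, set all $F_i\gets\emptyset$, $c_i\gets 0$, and call $\mathrm{rebuild}(L)$. * $\mathrm{rebuild}(i)$: for $j=i,i-1,\dots,0$: set $E_j\gets\mathrm{supp}_j(x)$, $c_j\gets0$ and, if $j\ne0$, let $F_{j-1}$ be the first set output by $\mathrm{degree\text{-}split}$ on the multigraph $E_j\uplus F_j$. * $\mathrm{update}(e,\nu)$: set $x_e\gets\nu$; for $i=L,L-1,\dots,0$: remove $e$ from $E_i$; if $i\neq0$, remove $e$ from $F_{i-1}$ if $e\in F_{i-1}$, and otherwise remove from $F_{i-1}$ one edge incident to each endpoint of $e$ (if there is one); set $c_i\gets c_i+1$; if $c_i>2^{i-2}\,\eta\|x\|/L$, call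 $\mathrm{rebuild}(i)$ and return. **Theorem.** 1. For all $\varepsilon\in(0,1)$ and $\delta\in(0,1]$, the algorithm run with accuracy $\eta=\varepsilon/2$ on a bipartite graph, under the promise $x_{\min}\ge\delta$ throughout, is a dynamic bipartite matching rounding algorithm with error $\varepsilon$: whatever admissible outputs $\mathrm{degree\text{-}split}$ returns and whichever incident edges are removed, after each operation $M\subseteq\mathrm{supp}(x)$, $M$ is a matching and $|M|\ge(1-\varepsilon)\|x\|$. 2. The algorithm has a deterministic word RAM implementation: two fixed programs (for $\mathrm{init}$ and $\mathrm{update}$) and absolute constants $b,C$ such that the following holds for all $n$, all bipartite graphs $G$ on $n$ vertices, all $\varepsilon\in(0,1)$, $\delta\in(0,1]$, and all inputs that satisfy the promise $x_{\min}\ge\delta$ and $\|x\|\ge1$ throughout. Let $K=\lceil 2/\varepsilon\rceil$, $D=\lceil1/\delta\rceil$. The machine has zero-initialized memory and words of $b\lceil\log_2(nKD)\rceil$ bits, and is given $n,K,D$, the list of the nonzero entries of $x$, and the updates, with all values truncated to their first $L$ binary digits after the point, where $L=1+\lceil\log_2(KD)\rceil$. After each operation its memory holds, as an array of mates, the output $M$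 of a run of the algorithm with accuracy $1/K$ and lower bound $1/D$ on the truncated input; $M$ is a matching, $M\subseteq\mathrm{supp}(x)$ and $|M|\ge(1-\varepsilon)\|x\|$ for the untruncated $x$. The $\mathrm{init}$ time is at most $C\,|\mathrm{supp}(x)|\log_2\frac{2}{\varepsilon\delta}$, and the amortized $\mathrm{update}$ time is at most $C\,\varepsilon^{-1}\log_2^2\frac{2}{\varepsilon\delta}$, i.e. for every $t$ the first $t$ updates take at most $t\cdot C\,\varepsilon^{-1}\log_2^2\frac{2}{\varepsilon\delta}$ time in total. -/

import Mathlib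

open Finset

namespace DynRound

/-! ### Fractional matchings and roundings -/

section Matchings

variable {V : Type*} [Fintype V] [DecidableEq V]

/-- The value `‖x‖ = ∑ₑ xₑ` of a vector indexed by (potential) edges. -/
noncomputable def total (x : Sym2 V → ℝ) : ℝ := ∑ e, x e

open Classical in
/-- The support `{e | xₑ > 0}`. -/
noncomputable def supp (x : Sym2 V → ℝ) : Finset (Sym2 V) := {e | 0 < x e}

/-- `x` is a fractional matching of `G`: a nonnegative vector that vanishes outside the edge set
and satisfies `x(v) = ∑_{e ∋ v} xₑ ≤ 1` at every vertex. -/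
def IsFractionalMatching (G : SimpleGraph V) (x : Sym2 V → ℝ) : Prop :=
  (∀ e, 0 ≤ x e) ∧ (∀ e, e ∉ G.edgeSet → x e = 0) ∧ ∀ v, ∑ e with v ∈ e, x e ≤ 1

/-- The promise on the dynamic input: `x` is a fractional matching of `G` and `x_min ≥ δ`. -/
def Promise (G : SimpleGraph V) (δ : ℝ) (x : Sym2 V → ℝ) : Prop :=
  IsFractionalMatching G x ∧ ∀ e ∈ supp x, δ ≤ x e

/-- A set of edges no two of which share a vertex. -/
def IsMatching (M : Finset (Sym2 V)) : Prop :=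
  ∀ e ∈ M, ∀ f ∈ M, ∀ v, v ∈ e → v ∈ f → e = f

/-- `M` is an `ε`-approximate rounding of `x`: `M ⊆ supp x`, `M` is a matching, and
`|M| ≥ (1 - ε) ‖x‖`. -/
def IsRounding (ε : ℝ) (x : Sym2 V → ℝ) (M : Finset (Sym2 V)) : Prop :=
  M ⊆ supp x ∧ IsMatching M ∧ (1 - ε) * total x ≤ (M.card : ℝ)

/-! ### Binary digits -/

/-- The `i`-th digit `(y)ᵢ` of `y = ∑ᵢ (y)ᵢ 2^{-i} ∈ [0, 1]`. -/
noncomputable def digit (y : ℝ) (i : ℕ) : ℕ := ⌊(2 : ℝ) ^ i * y⌋₊ % 2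

/-- `suppᵢ(x)`: the edges whose value has `i`-th digit one. -/
noncomputable def suppDigit (x : Sym2 V → ℝ) (i : ℕ) : Finset (Sym2 V) := {e | digit (x e) i = 1}

/-- `y` as a fixed-point number with `L` fractional digits: the integer `⌊2^L y⌋`. -/
noncomputable def fix (L : ℕ) (y : ℝ) : ℕ := ⌊(2 : ℝ) ^ L * y⌋₊

/-- `y` with all digits beyond the `L`-th set to zero. -/
noncomputable def trunc (L : ℕ) (y : ℝ) : ℝ := fix L y / 2 ^ L

/-- The number of layers, `L = 1 + ⌈log₂(η⁻¹ δ⁻¹)⌉`. -/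
noncomputable def layers (η δ : ℝ) : ℕ := 1 + ⌈Real.logb 2 (η⁻¹ * δ⁻¹)⌉₊

/-! ### The degree-split subroutine -/

/-- The degree of `v` in the graph with edge set `A`. -/
def deg (A : Finset (Sym2 V)) (v : V) : ℕ := #{e ∈ A | v ∈ e}

/-- `(E₁, E₂)` is an admissible output of degree-split on the multigraph `A ⊎ B`: the two simple
edge sets partition the multigraph, they have sizes `⌈m/2⌉` and `⌊m/2⌋`, and they halve every
degree `d` up to an additive one, respectively lie between `⌊d/2⌋` and `⌈d/2⌉` in the bipartite
case. -/
def IsDegreeSplit (A B E₁ E₂ : Finset (Sym2 V)) : Prop :=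
  A.val + B.val = E₁.val + E₂.val ∧
  #E₁ = (#A + #B + 1) / 2 ∧ #E₂ = (#A + #B) / 2 ∧
  (∀ H, H = E₁ ∨ H = E₂ → ∀ v,
    ((deg A v + deg B v : ℕ) : ℝ) / 2 - 1 ≤ deg H v ∧
    (deg H v : ℝ) ≤ ((deg A v + deg B v : ℕ) : ℝ) / 2 + 1) ∧
  ((SimpleGraph.fromEdgeSet (A ∪ B : Set (Sym2 V))).IsBipartite →
    ∀ H, H = E₁ ∨ H = E₂ → ∀ v,
      (deg A v + deg B v) / 2 ≤ deg H v ∧ deg H v ≤ (deg A v + deg B v + 1) / 2)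

/-! ### The hierarchical dynamic algorithm

The two steps that leave a choice (which admissible split degree-split returns, and which edge
at an endpoint is removed) are kept as a choice, so the algorithm is a relation between states. -/

/-- The global variables: the vector `x`, the sets `Eᵢ`, the partial roundings `Fᵢ` and the update
counts `cᵢ`. -/
structure AlgState (V : Type*) where
  x : Sym2 V → ℝ
  E : ℕ → Finset (Sym2 V)
  F : ℕ → Finset (Sym2 V)
  c : ℕ → ℕ

/-- The output `M = E₀ ∪ F₀`. -/
def AlgState.M (s : AlgState V) : Finset (Sym2 V) := s.E 0 ∪ s.F 0

/-- `Eⱼ ← suppⱼ(x)` and `cⱼ ← 0`. -/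
noncomputable def AlgState.reload (s : AlgState V) (j : ℕ) : AlgState V :=
  { s with E := Function.update s.E j (suppDigit s.x j), c := Function.update s.c j 0 }

/-- `rebuild(i)`: for `j = i, …, 0`, set `Eⱼ ← suppⱼ(x)`, `cⱼ ← 0` and, if `j ≠ 0`, let `Fⱼ₋₁` be
the first edge set output by degree-split on `Eⱼ ⊎ Fⱼ`. -/
inductive Rebuild : ℕ → AlgState V → AlgState V → Prop
  | zero (s : AlgState V) : Rebuild 0 s (s.reload 0)
  | succ (j : ℕ) (s s' : AlgState V) (E₁ E₂ : Finset (Sym2 V)) :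
      IsDegreeSplit (suppDigit s.x (j + 1)) (s.F (j + 1)) E₁ E₂ →
      Rebuild j { s.reload (j + 1) with F := Function.update s.F j E₁ } s' →
      Rebuild (j + 1) s s'

/-- Remove one edge incident to `v` from `F`, if there is one. -/
def RemoveAt (v : V) (F F' : Finset (Sym2 V)) : Prop :=
  (∃ f ∈ F, v ∈ f ∧ F' = F.erase f) ∨ ((∀ f ∈ F, v ∉ f) ∧ F' = F)

/-- If `e ∈ F`, remove `e` from `F`; otherwise remove one edge incident to each endpoint of `e`. -/
def Remove (e : Sym2 V) (F F' : Finset (Sym2 V)) : Prop :=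
  (e ∈ F ∧ F' = F.erase e) ∨
  (e ∉ F ∧ ∃ u v F₁, e = s(u, v) ∧ RemoveAt u F F₁ ∧ RemoveAt v F₁ F')

/-- The body of the loop of `update` at level `i`, up to and including `cᵢ ← cᵢ + 1`. -/
inductive Visit (e : Sym2 V) : ℕ → AlgState V → AlgState V → Prop
  | zero (s : AlgState V) :
      Visit e 0 s { s with
        E := Function.update s.E 0 ((s.E 0).erase e)
        c := Function.update s.c 0 (s.c 0 + 1) }
  | succ (j : ℕ) (s : AlgState V) (F' : Finset (Sym2 V)) : Remove e (s.F j) F' →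
      Visit e (j + 1) s { s with
        E := Function.update s.E (j + 1) ((s.E (j + 1)).erase e)
        F := Function.update s.F j F'
        c := Function.update s.c (j + 1) (s.c (j + 1) + 1) }

/-- The test `cᵢ > 2^{i-2} · η ‖x‖ / L`. -/
def Due (η : ℝ) (L : ℕ) (s : AlgState V) (i : ℕ) : Prop :=
  (2 : ℝ) ^ ((i : ℤ) - 2) * (η * total s.x / L) < s.c i

/-- The loop of `update` over the levels `i, i - 1, …, 0`; the first level whose test succeeds is
rebuilt, and then the loop is left. -/
inductive Sweep (η : ℝ) (L : ℕ) (e : Sym2 V) : ℕ → AlgState V → AlgState V → Prop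
  | rebuild (i : ℕ) (s s₁ s' : AlgState V) :
      Visit e i s s₁ → Due η L s₁ i → Rebuild i s₁ s' → Sweep η L e i s s'
  | next (i : ℕ) (s s₁ s' : AlgState V) :
      Visit e (i + 1) s s₁ → ¬ Due η L s₁ (i + 1) → Sweep η L e i s₁ s' →
      Sweep η L e (i + 1) s s'
  | done (s s₁ : AlgState V) : Visit e 0 s s₁ → ¬ Due η L s₁ 0 → Sweep η L e 0 s s₁

/-- `s` is a possible state after `init` on the vector `x` with `L` layers. -/
def InitStep (L : ℕ) (x : Sym2 V → ℝ) (s : AlgState V) : Prop :=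
  Rebuild L { x := x, E := fun _ => ∅, F := fun _ => ∅, c := fun _ => 0 } s

/-- `s'` is a possible state after `update(e, ν)` in state `s`, with accuracy `η` and `L` layers. -/
def UpdateStep (η : ℝ) (L : ℕ) (e : Sym2 V) (ν : ℝ) (s s' : AlgState V) : Prop :=
  Sweep η L e L { s with x := Function.update s.x e ν } s'

/-- The states that the algorithm with accuracy `η` and known lower bound `δ` can reach by `init`
and any finite sequence of `update`s, as long as the input keeps the promise. -/
inductive Reachable (G : SimpleGraph V) (η δ : ℝ) : AlgState V → Prop
  | init (x : Sym2 V → ℝ) (s : AlgState V) :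
      Promise G δ x → InitStep (layers η δ) x s → Reachable G η δ s
  | update (s s' : AlgState V) (e : Sym2 V) (ν : ℝ) :
      Reachable G η δ s → e ∈ G.edgeSet → Promise G δ (Function.update s.x e ν) →
      UpdateStep η (layers η δ) e ν s s' → Reachable G η δ s'

end Matchings

/-! ### The word RAM

A deterministic random access machine with words of `w` bits. The memory consists of registers and
of arrays, each addressed by words; a program mentions finitely many of them. Every arithmetic
operation, memory access, assignment and test costs one time unit, and a program that computes a
number of more than `w` bits is stuck. -/

/-- Arithmetic and comparison (with values `0`, `1`) of words. -/
inductive Op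
  | add | sub | mul | div | mod | lt | eq

/-- Value of an operation; subtraction is truncated at zero. -/
def Op.apply : Op → ℕ → ℕ → ℕ
  | .add, a, b => a + b
  | .sub, a, b => a - b
  | .mul, a, b => a * b
  | .div, a, b => a / b
  | .mod, a, b => a % b
  | .lt, a, b => if a < b then 1 else 0
  | .eq, a, b => if a = b then 1 else 0

/-- Expressions: constants, registers, reading the cell of an array, operations. -/
inductive Expr
  | const (k : ℕ)
  | reg (r : ℕ)
  | load (a : ℕ) (i : Expr)
  | op (o : Op) (p q : Expr)

/-- Programs. -/
inductive Cmd
  | skip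
  | assign (r : ℕ) (p : Expr)
  | store (a : ℕ) (i p : Expr)
  | seq (c d : Cmd)
  | cond (p : Expr) (c d : Cmd)
  | loop (p : Expr) (c : Cmd)

/-- Contents of the memory: registers, and the cells of the arrays. -/
structure Config where
  reg : ℕ → ℕ
  arr : ℕ → ℕ → ℕ

/-- Write `k` into register `r`. -/
def Config.setReg (σ : Config) (r k : ℕ) : Config :=
  { σ with reg := Function.update σ.reg r k }

/-- Write `k` into cell `i` of array `a`. -/
def Config.setArr (σ : Config) (a i k : ℕ) : Config :=
  { σ with arr := Function.update σ.arr a (Function.update (σ.arr a) i k) }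

/-- `k` if it fits into a word of `w` bits. -/
def word (w k : ℕ) : Option ℕ := if k < 2 ^ w then some k else none

/-- Value of an expression; undefined if an intermediate value does not fit into a word. -/
def Expr.eval (w : ℕ) (σ : Config) : Expr → Option ℕ
  | .const k => word w k
  | .reg r => word w (σ.reg r)
  | .load a i => (i.eval w σ).bind fun j => word w (σ.arr a j)
  | .op o p q => (p.eval w σ).bind fun a => (q.eval w σ).bind fun b => word w (o.apply a b)

/-- Time to evaluate an expression: one unit per node. -/
def Expr.time : Expr → ℕ
  | .const _ => 1
  | .reg _ => 1
  | .load _ i => i.time + 1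
  | .op _ p q => p.time + q.time + 1

/-- `Exec w c σ t σ'`: with words of `w` bits, the program `c` started in `σ` halts in `σ'` after
exactly `t` time units. -/
inductive Exec (w : ℕ) : Cmd → Config → ℕ → Config → Prop
  | skip (σ : Config) : Exec w .skip σ 1 σ
  | assign (r : ℕ) (p : Expr) (σ : Config) (k : ℕ) :
      p.eval w σ = some k → Exec w (.assign r p) σ (p.time + 1) (σ.setReg r k)
  | store (a : ℕ) (i p : Expr) (σ : Config) (j k : ℕ) :
      i.eval w σ = some j → p.eval w σ = some k →
      Exec w (.store a i p) σ (i.time + p.time + 1) (σ.setArr a j k)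
  | seq (c d : Cmd) (σ σ₁ σ₂ : Config) (t₁ t₂ : ℕ) :
      Exec w c σ t₁ σ₁ → Exec w d σ₁ t₂ σ₂ → Exec w (.seq c d) σ (t₁ + t₂) σ₂
  | condTrue (p : Expr) (c d : Cmd) (σ σ' : Config) (k t : ℕ) :
      p.eval w σ = some k → k ≠ 0 → Exec w c σ t σ' →
      Exec w (.cond p c d) σ (p.time + 1 + t) σ'
  | condFalse (p : Expr) (c d : Cmd) (σ σ' : Config) (t : ℕ) :
      p.eval w σ = some 0 → Exec w d σ t σ' → Exec w (.cond p c d) σ (p.time + 1 + t) σ'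
  | loopTrue (p : Expr) (c : Cmd) (σ σ₁ σ₂ : Config) (k t₁ t₂ : ℕ) :
      p.eval w σ = some k → k ≠ 0 → Exec w c σ t₁ σ₁ → Exec w (.loop p c) σ₁ t₂ σ₂ →
      Exec w (.loop p c) σ (p.time + 1 + t₁ + t₂) σ₂
  | loopFalse (p : Expr) (c : Cmd) (σ : Config) :
      p.eval w σ = some 0 → Exec w (.loop p c) σ (p.time + 1) σ

/-- The machine is deterministic. -/
theorem Exec.det {w : ℕ} {c : Cmd} {σ : Config} {t t' : ℕ} {ρ ρ' : Config}
    (h : Exec w c σ t ρ) (h' : Exec w c σ t' ρ') : t = t' ∧ ρ = ρ' := by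
  induction h generalizing t' ρ' with
  | skip => cases h'; simp
  | assign => cases h'; simp_all
  | store => cases h'; simp_all
  | seq _ _ _ _ _ _ _ _ _ ih₁ ih₂ =>
    cases h' with
    | seq _ _ _ _ _ _ _ g₁ g₂ =>
      obtain ⟨rfl, rfl⟩ := ih₁ g₁
      obtain ⟨rfl, rfl⟩ := ih₂ g₂
      simp
  | condTrue _ _ _ _ _ _ _ hp _ _ ih =>
    cases h' with
    | condTrue _ _ _ _ _ _ _ _ _ g => obtain ⟨rfl, rfl⟩ := ih g; simp
    | condFalse => simp_all
  | condFalse _ _ _ _ _ _ hp _ ih =>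
    cases h' with
    | condTrue => simp_all
    | condFalse _ _ _ _ _ _ _ g => obtain ⟨rfl, rfl⟩ := ih g; simp
  | loopTrue _ _ _ _ _ _ _ _ hp _ _ _ ih₁ ih₂ =>
    cases h' with
    | loopTrue _ _ _ _ _ _ _ _ _ _ g₁ g₂ =>
      obtain ⟨rfl, rfl⟩ := ih₁ g₁
      obtain ⟨rfl, rfl⟩ := ih₂ g₂
      simp
    | loopFalse => simp_all
  | loopFalse =>
    cases h' with
    | loopTrue => simp_all
    | loopFalse => simp

/-! ### Interface between the problem and the machine -/

/-- The memory at the call of `init`. Registers `0, 1, 2` hold `n`, `K`, `D` (which encode the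
accuracy `1 / K` and the lower bound `1 / D`), register `3` holds the number of nonzero entries of
`x`. Array `0` lists these entries as triples `u, v, ⌊2^L xₑ⌋` with `e = {u, v}`, in the order of
the list `l`. Everything else is zero. -/
noncomputable def initInput {n : ℕ} (K D L : ℕ) (x : Sym2 (Fin n) → ℝ)
    (l : List (Fin n × Fin n)) : Config where
  reg r := if r = 0 then n else if r = 1 then K else if r = 2 then D else
    if r = 3 then l.length else 0
  arr a i := if a = 0 then
      (l.flatMap fun p => [(p.1 : ℕ), (p.2 : ℕ), fix L (x s(p.1, p.2))]).getD i 0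
    else 0

/-- The memory at the call of `update({u, v}, ν)`: as it was left by the previous operation, with
`u`, `v` and `⌊2^L ν⌋` written into registers `0, 1, 2`. -/
noncomputable def updateInput {n : ℕ} (L : ℕ) (σ : Config) (u v : Fin n) (ν : ℝ) : Config :=
  ((σ.setReg 0 u).setReg 1 v).setReg 2 (fix L ν)

/-- Array `1` stores the matching `M`: its cell `v` contains `u + 1` if `{u, v} ∈ M`, and `0` if `v`
is unmatched. -/
def Stores {n : ℕ} (σ : Config) (M : Finset (Sym2 (Fin n))) : Prop :=
  ∀ v : Fin n, σ.arr 1 v ≤ n ∧ ∀ u : Fin n, s(u, v) ∈ M ↔ σ.arr 1 v = u + 1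

end DynRound

open DynRound

/-! Correctness rests on a degree bound and a size bound. Let `fractSum x i v` be the sum over the
edges at `v` of the fractional parts of `2 ^ i * x e`. The bound kept at every level is `deg (F i) v
< fractSum x i v + 1`. Doubling a fractional part splits off the next digit, so twice `fractSum` at
level `i` equals the degree in `suppDigit x (i + 1)` plus `fractSum` at level `i + 1`. A bipartite
degree-split, which rounds half degrees to a neighbouring integer, therefore passes the bound from
level `i + 1` to level `i` (`Rebuild.spec`). An update lowers `fractSum` by less than one, only at
the end points of the edge, and `Remove` deletes an edge there (`Mid.visit`). At level `0` digit and
fractional part add up to `x e`, so the degrees in `E 0` and `F 0` add up to less than `2`, hence to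
at most `1`.

For the size, `#(suppDigit x (i + 1)) + #(F (i + 1))` and `2 * #(F i)` differ by a rounding error
and a multiple of the counter `c (i + 1)`. Telescoping with weights `2 ^ (-i)` bounds `#M` from
below by the truncated value of `x` minus the weighted counters (`Inv.card_M`). The rebuilding
thresholds keep these below `3 / 2 * η * ‖x‖`, and truncation costs `η / 2 * ‖x‖` (`fract_loss_le`);
together this is `2 * η * ‖x‖`.

For the implementation, families of sets are kept as lists with an inverse array, which gives
insertion and deletion in constant time from zero-initialized memory (`FamRep`). Degree-split puts
the common edges into both parts and distributes the symmetric difference along alternating trails: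
first from vertices of odd remaining degree, then along closed trails, which are even in a bipartite
graph. This takes linear time (`walk_runs`, `phase_runs`, `split_runs`). The memory holds the digit
sets of the current vector, the layers `F i`, the counters and the array of mates, but not the sets
`E i`: a rebuild takes them afresh from the digits, and `E 0` is visible as the mated edges outside
`F 0`.

Rebuilding the levels up to `k` costs `O(2 ^ k * ‖x‖)`, because `upper` bounds the sizes of the
layers (`Inv.card_F_le`). It happens only when `c k` exceeds a threshold of order `2 ^ k * ‖x‖ / (K
* L)`, so a potential `O(K * L)` times the sum of the counters pays for it (`SweepCost.amortized`).
An update raises at most `L + 1` counters by one, which gives amortized time `O(K * L ^ 2)`.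

Programs are verified by triples with time bounds in which all cells stay below a bound `B`. An
expression of degree at most `16` then stays below `B ^ 16`, so overflow is excluded by a syntactic
check. Low registers are scratch space of inner routines and outer routines use higher numbers, so
that frames nest; registers from `100` on hold constants. -/

namespace DynRound

set_option linter.unusedSectionVars false

/-! ### Correctness of the abstract algorithm: digits and fractional parts -/

section Rounding

variable {V : Type*} [Fintype V] [DecidableEq V]

/-- The sum over the edges at `v` of the fractional parts of `2 ^ i * xₑ`. -/
noncomputable def fractSum (x : Sym2 V → ℝ) (i : ℕ) (v : V) : ℝ :=
  ∑ e with v ∈ e, Int.fract ((2 : ℝ) ^ i * x e)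

theorem fractSum_nonneg (x : Sym2 V → ℝ) (i : ℕ) (v : V) : 0 ≤ fractSum x i v :=
  sum_nonneg fun _ _ => Int.fract_nonneg _

theorem digit_le_one (y : ℝ) (i : ℕ) : digit y i ≤ 1 := by unfold digit; omega

/-- Doubling moves the binary point by one place, and the digit that crosses it leaves the
fractional part. Summed over the edges at a vertex, this is the exact real counterpart of what
degree-split does to integer degrees. -/
theorem two_mul_fract {y : ℝ} (hy : 0 ≤ y) (i : ℕ) :
    2 * Int.fract ((2 : ℝ) ^ i * y) = digit y (i + 1) + Int.fract ((2 : ℝ) ^ (i + 1) * y) := by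
  have h0 : 0 ≤ (2 : ℝ) ^ i * y := by positivity
  have h1 : 0 ≤ (2 : ℝ) ^ (i + 1) * y := by positivity
  set z := (2 : ℝ) ^ i * y with hz
  have hz2 : (2 : ℝ) ^ (i + 1) * y = 2 * z := by rw [hz]; ring
  unfold digit
  rw [hz2] at h1 ⊢
  rw [Int.fract, Int.fract, ← natCast_floor_eq_intCast_floor h0,
    ← natCast_floor_eq_intCast_floor h1]
  have hdiv : ⌊2 * z⌋₊ / 2 = ⌊z⌋₊ := by
    rw [← Nat.floor_div_natCast]; congr 1; push_cast; ring
  have := Nat.div_add_mod ⌊2 * z⌋₊ 2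
  rw [hdiv] at this
  have h : (2 * (⌊z⌋₊ : ℝ) + ((⌊2 * z⌋₊ % 2 : ℕ) : ℝ)) = (⌊2 * z⌋₊ : ℝ) := by exact_mod_cast this
  linarith

theorem digit_zero_add_fract {y : ℝ} (hy : 0 ≤ y) (hy1 : y ≤ 1) :
    (digit y 0 : ℝ) + Int.fract ((2 : ℝ) ^ 0 * y) = y := by
  unfold digit
  simp only [pow_zero, one_mul]
  rw [Int.fract, ← natCast_floor_eq_intCast_floor hy]
  have : ⌊y⌋₊ ≤ 1 := by
    have := Nat.floor_le_floor hy1; simpa using this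
  rw [Nat.mod_eq_of_lt (by omega)]
  ring

theorem mem_suppDigit {x : Sym2 V → ℝ} {i : ℕ} {e : Sym2 V} :
    e ∈ suppDigit x i ↔ digit (x e) i = 1 := by simp [suppDigit]

theorem mem_supp {x : Sym2 V → ℝ} {e : Sym2 V} : e ∈ supp x ↔ 0 < x e := by simp [supp]

theorem suppDigit_subset (x : Sym2 V → ℝ) (i : ℕ) : suppDigit x i ⊆ supp x := by
  intro e he
  rw [mem_suppDigit, digit] at he
  rw [mem_supp]
  by_contra h
  have : (2 : ℝ) ^ i * x e ≤ 0 := mul_nonpos_of_nonneg_of_nonpos (by positivity) (not_lt.1 h)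
  rw [Nat.floor_of_nonpos this] at he
  simp at he

theorem digit_eq_ite (y : ℝ) (i : ℕ) : (digit y i : ℝ) = if digit y i = 1 then 1 else 0 := by
  have := digit_le_one y i
  split_ifs with h
  · simp [h]
  · have : digit y i = 0 := by omega
    simp [this]

theorem deg_suppDigit (x : Sym2 V → ℝ) (i : ℕ) (v : V) :
    (deg (suppDigit x i) v : ℝ) = ∑ e with v ∈ e, (digit (x e) i : ℝ) := by
  simp_rw [digit_eq_ite, sum_ite, sum_const_zero, add_zero, sum_const, nsmul_eq_mul, mul_one, deg]
  congr 2
  ext e; simp [suppDigit, and_comm]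

theorem card_suppDigit (x : Sym2 V → ℝ) (i : ℕ) :
    (#(suppDigit x i) : ℝ) = ∑ e, (digit (x e) i : ℝ) := by
  simp_rw [digit_eq_ite, sum_ite, sum_const_zero, add_zero, sum_const, nsmul_eq_mul, mul_one]
  rfl

theorem two_mul_fractSum {x : Sym2 V → ℝ} (hx : ∀ e, 0 ≤ x e) (i : ℕ) (v : V) :
    2 * fractSum x i v = deg (suppDigit x (i + 1)) v + fractSum x (i + 1) v := by
  rw [deg_suppDigit, fractSum, fractSum, mul_sum, ← sum_add_distrib]
  exact sum_congr rfl fun e _ => two_mul_fract (hx e) i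

theorem fractSum_update_of_notMem (x : Sym2 V → ℝ) (e : Sym2 V) (ν : ℝ) (i : ℕ) {v : V}
    (hv : v ∉ e) : fractSum (Function.update x e ν) i v = fractSum x i v := by
  refine sum_congr rfl fun f hf => ?_
  have : f ≠ e := by rintro rfl; simp_all
  simp [Function.update_of_ne this]

/-- Only one summand changes, and two numbers in `[0, 1)` differ by less than one. The loss of one
edge at `v` therefore compensates for the update. -/
theorem fractSum_lt_update (x : Sym2 V → ℝ) (e : Sym2 V) (ν : ℝ) (i : ℕ) (v : V) :
    fractSum x i v < fractSum (Function.update x e ν) i v + 1 := by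
  by_cases hv : v ∈ e
  · have he : e ∈ ({f | v ∈ f} : Finset (Sym2 V)) := by simp [hv]
    unfold fractSum
    rw [← add_sum_erase _ _ he, ← add_sum_erase _ (fun f => Int.fract ((2 : ℝ) ^ i *
      Function.update x e ν f)) he]
    have h1 : ∑ f ∈ ({f | v ∈ f} : Finset (Sym2 V)).erase e,
        Int.fract ((2 : ℝ) ^ i * Function.update x e ν f) =
        ∑ f ∈ ({f | v ∈ f} : Finset (Sym2 V)).erase e, Int.fract ((2 : ℝ) ^ i * x f) :=
      sum_congr rfl fun f hf => by rw [Function.update_of_ne (ne_of_mem_erase hf)]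
    rw [h1]
    have h2 := Int.fract_lt_one ((2 : ℝ) ^ i * x e)
    have h3 := Int.fract_nonneg ((2 : ℝ) ^ i * Function.update x e ν e)
    linarith
  · rw [fractSum_update_of_notMem _ _ _ _ hv]; linarith

/-! ### Degrees and sizes under removals -/

theorem deg_le_of_subset {A B : Finset (Sym2 V)} (h : A ⊆ B) (v : V) : deg A v ≤ deg B v :=
  card_le_card (filter_subset_filter _ h)

theorem deg_erase_of_mem {A : Finset (Sym2 V)} {f : Sym2 V} (hf : f ∈ A) {v : V} (hv : v ∈ f) :
    deg (A.erase f) v + 1 = deg A v := by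
  unfold deg
  rw [filter_erase]
  exact card_erase_add_one (by simp [hf, hv])

theorem deg_erase_of_notMem {A : Finset (Sym2 V)} {f : Sym2 V} {v : V} (hv : v ∉ f) :
    deg (A.erase f) v = deg A v := by
  unfold deg
  rw [filter_erase, erase_eq_of_notMem (by simp [hv])]

theorem RemoveAt.spec {v : V} {F F' : Finset (Sym2 V)} (h : RemoveAt v F F') :
    F' ⊆ F ∧ #F ≤ #F' + 1 ∧ (deg F' v = 0 ∨ deg F' v + 1 ≤ deg F v) := by
  rcases h with ⟨f, hf, hv, rfl⟩ | ⟨h, rfl⟩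
  · exact ⟨erase_subset _ _, (card_erase_add_one hf).ge, Or.inr (deg_erase_of_mem hf hv).le⟩
  · refine ⟨Subset.rfl, by simp, Or.inl ?_⟩
    simpa [deg, filter_eq_empty_iff] using h

/-- The three parts serve different purposes: the absence of `e` keeps the layer inside the support
of the new vector, the loss of at most two edges controls sizes, and the drop of the degree at the
end points matches `fractSum_lt_update`. -/
theorem Remove.spec {e : Sym2 V} {F F' : Finset (Sym2 V)} (h : Remove e F F') :
    F' ⊆ F.erase e ∧ #F ≤ #F' + 2 ∧ ∀ v ∈ e, deg F' v = 0 ∨ deg F' v + 1 ≤ deg F v := by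
  rcases h with ⟨he, rfl⟩ | ⟨he, u, v, F₁, rfl, h1, h2⟩
  · exact ⟨Subset.rfl, by have := card_erase_add_one he; omega,
      fun v hv => Or.inr (deg_erase_of_mem he hv).le⟩
  · obtain ⟨a1, b1, c1⟩ := h1.spec
    obtain ⟨a2, b2, c2⟩ := h2.spec
    rw [erase_eq_of_notMem he]
    refine ⟨a2.trans a1, by omega, fun w hw => ?_⟩
    have d1 := deg_le_of_subset a1 w
    have d2 := deg_le_of_subset a2 w
    rcases Sym2.mem_iff.1 hw with rfl | rfl <;> omega

/-- What holds after every operation of the algorithm. -/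
structure Inv (η : ℝ) (L : ℕ) (s : AlgState V) : Prop where
  F_supp : ∀ i, s.F i ⊆ supp s.x
  F_high : ∀ i, L ≤ i → s.F i = ∅
  E_zero : s.E 0 ⊆ suppDigit s.x 0
  deg_F : ∀ i v, (deg (s.F i) v : ℝ) < fractSum s.x i v + 1
  lower : ∀ i < L, #(suppDigit s.x (i + 1)) + #(s.F (i + 1)) ≤ 2 * #(s.F i) + 5 * s.c (i + 1)
  upper : ∀ i < L, 2 * #(s.F i) ≤ #(suppDigit s.x (i + 1)) + #(s.F (i + 1)) + 1 + 3 * s.c (i + 1)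
  zero : #(suppDigit s.x 0) ≤ #(s.E 0) + s.c 0
  due : ∀ i ≤ L, ¬ Due η L s i

/-! ### Preservation of the invariant -/

theorem IsFractionalMatching.supp_subset {G : SimpleGraph V} {x : Sym2 V → ℝ}
    (hx : IsFractionalMatching G x) {e : Sym2 V} (he : e ∈ supp x) : e ∈ G.edgeSet := by
  by_contra h
  rw [mem_supp, hx.2.1 e h] at he
  exact lt_irrefl _ he

theorem isBipartite_of_subset_supp {G : SimpleGraph V} (hG : G.IsBipartite) {x : Sym2 V → ℝ}
    (hx : IsFractionalMatching G x) {A B : Finset (Sym2 V)} (hA : A ⊆ supp x) (hB : B ⊆ supp x) :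
    (SimpleGraph.fromEdgeSet (A ∪ B : Set (Sym2 V))).IsBipartite := by
  refine SimpleGraph.Colorable.mono_left (G' := G) ?_ hG
  intro u v h
  rw [SimpleGraph.fromEdgeSet_adj] at h
  rw [← SimpleGraph.mem_edgeSet]
  rcases h.1 with h | h
  · exact hx.supp_subset (hA h)
  · exact hx.supp_subset (hB h)

theorem total_nonneg {x : Sym2 V → ℝ} (hx : ∀ e, 0 ≤ x e) : 0 ≤ total x :=
  sum_nonneg fun e _ => hx e

/-- Only level `i` needs assumptions, since everything below it is recomputed from there.
Bipartiteness of the graph gives the sharp rounding of degrees, without which the slack of one would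
be lost. -/
theorem Rebuild.spec {G : SimpleGraph V} (hG : G.IsBipartite) {i : ℕ} {s s' : AlgState V}
    (h : Rebuild i s s') (hx : IsFractionalMatching G s.x) (hF : s.F i ⊆ supp s.x)
    (hd : ∀ v, (deg (s.F i) v : ℝ) < fractSum s.x i v + 1) :
    s'.x = s.x ∧ (∀ j ≥ i, s'.F j = s.F j) ∧ (∀ j > i, s'.c j = s.c j) ∧ (∀ j ≤ i, s'.c j = 0) ∧
    s'.E 0 = suppDigit s.x 0 ∧ ∀ j < i, s'.F j ⊆ supp s.x ∧
      (∀ v, (deg (s'.F j) v : ℝ) < fractSum s.x j v + 1) ∧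
      #(suppDigit s.x (j + 1)) + #(s'.F (j + 1)) ≤ 2 * #(s'.F j) ∧
      2 * #(s'.F j) ≤ #(suppDigit s.x (j + 1)) + #(s'.F (j + 1)) + 1 := by
  induction h with
  | zero s =>
    refine ⟨rfl, fun _ _ => rfl, fun j hj => ?_, fun j hj => ?_, ?_, fun j hj => by omega⟩
    · simp [AlgState.reload, Function.update_of_ne (show j ≠ 0 by omega)]
    · obtain rfl : j = 0 := by omega
      simp [AlgState.reload]
    · simp [AlgState.reload]
  | succ j s s' E₁ E₂ hs hr ih =>
    obtain ⟨hval, hc1, hc2, -, hb⟩ := hs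
    have hb := hb (isBipartite_of_subset_supp hG hx (suppDigit_subset _ _) hF) E₁ (Or.inl rfl)
    have hsub : E₁ ⊆ supp s.x := by
      intro f hf
      have : f ∈ (suppDigit s.x (j + 1)).val + (s.F (j + 1)).val := by
        rw [hval]; exact Multiset.mem_add.2 (Or.inl hf)
      rcases Multiset.mem_add.1 this with h | h
      · exact suppDigit_subset _ _ h
      · exact hF h
    have hdeg : ∀ v, (deg E₁ v : ℝ) < fractSum s.x j v + 1 := by
      intro v
      have h1 := two_mul_fractSum hx.1 j v
      have h2 := hd v
      -- Rounding up adds at most one to the doubled degree, and the slack inherited from level `j +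
      -- 1` is less than one. Both together are less than two, hence a slack below one after
      -- halving.
      have h3 : 2 * deg E₁ v ≤ deg (suppDigit s.x (j + 1)) v + deg (s.F (j + 1)) v + 1 := by
        have := (hb v).2; omega
      have h4 : (2 * deg E₁ v : ℝ) ≤ deg (suppDigit s.x (j + 1)) v + deg (s.F (j + 1)) v + 1 := by
        exact_mod_cast h3
      linarith
    obtain ⟨r1, r2, r3, r4, r5, r6⟩ := ih hx (by simpa [AlgState.reload] using hsub)
      (by simpa [AlgState.reload] using hdeg)
    simp only [AlgState.reload] at r1 r2 r3 r4 r5 r6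
    refine ⟨r1, fun k hk => ?_, fun k hk => ?_, fun k hk => ?_, r5, fun k hk => ?_⟩
    · rw [r2 k (by omega), Function.update_of_ne (by omega)]
    · rw [r3 k (by omega), Function.update_of_ne (by omega)]
    · rcases Nat.lt_or_ge j k with h | h
      · obtain rfl : k = j + 1 := by omega
        rw [r3 _ (by omega), Function.update_self]
      · exact r4 k h
    · rcases Nat.lt_or_ge k j with h | h
      · exact r6 k h
      · obtain rfl : k = j := by omega
        rw [r2 k le_rfl, r2 (k + 1) (by omega), Function.update_self,
          Function.update_of_ne (by omega)]
        exact ⟨hsub, hdeg, by omega, by omega⟩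

theorem not_due_of_c_eq_zero {η : ℝ} (hη : 0 ≤ η) {L : ℕ} {s : AlgState V}
    (hx : ∀ e, 0 ≤ s.x e) {i : ℕ} (hc : s.c i = 0) : ¬ Due η L s i := by
  have := total_nonneg hx
  unfold Due
  rw [hc, not_lt]
  simp only [Nat.cast_zero]
  positivity

theorem deg_empty (v : V) : deg ∅ v = 0 := by simp [deg]

theorem InitStep.inv {G : SimpleGraph V} (hG : G.IsBipartite) {η : ℝ} (hη : 0 ≤ η) {L : ℕ}
    {x : Sym2 V → ℝ} {s : AlgState V} (hx : IsFractionalMatching G x) (h : InitStep L x s) :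
    Inv η L s ∧ s.x = x := by
  have hz : ∀ i v, (0 : ℝ) < fractSum x i v + 1 := fun i v => by
    have := fractSum_nonneg x i v; linarith
  obtain ⟨r1, r2, r3, r4, r5, r6⟩ := Rebuild.spec hG h hx (by simp) (by simpa [deg_empty] using hz L)
  simp only at r1 r2 r3 r4 r5 r6
  refine ⟨⟨fun i => ?_, r2, by rw [r5, r1], fun i v => ?_, fun i hi => ?_, fun i hi => ?_, ?_,
    fun i hi => ?_⟩, r1⟩
  · rcases Nat.lt_or_ge i L with h | h
    · rw [r1]; exact (r6 i h).1
    · simp [r2 i h]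
  · rw [r1]
    rcases Nat.lt_or_ge i L with h | h
    · exact (r6 i h).2.1 v
    · simpa [r2 i h, deg_empty] using hz i v
  · rw [r1]; have := (r6 i hi).2.2.1; omega
  · rw [r1]; have := (r6 i hi).2.2.2; omega
  · rw [r1, r5]; omega
  · exact not_due_of_c_eq_zero hη (by rw [r1]; exact hx.1) (r4 i hi)

/-- The state `s` in the course of an update of `e` that was begun in the state `s₀` and has
finished the levels above `i`. -/
structure Mid (η : ℝ) (L : ℕ) (e : Sym2 V) (ν : ℝ) (s₀ : AlgState V) (i : ℕ) (s : AlgState V) :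
    Prop where
  x_eq : s.x = Function.update s₀.x e ν
  F_low : ∀ j < i, s.F j = s₀.F j
  c_low : ∀ j ≤ i, s.c j = s₀.c j
  E_low : s.E 0 = s₀.E 0
  card_le : #(s.F i) ≤ #(s₀.F i)
  le_card : #(s₀.F i) ≤ #(s.F i) + 2
  F_supp : ∀ j ≥ i, s.F j ⊆ supp s.x
  F_high : ∀ j, L ≤ j → s.F j = ∅
  deg_F : ∀ j ≥ i, ∀ v, (deg (s.F j) v : ℝ) < fractSum s.x j v + 1
  lower : ∀ j < L, i ≤ j →
    #(suppDigit s.x (j + 1)) + #(s.F (j + 1)) ≤ 2 * #(s.F j) + 5 * s.c (j + 1)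
  upper : ∀ j < L, i ≤ j →
    2 * #(s.F j) ≤ #(suppDigit s.x (j + 1)) + #(s.F (j + 1)) + 1 + 3 * s.c (j + 1)
  due : ∀ j ≤ L, i < j → ¬ Due η L s j

theorem suppDigit_update_subset (x : Sym2 V → ℝ) (e : Sym2 V) (ν : ℝ) (i : ℕ) :
    suppDigit (Function.update x e ν) i ⊆ insert e (suppDigit x i) := by
  intro f hf
  by_cases h : f = e
  · simp [h]
  · rw [mem_suppDigit, Function.update_of_ne h] at hf
    simp [mem_suppDigit, hf]

theorem subset_suppDigit_update (x : Sym2 V → ℝ) (e : Sym2 V) (ν : ℝ) (i : ℕ) :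
    suppDigit x i ⊆ insert e (suppDigit (Function.update x e ν) i) := by
  intro f hf
  by_cases h : f = e
  · simp [h]
  · simp [mem_suppDigit, Function.update_of_ne h]
    rw [mem_suppDigit] at hf
    exact Or.inr hf

/-- The constants of the invariant come from here. One update changes `suppDigit` by at most one
edge and removes at most two edges from each layer, while the counter rises by one: `lower` worsens
by `1 + 2 * 2 = 5`, and `upper` by `1 + 2 = 3`. -/
theorem Mid.visit {η : ℝ} {L : ℕ} {e : Sym2 V} {ν : ℝ} {s₀ : AlgState V} (h0 : Inv η L s₀)
    {j : ℕ} (hj : j + 1 ≤ L) {s s₁ : AlgState V} (h : Mid η L e ν s₀ (j + 1) s)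
    (hv : Visit e (j + 1) s s₁) (hd : ¬ Due η L s₁ (j + 1)) : Mid η L e ν s₀ j s₁ := by
  cases hv with | succ _ _ F' hr
  obtain ⟨hr1, hr2, hr3⟩ := hr.spec
  have hFj := h.F_low j (by omega)
  have hr1' : F' ⊆ s.F j := hr1.trans (erase_subset _ _)
  have hsub : F' ⊆ supp s.x := by
    intro f hf
    have h1 := hr1 hf
    rw [mem_erase] at h1
    have h2 := h0.F_supp j (hFj ▸ h1.2)
    rw [h.x_eq, mem_supp, Function.update_of_ne h1.1]
    exact mem_supp.1 h2
  have hdeg : ∀ v, (deg F' v : ℝ) < fractSum s.x j v + 1 := by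
    intro v
    have h1 := h0.deg_F j v
    have h2 := deg_le_of_subset hr1' v
    rw [hFj] at h2
    rw [h.x_eq]
    by_cases hv : v ∈ e
    · have h4 := fractSum_lt_update s₀.x e ν j v
      rcases hr3 v hv with h3 | h3
      -- A vertex with no edge left satisfies the bound for free; otherwise its degree has dropped
      -- by one.
      · have := fractSum_nonneg (Function.update s₀.x e ν) j v
        rw [h3]; push_cast; linarith
      · rw [hFj] at h3
        have : (deg F' v : ℝ) + 1 ≤ deg (s₀.F j) v := by exact_mod_cast h3
        linarith
    · rw [fractSum_update_of_notMem _ _ _ _ hv]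
      have : (deg F' v : ℝ) ≤ deg (s₀.F j) v := by exact_mod_cast h2
      linarith
  have hc := h.c_low (j + 1) le_rfl
  have e1 := card_le_card (suppDigit_update_subset s₀.x e ν (j + 1))
  have e2 := card_le_card (subset_suppDigit_update s₀.x e ν (j + 1))
  have e3 := card_insert_le e (suppDigit s₀.x (j + 1))
  have e4 := card_insert_le e (suppDigit (Function.update s₀.x e ν) (j + 1))
  have e5 := h.card_le
  have e6 := h.le_card
  have e7 := card_le_card hr1'
  have e8 := h0.lower j (by omega)
  have e9 := h0.upper j (by omega)
  have hx := h.x_eq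
  constructor
  · exact hx
  · intro k hk
    simp only [Function.update_of_ne (show k ≠ j by omega)]
    exact h.F_low k (by omega)
  · intro k hk
    simp only [Function.update_of_ne (show k ≠ j + 1 by omega)]
    exact h.c_low k (by omega)
  · simp only [Function.update_of_ne (show 0 ≠ j + 1 by omega)]
    exact h.E_low
  · simp only [Function.update_self]
    rw [← hFj]; exact e7
  · simp only [Function.update_self]
    rw [← hFj]; exact hr2
  · intro k hk
    rcases Nat.eq_or_lt_of_le hk with rfl | hk
    · simpa only [Function.update_self] using hsub
    · simp only [Function.update_of_ne (show k ≠ j by omega)]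
      exact h.F_supp k (by omega)
  · intro k hk
    simp only [Function.update_of_ne (show k ≠ j by omega)]
    exact h.F_high k hk
  · intro k hk
    rcases Nat.eq_or_lt_of_le hk with rfl | hk
    · simpa only [Function.update_self] using hdeg
    · simp only [Function.update_of_ne (show k ≠ j by omega)]
      exact h.deg_F k (by omega)
  · intro k hkL hk
    rcases Nat.eq_or_lt_of_le hk with rfl | hk
    · simp only [Function.update_self, Function.update_of_ne (show j + 1 ≠ j by omega)]
      rw [hx]; rw [hFj] at hr2 e7; omega
    · simp only [Function.update_of_ne (show k ≠ j by omega),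
        Function.update_of_ne (show k + 1 ≠ j by omega),
        Function.update_of_ne (show k + 1 ≠ j + 1 by omega)]
      exact h.lower k hkL (by omega)
  · intro k hkL hk
    rcases Nat.eq_or_lt_of_le hk with rfl | hk
    · simp only [Function.update_self, Function.update_of_ne (show j + 1 ≠ j by omega)]
      rw [hx]; rw [hFj] at hr2 e7; omega
    · simp only [Function.update_of_ne (show k ≠ j by omega),
        Function.update_of_ne (show k + 1 ≠ j by omega),
        Function.update_of_ne (show k + 1 ≠ j + 1 by omega)]
      exact h.upper k hkL (by omega)
  · intro k hkL hk
    rcases Nat.eq_or_lt_of_le hk with rfl | hk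
    · exact hd
    · have := h.due k hkL (by omega)
      simpa only [Due, Function.update_of_ne (show k ≠ j + 1 by omega)] using this

/-- The properties of levels `≥ i` in the middle of an update suffice for the invariant once the
levels up to `i` have been rebuilt. -/
theorem Mid.rebuild {G : SimpleGraph V} (hG : G.IsBipartite) {η : ℝ} (hη : 0 ≤ η) {L : ℕ}
    {e : Sym2 V} {ν : ℝ} {s₀ : AlgState V}
    (hx : IsFractionalMatching G (Function.update s₀.x e ν))
    {i : ℕ} (hi : i ≤ L) {s s₁ s' : AlgState V} (h : Mid η L e ν s₀ i s)
    (hv : Visit e i s s₁) (hr : Rebuild i s₁ s') : Inv η L s' ∧ s'.x = s.x := by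
  have hx' := hx
  rw [← h.x_eq] at hx'
  -- What the visit of level `i` modifies is overwritten by the rebuilding, so the state before the
  -- visit can be used at the levels that survive.
  have key : s₁.x = s.x ∧ (∀ j ≥ i, s₁.F j = s.F j) ∧ (∀ j > i, s₁.c j = s.c j) := by
    cases hv with
    | zero => exact ⟨rfl, fun _ _ => rfl, fun j hj => Function.update_of_ne (by omega) _ _⟩
    | succ j _ F' _ =>
      exact ⟨rfl, fun k hk => Function.update_of_ne (by omega) _ _,
        fun j hj => Function.update_of_ne (by omega) _ _⟩
  obtain ⟨k1, k2, k3⟩ := key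
  obtain ⟨r1, r2, r3, r4, r5, r6⟩ := Rebuild.spec hG hr (by rwa [k1])
    (by rw [k1, k2 i le_rfl]; exact h.F_supp i le_rfl)
    (by rw [k1, k2 i le_rfl]; exact h.deg_F i le_rfl)
  rw [k1] at r1 r5 r6
  have hF : ∀ j ≥ i, s'.F j = s.F j := fun j hj => (r2 j hj).trans (k2 j hj)
  have hc : ∀ j > i, s'.c j = s.c j := fun j hj => (r3 j hj).trans (k3 j hj)
  refine ⟨⟨fun j => ?_, fun j hj => ?_, by rw [r5, r1], fun j v => ?_, fun j hj => ?_,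
    fun j hj => ?_, by rw [r1, r5]; omega, fun j hj => ?_⟩, r1⟩
  · rw [r1]
    rcases Nat.lt_or_ge j i with hj | hj
    · exact (r6 j hj).1
    · rw [hF j hj]; exact h.F_supp j hj
  · rw [hF j (by omega)]; exact h.F_high j hj
  · rw [r1]
    rcases Nat.lt_or_ge j i with hj | hj
    · exact (r6 j hj).2.1 v
    · rw [hF j hj]; exact h.deg_F j hj v
  · rw [r1]
    rcases Nat.lt_or_ge j i with hj' | hj'
    · have := (r6 j hj').2.2.1; omega
    · rw [hF j hj', hF (j + 1) (by omega), hc (j + 1) (by omega)]; exact h.lower j hj hj'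
  · rw [r1]
    rcases Nat.lt_or_ge j i with hj' | hj'
    · have := (r6 j hj').2.2.2; omega
    · rw [hF j hj', hF (j + 1) (by omega), hc (j + 1) (by omega)]; exact h.upper j hj hj'
  · rcases Nat.lt_or_ge i j with hj' | hj'
    · have := h.due j hj hj'
      rwa [Due, r1, hc j hj', ← Due]
    · exact not_due_of_c_eq_zero hη (by rw [r1]; exact hx'.1) (r4 j hj')

theorem Mid.done {η : ℝ} {L : ℕ} {e : Sym2 V} {ν : ℝ} {s₀ : AlgState V} (h0 : Inv η L s₀)
    {s s₁ : AlgState V} (h : Mid η L e ν s₀ 0 s)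
    (hv : Visit e 0 s s₁) (hd : ¬ Due η L s₁ 0) : Inv η L s₁ ∧ s₁.x = s.x := by
  cases hv
  have hx := h.x_eq
  refine ⟨⟨fun j => h.F_supp j (Nat.zero_le _), h.F_high, ?_,
    fun j v => h.deg_F j (Nat.zero_le _) v, fun j hj => ?_, fun j hj => ?_, ?_, fun j hj => ?_⟩, rfl⟩
  · simp only [Function.update_self]
    intro f hf
    rw [mem_erase, h.E_low] at hf
    have := h0.E_zero hf.2
    rw [mem_suppDigit] at this ⊢
    rwa [hx, Function.update_of_ne hf.1]
  · simp only [Function.update_of_ne (show j + 1 ≠ 0 by omega)]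
    exact h.lower j hj (Nat.zero_le _)
  · simp only [Function.update_of_ne (show j + 1 ≠ 0 by omega)]
    exact h.upper j hj (Nat.zero_le _)
  · simp only [Function.update_self]
    rw [h.E_low, h.c_low 0 le_rfl]
    have hz := h0.zero
    have h1 : suppDigit s.x 0 ⊆ insert e (suppDigit s₀.x 0) := by
      rw [hx]; exact suppDigit_update_subset s₀.x e ν 0
    by_cases he : e ∈ s₀.E 0
    · have := card_erase_add_one he
      rw [insert_eq_of_mem (h0.E_zero he)] at h1
      have := card_le_card h1
      omega
    · rw [erase_eq_of_notMem he]
      have := card_le_card h1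
      have := card_insert_le e (suppDigit s₀.x 0)
      omega
  · rcases Nat.eq_zero_or_pos j with rfl | hj'
    · exact hd
    · have := h.due j hj hj'
      simpa only [Due, Function.update_of_ne (show j ≠ 0 by omega)] using this

theorem Sweep.inv {G : SimpleGraph V} (hG : G.IsBipartite) {η : ℝ} (hη : 0 ≤ η) {L : ℕ}
    {e : Sym2 V} {ν : ℝ} {s₀ : AlgState V} (h0 : Inv η L s₀)
    (hx : IsFractionalMatching G (Function.update s₀.x e ν))
    {i : ℕ} {s s' : AlgState V} (h : Sweep η L e i s s') (hi : i ≤ L)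
    (hm : Mid η L e ν s₀ i s) : Inv η L s' ∧ s'.x = s.x := by
  induction h with
  | rebuild i s s₁ s' hv hd hr => exact hm.rebuild hG hη hx hi hv hr
  | next i s s₁ s' hv hd hs ih =>
    have := hm.visit h0 hi hv hd
    have h2 := ih (by omega) this
    rwa [this.x_eq, ← hm.x_eq] at h2
  | done s s₁ hv hd => exact hm.done h0 hv hd

theorem Inv.mid {η : ℝ} {L : ℕ} {s₀ : AlgState V} (h0 : Inv η L s₀) (e : Sym2 V) (ν : ℝ) :
    Mid η L e ν s₀ L { s₀ with x := Function.update s₀.x e ν } := by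
  refine ⟨rfl, fun _ _ => rfl, fun _ _ => rfl, rfl, le_rfl, by simp, fun j hj => ?_,
    h0.F_high, fun j hj v => ?_, fun j hj hj' => by omega, fun j hj hj' => by omega,
    fun j hj hj' => by omega⟩
  · simp [h0.F_high j hj]
  · have := fractSum_nonneg (Function.update s₀.x e ν) j v
    simp only [h0.F_high j hj, deg_empty]; push_cast; linarith

theorem UpdateStep.inv {G : SimpleGraph V} (hG : G.IsBipartite) {η : ℝ} (hη : 0 ≤ η) {L : ℕ}
    {e : Sym2 V} {ν : ℝ} {s s' : AlgState V} (h0 : Inv η L s)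
    (hx : IsFractionalMatching G (Function.update s.x e ν)) (h : UpdateStep η L e ν s s') :
    Inv η L s' ∧ s'.x = Function.update s.x e ν :=
  Sweep.inv hG hη h0 hx h le_rfl (h0.mid e ν)

/-! ### From the invariant to the rounding guarantee -/

theorem IsFractionalMatching.le_one {G : SimpleGraph V} {x : Sym2 V → ℝ}
    (hx : IsFractionalMatching G x) (e : Sym2 V) : x e ≤ 1 := by
  induction e with | _ u v =>
  refine le_trans ?_ (hx.2.2 u)
  exact single_le_sum (f := x) (fun e _ => hx.1 e) (by simp)

/-- At level `0`, digit plus fractional part is `x e` itself, so the two degrees add up to less than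
`x(v) + 1 ≤ 2`; being integers, to at most `1`. -/
theorem deg_add_deg_le_one {G : SimpleGraph V} {x : Sym2 V → ℝ} (hx : IsFractionalMatching G x)
    {A F : Finset (Sym2 V)} (hA : A ⊆ suppDigit x 0)
    (hF : ∀ v, (deg F v : ℝ) < fractSum x 0 v + 1) (v : V) : deg A v + deg F v ≤ 1 := by
  have h1 : (deg A v : ℝ) ≤ deg (suppDigit x 0) v := by exact_mod_cast deg_le_of_subset hA v
  have h2 := hF v
  have h3 : (deg (suppDigit x 0) v : ℝ) + fractSum x 0 v ≤ 1 := by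
    rw [deg_suppDigit, fractSum, ← sum_add_distrib]
    refine le_trans (le_of_eq (sum_congr rfl fun e _ => ?_)) (hx.2.2 v)
    exact digit_zero_add_fract (hx.1 e) (hx.le_one e)
  have : (deg A v + deg F v : ℝ) < 2 := by linarith
  have : deg A v + deg F v < 2 := by exact_mod_cast this
  omega

theorem isMatching_union_of_deg {A F : Finset (Sym2 V)} (h : ∀ v, deg A v + deg F v ≤ 1) :
    IsMatching (A ∪ F) ∧ Disjoint A F := by
  constructor
  · intro e he f hf v hve hvf
    by_contra hne
    have h2 : 1 < #((A ∪ F).filter (v ∈ ·)) :=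
      one_lt_card.2 ⟨e, by simp [mem_union.1 he, hve], f, by simp [mem_union.1 hf, hvf], hne⟩
    have h3 := h v
    rw [filter_union] at h2
    have := card_union_le (A.filter (v ∈ ·)) (F.filter (v ∈ ·))
    unfold deg at h3
    omega
  · rw [disjoint_left]
    intro e he hf
    induction e with | _ u v =>
    have h1 : 0 < deg A u := card_pos.2 ⟨s(u, v), by simp [he]⟩
    have h2 : 0 < deg F u := card_pos.2 ⟨s(u, v), by simp [hf]⟩
    have := h u
    omega

theorem Inv.matching {G : SimpleGraph V} {η : ℝ} {L : ℕ} {s : AlgState V} (h : Inv η L s)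
    (hx : IsFractionalMatching G s.x) : IsMatching s.M ∧ Disjoint (s.E 0) (s.F 0) :=
  isMatching_union_of_deg (deg_add_deg_le_one hx h.E_zero (h.deg_F 0))

/-- In the weighted telescoping sum every level may lose the same amount `η * ‖x‖ / (4 * L)` per
unit factor of its counter. -/
theorem Inv.c_le {η : ℝ} {L : ℕ} {s : AlgState V} (h : Inv η L s) {i : ℕ} (hi : i ≤ L) :
    (s.c i : ℝ) / 2 ^ i ≤ η * total s.x / (4 * L) := by
  have := h.due i hi
  rw [Due, not_lt] at this
  rw [div_le_iff₀ (by positivity)]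
  refine this.trans (le_of_eq ?_)
  rw [zpow_sub₀ (by norm_num)]
  norm_num
  ring

/-- Telescoping `lower` with weights `2 ^ (-i)` loses at most `5 * q` on each of the `L` levels, and
`E 0` has lost at most `q`. As `L ≥ 1`, the total is at most `6 * q * L`, that is `3 / 2 * η * ‖x‖`.
-/
theorem Inv.card_M {G : SimpleGraph V} {η : ℝ} (hη : 0 ≤ η) {L : ℕ} (hL : 1 ≤ L) {s : AlgState V}
    (h : Inv η L s) (hx : IsFractionalMatching G s.x) :
    ∑ i ∈ range (L + 1), (#(suppDigit s.x i) : ℝ) / 2 ^ i - 3 / 2 * η * total s.x ≤ #s.M := by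
  rw [AlgState.M, card_union_of_disjoint (h.matching hx).2]
  have hL' : (1 : ℝ) ≤ L := by exact_mod_cast hL
  set q := η * total s.x / (4 * L) with hq
  have hq0 : 0 ≤ q := by
    have := total_nonneg hx.1; positivity
  have hql : q * L = η * total s.x / 4 := by rw [hq]; field_simp
  have step : ∀ k ≤ L, ∑ i ∈ range k, (#(suppDigit s.x (i + 1)) : ℝ) / 2 ^ (i + 1) +
      (#(s.F k) : ℝ) / 2 ^ k - 5 * q * k ≤ #(s.F 0) := by
    intro k hk
    induction k with
    | zero => simp
    | succ k ih =>
      refine le_trans ?_ (ih (by omega))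
      have h1 : (#(suppDigit s.x (k + 1)) + #(s.F (k + 1)) : ℝ) ≤ 2 * #(s.F k) + 5 * s.c (k + 1) := by
        exact_mod_cast h.lower k (by omega)
      have h2 := h.c_le hk
      rw [← hq] at h2
      rw [sum_range_succ]
      have h3 : ((#(suppDigit s.x (k + 1)) + #(s.F (k + 1)) : ℝ)) / 2 ^ (k + 1) ≤
          (2 * #(s.F k) + 5 * s.c (k + 1)) / 2 ^ (k + 1) := by gcongr
      have h4 : (2 * (#(s.F k) : ℝ)) / 2 ^ (k + 1) = #(s.F k) / 2 ^ k := by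
        rw [pow_succ]; field_simp
      rw [add_div, add_div, h4, mul_div_assoc] at h3
      push_cast
      linarith
  have hs := step L le_rfl
  rw [h.F_high L le_rfl] at hs
  rw [sum_range_succ']
  have hz : (#(suppDigit s.x 0) : ℝ) ≤ #(s.E 0) + s.c 0 := by exact_mod_cast h.zero
  have hc0 := h.c_le (Nat.zero_le L)
  rw [← hq] at hc0
  have : q ≤ q * L := by nlinarith
  simp only [card_empty, pow_zero, div_one, Nat.cast_zero, zero_div] at *
  push_cast
  linarith

/-- The first `L` digits of `y` add up to `y` truncated. -/
theorem sum_digit {y : ℝ} (hy : 0 ≤ y) (hy1 : y ≤ 1) (L : ℕ) :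
    ∑ i ∈ range (L + 1), (digit y i : ℝ) / 2 ^ i = y - Int.fract ((2 : ℝ) ^ L * y) / 2 ^ L := by
  induction L with
  | zero =>
    have := digit_zero_add_fract hy hy1
    simp only [zero_add, range_one, sum_singleton, pow_zero, div_one]
    simp only [pow_zero] at this
    linarith
  | succ L ih =>
    rw [sum_range_succ, ih]
    have := two_mul_fract hy L
    rw [pow_succ]
    have h2 : (2 : ℝ) ^ L ≠ 0 := by positivity
    rw [pow_succ] at this
    set a := Int.fract ((2 : ℝ) ^ L * y)
    set b := Int.fract ((2 : ℝ) ^ L * 2 * y)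
    field_simp
    linarith

theorem sum_card_suppDigit {G : SimpleGraph V} {x : Sym2 V → ℝ} (hx : IsFractionalMatching G x)
    (L : ℕ) : ∑ i ∈ range (L + 1), (#(suppDigit x i) : ℝ) / 2 ^ i =
      total x - (∑ e, Int.fract ((2 : ℝ) ^ L * x e)) / 2 ^ L := by
  simp_rw [card_suppDigit, sum_div]
  rw [sum_comm, total, ← sum_sub_distrib]
  exact sum_congr rfl fun e _ => sum_digit (hx.1 e) (hx.le_one e) L

theorem sum_fract_le {x : Sym2 V → ℝ} (hx : ∀ e, 0 ≤ x e) (a : ℝ) :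
    ∑ e, Int.fract (a * x e) ≤ #(supp x) := by
  have : ∀ e, Int.fract (a * x e) ≤ if e ∈ supp x then 1 else 0 := by
    intro e
    split_ifs with h
    · exact (Int.fract_lt_one _).le
    · rw [mem_supp] at h
      have : x e = 0 := le_antisymm (not_lt.1 h) (hx e)
      simp [this]
  refine (sum_le_sum fun e _ => this e).trans ?_
  simp

theorem card_supp_mul_le {G : SimpleGraph V} {δ : ℝ} {x : Sym2 V → ℝ} (hx : Promise G δ x) :
    #(supp x) * δ ≤ total x := by
  have h1 : #(supp x) • δ ≤ ∑ e ∈ supp x, x e := card_nsmul_le_sum _ _ _ hx.2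
  rw [nsmul_eq_mul] at h1
  refine h1.trans (sum_le_univ_sum_of_nonneg hx.1.1)

theorem two_le_pow_layers {η δ : ℝ} (hη : 0 < η) (hδ : 0 < δ) :
    2 * (η⁻¹ * δ⁻¹) ≤ 2 ^ layers η δ := by
  unfold layers
  rw [pow_add, pow_one]
  have hp : 0 < η⁻¹ * δ⁻¹ := by positivity
  have h1 := Nat.le_ceil (Real.logb 2 (η⁻¹ * δ⁻¹))
  have h2 : η⁻¹ * δ⁻¹ ≤ 2 ^ (⌈Real.logb 2 (η⁻¹ * δ⁻¹)⌉₊ : ℝ) := by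
    rw [← Real.logb_le_iff_le_rpow (by norm_num) hp]; exact h1
  rw [Real.rpow_natCast] at h2
  linarith

/-- Every edge of the support loses less than `2 ^ (-L)`, and there are at most `‖x‖ / δ` such
edges; `L` is chosen so that `2 ^ L ≥ 2 / (η * δ)`. The lower bound on the nonzero entries is needed
only for this estimate. -/
theorem fract_loss_le {G : SimpleGraph V} {η δ : ℝ} (hη : 0 < η) (hδ : 0 < δ) {x : Sym2 V → ℝ}
    (hx : Promise G δ x) :
    (∑ e, Int.fract ((2 : ℝ) ^ layers η δ * x e)) / 2 ^ layers η δ ≤ η / 2 * total x := by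
  have h1 := sum_fract_le hx.1.1 ((2 : ℝ) ^ layers η δ)
  have h2 := card_supp_mul_le hx
  have h3 := two_le_pow_layers hη hδ
  rw [div_le_iff₀ (by positivity)]
  have h4 : (#(supp x) : ℝ) ≤ total x * δ⁻¹ := by
    rw [← div_eq_mul_inv, le_div_iff₀ hδ]; exact h2
  have h5 := total_nonneg hx.1.1
  calc _ ≤ total x * δ⁻¹ := h1.trans h4
    _ = η / 2 * total x * (2 * (η⁻¹ * δ⁻¹)) := by field_simp
    _ ≤ _ := by gcongr

theorem Reachable.inv {G : SimpleGraph V} (hG : G.IsBipartite) {η δ : ℝ} (hη : 0 ≤ η)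
    {s : AlgState V} (h : Reachable G η δ s) : Inv η (layers η δ) s ∧ Promise G δ s.x := by
  induction h with
  | init x s hp hi =>
    obtain ⟨h1, h2⟩ := hi.inv hG hη hp.1
    exact ⟨h1, h2 ▸ hp⟩
  | update s s' e ν hr he hp hu ih =>
    obtain ⟨h1, h2⟩ := hu.inv hG hη ih.1 hp.1
    exact ⟨h1, h2 ▸ hp⟩

theorem Inv.M_subset {η : ℝ} {L : ℕ} {s : AlgState V} (h : Inv η L s) : s.M ⊆ supp s.x :=
  union_subset (h.E_zero.trans (suppDigit_subset _ _)) (h.F_supp 0)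

theorem Reachable.isRounding {G : SimpleGraph V} (hG : G.IsBipartite) {ε δ : ℝ} (hε : 0 < ε)
    (hδ : 0 < δ) {s : AlgState V} (h : Reachable G (ε / 2) δ s) : IsRounding ε s.x s.M := by
  obtain ⟨h1, h2⟩ := h.inv hG (by positivity)
  refine ⟨h1.M_subset, (h1.matching h2.1).1, ?_⟩
  have h3 := h1.card_M (by positivity) (by unfold layers; omega) h2.1
  rw [sum_card_suppDigit h2.1] at h3
  -- With `η = ε / 2`, the counters cost `3 / 2 * η` and the dropped digits `1 / 2 * η`, together
  -- `ε`.
  have h4 := fract_loss_le (show 0 < ε / 2 by positivity) hδ h2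
  linarith

end Rounding

/-! ### Reasoning about programs -/

/-- Value of an expression in unbounded arithmetic. -/
def Expr.val (σ : Config) : Expr → ℕ
  | .const k => k
  | .reg r => σ.reg r
  | .load a i => σ.arr a (i.val σ)
  | .op o p q => o.apply (p.val σ) (q.val σ)

/-- If all cells are below `B`, then all values occurring in an expression `p` are below
`B ^ p.deg`. -/
def Expr.deg : Expr → ℕ
  | .const k => k + 1
  | .reg _ => 1
  | .load _ i => i.deg
  | .op .add p q => max p.deg q.deg + 1
  | .op .mul p q => p.deg + q.deg
  | .op _ p q => max p.deg q.deg

/-- All memory cells are below `B`. -/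
def Small (B : ℕ) (σ : Config) : Prop := (∀ r, σ.reg r < B) ∧ ∀ a i, σ.arr a i < B

theorem Expr.deg_pos (p : Expr) : 1 ≤ p.deg := by
  induction p with
  | const k => simp [Expr.deg]
  | reg r => simp [Expr.deg]
  | load a i ih => simpa [Expr.deg] using ih
  | op o p q ih _ => cases o <;> simp only [Expr.deg] <;> omega

/-- A sum at most doubles the maximum, which costs one factor `B ≥ 2`; a product adds the exponents;
no other operation exceeds the larger of `1` and its operands. The degree is computed from the
syntax alone, so the absence of overflow becomes decidable. -/
theorem Expr.val_lt {B : ℕ} {σ : Config} (h : Small B σ) (hB : 2 ≤ B) (p : Expr) :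
    p.val σ < B ^ p.deg := by
  have mono : ∀ {a b : ℕ}, a ≤ b → B ^ a ≤ B ^ b := fun hab => Nat.pow_le_pow_right (by omega) hab
  have pos : ∀ a, 0 < B ^ a := fun a => by positivity
  induction p with
  | const k =>
    calc k < 2 ^ k := Nat.lt_two_pow_self
      _ ≤ B ^ k := Nat.pow_le_pow_left hB k
      _ ≤ B ^ (k + 1) := mono (by omega)
  | reg r => simpa [Expr.deg, Expr.val] using h.1 r
  | load a i _ =>
    calc σ.arr a (i.val σ) < B ^ 1 := by simpa using h.2 a _
      _ ≤ _ := mono i.deg_pos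
  | op o p q ihp ihq =>
    have h1 : p.val σ < B ^ max p.deg q.deg := ihp.trans_le (mono (le_max_left _ _))
    have h2 : q.val σ < B ^ max p.deg q.deg := ihq.trans_le (mono (le_max_right _ _))
    have h3 : 1 < B ^ max p.deg q.deg :=
      lt_of_lt_of_le (by rw [pow_one]; omega) (mono (p.deg_pos.trans (le_max_left _ _)) : B ^ 1 ≤ _)
    cases o with
    | add =>
      simp only [Expr.val, Op.apply, Expr.deg, pow_succ]
      nlinarith
    | sub => simp only [Expr.val, Op.apply, Expr.deg]; omega
    | mul =>
      simp only [Expr.val, Op.apply, Expr.deg, pow_add]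
      exact Nat.mul_lt_mul'' ihp ihq
    | div =>
      simp only [Expr.val, Op.apply, Expr.deg]
      exact (Nat.div_le_self _ _).trans_lt h1
    | mod =>
      simp only [Expr.val, Op.apply, Expr.deg]
      exact (Nat.mod_le _ _).trans_lt h1
    | lt => simp only [Expr.val, Op.apply, Expr.deg]; split_ifs <;> omega
    | eq => simp only [Expr.val, Op.apply, Expr.deg]; split_ifs <;> omega

theorem word_eq {w k : ℕ} (h : k < 2 ^ w) : word w k = some k := if_pos h

theorem Expr.deg_le_left (o : Op) (p q : Expr) : p.deg ≤ (Expr.op o p q).deg := by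
  cases o <;> simp only [Expr.deg] <;> omega

theorem Expr.deg_le_right (o : Op) (p q : Expr) : q.deg ≤ (Expr.op o p q).deg := by
  cases o <;> simp only [Expr.deg] <;> omega

theorem Expr.eval_eq {B : ℕ} {σ : Config} (h : Small B σ) (hB : 2 ≤ B) (p : Expr) {d w : ℕ}
    (hd : p.deg ≤ d) (hw : B ^ d ≤ 2 ^ w) : p.eval w σ = some (p.val σ) := by
  have lt : p.val σ < 2 ^ w :=
    (p.val_lt h hB).trans_le ((Nat.pow_le_pow_right (by omega) hd).trans hw)
  induction p with
  | const k => exact word_eq lt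
  | reg r => exact word_eq lt
  | load a i ih =>
    have hi := ih hd (((i.val_lt h hB).trans_le (Nat.pow_le_pow_right (by omega) hd)).trans_le hw)
    simp only [Expr.eval, hi, Option.bind_some]
    exact word_eq lt
  | op o p q ihp ihq =>
    have h1 := (p.deg_le_left o q).trans hd
    have h2 := (p.deg_le_right o q).trans hd
    have hp := ihp h1 (((p.val_lt h hB).trans_le (Nat.pow_le_pow_right (by omega) h1)).trans_le hw)
    have hq := ihq h2 (((q.val_lt h hB).trans_le (Nat.pow_le_pow_right (by omega) h2)).trans_le hw)
    simp only [Expr.eval, hp, hq, Option.bind_some]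
    exact word_eq lt

theorem Small.setReg {B : ℕ} {σ : Config} (h : Small B σ) {r k : ℕ} (hk : k < B) :
    Small B (σ.setReg r k) := by
  refine ⟨fun r' => ?_, h.2⟩
  simp only [Config.setReg, Function.update_apply]
  split_ifs
  · exact hk
  · exact h.1 r'

theorem Small.setArr {B : ℕ} {σ : Config} (h : Small B σ) {a i k : ℕ} (hk : k < B) :
    Small B (σ.setArr a i k) := by
  refine ⟨h.1, fun a' i' => ?_⟩
  simp only [Config.setArr, Function.update_apply]
  split_ifs with h1
  · simp only [Function.update_apply]
    split_ifs
    · exact hk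
    · exact h.2 _ _
  · exact h.2 _ _

@[simp] theorem reg_setReg (σ : Config) (r k r' : ℕ) :
    (σ.setReg r k).reg r' = if r' = r then k else σ.reg r' := by
  simp [Config.setReg, Function.update_apply]

@[simp] theorem arr_setReg (σ : Config) (r k : ℕ) : (σ.setReg r k).arr = σ.arr := rfl

@[simp] theorem reg_setArr (σ : Config) (a i k : ℕ) : (σ.setArr a i k).reg = σ.reg := rfl

@[simp] theorem arr_setArr (σ : Config) (a i k a' : ℕ) :
    (σ.setArr a i k).arr a' = if a' = a then Function.update (σ.arr a) i k else σ.arr a' := by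
  simp [Config.setArr, Function.update_apply]

/-! ### Triples with time bounds -/

/-- Started in `σ`, the program `c` halts within time `T` in a configuration that satisfies `Q`;
all cells stay below `B`, and words with room for `B ^ 16` suffice. -/
def Runs (B : ℕ) (c : Cmd) (σ : Config) (T : ℕ) (Q : Config → Prop) : Prop :=
  Small B σ → ∃ t ρ, (∀ w, B ^ 16 ≤ 2 ^ w → Exec w c σ t ρ) ∧ t ≤ T ∧ Small B ρ ∧ Q ρ

theorem Runs.mono {B : ℕ} {c : Cmd} {σ : Config} {T T' : ℕ} {Q Q' : Config → Prop}
    (h : Runs B c σ T Q) (hT : T ≤ T') (hQ : ∀ ρ, Small B ρ → Q ρ → Q' ρ) : Runs B c σ T' Q' := by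
  intro hσ
  obtain ⟨t, ρ, h1, h2, h3, h4⟩ := h hσ
  exact ⟨t, ρ, h1, h2.trans hT, h3, hQ ρ h3 h4⟩

theorem Runs.of_small {B : ℕ} {c : Cmd} {σ : Config} {T : ℕ} {Q : Config → Prop}
    (h : Small B σ → Runs B c σ T Q) : Runs B c σ T Q := fun hσ => h hσ hσ

theorem Runs.seq {B : ℕ} {c d : Cmd} {σ : Config} {T₁ T₂ : ℕ} {Q : Config → Prop}
    (h : Runs B c σ T₁ fun ρ => Runs B d ρ T₂ Q) : Runs B (.seq c d) σ (T₁ + T₂) Q := by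
  intro hσ
  obtain ⟨t, ρ, h1, h2, h3, h4⟩ := h hσ
  obtain ⟨t', ρ', h1', h2', h3', h4'⟩ := h4 h3
  exact ⟨t + t', ρ', fun w hw => .seq _ _ _ _ _ _ _ (h1 w hw) (h1' w hw), by omega, h3', h4'⟩

theorem Runs.skip {B : ℕ} {σ : Config} {Q : Config → Prop} (h : Q σ) : Runs B .skip σ 1 Q :=
  fun hσ => ⟨1, σ, fun _ _ => .skip _, le_rfl, hσ, h⟩

theorem Runs.cond {B : ℕ} (hB : 2 ≤ B) {p : Expr} (hp : p.deg ≤ 16) {c d : Cmd} {σ : Config}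
    {T : ℕ} {Q : Config → Prop} (h1 : p.val σ ≠ 0 → Runs B c σ T Q)
    (h2 : p.val σ = 0 → Runs B d σ T Q) : Runs B (.cond p c d) σ (p.time + 1 + T) Q := by
  intro hσ
  by_cases h : p.val σ = 0
  · obtain ⟨t, ρ, g1, g2, g3, g4⟩ := h2 h hσ
    exact ⟨_, ρ, fun w hw => .condFalse _ _ _ _ _ _ (by rw [p.eval_eq hσ hB hp hw, h]) (g1 w hw),
      by omega, g3, g4⟩
  · obtain ⟨t, ρ, g1, g2, g3, g4⟩ := h1 h hσ
    exact ⟨_, ρ, fun w hw => .condTrue _ _ _ _ _ _ _ (p.eval_eq hσ hB hp hw) h (g1 w hw),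
      by omega, g3, g4⟩

/-- Started in `σ`, the program `c` halts after a time `t` in a configuration `ρ` such that `Q t ρ`. -/
def RunsIn (B : ℕ) (c : Cmd) (σ : Config) (Q : ℕ → Config → Prop) : Prop :=
  Small B σ → ∃ t ρ, (∀ w, B ^ 16 ≤ 2 ^ w → Exec w c σ t ρ) ∧ Small B ρ ∧ Q t ρ

theorem Runs.runsIn {B : ℕ} {c : Cmd} {σ : Config} {T : ℕ} {Q : Config → Prop}
    (h : Runs B c σ T Q) : RunsIn B c σ fun t ρ => t ≤ T ∧ Q ρ := by
  intro hσ
  obtain ⟨t, ρ, h1, h2, h3, h4⟩ := h hσ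
  exact ⟨t, ρ, h1, h3, h2, h4⟩

theorem RunsIn.runs {B : ℕ} {c : Cmd} {σ : Config} {T : ℕ} {Q : Config → Prop}
    (h : RunsIn B c σ fun t ρ => t ≤ T ∧ Q ρ) : Runs B c σ T Q := by
  intro hσ
  obtain ⟨t, ρ, h1, h3, h2, h4⟩ := h hσ
  exact ⟨t, ρ, h1, h2, h3, h4⟩

theorem RunsIn.mono {B : ℕ} {c : Cmd} {σ : Config} {Q Q' : ℕ → Config → Prop}
    (h : RunsIn B c σ Q) (hQ : ∀ t ρ, Small B ρ → Q t ρ → Q' t ρ) : RunsIn B c σ Q' := by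
  intro hσ
  obtain ⟨t, ρ, h1, h2, h3⟩ := h hσ
  exact ⟨t, ρ, h1, h2, hQ t ρ h2 h3⟩

theorem RunsIn.seq {B : ℕ} {c d : Cmd} {σ : Config} {P Q : ℕ → Config → Prop}
    (h : RunsIn B c σ P)
    (h' : ∀ t ρ, Small B ρ → P t ρ → RunsIn B d ρ fun t' ρ' => Q (t + t') ρ') :
    RunsIn B (.seq c d) σ Q := by
  intro hσ
  obtain ⟨t, ρ, h1, h2, h3⟩ := h hσ
  obtain ⟨t', ρ', h1', h2', h3'⟩ := h' t ρ h2 h3 h2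
  exact ⟨t + t', ρ', fun w hw => .seq _ _ _ _ _ _ _ (h1 w hw) (h1' w hw), h2', h3'⟩

theorem RunsIn.cond {B : ℕ} (hB : 2 ≤ B) {p : Expr} (hp : p.deg ≤ 16) {c d : Cmd} {σ : Config}
    {Q : ℕ → Config → Prop}
    (h1 : p.val σ ≠ 0 → RunsIn B c σ fun t ρ => Q (p.time + 1 + t) ρ)
    (h2 : p.val σ = 0 → RunsIn B d σ fun t ρ => Q (p.time + 1 + t) ρ) :
    RunsIn B (.cond p c d) σ Q := by
  intro hσ
  by_cases h : p.val σ = 0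
  · obtain ⟨t, ρ, g1, g2, g3⟩ := h2 h hσ
    exact ⟨_, ρ, fun w hw => .condFalse _ _ _ _ _ _ (by rw [p.eval_eq hσ hB hp hw, h]) (g1 w hw),
      g2, g3⟩
  · obtain ⟨t, ρ, g1, g2, g3⟩ := h1 h hσ
    exact ⟨_, ρ, fun w hw => .condTrue _ _ _ _ _ _ _ (p.eval_eq hσ hB hp hw) h (g1 w hw), g2, g3⟩

/-- Rule for loops with an invariant `I k` that includes a budget `k` of time. -/
theorem RunsIn.loop {B : ℕ} (hB : 2 ≤ B) {p : Expr} (hp : p.deg ≤ 16) {c : Cmd}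
    {Q : ℕ → Config → Prop} (I : ℕ → Config → Prop)
    (step : ∀ σ k, I k σ → Small B σ → p.val σ ≠ 0 →
      RunsIn B c σ fun t ρ => ∃ k', t + p.time + 1 + k' ≤ k ∧ I k' ρ)
    (exit : ∀ σ k, I k σ → Small B σ → p.val σ = 0 → ∃ k', p.time + 1 + k' ≤ k ∧ Q k' σ)
    {σ : Config} {k : ℕ} (h : I k σ) :
    RunsIn B (.loop p c) σ fun t ρ => ∃ k', t + k' ≤ k ∧ Q k' ρ := by
  -- Each round spends at least one unit, so the budget is also the termination measure.
  induction k using Nat.strong_induction_on generalizing σ with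
  | _ k ih =>
    intro hσ
    by_cases hv : p.val σ = 0
    · obtain ⟨k', h1, h2⟩ := exit σ k h hσ hv
      exact ⟨_, σ, fun w hw => .loopFalse _ _ _ (by rw [p.eval_eq hσ hB hp hw, hv]), hσ, k', h1, h2⟩
    · obtain ⟨t, ρ, g1, g2, k', hk, g3⟩ := step σ k h hσ hv hσ
      obtain ⟨t', ρ', f1, f2, k'', f3, f4⟩ := ih k' (by omega) g3 g2
      exact ⟨_, ρ', fun w hw => .loopTrue _ _ _ _ _ _ _ _ (p.eval_eq hσ hB hp hw) hv (g1 w hw)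
        (f1 w hw), f2, k'', by omega, f4⟩

theorem Runs.loop {B : ℕ} (hB : 2 ≤ B) {p : Expr} (hp : p.deg ≤ 16) {c : Cmd}
    {Q : Config → Prop} (I : ℕ → Config → Prop)
    (step : ∀ σ k, I k σ → Small B σ → p.val σ ≠ 0 →
      ∃ T, Runs B c σ T fun ρ => ∃ k', T + p.time + 1 + k' ≤ k ∧ I k' ρ)
    (exit : ∀ σ k, I k σ → Small B σ → p.val σ = 0 → p.time + 1 ≤ k ∧ Q σ)
    {σ : Config} {k : ℕ} (h : I k σ) : Runs B (.loop p c) σ k Q := by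
  refine RunsIn.runs ((RunsIn.loop (Q := fun _ ρ => Q ρ) hB hp I (fun σ k hI hσ hv => ?_)
    (fun σ k hI hσ hv => ⟨0, exit σ k hI hσ hv⟩) h).mono fun t ρ _ ⟨k', hk, hQ⟩ => ⟨by omega, hQ⟩)
  obtain ⟨T, hT⟩ := step σ k hI hσ hv
  exact hT.runsIn.mono fun t ρ _ ⟨ht, k', hk, hI'⟩ => ⟨k', by omega, hI'⟩

/-! ### Loop-free programs -/

/-- A program without loops all of whose expressions have degree at most `16`. -/
def Cmd.flat : Cmd → Bool
  | .skip => true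
  | .assign _ p => p.deg ≤ 16
  | .store _ i p => i.deg ≤ 16 && p.deg ≤ 16
  | .seq c d => c.flat && d.flat
  | .cond p c d => p.deg ≤ 16 && c.flat && d.flat
  | .loop _ _ => false

/-- An upper bound for the running time of a program without loops. -/
def Cmd.tmax : Cmd → ℕ
  | .skip => 1
  | .assign _ p => p.time + 1
  | .store _ i p => i.time + p.time + 1
  | .seq c d => c.tmax + d.tmax
  | .cond p c d => p.time + 1 + (c.tmax + d.tmax)
  | .loop _ _ => 0

/-- The weakest precondition of a program without loops. -/
def Cmd.wp (B : ℕ) : Cmd → (Config → Prop) → Config → Prop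
  | .skip, Q, σ => Q σ
  | .assign r p, Q, σ => p.val σ < B ∧ Q (σ.setReg r (p.val σ))
  | .store a i p, Q, σ => p.val σ < B ∧ Q (σ.setArr a (i.val σ) (p.val σ))
  | .seq c d, Q, σ => c.wp B (d.wp B Q) σ
  | .cond p c d, Q, σ => (p.val σ ≠ 0 → c.wp B Q σ) ∧ (p.val σ = 0 → d.wp B Q σ)
  | .loop _ _, _, _ => False

/-- The precondition demands that every written value be below `B`, which keeps all cells small;
intermediate values of expressions are covered by the degree bound. -/
theorem Runs.of_wp {B : ℕ} (hB : 2 ≤ B) {c : Cmd} (hc : c.flat = true) {σ : Config}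
    {Q : Config → Prop} (h : c.wp B Q σ) : Runs B c σ c.tmax Q := by
  induction c generalizing σ Q with
  | skip => exact Runs.skip h
  | assign r p =>
    intro hσ
    simp only [Cmd.flat, decide_eq_true_eq] at hc
    exact ⟨_, _, fun w hw => .assign _ _ _ _ (p.eval_eq hσ hB hc hw), le_rfl, hσ.setReg h.1, h.2⟩
  | store a i p =>
    intro hσ
    simp only [Cmd.flat, Bool.and_eq_true, decide_eq_true_eq] at hc
    exact ⟨_, _, fun w hw => .store _ _ _ _ _ _ (i.eval_eq hσ hB hc.1 hw)
      (p.eval_eq hσ hB hc.2 hw), le_rfl, hσ.setArr h.1, h.2⟩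
  | seq c d ihc ihd =>
    simp only [Cmd.flat, Bool.and_eq_true] at hc
    exact Runs.seq ((ihc hc.1 h).mono le_rfl fun ρ _ hρ => ihd hc.2 hρ)
  | cond p c d ihc ihd =>
    simp only [Cmd.flat, Bool.and_eq_true, decide_eq_true_eq] at hc
    exact Runs.cond hB hc.1.1
      (fun hv => (ihc hc.1.2 (h.1 hv)).mono (Nat.le_add_right _ _) fun _ _ h => h)
      (fun hv => (ihd hc.2 (h.2 hv)).mono (Nat.le_add_left _ _) fun _ _ h => h)
  | loop p c => exact h.elim

theorem Runs.mono_time {B : ℕ} {c : Cmd} {σ : Config} {T T' : ℕ} {Q : Config → Prop}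
    (h : Runs B c σ T Q) (hT : T ≤ T') : Runs B c σ T' Q := h.mono hT fun _ _ h => h

/-- A program without loops, with degrees at most `16` and running time at most `t`. -/
def Cmd.quick (t : ℕ) (c : Cmd) : Bool := c.flat && Nat.ble c.tmax t

/-- For a concrete program `quick` is a closed Boolean, so degrees and running time are checked by
evaluation and only the weakest precondition is left to prove. -/
theorem Runs.of_quick {B : ℕ} (hB : 2 ≤ B) {c : Cmd} (t : ℕ) (hc : c.quick t = true) {σ : Config}
    {Q : Config → Prop} (h : c.wp B Q σ) : Runs B c σ t Q := by
  simp only [Cmd.quick, Bool.and_eq_true, Nat.ble_eq] at hc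
  exact (Runs.of_wp hB hc.1 h).mono_time hc.2

theorem Runs.quick_seq {B : ℕ} (hB : 2 ≤ B) {c d : Cmd} (t : ℕ) (hc : c.quick t = true) {σ : Config}
    {T : ℕ} {Q : Config → Prop} (h : c.wp B (fun ρ => Runs B d ρ T Q) σ) :
    Runs B (.seq c d) σ (t + T) Q := Runs.seq (Runs.of_quick hB t hc h)

theorem Runs.call_seq {B : ℕ} {c d : Cmd} {σ : Config} {T₁ T₂ : ℕ} {P Q : Config → Prop}
    (h : Runs B c σ T₁ P) (h' : ∀ ρ, Small B ρ → P ρ → Runs B d ρ T₂ Q) :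
    Runs B (.seq c d) σ (T₁ + T₂) Q := Runs.seq (h.mono le_rfl h')

/-! ### Frames: what a program leaves unchanged -/

/-- All registers written by a program are below `b`. -/
def Cmd.regBelow (b : ℕ) : Cmd → Bool
  | .assign r _ => r < b
  | .seq c d => c.regBelow b && d.regBelow b
  | .cond _ c d => c.regBelow b && d.regBelow b
  | .loop _ c => c.regBelow b
  | _ => true

/-- All arrays written by a program belong to `A`. -/
def Cmd.arrIn (A : List ℕ) : Cmd → Bool
  | .store a _ _ => a ∈ A
  | .seq c d => c.arrIn A && d.arrIn A
  | .cond _ c d => c.arrIn A && d.arrIn A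
  | .loop _ c => c.arrIn A
  | _ => true

/-- This makes the frame rule applicable to an unspecified subprogram when only its registers
matter. -/
theorem Cmd.exists_arrIn (c : Cmd) : ∃ A, c.arrIn A = true := by
  have mono : ∀ (c : Cmd) (A A' : List ℕ), A ⊆ A' → c.arrIn A = true → c.arrIn A' = true := by
    intro c A A' hA
    induction c <;> simp_all [Cmd.arrIn]
    exact fun h => hA h
  induction c with
  | skip => exact ⟨[], rfl⟩
  | assign => exact ⟨[], rfl⟩
  | store a => exact ⟨[a], by simp [Cmd.arrIn]⟩
  | seq c d ih ih' =>
    obtain ⟨A, hA⟩ := ih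
    obtain ⟨A', hA'⟩ := ih'
    exact ⟨A ++ A', by simp [Cmd.arrIn, mono c A (A ++ A') (by simp) hA,
      mono d A' (A ++ A') (by simp) hA']⟩
  | cond _ c d ih ih' =>
    obtain ⟨A, hA⟩ := ih
    obtain ⟨A', hA'⟩ := ih'
    exact ⟨A ++ A', by simp [Cmd.arrIn, mono c A (A ++ A') (by simp) hA,
      mono d A' (A ++ A') (by simp) hA']⟩
  | loop _ c ih => exact ih

/-- `ρ` agrees with `σ` except for registers below `b` and arrays in `A`. -/
def Frame (b : ℕ) (A : List ℕ) (σ ρ : Config) : Prop :=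
  (∀ r, b ≤ r → ρ.reg r = σ.reg r) ∧ ∀ a, a ∉ A → ρ.arr a = σ.arr a

theorem Frame.refl (b : ℕ) (A : List ℕ) (σ : Config) : Frame b A σ σ :=
  ⟨fun _ _ => rfl, fun _ _ => rfl⟩

theorem Frame.trans {b : ℕ} {A : List ℕ} {σ ρ τ : Config} (h : Frame b A σ ρ)
    (h' : Frame b A ρ τ) : Frame b A σ τ :=
  ⟨fun r hr => (h'.1 r hr).trans (h.1 r hr), fun a ha => (h'.2 a ha).trans (h.2 a ha)⟩

theorem Exec.frame {w : ℕ} {c : Cmd} {σ : Config} {t : ℕ} {ρ : Config} (h : Exec w c σ t ρ)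
    {b : ℕ} {A : List ℕ} (hb : c.regBelow b = true) (hA : c.arrIn A = true) : Frame b A σ ρ := by
  induction h with
  | skip => exact Frame.refl _ _ _
  | assign r p σ k _ =>
    simp only [Cmd.regBelow, decide_eq_true_eq] at hb
    refine ⟨fun r' hr => ?_, fun _ _ => rfl⟩
    rw [reg_setReg, if_neg (by omega)]
  | store a i p σ j k _ _ =>
    simp only [Cmd.arrIn, decide_eq_true_eq] at hA
    refine ⟨fun _ _ => rfl, fun a' ha => ?_⟩
    rw [arr_setArr, if_neg (by rintro rfl; exact ha hA)]
  | seq c d σ σ₁ σ₂ t₁ t₂ _ _ ih₁ ih₂ =>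
    simp only [Cmd.regBelow, Cmd.arrIn, Bool.and_eq_true] at hb hA
    exact (ih₁ hb.1 hA.1).trans (ih₂ hb.2 hA.2)
  | condTrue p c d σ σ' k t _ _ _ ih =>
    simp only [Cmd.regBelow, Cmd.arrIn, Bool.and_eq_true] at hb hA
    exact ih hb.1 hA.1
  | condFalse p c d σ σ' t _ _ ih =>
    simp only [Cmd.regBelow, Cmd.arrIn, Bool.and_eq_true] at hb hA
    exact ih hb.2 hA.2
  | loopTrue p c σ σ₁ σ₂ k t₁ t₂ _ _ _ _ ih₁ ih₂ => exact (ih₁ hb hA).trans (ih₂ hb hA)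
  | loopFalse => exact Frame.refl _ _ _

theorem exists_pow_le (m : ℕ) : ∃ w, m ≤ 2 ^ w := ⟨m, Nat.lt_two_pow_self.le⟩

/-- Frames are a property of executions, so some word length with enough room is fixed to obtain
one; the final configuration does not depend on it. -/
theorem Runs.frame {B : ℕ} {c : Cmd} {σ : Config} {T : ℕ} {Q : Config → Prop} (b : ℕ)
    (A : List ℕ) (h : Runs B c σ T Q) (hb : c.regBelow b = true) (hA : c.arrIn A = true) :
    Runs B c σ T fun ρ => Q ρ ∧ Frame b A σ ρ := by
  intro hσ
  obtain ⟨t, ρ, h1, h2, h3, h4⟩ := h hσ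
  obtain ⟨w, hw⟩ := exists_pow_le (B ^ 16)
  exact ⟨t, ρ, h1, h2, h3, h4, (h1 w hw).frame hb hA⟩

theorem RunsIn.frame {B : ℕ} {c : Cmd} {σ : Config} {Q : ℕ → Config → Prop} (b : ℕ)
    (A : List ℕ) (h : RunsIn B c σ Q) (hb : c.regBelow b = true) (hA : c.arrIn A = true) :
    RunsIn B c σ fun t ρ => Q t ρ ∧ Frame b A σ ρ := by
  intro hσ
  obtain ⟨t, ρ, h1, h2, h3⟩ := h hσ
  obtain ⟨w, hw⟩ := exists_pow_le (B ^ 16)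
  exact ⟨t, ρ, h1, h2, h3, (h1 w hw).frame hb hA⟩

/-! ### Notation for programs -/

instance : Add Expr := ⟨Expr.op .add⟩
instance : Sub Expr := ⟨Expr.op .sub⟩
instance : Mul Expr := ⟨Expr.op .mul⟩
instance : Div Expr := ⟨Expr.op .div⟩
instance : Mod Expr := ⟨Expr.op .mod⟩
instance (k : ℕ) : OfNat Expr k := ⟨Expr.const k⟩

/-- Register `r`. -/
abbrev R (r : ℕ) : Expr := .reg r

/-- `p < q`. -/
def Expr.lt (p q : Expr) : Expr := .op .lt p q

/-- `p = q`. -/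
def Expr.eq (p q : Expr) : Expr := .op .eq p q

@[simp] theorem val_const (σ : Config) (k : ℕ) : (Expr.const k).val σ = k := rfl
@[simp] theorem val_ofNat (σ : Config) (k : ℕ) : (OfNat.ofNat k : Expr).val σ = k := rfl
@[simp] theorem val_zero (σ : Config) : (0 : Expr).val σ = 0 := rfl
@[simp] theorem val_one (σ : Config) : (1 : Expr).val σ = 1 := rfl
@[simp] theorem val_reg (σ : Config) (r : ℕ) : (Expr.reg r).val σ = σ.reg r := rfl
@[simp] theorem val_load (σ : Config) (a : ℕ) (p : Expr) :
    (Expr.load a p).val σ = σ.arr a (p.val σ) := rfl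
@[simp] theorem val_add (σ : Config) (p q : Expr) : (p + q).val σ = p.val σ + q.val σ := rfl
@[simp] theorem val_sub (σ : Config) (p q : Expr) : (p - q).val σ = p.val σ - q.val σ := rfl
@[simp] theorem val_mul (σ : Config) (p q : Expr) : (p * q).val σ = p.val σ * q.val σ := rfl
@[simp] theorem val_div (σ : Config) (p q : Expr) : (p / q).val σ = p.val σ / q.val σ := rfl
@[simp] theorem val_mod (σ : Config) (p q : Expr) : (p % q).val σ = p.val σ % q.val σ := rfl
@[simp] theorem val_lt (σ : Config) (p q : Expr) :
    (p.lt q).val σ = if p.val σ < q.val σ then 1 else 0 := rfl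
@[simp] theorem val_eq (σ : Config) (p q : Expr) :
    (p.eq q).val σ = if p.val σ = q.val σ then 1 else 0 := rfl

/-- The commands of a list, one after the other. -/
def block : List Cmd → Cmd
  | [] => .skip
  | [c] => c
  | c :: d :: l => .seq c (block (d :: l))

/-! ### Families of indexed sets -/

theorem mul_add_inj {N r k r' k' : ℕ} (hk : k < N) (hk' : k' < N) :
    r * N + k = r' * N + k' ↔ r = r' ∧ k = k' := by
  refine ⟨fun h => ?_, by rintro ⟨rfl, rfl⟩; rfl⟩
  have h1 : (r * N + k) / N = r := by
    rw [mul_comm, Nat.mul_add_div (by omega), Nat.div_eq_of_lt hk, add_zero]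
  have h2 : (r' * N + k') / N = r' := by
    rw [mul_comm, Nat.mul_add_div (by omega), Nat.div_eq_of_lt hk', add_zero]
  rw [h, h2] at h1
  subst h1
  omega

/-- The arrays `len`, `adj`, `pos` represent the sets `{x | mem r x}` of numbers below `N`: row `r`
of `adj` lists the `len r` elements, and row `r` of `pos` holds their positions, counted from one. -/
structure FamRep (N : ℕ) (len adj pos : ℕ → ℕ) (mem : ℕ → ℕ → Prop) : Prop where
  mem_lt : ∀ {r x}, mem r x → x < N
  pos_iff : ∀ {r x}, x < N → (pos (r * N + x) ≠ 0 ↔ mem r x)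
  pos_le : ∀ {r x}, mem r x → pos (r * N + x) ≤ len r
  adj_pos : ∀ {r x}, mem r x → adj (r * N + (pos (r * N + x) - 1)) = x
  mem_adj : ∀ {r k}, k < len r → mem r (adj (r * N + k))
  pos_adj : ∀ {r k}, k < len r → pos (r * N + adj (r * N + k)) = k + 1

namespace FamRep

variable {N : ℕ} {len adj pos : ℕ → ℕ} {mem : ℕ → ℕ → Prop}

theorem adj_injOn (h : FamRep N len adj pos mem) (r : ℕ) :
    Set.InjOn (fun k => adj (r * N + k)) (range (len r) : Set ℕ) := by
  intro k hk k' hk' he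
  have h1 := h.pos_adj (r := r) (mem_range.1 hk)
  have h2 := h.pos_adj (r := r) (mem_range.1 hk')
  simp only at he
  rw [he] at h1
  omega

theorem image_adj (h : FamRep N len adj pos mem) (r : ℕ) (S : Finset ℕ)
    (hS : ∀ x, x ∈ S ↔ mem r x) : (range (len r)).image (fun k => adj (r * N + k)) = S := by
  ext x
  rw [hS, mem_image]
  constructor
  · rintro ⟨k, hk, rfl⟩
    exact h.mem_adj (mem_range.1 hk)
  · intro hx
    have h1 := (h.pos_iff (h.mem_lt hx)).2 hx
    have h2 := h.pos_le hx
    exact ⟨_, mem_range.2 (by omega), h.adj_pos hx⟩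

theorem len_eq (h : FamRep N len adj pos mem) (r : ℕ) (S : Finset ℕ)
    (hS : ∀ x, x ∈ S ↔ mem r x) : len r = #S := by
  rw [← h.image_adj r S hS, card_image_of_injOn (h.adj_injOn r), card_range]

theorem len_le (h : FamRep N len adj pos mem) (r : ℕ) : len r ≤ N := by
  classical
  rw [h.len_eq r {x ∈ range N | mem r x} fun x => by
    simp only [mem_filter, mem_range, and_iff_right_iff_imp]; exact h.mem_lt]
  exact (card_filter_le _ _).trans (by simp)

theorem len_lt (h : FamRep N len adj pos mem) {r x : ℕ} (hx : x < N) (hm : ¬ mem r x) :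
    len r < N := by
  classical
  rw [h.len_eq r {x ∈ range N | mem r x} fun x => by
    simp only [mem_filter, mem_range, and_iff_right_iff_imp]; exact h.mem_lt]
  refine lt_of_lt_of_eq (card_lt_card (filter_ssubset.2 ⟨x, by simpa, hm⟩)) (by simp)

theorem congr (h : FamRep N len adj pos mem) {mem' : ℕ → ℕ → Prop}
    (hm : ∀ r x, mem' r x ↔ mem r x) : FamRep N len adj pos mem' := by
  have : mem' = mem := by ext r x; exact hm r x
  rwa [this]

/-- The element is appended to its row. Since a nonmember exists, the row has fewer than `N` entries
and the new cell does not run into the next row. -/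
theorem insert (h : FamRep N len adj pos mem) {r x : ℕ} (hx : x < N) (hm : ¬ mem r x) :
    FamRep N (Function.update len r (len r + 1)) (Function.update adj (r * N + len r) x)
      (Function.update pos (r * N + x) (len r + 1)) fun r' y => mem r' y ∨ (r' = r ∧ y = x) := by
  have hl := h.len_lt hx hm
  have hle := h.len_le
  have upos : ∀ r' y, y < N → Function.update pos (r * N + x) (len r + 1) (r' * N + y) =
      if r' = r ∧ y = x then len r + 1 else pos (r' * N + y) := by
    intro r' y hy; simp only [Function.update_apply, mul_add_inj hy hx]
  have uadj : ∀ r' k, k < N → Function.update adj (r * N + len r) x (r' * N + k) =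
      if r' = r ∧ k = len r then x else adj (r' * N + k) := by
    intro r' y hy; simp only [Function.update_apply, mul_add_inj hy hl]
  have ulen : ∀ r', Function.update len r (len r + 1) r' = if r' = r then len r + 1 else len r' :=
    fun r' => Function.update_apply _ _ _ _
  have hlt : ∀ {r' y}, (mem r' y ∨ (r' = r ∧ y = x)) → y < N := by
    rintro r' y (h1 | ⟨-, rfl⟩)
    · exact h.mem_lt h1
    · exact hx
  refine ⟨hlt, fun {r' y} hy => ?_, fun {r' y} hy => ?_, fun {r' y} hy => ?_, fun {r' k} hk => ?_,
    fun {r' k} hk => ?_⟩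
  · rw [upos _ _ hy]
    split_ifs with h1
    · simp [h1]
    · rw [h.pos_iff hy]; simp [h1]
  · rw [upos _ _ (hlt hy), ulen]
    by_cases h1 : r' = r ∧ y = x
    · simp [h1]
    · have h2 := h.pos_le (hy.resolve_right h1)
      rw [if_neg h1]
      split_ifs with h3
      · subst h3; omega
      · exact h2
  · rw [upos _ _ (hlt hy)]
    by_cases h1 : r' = r ∧ y = x
    · simp [h1]
    · have h2 := h.pos_le (hy.resolve_right h1)
      have h3 := (h.pos_iff (h.mem_lt (hy.resolve_right h1))).2 (hy.resolve_right h1)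
      have h4 := hle r'
      rw [if_neg h1, uadj _ _ (by omega), if_neg (by rintro ⟨rfl, _⟩; omega),
        h.adj_pos (hy.resolve_right h1)]
  · rw [ulen] at hk
    have hkN : k < N := by
      split_ifs at hk
      · omega
      · exact hk.trans_le (hle r')
    rw [uadj _ _ hkN]
    split_ifs with h1
    · exact Or.inr ⟨h1.1, rfl⟩
    · refine Or.inl (h.mem_adj ?_)
      split_ifs at hk with h2
      · subst h2; simp only [true_and] at h1; omega
      · exact hk
  · rw [ulen] at hk
    have hkN : k < N := by
      split_ifs at hk
      · omega
      · exact hk.trans_le (hle r')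
    rw [uadj _ _ hkN]
    by_cases h1 : r' = r ∧ k = len r
    · simp [h1]
    · have hk' : k < len r' := by
        split_ifs at hk with h2
        · subst h2; simp only [true_and] at h1; omega
        · exact hk
      have h3 := h.mem_adj hk'
      rw [if_neg h1, upos _ _ (h.mem_lt h3), if_neg (by rintro ⟨rfl, h4⟩; exact hm (h4 ▸ h3)),
        h.pos_adj hk']

/-- The last entry `z` of the row moves into the gap. The zero has to be written to `pos` after the
new position of `z`, because `z = x` when the last entry itself is deleted. -/
theorem delete (h : FamRep N len adj pos mem) {r x : ℕ} (hm : mem r x) :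
    FamRep N (Function.update len r (len r - 1))
      (Function.update adj (r * N + (pos (r * N + x) - 1)) (adj (r * N + (len r - 1))))
      (Function.update (Function.update pos (r * N + adj (r * N + (len r - 1)))
        (pos (r * N + x) - 1 + 1)) (r * N + x) 0)
      fun r' y => mem r' y ∧ ¬ (r' = r ∧ y = x) := by
  have hx := h.mem_lt hm
  have hp0 := (h.pos_iff hx).2 hm
  have hpl := h.pos_le hm
  have hle := h.len_le
  have hler := hle r
  set p := pos (r * N + x) with hp
  set z := adj (r * N + (len r - 1)) with hz
  have hzm : mem r z := h.mem_adj (by omega)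
  have hzp : pos (r * N + z) = len r := by
    rw [hz, h.pos_adj (by omega)]; omega
  have hzN := h.mem_lt hzm
  have hxz : p = len r → x = z := by
    intro he
    have := h.adj_pos hm
    rw [← hp, he] at this
    exact this.symm
  have upos : ∀ r' y, y < N → Function.update (Function.update pos (r * N + z) (p - 1 + 1))
      (r * N + x) 0 (r' * N + y) =
      if r' = r ∧ y = x then 0 else if r' = r ∧ y = z then p else pos (r' * N + y) := by
    intro r' y hy
    simp only [Function.update_apply, mul_add_inj hy hx, mul_add_inj hy hzN,
      Nat.sub_add_cancel (show 1 ≤ p by omega)]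
  have uadj : ∀ r' k, k < N → Function.update adj (r * N + (p - 1)) z (r' * N + k) =
      if r' = r ∧ k = p - 1 then z else adj (r' * N + k) := by
    intro r' y hy
    simp only [Function.update_apply, mul_add_inj hy (show p - 1 < N by omega)]
  have ulen : ∀ r', Function.update len r (len r - 1) r' = if r' = r then len r - 1 else len r' :=
    fun r' => Function.update_apply _ _ _ _
  have posinj : ∀ {r' y y'}, mem r' y → mem r' y' → pos (r' * N + y) = pos (r' * N + y') → y = y' := by
    intro r' y y' h1 h2 h3
    have h4 := h.adj_pos h1
    rw [h3, h.adj_pos h2] at h4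
    exact h4.symm
  refine ⟨fun hy => h.mem_lt hy.1, fun {r' y} hy => ?_, fun {r' y} hy => ?_, fun {r' y} hy => ?_,
    fun {r' k} hk => ?_, fun {r' k} hk => ?_⟩
  · rw [upos _ _ hy]
    split_ifs with h1 h2
    · simp [h1]
    · obtain ⟨rfl, rfl⟩ := h2
      exact iff_of_true hp0 ⟨hzm, h1⟩
    · rw [h.pos_iff hy]; simp [h1]
  · rw [upos _ _ (h.mem_lt hy.1), ulen, if_neg hy.2]
    have h1 := h.pos_le hy.1
    by_cases h2 : r' = r
    · subst h2
      have h3 : y ≠ x := fun h4 => hy.2 ⟨rfl, h4⟩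
      rw [if_pos rfl]
      split_ifs with h4
      · have : p ≠ len r' := fun h5 => h3 (h4.2.trans (hxz h5).symm)
        omega
      · have : pos (r' * N + y) ≠ len r' := fun h5 =>
          h4 ⟨rfl, posinj hy.1 hzm (h5.trans hzp.symm)⟩
        omega
    · rw [if_neg (by tauto), if_neg h2]; exact h1
  · have h0 := (h.pos_iff (h.mem_lt hy.1)).2 hy.1
    have h1 := h.pos_le hy.1
    have h2 := hle r'
    rw [upos _ _ (h.mem_lt hy.1), if_neg hy.2]
    split_ifs with h4
    · obtain ⟨rfl, rfl⟩ := h4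
      rw [uadj _ _ (by omega), if_pos ⟨rfl, rfl⟩]
    · rw [uadj _ _ (by omega), if_neg, h.adj_pos hy.1]
      rintro ⟨rfl, h5⟩
      exact hy.2 ⟨rfl, posinj hy.1 hm (by omega)⟩
  · rw [ulen] at hk
    have hk' : k < len r' := by
      split_ifs at hk with h1
      · subst h1; omega
      · exact hk
    have hkN := hk'.trans_le (hle r')
    rw [uadj _ _ hkN]
    split_ifs with h1
    · obtain ⟨rfl, rfl⟩ := h1
      rw [if_pos rfl] at hk
      refine ⟨hzm, fun h2 => ?_⟩
      have h3 : pos (r' * N + z) = p := by rw [h2.2]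
      omega
    · refine ⟨h.mem_adj hk', ?_⟩
      rintro ⟨rfl, h2⟩
      have h3 := h.pos_adj hk'
      rw [h2] at h3
      exact h1 ⟨rfl, by omega⟩
  · rw [ulen] at hk
    have hk' : k < len r' := by
      split_ifs at hk with h1
      · subst h1; omega
      · exact hk
    have hkN := hk'.trans_le (hle r')
    rw [uadj _ _ hkN]
    split_ifs with h1
    · obtain ⟨rfl, rfl⟩ := h1
      rw [if_pos rfl] at hk
      rw [upos _ _ hzN, if_neg, if_pos ⟨rfl, rfl⟩]
      · omega
      · rintro ⟨-, h2⟩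
        have h3 : pos (r' * N + z) = p := by rw [h2]
        omega
    · have h3 := h.pos_adj hk'
      rw [upos _ _ (h.mem_lt (h.mem_adj hk')), if_neg, if_neg, h3]
      · rintro ⟨rfl, h2⟩
        rw [if_pos rfl] at hk
        rw [h2] at h3
        omega
      · rintro ⟨rfl, h2⟩
        rw [h2] at h3
        exact h1 ⟨rfl, by omega⟩

end FamRep

/-- Insert the element in register `11` into row (register `10`) of the family in the arrays `a`,
`a + 1`, `a + 2` with row length in register `12`. -/
def famIns (a : ℕ) : Cmd := block [
  .store (a + 1) (R 10 * R 12 + .load a (R 10)) (R 11),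
  .store a (R 10) (.load a (R 10) + 1),
  .store (a + 2) (R 10 * R 12 + R 11) (.load a (R 10))]

/-- Delete the element in register `11` from row (register `10`) of the family in the arrays `a`,
`a + 1`, `a + 2` with row length in register `12`. -/
def famDel (a : ℕ) : Cmd := block [
  .assign 13 (.load (a + 2) (R 10 * R 12 + R 11) - 1),
  .assign 14 (.load a (R 10) - 1),
  .assign 15 (.load (a + 1) (R 10 * R 12 + R 14)),
  .store (a + 1) (R 10 * R 12 + R 13) (R 15),
  .store (a + 2) (R 10 * R 12 + R 15) (R 13 + 1),
  .store (a + 2) (R 10 * R 12 + R 11) 0,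
  .store a (R 10) (R 14)]

/-- The family in the arrays `a`, `a + 1`, `a + 2`. -/
def Fam (a N : ℕ) (mem : ℕ → ℕ → Prop) (σ : Config) : Prop :=
  FamRep N (σ.arr a) (σ.arr (a + 1)) (σ.arr (a + 2)) mem

/-- The lists of all rows but `r` are the same in `σ` and in `ρ`. -/
def SameRows (a N r : ℕ) (σ ρ : Config) : Prop :=
  ∀ r', r' ≠ r → ρ.arr a r' = σ.arr a r' ∧
    ∀ k < N, ρ.arr (a + 1) (r' * N + k) = σ.arr (a + 1) (r' * N + k)

theorem famIns_runs {B a N r x : ℕ} {mem : ℕ → ℕ → Prop} {σ : Config} (hN : N < B)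
    (h : Fam a N mem σ) (hr : σ.reg 10 = r) (hx : σ.reg 11 = x) (hN' : σ.reg 12 = N) (hxN : x < N)
    (hm : ¬ mem r x) :
    Runs B (famIns a) σ 50 fun ρ => (Fam a N (fun r' y => mem r' y ∨ (r' = r ∧ y = x)) ρ ∧
      SameRows a N r σ ρ) ∧
      Frame 20 [a, a + 1, a + 2] σ ρ := by
  refine Runs.frame 20 _ (Runs.of_small fun hσ => Runs.of_quick (by have := hσ.1 0; omega) 50 (by rfl) ?_)
    (by rfl) (by simp [famIns, block, Cmd.arrIn])
  have hl := FamRep.len_lt h hxN hm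
  have := hσ.1 11
  simp [famIns, block, Cmd.wp, hr, hx, hN', Fam, SameRows]
  refine ⟨by omega, by omega, FamRep.insert h hxN hm, fun r' hr' => ⟨?_, fun k hk => ?_⟩⟩
  · rw [Function.update_of_ne hr']
  · rw [Function.update_of_ne]
    rw [ne_eq, mul_add_inj hk hl]
    exact fun h => hr' h.1

theorem famDel_runs {B a N r x : ℕ} {mem : ℕ → ℕ → Prop} {σ : Config} (hN : N < B)
    (h : Fam a N mem σ) (hr : σ.reg 10 = r) (hx : σ.reg 11 = x) (hN' : σ.reg 12 = N)
    (hm : mem r x) :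
    Runs B (famDel a) σ 80 fun ρ => (Fam a N (fun r' y => mem r' y ∧ ¬ (r' = r ∧ y = x)) ρ ∧
      SameRows a N r σ ρ) ∧
      Frame 20 [a, a + 1, a + 2] σ ρ := by
  refine Runs.frame 20 _ (Runs.of_small fun hσ => Runs.of_quick (by have := FamRep.mem_lt h hm; omega) 80 (by rfl) ?_)
    (by rfl) (by simp [famDel, block, Cmd.arrIn])
  have hl := FamRep.len_le h r
  have hl' := FamRep.pos_le h hm
  have h1 := hσ.2 (a + 2) (r * N + x)
  have h2 := hσ.2 (a + 1) (r * N + (σ.arr a r - 1))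
  have h0 := (FamRep.pos_iff h (FamRep.mem_lt h hm)).2 hm
  simp [famDel, block, Cmd.wp, hr, hx, hN', Fam, SameRows]
  refine ⟨by omega, by omega, h2, by omega, by omega, by omega,
    (FamRep.delete h hm).congr fun r' y => by tauto, fun r' hr' => ⟨?_, fun k hk => ?_⟩⟩
  · rw [Function.update_of_ne hr']
  · rw [Function.update_of_ne]
    rw [ne_eq, mul_add_inj hk (by have := FamRep.len_le h r; omega)]
    exact fun h => hr' h.1

/-! ### Layered graphs in memory -/

/-- The number that identifies an edge. -/
def eid {n : ℕ} : Sym2 (Fin n) → ℕ :=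
  Sym2.lift ⟨fun u v => if u < v then (u : ℕ) * n + v else (v : ℕ) * n + u, fun u v => by
    rcases lt_trichotomy u v with h | rfl | h
    · simp [h, h.not_gt]
    · rfl
    · simp [h, h.not_gt]⟩

theorem eid_mk {n : ℕ} (u v : Fin n) :
    eid s(u, v) = if (u : ℕ) < v then (u : ℕ) * n + v else (v : ℕ) * n + u := rfl

theorem mul_add_lt {n a b c : ℕ} (ha : a < c) (hb : b < n) : a * n + b < c * n := by
  have : (a + 1) * n ≤ c * n := Nat.mul_le_mul_right n ha
  rw [add_mul] at this
  omega

theorem row_eq {n r j u : ℕ} (hu : u < n) : r = j * n + u ↔ r / n = j ∧ r % n = u := by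
  constructor
  · rintro rfl
    rw [mul_comm, Nat.mul_add_div (by omega), Nat.div_eq_of_lt hu, Nat.mul_add_mod,
      Nat.mod_eq_of_lt hu]
    simp
  · rintro ⟨rfl, rfl⟩
    rw [mul_comm]; exact (Nat.div_add_mod r n).symm

theorem eid_lt {n : ℕ} (e : Sym2 (Fin n)) : eid e < n * n := by
  induction e with | _ u v =>
  rw [eid_mk]
  split_ifs
  · exact mul_add_lt u.2 v.2
  · exact mul_add_lt v.2 u.2

theorem eid_decode {n : ℕ} (e : Sym2 (Fin n)) :
    ∃ u v : Fin n, eid e / n = u ∧ eid e % n = v ∧ e = s(u, v) := by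
  induction e with | _ u v =>
  rw [eid_mk]
  split_ifs with h
  · exact ⟨u, v, ((row_eq v.2).1 rfl).1, ((row_eq v.2).1 rfl).2, rfl⟩
  · exact ⟨v, u, ((row_eq u.2).1 rfl).1, ((row_eq u.2).1 rfl).2, Sym2.eq_swap⟩

theorem eid_injective {n : ℕ} : Function.Injective (eid : Sym2 (Fin n) → ℕ) := by
  intro e f h
  obtain ⟨u, v, h1, h2, rfl⟩ := eid_decode e
  obtain ⟨u', v', h1', h2', hf⟩ := eid_decode f
  rw [hf]
  rw [h] at h1 h2
  obtain rfl : u = u' := Fin.ext (h1.symm.trans h1')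
  obtain rfl : v = v' := Fin.ext (h2.symm.trans h2')
  rfl

theorem eid_mem {n : ℕ} {A : Finset (Sym2 (Fin n))} {e : Sym2 (Fin n)} :
    (∃ f ∈ A, eid f = eid e) ↔ e ∈ A :=
  ⟨fun ⟨_, hf, h⟩ => eid_injective h ▸ hf, fun h => ⟨e, h, rfl⟩⟩

/-- The incidence lists of the graphs `F 0, F 1, …` are in the arrays `2`, `3`, `4`, row `j * n + u`
for the neighbours of `u` in `F j`; their edge lists are in the arrays `5`, `6`, `7`. -/
def Graphs {n : ℕ} (F : ℕ → Finset (Sym2 (Fin n))) (σ : Config) : Prop :=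
  Fam 2 n (fun r x => ∃ u v : Fin n, r % n = u ∧ x = v ∧ s(u, v) ∈ F (r / n)) σ ∧
  Fam 5 (n * n) (fun j x => ∃ e ∈ F j, eid e = x) σ

theorem Graphs.congr {n : ℕ} {F : ℕ → Finset (Sym2 (Fin n))} {σ ρ : Config} (h : Graphs F σ)
    (h' : ∀ a, 2 ≤ a → a ≤ 7 → ρ.arr a = σ.arr a) : Graphs F ρ := by
  simp only [Graphs, Fam] at h ⊢
  simpa [h'] using h

theorem Graphs.deg_eq {n : ℕ} {F : ℕ → Finset (Sym2 (Fin n))} {σ : Config} (h : Graphs F σ)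
    (j : ℕ) (u : Fin n) : σ.arr 2 (j * n + u) = deg (F j) u := by
  classical
  obtain ⟨h1, h2⟩ := (row_eq (n := n) (r := j * n + u) (j := j) u.2).1 rfl
  have hS : ∀ x, x ∈ ({v | s(u, v) ∈ F j} : Finset (Fin n)).map Fin.valEmbedding ↔
      ∃ u' v : Fin n, (j * n + u) % n = u' ∧ x = v ∧ s(u', v) ∈ F ((j * n + u) / n) := by
    intro x
    simp only [mem_map, mem_filter, mem_univ, true_and, Fin.valEmbedding_apply]
    rw [h1, h2]
    constructor
    · rintro ⟨v, hv, rfl⟩; exact ⟨u, v, rfl, rfl, hv⟩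
    · rintro ⟨u', v, hu, rfl, hv⟩
      obtain rfl : u = u' := Fin.ext hu
      exact ⟨v, hv, rfl⟩
  rw [FamRep.len_eq h.1 _ _ hS, card_map, deg]
  refine card_bij (fun v _ => s(u, v)) (fun v hv => by simpa using hv) (fun v _ w _ h => ?_)
    fun e he => ?_
  · exact Sym2.congr_right.1 h
  · rw [mem_filter] at he
    obtain ⟨v, rfl⟩ := Sym2.mem_iff_exists.1 he.2
    exact ⟨v, by simpa using he.1, rfl⟩

theorem card_map_eid {n : ℕ} (A : Finset (Sym2 (Fin n))) : #(A.image eid) = #A :=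
  card_image_of_injective _ eid_injective

theorem Fam.edges_len {n a : ℕ} {F : ℕ → Finset (Sym2 (Fin n))} {σ : Config}
    (h : Fam a (n * n) (fun j x => ∃ e ∈ F j, eid e = x) σ) (j : ℕ) : σ.arr a j = #(F j) := by
  classical
  rw [FamRep.len_eq h j ((F j).image eid) (by simp), card_map_eid]

theorem Graphs.mem_iff {n : ℕ} {F : ℕ → Finset (Sym2 (Fin n))} {σ : Config} (h : Graphs F σ)
    (j : ℕ) (u v : Fin n) : σ.arr 4 ((j * n + u) * n + v) ≠ 0 ↔ s(u, v) ∈ F j := by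
  rw [FamRep.pos_iff h.1 v.2]
  obtain ⟨h1, h2⟩ := (row_eq (n := n) (r := j * n + u) (j := j) u.2).1 rfl
  rw [h1, h2]
  constructor
  · rintro ⟨u', v', hu, hv, h⟩
    rwa [Fin.ext hu, Fin.ext hv]
  · intro h; exact ⟨u, v, rfl, rfl, h⟩

theorem Graphs.neighbor {n : ℕ} {F : ℕ → Finset (Sym2 (Fin n))} {σ : Config} (h : Graphs F σ)
    {j : ℕ} {u : Fin n} {k : ℕ} (hk : k < σ.arr 2 (j * n + u)) :
    ∃ v : Fin n, σ.arr 3 ((j * n + u) * n + k) = v ∧ s(u, v) ∈ F j := by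
  obtain ⟨u', v, h1, h2, h3⟩ := FamRep.mem_adj h.1 hk
  obtain ⟨h4, h5⟩ := (row_eq (n := n) (r := j * n + u) (j := j) u.2).1 rfl
  rw [h5] at h1
  rw [h4] at h3
  obtain rfl : u = u' := Fin.ext h1
  exact ⟨v, h2, h3⟩

/-- Load the parameters for the two halves of the edge between the vertices in registers `21` and
`22` in the layer in register `20`, and call `c` for each of them and `d` for the edge list. -/
def onEdge (c d : Cmd) : Cmd :=
  .seq (block [.assign 10 (R 20 * R 100 + R 21), .assign 11 (R 22), .assign 12 (R 100)])
    (.seq c (.seq (block [.assign 10 (R 20 * R 100 + R 22), .assign 11 (R 21), .assign 12 (R 100)])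
      (.seq c (.seq (block [.assign 10 (R 20),
        .cond ((R 21).lt (R 22)) (.assign 11 (R 21 * R 100 + R 22))
          (.assign 11 (R 22 * R 100 + R 21)), .assign 12 (R 101)]) d))))

/-- Insert an edge. -/
def gIns : Cmd := onEdge (famIns 2) (famIns 5)

/-- Delete an edge. -/
def gDel : Cmd := onEdge (famDel 2) (famDel 5)

/-- Insertion and deletion both touch the two incidence rows and the edge list, so the parameter
passing is verified once for arbitrary `c` and `d`. The condition on the registers of `c` keeps the
layer and the end points intact between the calls. -/
theorem onEdge_runs {B n j T : ℕ} {c d : Cmd} {σ : Config} {u v : Fin n}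
    (hB : n * n < B) (hjB : (j + 1) * n ≤ B) (hn : σ.reg 100 = n) (hN : σ.reg 101 = n * n)
    (hj : σ.reg 20 = j) (hu : σ.reg 21 = u) (hv : σ.reg 22 = v) (huv : u ≠ v)
    (hcb : c.regBelow 20 = true) (P₁ P₂ Q : Config → Prop)
    (h₁ : ∀ τ, τ.arr = σ.arr → τ.reg 10 = j * n + u → τ.reg 11 = (v : ℕ) → τ.reg 12 = n →
      Runs B c τ T P₁)
    (h₂ : ∀ ρ τ, P₁ ρ → τ.arr = ρ.arr → τ.reg 10 = j * n + v → τ.reg 11 = (u : ℕ) → τ.reg 12 = n →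
      Runs B c τ T P₂)
    (h₃ : ∀ ρ τ, P₂ ρ → τ.arr = ρ.arr → τ.reg 10 = j → τ.reg 11 = eid s(u, v) →
      τ.reg 12 = n * n → Runs B d τ T Q) :
    Runs B (onEdge c d) σ (100 + 3 * T) Q := by
  have hu2 := u.2
  have hv2 := v.2
  have hnn : n ≤ n * n := Nat.le_mul_self n
  have hn2 : 2 ≤ n := by
    by_contra hlt
    exact huv (Fin.ext (by omega))
  have hB2 : 2 ≤ B := by omega
  have hju : j * n + u < B := lt_of_lt_of_le (mul_add_lt (Nat.lt_succ_self j) hu2) hjB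
  have hjv : j * n + v < B := lt_of_lt_of_le (mul_add_lt (Nat.lt_succ_self j) hv2) hjB
  obtain ⟨A, hcA⟩ := c.exists_arrIn
  refine Runs.of_small fun hσ => ?_
  have hjB' : j < B := hj ▸ hσ.1 20
  refine Runs.mono_time (T := 20 + (T + (20 + (T + (60 + T))))) ?_ (by omega)
  refine Runs.quick_seq hB2 20 (by rfl) ?_
  simp only [block, Cmd.wp, val_add, val_mul, val_reg, reg_setReg]
  simp only [hj, hu, hv, hn, Nat.reduceEqDiff, if_false]
  refine ⟨hju, by omega, by omega, ?_⟩
  refine Runs.call_seq (Runs.frame 20 A (h₁ _ rfl (by simp) (by simp) (by simp)) hcb hcA)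
    fun ρ hρ ⟨hf1, hfr1⟩ => ?_
  refine Runs.quick_seq hB2 20 (by rfl) ?_
  simp only [Cmd.wp, val_add, val_mul, val_reg, reg_setReg]
  simp only [hfr1.1 _ (show 20 ≤ 20 by norm_num), hfr1.1 _ (show 20 ≤ 21 by norm_num),
    hfr1.1 _ (show 20 ≤ 22 by norm_num), hfr1.1 _ (show 20 ≤ 100 by norm_num), reg_setReg,
    hj, hu, hv, hn, Nat.reduceEqDiff, if_false]
  refine ⟨hjv, by omega, by omega, ?_⟩
  refine Runs.call_seq (Runs.frame 20 A (h₂ _ _ hf1 rfl (by simp) (by simp) (by simp)) hcb hcA)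
    fun ρ' hρ' ⟨hf2, hfr2⟩ => ?_
  have e2 : ∀ r, 20 ≤ r → ρ'.reg r = σ.reg r := by
    intro r hr
    rw [hfr2.1 r hr]
    simp only [reg_setReg]
    rw [if_neg (by omega), if_neg (by omega), if_neg (by omega), hfr1.1 r hr]
    simp only [reg_setReg]
    rw [if_neg (by omega), if_neg (by omega), if_neg (by omega)]
  refine Runs.quick_seq hB2 60 (by rfl) ?_
  simp only [Cmd.wp, val_lt, val_add, val_mul, val_reg, reg_setReg,
    Nat.reduceEqDiff, if_false,
    e2 _ (show 20 ≤ 20 by norm_num), e2 _ (show 20 ≤ 21 by norm_num),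
    e2 _ (show 20 ≤ 22 by norm_num), e2 _ (show 20 ≤ 100 by norm_num),
    e2 _ (show 20 ≤ 101 by norm_num), hj, hu, hv, hn, hN]
  have hl := eid_lt s(u, v)
  refine ⟨hjB', fun hlt => ?_, fun hlt => ?_⟩
  · have hlt' : (u : ℕ) < v := by by_contra h0; simp [h0] at hlt
    have hid : eid s(u, v) = u * n + v := by rw [eid_mk, if_pos hlt']
    refine ⟨by omega, by omega, ?_⟩
    exact h₃ _ _ hf2 rfl (by simp) (by simp [hid]) (by simp)
  · have hlt' : ¬ (u : ℕ) < v := by by_contra h0; simp [h0] at hlt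
    have hid : eid s(u, v) = v * n + u := by rw [eid_mk, if_neg hlt']
    refine ⟨by omega, by omega, ?_⟩
    exact h₃ _ _ hf2 rfl (by simp) (by simp [hid]) (by simp)

theorem gIns_runs {B n j : ℕ} {F : ℕ → Finset (Sym2 (Fin n))} {σ : Config} {u v : Fin n}
    (hB : n * n < B) (hjB : (j + 1) * n ≤ B)
    (hn : σ.reg 100 = n) (hN : σ.reg 101 = n * n) (h : Graphs F σ)
    (hj : σ.reg 20 = j) (hu : σ.reg 21 = u) (hv : σ.reg 22 = v) (huv : u ≠ v)
    (he : s(u, v) ∉ F j) :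
    Runs B gIns σ 250 fun ρ => (Graphs (Function.update F j (insert s(u, v) (F j))) ρ ∧
      SameRows 5 (n * n) j σ ρ) ∧
      Frame 20 [2, 3, 4, 5, 6, 7] σ ρ := by
  have hu2 := u.2
  have hv2 := v.2
  have hnn : n ≤ n * n := Nat.le_mul_self n
  obtain ⟨d1, m1⟩ := (row_eq (n := n) (r := j * n + u) (j := j) u.2).1 rfl
  obtain ⟨d2, m2⟩ := (row_eq (n := n) (r := j * n + v) (j := j) v.2).1 rfl
  refine Runs.frame 20 _ ?_ (by rfl) (by rfl)
  refine onEdge_runs hB hjB hn hN hj hu hv huv (by rfl)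
    (fun ρ => Fam 2 n (fun r y => (∃ a b : Fin n, r % n = a ∧ y = b ∧ s(a, b) ∈ F (r / n)) ∨ (r = j * n + u ∧ y = v)) ρ ∧
      ∀ a, 5 ≤ a → a ≤ 7 → ρ.arr a = σ.arr a)
    (fun ρ => Fam 2 n (fun r y => ((∃ a b : Fin n, r % n = a ∧ y = b ∧ s(a, b) ∈ F (r / n)) ∨ (r = j * n + u ∧ y = v)) ∨ (r = j * n + v ∧ y = u)) ρ ∧
      ∀ a, 5 ≤ a → a ≤ 7 → ρ.arr a = σ.arr a)
    _ (T := 50)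
    (fun τ ht h10 h11 h12 => ?_) (fun ρ τ ⟨hp, ha⟩ ht h10 h11 h12 => ?_)
    (fun ρ τ ⟨hp, ha⟩ ht h10 h11 h12 => ?_)
  · refine (famIns_runs (by omega) ?_ h10 h11 h12 hv2 ?_).mono le_rfl
      fun ρ _ ⟨⟨h1, _⟩, h2⟩ => ⟨h1, fun a h5 h7 => ?_⟩
    · simpa only [Fam, ht] using h.1
    · rw [d1, m1]
      rintro ⟨u', v', hu, hv, h'⟩
      rw [← Fin.ext hu, ← Fin.ext hv] at h'
      exact he h'
    · rw [h2.2 a (by simp; omega), ht]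
  · refine (famIns_runs (by omega) ?_ h10 h11 h12 hu2 ?_).mono le_rfl
      fun ρ _ ⟨⟨h1, _⟩, h2⟩ => ⟨h1, fun a h5 h7 => ?_⟩
    · simpa only [Fam, ht] using hp
    · rw [d2, m2]
      rintro (⟨u', v', hu, hv, h'⟩ | ⟨h', -⟩)
      · rw [← Fin.ext hu, ← Fin.ext hv, Sym2.eq_swap] at h'
        exact he h'
      · exact huv (Fin.ext (by omega))
    · rw [h2.2 a (by simp; omega), ht, ha a h5 h7]
  · refine (famIns_runs (B := B) (a := 5) (mem := fun j x => ∃ e ∈ F j, eid e = x) hB ?_ h10 h11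
      h12 (eid_lt _) (by rw [eid_mem]; exact he)).mono le_rfl fun ρ'' _ ⟨⟨hf3, hsr⟩, hfr3⟩ => ⟨⟨?_, ?_⟩, ?_⟩
    · have := h.2
      simp only [Fam] at this ⊢
      rw [ht, ha _ (by simp) (by simp), ha _ (by simp) (by simp), ha _ (by simp) (by simp)]
      exact this
    · simp only [Fam] at hp ⊢
      rw [hfr3.2 _ (by simp), hfr3.2 _ (by simp), hfr3.2 _ (by simp), ht]
      refine hp.congr fun r x => ?_
      rw [row_eq hu2, row_eq hv2]
      constructor
      · rintro ⟨u', v', h1, rfl, h3⟩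
        rw [Function.update_apply] at h3
        split_ifs at h3 with h4
        · rw [mem_insert, Sym2.eq_iff] at h3
          rcases h3 with (⟨rfl, rfl⟩ | ⟨rfl, rfl⟩) | h3
          · exact Or.inl (Or.inr ⟨⟨h4, h1⟩, rfl⟩)
          · exact Or.inr ⟨⟨h4, h1⟩, rfl⟩
          · exact Or.inl (Or.inl ⟨u', v', h1, rfl, h4 ▸ h3⟩)
        · exact Or.inl (Or.inl ⟨u', v', h1, rfl, h3⟩)
      · rintro ((⟨u', v', h1, rfl, h3⟩ | ⟨⟨h1, h2⟩, rfl⟩) | ⟨⟨h1, h2⟩, rfl⟩)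
        · refine ⟨u', v', h1, rfl, ?_⟩
          rw [Function.update_apply]
          split_ifs with h4
          · exact mem_insert_of_mem (h4 ▸ h3)
          · exact h3
        · exact ⟨u, v, h2, rfl, by simp [h1]⟩
        · exact ⟨v, u, h2, rfl, by simp [h1, Sym2.eq_swap]⟩
    · refine hf3.congr fun r x => ?_
      rw [Function.update_apply]
      split_ifs with h4
      · subst h4
        simp only [mem_insert, exists_eq_or_imp, true_and]
        rw [or_comm, eq_comm (a := x)]
      · simp [h4]
    · simp only [SameRows] at hsr ⊢
      rwa [ht, ha _ (by simp) (by simp), ha _ (by simp) (by simp)] at hsr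

theorem gDel_runs {B n j : ℕ} {F : ℕ → Finset (Sym2 (Fin n))} {σ : Config} {u v : Fin n}
    (hB : n * n < B) (hjB : (j + 1) * n ≤ B)
    (hn : σ.reg 100 = n) (hN : σ.reg 101 = n * n) (h : Graphs F σ)
    (hj : σ.reg 20 = j) (hu : σ.reg 21 = u) (hv : σ.reg 22 = v) (huv : u ≠ v)
    (he : s(u, v) ∈ F j) :
    Runs B gDel σ 340 fun ρ => (Graphs (Function.update F j ((F j).erase s(u, v))) ρ ∧
      SameRows 5 (n * n) j σ ρ) ∧
      Frame 20 [2, 3, 4, 5, 6, 7] σ ρ := by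
  have hu2 := u.2
  have hv2 := v.2
  have hnn : n ≤ n * n := Nat.le_mul_self n
  obtain ⟨d1, m1⟩ := (row_eq (n := n) (r := j * n + u) (j := j) u.2).1 rfl
  obtain ⟨d2, m2⟩ := (row_eq (n := n) (r := j * n + v) (j := j) v.2).1 rfl
  refine Runs.frame 20 _ ?_ (by rfl) (by rfl)
  refine onEdge_runs hB hjB hn hN hj hu hv huv (by rfl)
    (fun ρ => Fam 2 n (fun r y => (∃ a b : Fin n, r % n = a ∧ y = b ∧ s(a, b) ∈ F (r / n)) ∧ ¬ (r = j * n + u ∧ y = v)) ρ ∧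
      ∀ a, 5 ≤ a → a ≤ 7 → ρ.arr a = σ.arr a)
    (fun ρ => Fam 2 n (fun r y => ((∃ a b : Fin n, r % n = a ∧ y = b ∧ s(a, b) ∈ F (r / n)) ∧ ¬ (r = j * n + u ∧ y = v)) ∧ ¬ (r = j * n + v ∧ y = u)) ρ ∧
      ∀ a, 5 ≤ a → a ≤ 7 → ρ.arr a = σ.arr a)
    _ (T := 80)
    (fun τ ht h10 h11 h12 => ?_) (fun ρ τ ⟨hp, ha⟩ ht h10 h11 h12 => ?_)
    (fun ρ τ ⟨hp, ha⟩ ht h10 h11 h12 => ?_)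
  · refine (famDel_runs (by omega) ?_ h10 h11 h12 ?_).mono le_rfl
      fun ρ _ ⟨⟨h1, _⟩, h2⟩ => ⟨h1, fun a h5 h7 => ?_⟩
    · simpa only [Fam, ht] using h.1
    · rw [d1, m1]
      exact ⟨u, v, rfl, rfl, he⟩
    · rw [h2.2 a (by simp; omega), ht]
  · refine (famDel_runs (by omega) ?_ h10 h11 h12 ?_).mono le_rfl
      fun ρ _ ⟨⟨h1, _⟩, h2⟩ => ⟨h1, fun a h5 h7 => ?_⟩
    · simpa only [Fam, ht] using hp
    · rw [d2, m2]
      refine ⟨⟨v, u, rfl, rfl, Sym2.eq_swap ▸ he⟩, fun ⟨h', _⟩ => huv (Fin.ext (by omega))⟩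
    · rw [h2.2 a (by simp; omega), ht, ha a h5 h7]
  · refine (famDel_runs (B := B) (a := 5) (mem := fun j x => ∃ e ∈ F j, eid e = x) hB ?_ h10 h11
      h12 ⟨_, he, rfl⟩).mono le_rfl fun ρ'' _ ⟨⟨hf3, hsr⟩, hfr3⟩ => ⟨⟨?_, ?_⟩, ?_⟩
    · have := h.2
      simp only [Fam] at this ⊢
      rw [ht, ha _ (by simp) (by simp), ha _ (by simp) (by simp), ha _ (by simp) (by simp)]
      exact this
    · simp only [Fam] at hp ⊢
      rw [hfr3.2 _ (by simp), hfr3.2 _ (by simp), hfr3.2 _ (by simp), ht]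
      refine hp.congr fun r x => ?_
      rw [row_eq hu2, row_eq hv2]
      constructor
      · rintro ⟨u', v', h1, rfl, h3⟩
        rw [Function.update_apply] at h3
        split_ifs at h3 with h4
        · rw [mem_erase, ne_eq, Sym2.eq_iff] at h3
          refine ⟨⟨⟨u', v', h1, rfl, h4 ▸ h3.2⟩, ?_⟩, ?_⟩
          · rintro ⟨⟨-, h5⟩, h6⟩
            exact h3.1 (Or.inl ⟨Fin.ext (h1.symm.trans h5), Fin.ext h6⟩)
          · rintro ⟨⟨-, h5⟩, h6⟩
            exact h3.1 (Or.inr ⟨Fin.ext (h1.symm.trans h5), Fin.ext h6⟩)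
        · exact ⟨⟨⟨u', v', h1, rfl, h3⟩, fun h5 => h4 h5.1.1⟩, fun h5 => h4 h5.1.1⟩
      · rintro ⟨⟨⟨u', v', h1, rfl, h3⟩, h5⟩, h6⟩
        refine ⟨u', v', h1, rfl, ?_⟩
        rw [Function.update_apply]
        split_ifs with h4
        · rw [mem_erase, ne_eq, Sym2.eq_iff]
          refine ⟨?_, h4 ▸ h3⟩
          rintro (⟨rfl, rfl⟩ | ⟨rfl, rfl⟩)
          · exact h5 ⟨⟨h4, h1⟩, rfl⟩
          · exact h6 ⟨⟨h4, h1⟩, rfl⟩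
        · exact h3
    · refine hf3.congr fun r x => ?_
      rw [Function.update_apply]
      split_ifs with h4
      · subst h4
        simp only [mem_erase, true_and]
        constructor
        · rintro ⟨f, ⟨h1, h2⟩, rfl⟩
          exact ⟨⟨f, h2, rfl⟩, fun h3 => h1 (eid_injective h3)⟩
        · rintro ⟨⟨f, h2, rfl⟩, h3⟩
          exact ⟨f, ⟨fun h4 => h3 (by rw [h4]), h2⟩, rfl⟩
      · simp [h4]
    · simp only [SameRows] at hsr ⊢
      rwa [ht, ha _ (by simp) (by simp), ha _ (by simp) (by simp)] at hsr

/-! ### Degree splitting by alternating trails -/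

section Split

variable {V : Type*} [Fintype V] [DecidableEq V]

set_option linter.unusedSectionVars false

/-- The edges `H` that are not yet assigned, the two parts `P` and `Q`, and the index `c` of the part
that gets the next edge. -/
structure Trail (V : Type*) where
  H : Finset (Sym2 V)
  P : Finset (Sym2 V)
  Q : Finset (Sym2 V)
  c : ℕ

/-- Assign the edge `e` to the part that is due. -/
def Trail.step (S : Trail V) (e : Sym2 V) : Trail V where
  H := S.H.erase e
  P := if S.c = 0 then insert e S.P else S.P
  Q := if S.c = 0 then S.Q else insert e S.Q
  c := 1 - S.c

/-- The three sets partition `H₀`, and the sizes of the parts are balanced. -/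
structure Trail.Base (H₀ : Finset (Sym2 V)) (S : Trail V) : Prop where
  part : S.H.val + S.P.val + S.Q.val = H₀.val
  size : #S.P = #S.Q + S.c
  c_le : S.c ≤ 1

/-- The difference of the degrees in the two parts. -/
def Trail.bal (S : Trail V) (v : V) : ℤ := deg S.P v - deg S.Q v

/-- The change of the balance by the next edge. -/
def Trail.sg (S : Trail V) : ℤ := if S.c = 0 then 1 else -1

theorem Trail.Base.notMem {H₀ : Finset (Sym2 V)} {S : Trail V} (h : S.Base H₀) {e : Sym2 V}
    (he : e ∈ S.H) : e ∉ S.P ∧ e ∉ S.Q ∧ e ∈ H₀ := by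
  have h1 := H₀.nodup
  rw [← h.part, Multiset.nodup_add, Multiset.nodup_add] at h1
  refine ⟨Multiset.disjoint_left.1 h1.1.2.2 he,
    Multiset.disjoint_left.1 h1.2.2 (Multiset.mem_add.2 (Or.inl he)), ?_⟩
  rw [← mem_val, ← h.part]
  simp [he]

theorem Trail.Base.step {H₀ : Finset (Sym2 V)} {S : Trail V} (h : S.Base H₀) {e : Sym2 V}
    (he : e ∈ S.H) : (S.step e).Base H₀ := by
  obtain ⟨h1, h2, -⟩ := h.notMem he
  have h3 := h.size
  have h4 := h.c_le
  have h5 : S.H.val = e ::ₘ (S.H.erase e).val := by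
    rw [erase_val]; exact (Multiset.cons_erase he).symm
  by_cases hc : S.c = 0
  · refine ⟨?_, ?_, by simp [Trail.step]⟩
    · simp only [Trail.step, hc, if_true]
      rw [insert_val_of_notMem h1, ← h.part, h5]
      simp
    · simp only [Trail.step, hc, if_true]
      rw [card_insert_of_notMem h1]; omega
  · refine ⟨?_, ?_, by simp [Trail.step]⟩
    · simp only [Trail.step, hc, if_false]
      rw [insert_val_of_notMem h2, ← h.part, h5]
      simp
    · simp only [Trail.step, hc, if_false]
      rw [card_insert_of_notMem h2]; omega

theorem Trail.sg_step (S : Trail V) (h : S.c ≤ 1) (e : Sym2 V) : (S.step e).sg = -S.sg := by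
  unfold Trail.sg Trail.step
  rcases Nat.le_one_iff_eq_zero_or_eq_one.1 h with h | h <;> simp [h]

theorem deg_insert {A : Finset (Sym2 V)} {e : Sym2 V} (he : e ∉ A) (v : V) :
    deg (insert e A) v = deg A v + if v ∈ e then 1 else 0 := by
  unfold deg
  rw [filter_insert]
  split_ifs with h
  · rw [card_insert_of_notMem (by simp [he])]
  · simp

theorem deg_erase {A : Finset (Sym2 V)} {e : Sym2 V} (he : e ∈ A) (v : V) :
    deg (A.erase e) v + (if v ∈ e then 1 else 0) = deg A v := by
  split_ifs with h
  · exact deg_erase_of_mem he h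
  · exact deg_erase_of_notMem h

theorem Trail.Base.bal_step {H₀ : Finset (Sym2 V)} {S : Trail V} (h : S.Base H₀) {e : Sym2 V}
    (he : e ∈ S.H) (v : V) : (S.step e).bal v = S.bal v + if v ∈ e then S.sg else 0 := by
  obtain ⟨h1, h2, -⟩ := h.notMem he
  unfold Trail.bal Trail.sg Trail.step
  by_cases hc : S.c = 0
  · simp only [hc, if_true, deg_insert h1]
    split_ifs <;> push_cast <;> ring
  · simp only [hc, if_false, deg_insert h2]
    split_ifs <;> push_cast <;> ring

theorem Trail.sg_sq (S : Trail V) : S.sg = 1 ∨ S.sg = -1 := by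
  unfold Trail.sg; split_ifs <;> simp

/-- The state between two trails of the first phase, after the vertices in `D` have been treated. -/
def Trail.Idle₁ (H₀ : Finset (Sym2 V)) (D : V → Prop) (S : Trail V) : Prop :=
  S.Base H₀ ∧ ∀ v, |S.bal v| ≤ 1 ∧ (S.bal v ≠ 0 → Even (deg S.H v)) ∧ (D v → Even (deg S.H v))

/-- The state during a trail of the first phase that has arrived at `t`. -/
def Trail.Walk₁ (H₀ : Finset (Sym2 V)) (D : V → Prop) (S : Trail V) (t : V) : Prop :=
  S.Base H₀ ∧ (∀ v, v ≠ t →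
    |S.bal v| ≤ 1 ∧ (S.bal v ≠ 0 → Even (deg S.H v)) ∧ (D v → Even (deg S.H v))) ∧
  |S.bal t + S.sg| ≤ 1 ∧ (S.bal t + S.sg ≠ 0 → Odd (deg S.H t)) ∧ (D t → Odd (deg S.H t))

/-- A vertex of odd remaining degree has balance zero, so an edge of either sign may start there. -/
theorem Trail.Idle₁.start {H₀ : Finset (Sym2 V)} {D : V → Prop} {S : Trail V} (h : S.Idle₁ H₀ D)
    {s : V} (hs : Odd (deg S.H s)) : S.Walk₁ H₀ (fun v => D v ∨ v = s) s := by
  refine ⟨h.1, fun v hv => ⟨(h.2 v).1, (h.2 v).2.1, fun hd => (h.2 v).2.2 (hd.resolve_right hv)⟩,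
    ?_, fun _ => hs, fun _ => hs⟩
  have h0 : S.bal s = 0 := by
    by_contra hne
    exact Nat.not_even_iff_odd.2 hs ((h.2 s).2.1 hne)
  rw [h0]
  rcases S.sg_sq with h | h <;> simp [h]

theorem Trail.Idle₁.pass {H₀ : Finset (Sym2 V)} {D : V → Prop} {S : Trail V} (h : S.Idle₁ H₀ D)
    {s : V} (hs : Even (deg S.H s)) : S.Idle₁ H₀ (fun v => D v ∨ v = s) := by
  refine ⟨h.1, fun v => ⟨(h.2 v).1, (h.2 v).2.1, ?_⟩⟩
  rintro (hd | rfl)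
  · exact (h.2 v).2.2 hd
  · exact hs

/-- At the current vertex the invariant counts the next edge in advance. Leaving the vertex makes
that count real, and at the vertex reached the incoming edge cancels against the anticipated
outgoing one, since consecutive edges have opposite signs. -/
theorem Trail.Walk₁.step {H₀ : Finset (Sym2 V)} {D : V → Prop} {S : Trail V} {t w : V}
    (h : S.Walk₁ H₀ D t) (htw : t ≠ w) (he : s(t, w) ∈ S.H) :
    (S.step s(t, w)).Walk₁ H₀ D w := by
  obtain ⟨hb, hv, h1, h2, h3⟩ := h
  have hdeg := deg_erase he
  have hbal := hb.bal_step he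
  have hsg := S.sg_step hb.c_le s(t, w)
  refine ⟨hb.step he, fun v hvw => ?_, ?_⟩
  · by_cases hvt : v = t
    · subst hvt
      have d := hdeg v
      have b := hbal v
      simp only [Sym2.mem_iff, true_or, if_true] at d b
      rw [b]
      have par : Odd (deg S.H v) → Even (deg (S.step s(v, w)).H v) := fun ho => by
        rw [← d] at ho
        simpa [Nat.odd_add_one, Trail.step] using ho
      exact ⟨h1, fun h => par (h2 h), fun h => par (h3 h)⟩
    · have d := hdeg v
      have b := hbal v
      simp only [Sym2.mem_iff, hvt, hvw, or_self, if_false, add_zero] at d b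
      rw [b]
      have := hv v hvt
      rw [← d] at this
      exact this
  · have d := hdeg w
    have b := hbal w
    simp only [Sym2.mem_iff, or_true, if_true] at d b
    rw [b, hsg, add_neg_cancel_right]
    have h4 := hv w htw.symm
    have par : Even (deg S.H w) → Odd (deg (S.step s(t, w)).H w) := fun ho => by
      rw [← d] at ho
      simpa [Nat.even_add_one, Trail.step] using ho
    exact ⟨h4.1, fun h => par (h4.2.1 h), fun h => par (h4.2.2 h)⟩

/-- Zero is not odd, so the anticipated balance must vanish at the end of the trail. The true
balance is then `±1`, and no edge is left there to change it. -/
theorem Trail.Walk₁.stuck {H₀ : Finset (Sym2 V)} {D : V → Prop} {S : Trail V} {t : V}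
    (h : S.Walk₁ H₀ D t) (h0 : deg S.H t = 0) : S.Idle₁ H₀ D := by
  obtain ⟨hb, hv, h1, h2, h3⟩ := h
  refine ⟨hb, fun v => ?_⟩
  by_cases hvt : v = t
  · subst hvt
    rw [h0] at h2 h3 ⊢
    have : S.bal v + S.sg = 0 := by
      by_contra h
      exact absurd (h2 h) (by decide)
    refine ⟨?_, fun _ => Even.zero, fun _ => Even.zero⟩
    rw [eq_neg_of_add_eq_zero_left this, abs_neg]
    rcases S.sg_sq with h | h <;> simp [h]
  · exact hv v hvt

/-- The state between two trails of the second phase, after the vertices in `D` have been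
exhausted. -/
def Trail.Idle₂ (H₀ : Finset (Sym2 V)) (D : V → Prop) (S : Trail V) : Prop :=
  S.Base H₀ ∧ ∀ v, |S.bal v| ≤ 1 ∧ Even (deg S.H v) ∧ (D v → deg S.H v = 0)

/-- The state during a trail of the second phase that began at `s` with part `c₀` and has arrived at
`t`. -/
def Trail.Walk₂ (H₀ : Finset (Sym2 V)) (side : V → Bool) (D : V → Prop) (s : V) (c₀ : ℕ) (g₀ : ℤ)
    (S : Trail V) (t : V) : Prop :=
  S.Base H₀ ∧ (∀ v, |S.bal v - (if v = s then g₀ else 0) + (if v = t then S.sg else 0)| ≤ 1 ∧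
    Even (deg S.H v + (if v = s then 1 else 0) + (if v = t then 1 else 0)) ∧
    (D v → deg S.H v = 0)) ∧ c₀ ≤ 1 ∧ g₀ = (if c₀ = 0 then 1 else -1) ∧ (side t = side s ↔ S.c = c₀)

theorem Trail.Idle₂.start {H₀ : Finset (Sym2 V)} (side : V → Bool) {D : V → Prop} {S : Trail V}
    (h : S.Idle₂ H₀ D) (s : V) : S.Walk₂ H₀ side D s S.c S.sg s := by
  refine ⟨h.1, fun v => ?_, h.1.c_le, rfl, by simp⟩
  have := h.2 v
  split_ifs
  · simpa [Nat.even_add_one] using this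
  · simpa using this

/-- The first edge is counted as if not yet taken and the next one as if already taken, so interior
visits leave the corrected balance unchanged. Each edge flips both the side and the part that is
due, which preserves the last equivalence. -/
theorem Trail.Walk₂.step {H₀ : Finset (Sym2 V)} {side : V → Bool} {D : V → Prop} {s : V} {c₀ : ℕ}
    {g₀ : ℤ} {S : Trail V} {t w : V} (h : S.Walk₂ H₀ side D s c₀ g₀ t)
    (htw : side t ≠ side w) (he : s(t, w) ∈ S.H) :
    (S.step s(t, w)).Walk₂ H₀ side D s c₀ g₀ w := by
  obtain ⟨hb, hv, h1, h2, h3⟩ := h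
  have hne : t ≠ w := fun h => htw (by rw [h])
  have hsg := S.sg_step hb.c_le s(t, w)
  refine ⟨hb.step he, fun v => ?_, h1, h2, ?_⟩
  · have d := deg_erase he v
    have b := hb.bal_step he v
    obtain ⟨i1, i2, i3⟩ := hv v
    rw [hsg, b]
    have hH : (S.step s(t, w)).H = S.H.erase s(t, w) := rfl
    rw [hH]
    refine ⟨?_, ?_, fun hD => by have := i3 hD; omega⟩
    · refine le_of_eq_of_le (congrArg _ ?_) i1
      by_cases hvt : v = t
      · subst hvt; simp [hne]; ring
      · by_cases hvw : v = w
        · subst hvw; simp [hvt]; ring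
        · simp [hvt, hvw]
    · rw [← d] at i2
      by_cases hvt : v = t
      · subst hvt
        simp only [Sym2.mem_iff, true_or, if_true, hne, if_false, add_zero] at i2 ⊢
        rw [Nat.even_iff] at i2 ⊢
        omega
      · by_cases hvw : v = w
        · subst hvw
          simp only [Sym2.mem_iff, or_true, if_true, hvt, if_false, add_zero] at i2 ⊢
          rw [Nat.even_iff] at i2 ⊢
          omega
        · simpa [hvt, hvw] using i2
  · have hc := hb.c_le
    have e1 : side w = side s ↔ ¬ side t = side s := by
      revert htw
      cases side t <;> cases side w <;> cases side s <;> simp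
    rw [e1, h3]
    simp only [Trail.step]
    omega

/-- By parity the trail can only get stuck at its start. There the side is the initial one, so the
closed trail has even length and the two corrections cancel. This is the step that needs
bipartiteness. -/
theorem Trail.Walk₂.stuck {H₀ : Finset (Sym2 V)} {side : V → Bool} {D : V → Prop} {s : V} {c₀ : ℕ}
    {g₀ : ℤ} {S : Trail V} {t : V} (h : S.Walk₂ H₀ side D s c₀ g₀ t) (h0 : deg S.H t = 0) :
    S.Idle₂ H₀ fun v => D v ∨ v = s := by
  obtain ⟨hb, hv, h1, h2, h3⟩ := h
  obtain rfl : t = s := by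
    by_contra hts
    have := (hv t).2.1
    simp [h0, hts] at this
  have hg : S.sg = g₀ := by rw [h2, ← h3.1 rfl]; rfl
  refine ⟨hb, fun v => ?_⟩
  obtain ⟨i1, i2, i3⟩ := hv v
  rw [hg] at i1
  refine ⟨?_, ?_, ?_⟩
  · split_ifs at i1 <;> simpa using i1
  · split_ifs at i2
    · simpa [Nat.even_add_one] using i2
    · simpa using i2
  · rintro (h | rfl)
    · exact i3 h
    · exact h0

/-- Treated vertices have even remaining degree, and every other vertex is isolated in `H₀`. -/
theorem Trail.Idle₁.idle₂ {H₀ : Finset (Sym2 V)} {D : V → Prop} {S : Trail V} (h : S.Idle₁ H₀ D)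
    (hD : ∀ e ∈ H₀, ∀ v ∈ e, D v) : S.Idle₂ H₀ fun _ => False := by
  refine ⟨h.1, fun v => ⟨(h.2 v).1, ?_, fun h => h.elim⟩⟩
  by_cases hv : D v
  · exact (h.2 v).2.2 hv
  · have : deg S.H v = 0 := by
      rw [deg, card_eq_zero, filter_eq_empty_iff]
      exact fun e he hve => hv (hD e (h.1.notMem he).2.2 v hve)
    rw [this]; exact Even.zero

theorem Trail.Idle₂.H_eq {H₀ : Finset (Sym2 V)} {D : V → Prop} {S : Trail V} (h : S.Idle₂ H₀ D)
    (hD : ∀ e ∈ H₀, ∀ v ∈ e, D v) : S.H = ∅ := by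
  rw [eq_empty_iff_forall_notMem]
  intro e he
  induction e with | _ u v =>
  have h1 := (h.2 u).2.2 (hD _ (h.1.notMem he).2.2 u (by simp))
  rw [deg, card_eq_zero, filter_eq_empty_iff] at h1
  exact h1 he (by simp)

theorem deg_of_val_eq {A B C D : Finset (Sym2 V)} (h : A.val + B.val = C.val + D.val) (v : V) :
    deg A v + deg B v = deg C v + deg D v := by
  have := congrArg (fun m => (m.filter (v ∈ ·)).card) h
  simpa [Multiset.filter_add, deg, card, filter_val] using this

/-- An edge of multiplicity two goes once to either part, which halves it exactly. Only the
symmetric difference, a simple graph, has to be split. -/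
theorem inter_add_symmDiff {A B : Finset (Sym2 V)} :
    (A ∩ B).val + (A ∩ B).val + ((A \ B) ∪ (B \ A)).val = A.val + B.val := by
  ext e
  simp only [Multiset.count_add, Multiset.count_eq_of_nodup (nodup _), mem_val, mem_inter,
    mem_union, mem_sdiff]
  by_cases h1 : e ∈ A <;> by_cases h2 : e ∈ B <;> simp [h1, h2]

/-- Since `P` always receives the first of two edges, it has the larger half. A balance of at most
one at each vertex gives the floor and ceiling bounds, which imply the weaker ones. -/
theorem Trail.Base.isDegreeSplit {A B : Finset (Sym2 V)} {S : Trail V}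
    (h : S.Base ((A \ B) ∪ (B \ A))) (hH : S.H = ∅) (hb : ∀ v, |S.bal v| ≤ 1) :
    IsDegreeSplit A B ((A ∩ B) ∪ S.P) ((A ∩ B) ∪ S.Q) := by
  have hp := h.part
  rw [hH, empty_val, zero_add] at hp
  have hsub : ∀ e, e ∈ S.P ∨ e ∈ S.Q → e ∉ A ∩ B := by
    intro e he
    have : e ∈ (A \ B) ∪ (B \ A) := by
      rw [← mem_val, ← hp, Multiset.mem_add]; exact he
    simp only [mem_union, mem_sdiff, mem_inter] at this ⊢
    tauto
  have dP : Disjoint (A ∩ B) S.P := disjoint_right.2 fun e he => hsub e (Or.inl he)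
  have dQ : Disjoint (A ∩ B) S.Q := disjoint_right.2 fun e he => hsub e (Or.inr he)
  have vP : ((A ∩ B) ∪ S.P).val = (A ∩ B).val + S.P.val := by
    rw [← disjUnion_eq_union _ _ dP]; rfl
  have vQ : ((A ∩ B) ∪ S.Q).val = (A ∩ B).val + S.Q.val := by
    rw [← disjUnion_eq_union _ _ dQ]; rfl
  have hval : A.val + B.val = ((A ∩ B) ∪ S.P).val + ((A ∩ B) ∪ S.Q).val := by
    rw [vP, vQ, ← inter_add_symmDiff, ← hp]
    abel
  have hcard : #A + #B = #((A ∩ B) ∪ S.P) + #((A ∩ B) ∪ S.Q) := by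
    have := congrArg Multiset.card hval
    rwa [Multiset.card_add, Multiset.card_add] at this
  have c1 := card_union_of_disjoint dP
  have c2 := card_union_of_disjoint dQ
  have c3 := h.size
  have c4 := h.c_le
  have degU : ∀ (X Y : Finset (Sym2 V)), Disjoint X Y → ∀ v, deg (X ∪ Y) v = deg X v + deg Y v := by
    intro X Y hXY v
    unfold deg
    rw [filter_union, card_union_of_disjoint (disjoint_filter_filter hXY)]
  have key : ∀ K, K = (A ∩ B) ∪ S.P ∨ K = (A ∩ B) ∪ S.Q → ∀ v,
      (deg A v + deg B v) / 2 ≤ deg K v ∧ deg K v ≤ (deg A v + deg B v + 1) / 2 := by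
    intro K hK v
    have h1 := deg_of_val_eq hval v
    have h2 := degU _ _ dP v
    have h3 := degU _ _ dQ v
    have h4 := abs_le.1 (hb v)
    unfold Trail.bal at h4
    rcases hK with rfl | rfl <;> omega
  refine ⟨hval, by omega, by omega, fun K hK v => ?_, fun _ => key⟩
  obtain ⟨k1, k2⟩ := key K hK v
  have k3 : deg A v + deg B v ≤ 2 * deg K v + 1 := by omega
  have k4 : 2 * deg K v ≤ deg A v + deg B v + 1 := by omega
  have k3' : ((deg A v + deg B v : ℕ) : ℝ) ≤ 2 * deg K v + 1 := by exact_mod_cast k3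
  have k4' : (2 * deg K v : ℝ) ≤ (deg A v + deg B v : ℕ) + 1 := by exact_mod_cast k4
  constructor <;> linarith

end Split

/-! ### Deletions that keep the array of mates up to date -/

/-- The registers that hold constants: `n`, `n ^ 2` and the layer for scratch work. -/
structure Ctx (n HL : ℕ) (σ : Config) : Prop where
  n_eq : σ.reg 100 = n
  N_eq : σ.reg 101 = n * n
  H_eq : σ.reg 102 = HL

/-- The memory cells have room for all indices that occur. -/
def Room (B n HL : ℕ) : Prop := 4 * (n * n) + 8 ≤ B ∧ (HL + 1) * n ≤ B

theorem Room.two_le {B n HL : ℕ} (h : Room B n HL) : 2 ≤ B := by have := h.1; omega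

theorem Room.row_le {B n HL j : ℕ} (h : Room B n HL) (hj : j ≤ HL) : (j + 1) * n ≤ B :=
  (Nat.mul_le_mul_right n (by omega)).trans h.2

theorem Ctx.frame {n HL : ℕ} {σ ρ : Config} (h : Ctx n HL σ) {b : ℕ} {A : List ℕ} (hb : b ≤ 100)
    (hf : Frame b A σ ρ) : Ctx n HL ρ :=
  ⟨(hf.1 _ hb).trans h.n_eq, (hf.1 _ (by omega)).trans h.N_eq, (hf.1 _ (by omega)).trans h.H_eq⟩

theorem Ctx.setReg {n HL : ℕ} {σ : Config} (h : Ctx n HL σ) {r k : ℕ} (hr : r < 100) :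
    Ctx n HL (σ.setReg r k) := by
  refine ⟨?_, ?_, ?_⟩ <;> rw [reg_setReg, if_neg (by omega)]
  exacts [h.n_eq, h.N_eq, h.H_eq]

theorem Ctx.setArr {n HL : ℕ} {σ : Config} (h : Ctx n HL σ) (a i k : ℕ) :
    Ctx n HL (σ.setArr a i k) := ⟨h.n_eq, h.N_eq, h.H_eq⟩

theorem Stores.congr {n : ℕ} {σ ρ : Config} {M : Finset (Sym2 (Fin n))} (h : Stores σ M)
    (h' : ρ.arr 1 = σ.arr 1) : Stores ρ M := by
  unfold Stores; rw [h']; exact h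

/-- No other edge of a matching meets `u` or `v`, so clearing two cells suffices. -/
theorem Stores.erase {n : ℕ} {σ : Config} {M : Finset (Sym2 (Fin n))} (h : Stores σ M)
    (hM : IsMatching M) {u v : Fin n} (he : s(u, v) ∈ M) :
    Stores ((σ.setArr 1 u 0).setArr 1 v 0) (M.erase s(u, v)) := by
  intro w
  have h1 := h w
  simp only [arr_setArr, reduceIte, Function.update_apply]
  have key : w = v ∨ w = u → ∀ u', s(u', w) ∉ M.erase s(u, v) := by
    intro hw u' hmem
    rw [mem_erase] at hmem
    refine hmem.1 (hM _ hmem.2 _ he w (by simp) ?_)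
    rcases hw with rfl | rfl <;> simp
  by_cases hv : w = v
  · simp only [hv, reduceIte, Nat.zero_le, true_and]
    intro u'
    have := key (Or.inl hv) u'
    rw [hv] at this
    exact iff_of_false this (by omega)
  · by_cases hu : w = u
    · have hv' : ¬ (w : ℕ) = v := fun h => hv (Fin.ext h)
      have hu' : (w : ℕ) = u := by rw [hu]
      simp only [hu', reduceIte, ite_self, Nat.zero_le, true_and]
      exact fun u' => iff_of_false (key (Or.inr hu) u') (by omega)
    · have hv' : ¬ (w : ℕ) = v := fun h => hv (Fin.ext h)
      have hu' : ¬ (w : ℕ) = u := fun h => hu (Fin.ext h)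
      simp only [hv', hu', if_false]
      refine ⟨h1.1, fun u' => ?_⟩
      rw [← h1.2 u', mem_erase]
      refine ⟨fun h => h.2, fun h => ⟨fun heq => ?_, h⟩⟩
      have : w ∈ s(u, v) := by rw [← heq]; simp
      rcases Sym2.mem_iff.1 this with h | h
      · exact hu h
      · exact hv h

/-- Delete an edge, also from the array of mates if the layer is `0`. -/
def gDelM : Cmd := .seq gDel (.cond (R 20) .skip (block [.store 1 (R 21) 0, .store 1 (R 22) 0]))

theorem gDelM_runs {B n HL j : ℕ} {F : ℕ → Finset (Sym2 (Fin n))} {E₀ : Finset (Sym2 (Fin n))}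
    {σ : Config} {u v : Fin n} (hB : Room B n HL) (hjH : j ≤ HL) (hc : Ctx n HL σ) (h : Graphs F σ)
    (hj : σ.reg 20 = j) (hu : σ.reg 21 = u) (hv : σ.reg 22 = v) (huv : u ≠ v)
    (he : s(u, v) ∈ F j) (hM : IsMatching (E₀ ∪ F 0)) (hd : Disjoint E₀ (F 0))
    (hs : Stores σ (E₀ ∪ F 0)) :
    Runs B gDelM σ 360 fun ρ => (Graphs (Function.update F j ((F j).erase s(u, v))) ρ ∧
      Stores ρ (E₀ ∪ Function.update F j ((F j).erase s(u, v)) 0)) ∧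
      Frame 20 [1, 2, 3, 4, 5, 6, 7] σ ρ := by
  have hB2 := hB.two_le
  refine Runs.frame 20 _ ?_ (by rfl) (by rfl)
  refine Runs.mono_time (T := 340 + 20) ?_ le_rfl
  refine Runs.call_seq (gDel_runs (by have := hB.1; omega) (hB.row_le hjH) hc.n_eq hc.N_eq h hj hu hv
    huv he) fun ρ hρ ⟨⟨hg, _⟩, hf⟩ => ?_
  have hs' : Stores ρ (E₀ ∪ F 0) := hs.congr (hf.2 1 (by decide))
  refine Runs.of_quick hB2 20 (by rfl) ?_
  simp only [Cmd.wp, block, val_reg, val_zero, reg_setArr, hf.1 20 le_rfl, hf.1 21 (by norm_num),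
    hf.1 22 (by norm_num), hj, hu, hv]
  refine ⟨fun h0 => ⟨hg, ?_⟩, fun h0 => ⟨by omega, by omega, ?_, ?_⟩⟩
  · rwa [Function.update_of_ne (Ne.symm h0)]
  · refine hg.congr fun a h2 h7 => ?_
    rw [arr_setArr, if_neg (by omega), arr_setArr, if_neg (by omega)]
  · subst h0
    rw [Function.update_self]
    have := hs'.erase hM (mem_union_right _ he)
    rwa [erase_union_distrib, erase_eq_of_notMem (disjoint_right.1 hd he)] at this

/-! ### Iteration over the edges of a set -/

/-- The first `len` entries of `lst` are the numbers of the edges in `A`, without repetition. -/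
def Lists {n : ℕ} (A : Finset (Sym2 (Fin n))) (len : ℕ) (lst : ℕ → ℕ) : Prop :=
  len = #A ∧ (∀ k < len, ∃ e ∈ A, lst k = eid e) ∧
    ∀ k < len, ∀ k' < len, lst k = lst k' → k = k'

theorem Fam.lists {n a : ℕ} {A : ℕ → Finset (Sym2 (Fin n))} {σ : Config}
    (h : Fam a (n * n) (fun j x => ∃ e ∈ A j, eid e = x) σ) (j : ℕ) :
    Lists (A j) (σ.arr a j) (fun k => σ.arr (a + 1) (j * (n * n) + k)) := by
  refine ⟨Fam.edges_len h j, fun k hk => ?_, fun k hk k' hk' he => ?_⟩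
  · obtain ⟨e, h1, h2⟩ := FamRep.mem_adj h hk
    exact ⟨e, h1, h2.symm⟩
  · exact FamRep.adj_injOn h j (by simpa using hk) (by simpa using hk') he

/-- The edges among the first `k` entries of a list. -/
noncomputable def prefixSet {n : ℕ} (A : Finset (Sym2 (Fin n))) (lst : ℕ → ℕ) (k : ℕ) :
    Finset (Sym2 (Fin n)) := by
  classical exact {e ∈ A | ∃ k' < k, lst k' = eid e}

theorem prefixSet_succ {n : ℕ} {A : Finset (Sym2 (Fin n))} {len : ℕ} {lst : ℕ → ℕ}
    (h : Lists A len lst) {k : ℕ} (hk : k < len) {e : Sym2 (Fin n)} (he : e ∈ A)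
    (hl : lst k = eid e) :
    e ∉ prefixSet A lst k ∧ prefixSet A lst (k + 1) = insert e (prefixSet A lst k) := by
  constructor
  · simp only [prefixSet, mem_filter, not_and, not_exists]
    intro _ k' hk' hl'
    have := h.2.2 k' (by omega) k hk (by rw [hl, hl'])
    omega
  · ext f
    simp only [prefixSet, mem_filter, mem_insert]
    constructor
    · rintro ⟨hf, k', hk', hl'⟩
      rcases Nat.lt_succ_iff_lt_or_eq.1 hk' with hk' | rfl
      · exact Or.inr ⟨hf, k', hk', hl'⟩
      · exact Or.inl (eid_injective (hl'.symm.trans hl))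
    · rintro (rfl | ⟨hf, k', hk', hl'⟩)
      · exact ⟨he, k, by omega, hl⟩
      · exact ⟨hf, k', by omega, hl'⟩

theorem prefixSet_zero {n : ℕ} (A : Finset (Sym2 (Fin n))) (lst : ℕ → ℕ) :
    prefixSet A lst 0 = ∅ := by simp [prefixSet]

theorem card_prefixSet {n : ℕ} {A : Finset (Sym2 (Fin n))} {len : ℕ} {lst : ℕ → ℕ}
    (h : Lists A len lst) {k : ℕ} (hk : k ≤ len) : #(prefixSet A lst k) = k := by
  induction k with
  | zero => simp [prefixSet_zero]
  | succ k ih =>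
    obtain ⟨e, he, hl⟩ := h.2.1 k hk
    obtain ⟨h1, h2⟩ := prefixSet_succ h hk he hl
    rw [h2, card_insert_of_notMem h1, ih (by omega)]

theorem prefixSet_len {n : ℕ} {A : Finset (Sym2 (Fin n))} {len : ℕ} {lst : ℕ → ℕ}
    (h : Lists A len lst) : prefixSet A lst len = A := by
  refine eq_of_subset_of_card_le (by simp [prefixSet]) ?_
  rw [card_prefixSet h le_rfl, h.1]

/-- Run `c` for every edge in the row (register `row`) of the edge lists in the arrays `a`, `a + 1`,
with the end points of the edge in registers `21` and `22` and its number in register `38`. -/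
def forEach (a row : ℕ) (c : Cmd) : Cmd :=
  .seq (.assign 50 0) (.loop ((R 50).lt (.load a (R row)))
    (.seq (block [.assign 38 (.load (a + 1) (R row * R 101 + R 50)), .assign 21 (R 38 / R 100),
        .assign 22 (R 38 % R 100)])
      (.seq c (.assign 50 (R 50 + 1)))))

/-- The invariant is indexed by the set of edges treated so far, so the order of the list is
irrelevant to its users. `hI` says that it tolerates the registers of the loop itself, and `hrd`
that it protects the list being traversed. -/
theorem forEach_runs {B n HL a row T : ℕ} {A : Finset (Sym2 (Fin n))} {len : ℕ} {lst : ℕ → ℕ}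
    (hB : Room B n HL) (hl : Lists A len lst) (hlen : len ≤ n * n) {c : Cmd}
    (hcb : c.regBelow 50 = true) (I : Finset (Sym2 (Fin n)) → Config → Prop)
    (hI : ∀ E σ τ, I E σ → τ.arr = σ.arr →
      (∀ r, r ≠ 21 → r ≠ 22 → r ≠ 38 → r ≠ 50 → τ.reg r = σ.reg r) → I E τ)
    (hrd : ∀ E σ, I E σ → Ctx n HL σ ∧ σ.arr a (σ.reg row) = len ∧
      ∀ k < len, σ.arr (a + 1) (σ.reg row * (n * n) + k) = lst k)
    (step : ∀ E e σ (u v : Fin n), E ⊆ A → e ∈ A → e ∉ E → I E σ → e = s(u, v) → σ.reg 21 = u →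
      σ.reg 22 = v → σ.reg 38 = eid e → Small B σ → Runs B c σ T (I (insert e E)))
    {σ : Config} (h0 : I ∅ σ) : Runs B (forEach a row c) σ ((T + 60) * #A + 20) (I A) := by
  have hB2 := hB.two_le
  rw [← hl.1]
  obtain ⟨Ar, hcA⟩ := c.exists_arrIn
  refine Runs.mono_time (T := 2 + ((T + 60) * len + 10)) ?_ (by omega)
  refine Runs.quick_seq hB2 2 (by rfl) ?_
  simp only [Cmd.wp, val_zero]
  refine ⟨by omega, Runs.loop hB2 (by simp only [Expr.lt, Expr.deg]; omega)
    (fun b ρ => ∃ k, k ≤ len ∧ ρ.reg 50 = k ∧ I (prefixSet A lst k) ρ ∧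
      b = (T + 60) * (len - k) + 10) ?_ ?_ ?_⟩
  · rintro ρ b ⟨k, hk, h50, hIk, rfl⟩ hρ hv
    obtain ⟨hc, hrl, hrlst⟩ := hrd _ _ hIk
    have hkl : k < len := by
      by_contra h
      simp [h50, hrl, h] at hv
    obtain ⟨e, he, hle⟩ := hl.2.1 k hkl
    obtain ⟨u, v, hu, hv, rfl⟩ := eid_decode e
    obtain ⟨hp1, hp2⟩ := prefixSet_succ hl hkl he hle
    have hid := eid_lt s(u, v)
    have hu2 := u.2
    have hv2 := v.2
    have hnn : n ≤ n * n := Nat.le_mul_self n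
    have hB1 := hB.1
    have hre : ρ.arr (a + 1) (ρ.reg row * (n * n) + k) = eid s(u, v) := by rw [hrlst k hkl, hle]
    have goal : Runs B (.seq (block [.assign 38 (.load (a + 1) (R row * R 101 + R 50)),
        .assign 21 (R 38 / R 100), .assign 22 (R 38 % R 100)])
        (.seq c (.assign 50 (R 50 + 1)))) ρ (40 + (T + 4)) fun ρ' => ρ'.reg 50 = k + 1 ∧ I (prefixSet A lst (k + 1)) ρ' := by
      refine Runs.quick_seq hB2 40 (by rfl) ?_
      simp only [block, Cmd.wp, val_load, val_add, val_mul, val_div, val_mod, val_reg, reg_setReg,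
        h50, hc.n_eq, hc.N_eq, hre, reduceIte, Nat.reduceEqDiff, if_false, hu, hv]
      refine ⟨by omega, by omega, by omega, ?_⟩
      refine Runs.call_seq (Runs.frame 50 Ar (step (prefixSet A lst k) _ _ u v
        (by simp [prefixSet]) he hp1 ?_ rfl (by simp) (by simp) (by simp) ?_) hcb hcA)
        fun ρ' hρ' ⟨hI', hfr⟩ => ?_
      · refine hI _ _ _ hIk rfl fun r h1 h2 h3 _ => ?_
        simp [h1, h2, h3]
      · exact ((hρ.setReg (by omega)).setReg (by omega)).setReg (by omega)
      · have h50' : ρ'.reg 50 = k := by rw [hfr.1 50 le_rfl]; simp [h50]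
        refine Runs.of_quick hB2 4 (by rfl) ?_
        simp only [Cmd.wp, val_add, val_reg, val_one, h50', reg_setReg, reduceIte, true_and]
        refine ⟨by omega, ?_⟩
        rw [hp2]
        refine hI _ _ _ hI' rfl fun r _ _ _ h4 => ?_
        simp [h4]
    refine ⟨_, goal.mono le_rfl fun ρ' _ ⟨h1, h2⟩ => ⟨_, ?_, k + 1, hkl, h1, h2, rfl⟩⟩
    have : len - k = len - (k + 1) + 1 := by omega
    rw [this, mul_add, mul_one]
    simp only [Expr.time, Expr.lt]
    omega
  · rintro ρ b ⟨k, hk, h50, hIk, rfl⟩ hρ hv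
    obtain ⟨hc, hrl, hrlst⟩ := hrd _ _ hIk
    have hkl : k = len := by
      by_contra h
      have : k < len := by omega
      simp [h50, hrl, this] at hv
    subst hkl
    rw [prefixSet_len hl] at hIk
    refine ⟨?_, hIk⟩
    simp only [Expr.time, Expr.lt]
    omega
  · refine ⟨0, by omega, by simp, ?_, by simp⟩
    rw [prefixSet_zero]
    refine hI _ _ _ h0 rfl fun r _ _ _ h4 => ?_
    simp [h4]

/-! ### Trails in memory -/

/-- The graphs `F` with layer `J` replaced by `X` and layer `HL` replaced by `Y`. -/
def lay {n : ℕ} (F : ℕ → Finset (Sym2 (Fin n))) (J HL : ℕ) (X Y : Finset (Sym2 (Fin n))) :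
    ℕ → Finset (Sym2 (Fin n)) := Function.update (Function.update F J X) HL Y

theorem lay_HL {n : ℕ} (F : ℕ → Finset (Sym2 (Fin n))) (J HL : ℕ) (X Y : Finset (Sym2 (Fin n))) :
    lay F J HL X Y HL = Y := by simp [lay]

theorem lay_J {n : ℕ} (F : ℕ → Finset (Sym2 (Fin n))) {J HL : ℕ} (h : J < HL)
    (X Y : Finset (Sym2 (Fin n))) : lay F J HL X Y J = X := by
  simp [lay, Function.update_of_ne h.ne]

theorem lay_of_ne {n : ℕ} (F : ℕ → Finset (Sym2 (Fin n))) {J HL i : ℕ} (h : i ≠ J) (h' : i ≠ HL)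
    (X Y : Finset (Sym2 (Fin n))) : lay F J HL X Y i = F i := by
  simp [lay, Function.update_of_ne h, Function.update_of_ne h']

theorem update_lay_HL {n : ℕ} (F : ℕ → Finset (Sym2 (Fin n))) (J HL : ℕ)
    (X Y Y' : Finset (Sym2 (Fin n))) :
    Function.update (lay F J HL X Y) HL Y' = lay F J HL X Y' := by simp [lay]

theorem update_lay_J {n : ℕ} (F : ℕ → Finset (Sym2 (Fin n))) {J HL : ℕ} (h : J < HL)
    (X X' Y : Finset (Sym2 (Fin n))) :
    Function.update (lay F J HL X Y) J X' = lay F J HL X' Y := by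
  rw [lay, Function.update_comm h.ne', Function.update_idem]; rfl

/-- Follow a trail from the vertex in register `30` through the layer `HL` as long as possible.
Delete its edges there, and insert every other edge into the layer in register `35`. -/
def walk : Cmd := .loop (.load 2 (R 102 * R 100 + R 30))
  (.seq (block [.assign 31 (.load 3 ((R 102 * R 100 + R 30) * R 100)), .assign 20 (R 102),
      .assign 21 (R 30), .assign 22 (R 31), .assign 30 (R 31)])
    (.seq gDel (.cond (R 32) (.assign 32 0)
      (.seq (.assign 20 (R 35)) (.seq gIns (.assign 32 1))))))

/-- The trail invariant `W` is a parameter, because both phases use the same program. Each round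
deletes one edge from the scratch layer, which releases `800` units of time. The part `Q` is never
stored: its edges are just deleted. -/
theorem walk_runs {B n HL J : ℕ} {F : ℕ → Finset (Sym2 (Fin n))} {H₀ D : Finset (Sym2 (Fin n))}
    (hB : Room B n HL) (hJ : J < HL) (hD : Disjoint D H₀) (hne : ∀ u v, s(u, v) ∈ H₀ → u ≠ v)
    {W : Trail (Fin n) → Fin n → Prop} (hW : ∀ S t, W S t → S.Base H₀)
    (hstep : ∀ S t w, W S t → s(t, w) ∈ S.H → W (S.step s(t, w)) w)
    {σ : Config} {S : Trail (Fin n)} {t : Fin n} (hc : Ctx n HL σ)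
    (hg : Graphs (lay F J HL (D ∪ S.P) S.H) σ) (h30 : σ.reg 30 = t) (h32 : σ.reg 32 = S.c)
    (h35 : σ.reg 35 = J) (h : W S t) :
    RunsIn B walk σ fun τ ρ => (∃ S' t', τ + 800 * #S'.H ≤ 800 * #S.H + 20 ∧ W S' t' ∧
      deg S'.H t' = 0 ∧ ρ.reg 32 = S'.c ∧ Graphs (lay F J HL (D ∪ S'.P) S'.H) ρ) ∧
      Frame 33 [2, 3, 4, 5, 6, 7] σ ρ := by
  have hB2 := hB.two_le
  have hB1 := hB.1
  refine RunsIn.frame 33 _ ?_ (by rfl) (by rfl)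
  refine (RunsIn.loop (k := 800 * #S.H + 20) hB2 (by decide)
    (Q := fun k' ρ => ∃ S' t', k' = 800 * #S'.H ∧ W S' t' ∧ deg S'.H t' = 0 ∧ ρ.reg 32 = S'.c ∧
      Graphs (lay F J HL (D ∪ S'.P) S'.H) ρ)
    (fun k ρ => ∃ S' t', k = 800 * #S'.H + 20 ∧ W S' t' ∧ Ctx n HL ρ ∧ ρ.reg 30 = (t' : Fin n) ∧
      ρ.reg 32 = S'.c ∧ ρ.reg 35 = J ∧ Graphs (lay F J HL (D ∪ S'.P) S'.H) ρ) ?_ ?_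
    ⟨S, t, rfl, h, hc, h30, h32, h35, hg⟩).mono ?_
  · clear hg h30 h32 h35 h hc
    rintro σ k ⟨S, t, rfl, h, hc, h30, h32, h35, hg⟩ hσ hv
    have hb := hW S t h
    have hv' : σ.arr 2 (HL * n + t) ≠ 0 := by simpa [hc.H_eq, hc.n_eq, h30] using hv
    obtain ⟨w, hw, hwe⟩ := hg.neighbor (k := 0) (Nat.pos_of_ne_zero hv')
    rw [lay_HL] at hwe
    have htw := hne _ _ (hb.notMem hwe).2.2
    have ht2 := t.2
    have hw2 := w.2
    have hnn : n ≤ n * n := Nat.le_mul_self n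
    have hH : HL < B := hc.H_eq ▸ hσ.1 102
    have hJB : J < B := by omega
    have hcard : #(S.step s(t, w)).H + 1 = #S.H := card_erase_add_one hwe
    have goal : Runs B (.seq (block [.assign 31 (.load 3 ((R 102 * R 100 + R 30) * R 100)),
        .assign 20 (R 102), .assign 21 (R 30), .assign 22 (R 31), .assign 30 (R 31)])
        (.seq gDel (.cond (R 32) (.assign 32 0)
          (.seq (.assign 20 (R 35)) (.seq gIns (.assign 32 1)))))) σ
        (60 + (340 + (2 + (2 + (250 + 10))))) fun ρ =>
        Ctx n HL ρ ∧ ρ.reg 30 = w ∧ ρ.reg 32 = (S.step s(t, w)).c ∧ ρ.reg 35 = J ∧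
        Graphs (lay F J HL (D ∪ (S.step s(t, w)).P) (S.step s(t, w)).H) ρ := by
      refine Runs.quick_seq hB2 60 (by rfl) ?_
      simp only [block, Cmd.wp, val_load, val_add, val_mul, val_reg, reg_setReg, h30,
        hc.n_eq, hc.H_eq, reduceIte, Nat.reduceEqDiff, if_false]
      rw [add_zero] at hw
      rw [hw]
      refine ⟨by omega, by omega, by omega, by omega, by omega, ?_⟩
      refine Runs.call_seq (gDel_runs (j := HL) (u := t) (v := w)
        (F := lay F J HL (D ∪ S.P) S.H) (by omega) (hB.row_le le_rfl) ?_ ?_ hg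
        (by simp) (by simp) (by simp) htw (by rw [lay_HL]; exact hwe)) fun ρ hρ ⟨⟨hg1, _⟩, hf⟩ => ?_
      · simp [hc.n_eq]
      · simp [hc.N_eq]
      rw [lay_HL, update_lay_HL] at hg1
      have r : ∀ r, 20 ≤ r → r ≠ 31 → r ≠ 20 → r ≠ 21 → r ≠ 22 → r ≠ 30 → ρ.reg r = σ.reg r := by
        intro r h0 h1 h2 h3 h4 h5
        rw [hf.1 r h0]; simp [h1, h2, h3, h4, h5]
      have c' : Ctx n HL ρ := ⟨by rw [r] <;> simp [hc.n_eq], by rw [r] <;> simp [hc.N_eq],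
        by rw [r] <;> simp [hc.H_eq]⟩
      have e20 : ρ.reg 21 = t := by rw [hf.1 21 (by norm_num)]; simp
      have e22 : ρ.reg 22 = w := by rw [hf.1 22 (by norm_num)]; simp
      have e30 : ρ.reg 30 = w := by rw [hf.1 30 (by norm_num)]; simp
      have e32 : ρ.reg 32 = S.c := by rw [r 32] <;> simp [h32]
      have e35 : ρ.reg 35 = J := by rw [r 35] <;> simp [h35]
      have hcle := hb.c_le
      refine Runs.cond hB2 (by decide) (fun h1 => ?_) (fun h1 => ?_)
      · simp only [val_reg, e32] at h1
        refine Runs.mono_time (T := 2) (Runs.of_quick hB2 2 (by rfl) ?_) (by omega)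
        simp only [Cmd.wp, val_zero, reg_setReg, Nat.reduceEqDiff, if_false, reduceIte]
        refine ⟨by omega, c'.setReg (by norm_num), e30, ?_, e35, ?_⟩
        · simp only [Trail.step]; omega
        · simp only [Trail.step, h1, if_false]; exact hg1
      · simp only [val_reg, e32] at h1
        refine Runs.mono_time (T := 2 + (250 + 2)) ?_ (by omega)
        refine Runs.quick_seq hB2 2 (by rfl) ?_
        simp only [Cmd.wp, val_reg, e35]
        refine ⟨hJB, ?_⟩
        refine Runs.call_seq (gIns_runs (j := J) (u := t) (v := w) (by omega) (hB.row_le hJ.le) ?_ ?_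
          hg1 (by simp) (by simp [e20]) (by simp [e22]) htw ?_) fun ρ' hρ' ⟨⟨hg2, _⟩, hf2⟩ => ?_
        · simp [c'.n_eq]
        · simp [c'.N_eq]
        · rw [lay_J _ hJ, mem_union]
          rintro (h2 | h2)
          · exact disjoint_left.1 hD h2 (hb.notMem hwe).2.2
          · exact (hb.notMem hwe).1 h2
        · rw [lay_J _ hJ, update_lay_J _ hJ] at hg2
          refine Runs.of_quick hB2 2 (by rfl) ?_
          have r2 : ∀ r, 21 ≤ r → ρ'.reg r = ρ.reg r := by
            intro r hr
            rw [hf2.1 r (by omega), reg_setReg, if_neg (by omega)]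
          simp only [Cmd.wp, val_one, reg_setReg, Nat.reduceEqDiff, if_false, reduceIte]
          refine ⟨by omega, ⟨?_, ?_, ?_⟩, ?_, ?_, ?_, ?_⟩
          · simpa [r2] using c'.n_eq
          · simpa [r2] using c'.N_eq
          · simpa [r2] using c'.H_eq
          · rw [r2 _ (by norm_num), e30]
          · simp [Trail.step, h1]
          · rw [r2 _ (by norm_num), e35]
          · simp only [Trail.step, h1, if_true]
            rw [union_insert]
            exact hg2
    refine goal.runsIn.mono fun τ ρ _ ⟨hτ, g1, g2, g3, g4, g5⟩ =>
      ⟨_, ?_, _, _, rfl, hstep S t w h hwe, g1, g2, g3, g4, g5⟩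
    have ht : (Expr.load 2 (R 102 * R 100 + R 30)).time = 6 := rfl
    rw [ht]
    omega
  · rintro ρ k ⟨S', t', rfl, h1, h2, h3, h4, h5, h6⟩ hρ hv
    have ht : (Expr.load 2 (R 102 * R 100 + R 30)).time = 6 := rfl
    refine ⟨800 * #S'.H, by omega, S', t', rfl, h1, ?_, h4, h6⟩
    have := h6.deg_eq HL t'
    rw [lay_HL] at this
    rw [← this]
    simpa [h2.H_eq, h2.n_eq, h3] using hv
  · rintro τ ρ hρ ⟨k', hk, S', t', rfl, h⟩
    exact ⟨S', t', hk, h⟩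

/-- For every vertex in the array `13`, follow a trail from it if `g` is not zero. -/
def phase (g : Expr) : Cmd :=
  .seq (.assign 36 0) (.loop ((R 36).lt (R 37))
    (.seq (.assign 30 (.load 13 (R 36))) (.seq (.cond g walk .skip) (.assign 36 (R 36 + 1)))))

/-- The guard is a function `gf` of the remaining degree: its parity in the first phase, constantly
one in the second. Keeping `800` units per remaining edge through all trails makes the whole phase
linear although single trails may be long. -/
theorem phase_runs {B n HL J : ℕ} {F : ℕ → Finset (Sym2 (Fin n))} {H₀ D : Finset (Sym2 (Fin n))}
    (hB : Room B n HL) (hJ : J < HL) (hD : Disjoint D H₀) (hne : ∀ u v, s(u, v) ∈ H₀ → u ≠ v)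
    (Idle : (Fin n → Prop) → Trail (Fin n) → Prop) {g : Expr} (gf : ℕ → ℕ)
    (hg : ∀ σ, Ctx n HL σ → g.val σ = gf (σ.arr 2 (HL * n + σ.reg 30)))
    (hgd : g.deg ≤ 16) (hgt : g.time ≤ 20)
    (htrue : ∀ X S s, Idle X S → gf (deg S.H s) ≠ 0 → ∃ W : Trail (Fin n) → Fin n → Prop,
      (∀ S t, W S t → S.Base H₀) ∧ (∀ S t w, W S t → s(t, w) ∈ S.H → W (S.step s(t, w)) w) ∧
      W S s ∧ ∀ S' t', W S' t' → deg S'.H t' = 0 → Idle (fun v => X v ∨ v = s) S')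
    (hfalse : ∀ X S s, Idle X S → gf (deg S.H s) = 0 → Idle (fun v => X v ∨ v = s) S)
    {σ : Config} {S : Trail (Fin n)} {wc : ℕ} (hc : Ctx n HL σ)
    (hG : Graphs (lay F J HL (D ∪ S.P) S.H) σ) (h32 : σ.reg 32 = S.c)
    (h35 : σ.reg 35 = J) (h37 : σ.reg 37 = wc) (hw : ∀ i < wc, ∃ v : Fin n, σ.arr 13 i = v)
    (h : Idle (fun _ => False) S) :
    RunsIn B (phase g) σ fun τ ρ => (∃ S', τ + 800 * #S'.H ≤ 800 * #S.H + 80 * wc + 20 ∧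
      Idle (fun v => ∃ i < wc, σ.arr 13 i = v) S' ∧ ρ.reg 32 = S'.c ∧
      Graphs (lay F J HL (D ∪ S'.P) S'.H) ρ) ∧
      Frame 37 [2, 3, 4, 5, 6, 7] σ ρ ∧ ρ.reg 35 = J := by
  have hB2 := hB.two_le
  have hB1 := hB.1
  have hwcB : ∀ ρ : Config, Small B ρ → ρ.reg 37 = wc → wc < B := fun ρ hρ h => h ▸ hρ.1 37
  set E : ℕ → Fin n → Prop := fun k v => ∃ i < k, σ.arr 13 i = v with hE
  have goal : RunsIn B (phase g) σ fun τ ρ =>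
      (∃ S', τ + 800 * #S'.H ≤ 800 * #S.H + 80 * wc + 20 ∧ Idle (E wc) S' ∧ ρ.reg 32 = S'.c ∧
        Graphs (lay F J HL (D ∪ S'.P) S'.H) ρ) ∧ ρ.reg 35 = J := by
    refine RunsIn.seq (P := fun t ρ => t ≤ 2 ∧ ρ = σ.setReg 36 0)
      (Runs.of_quick (c := .assign 36 0) hB2 2 (by rfl) ?_).runsIn fun t₁ ρ₁ _ ⟨ht₁, e₁⟩ => ?_
    · simp only [Cmd.wp, val_zero]
      exact ⟨by omega, trivial⟩
    subst e₁
    refine (RunsIn.loop (k := 800 * #S.H + 80 * wc + 10) hB2 (by decide)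
      (Q := fun k' ρ => ∃ S', k' = 800 * #S'.H ∧ Idle (E wc) S' ∧ ρ.reg 32 = S'.c ∧
        Graphs (lay F J HL (D ∪ S'.P) S'.H) ρ ∧ ρ.reg 35 = J)
      (fun b ρ => ∃ k S', k ≤ wc ∧ b = 800 * #S'.H + 80 * (wc - k) + 10 ∧ Idle (E k) S' ∧
        Ctx n HL ρ ∧ ρ.reg 36 = k ∧ ρ.reg 32 = S'.c ∧ ρ.reg 35 = J ∧ ρ.reg 37 = wc ∧
        ρ.arr 13 = σ.arr 13 ∧ Graphs (lay F J HL (D ∪ S'.P) S'.H) ρ) ?_ ?_ ?_).mono ?_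
    · clear hG h32 h h35 ht₁ h37 hc
      rintro ρ b ⟨k, S, hk, rfl, hI, hc, h36, h32, h35, h37, h13, hG⟩ hρ hv
      have hkw : k < wc := by
        by_contra hlt
        simp [h36, h37, hlt] at hv
      have hwB := hwcB ρ hρ h37
      obtain ⟨s, hs⟩ := hw k hkw
      have hs2 := s.2
      have hnn : n ≤ n * n := Nat.le_mul_self n
      have hEk : E (k + 1) = fun v => E k v ∨ v = s := by
        ext v
        simp only [hE]
        constructor
        · rintro ⟨i, hi, he⟩
          rcases Nat.lt_succ_iff_lt_or_eq.1 hi with hi | rfl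
          · exact Or.inl ⟨i, hi, he⟩
          · exact Or.inr (Fin.ext (he.symm.trans hs))
        · rintro (⟨i, hi, he⟩ | rfl)
          · exact ⟨i, by omega, he⟩
          · exact ⟨k, by omega, hs⟩
      refine RunsIn.seq (P := fun t ρ' => t ≤ 3 ∧ ρ' = ρ.setReg 30 s)
        (Runs.of_quick (c := .assign 30 (.load 13 (R 36))) hB2 3 (by rfl) ?_).runsIn
        fun t₂ ρ₂ _ ⟨ht₂, e₂⟩ => ?_
      · simp only [Cmd.wp, val_load, val_reg, h36, h13, hs]
        exact ⟨by omega, trivial⟩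
      subst e₂
      have hc2 : Ctx n HL (ρ.setReg 30 s) := hc.setReg (by norm_num)
      have hgv : g.val (ρ.setReg 30 s) = gf (deg S.H s) := by
        rw [hg _ hc2, reg_setReg, if_pos rfl, arr_setReg, hG.deg_eq HL s, lay_HL]
      refine RunsIn.seq (P := fun t ρ' => ∃ S', t + 800 * #S'.H ≤ 800 * #S.H + 50 ∧
        Idle (E (k + 1)) S' ∧ ρ'.reg 32 = S'.c ∧ Graphs (lay F J HL (D ∪ S'.P) S'.H) ρ' ∧
        Frame 33 [2, 3, 4, 5, 6, 7] (ρ.setReg 30 s) ρ')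
        (RunsIn.cond hB2 hgd (fun h1 => ?_) fun h1 => ?_)
        fun t₃ ρ₃ _ ⟨S', ht₃, hI', h32', hG', hf⟩ => ?_
      · rw [hgv] at h1
        obtain ⟨W, w1, w2, w3, w4⟩ := htrue _ _ _ hI h1
        refine (walk_runs hB hJ hD hne w1 w2 hc2 hG (by simp) (by simpa using h32)
          (by simpa using h35) w3).mono fun τ ρ' _ ⟨⟨S', t', k1, k2, k3, k4, k5⟩, k6⟩ =>
            ⟨S', by omega, ?_, k4, k5, k6⟩
        rw [hEk]
        exact w4 S' t' k2 k3
      · rw [hgv] at h1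
        refine (Runs.skip (Q := fun ρ' => ρ' = ρ.setReg 30 s) rfl).runsIn.mono
          fun τ ρ' _ ⟨h2, h3⟩ => ⟨S, by omega, ?_, ?_, ?_, ?_⟩
        · rw [hEk]; exact hfalse _ _ _ hI h1
        · rw [h3]; simpa using h32
        · rw [h3]; exact hG
        · rw [h3]; exact Frame.refl _ _ _
      · refine (Runs.of_quick (c := .assign 36 (R 36 + 1)) (Q := fun ρ' => ρ' = ρ₃.setReg 36 (k + 1))
          hB2 4 (by rfl) ?_).runsIn.mono fun τ ρ' _ ⟨h2, h3⟩ =>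
            ⟨800 * #S'.H + 80 * (wc - (k + 1)) + 10, ?_, k + 1, S', hkw, rfl, hI', ?_, ?_, ?_, ?_, ?_,
              ?_, ?_⟩
        · have h36' : ρ₃.reg 36 = k := by rw [hf.1 36 (by norm_num)]; simpa using h36
          simp only [Cmd.wp, val_add, val_reg, val_one, h36']
          exact ⟨by omega, trivial⟩
        · have : ((R 36).lt (R 37)).time = 3 := rfl
          omega
        · rw [h3]
          exact (hc2.frame (by norm_num) hf).setReg (by norm_num)
        · rw [h3]; simp
        · rw [h3]; simpa using h32'
        · rw [h3]; simp only [reg_setReg, Nat.reduceEqDiff, if_false]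
          rw [hf.1 35 (by norm_num)]; simpa using h35
        · rw [h3]; simp only [reg_setReg, Nat.reduceEqDiff, if_false]
          rw [hf.1 37 (by norm_num)]; simpa using h37
        · rw [h3, arr_setReg, hf.2 13 (by decide)]; simpa using h13
        · rw [h3]; exact hG'
    · rintro ρ b ⟨k, S', hk, rfl, hI, hc, h36, h32, h35, h37, h13, hG⟩ hρ hv
      have hkw : k = wc := by
        by_contra hlt
        have : k < wc := by omega
        simp [h36, h37, this] at hv
      subst hkw
      have : ((R 36).lt (R 37)).time = 3 := rfl
      exact ⟨800 * #S'.H, by omega, S', rfl, hI, h32, hG, h35⟩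
    · refine ⟨0, S, Nat.zero_le _, rfl, ?_, hc.setReg (by norm_num), by simp, by simpa using h32,
        by simpa using h35, by simpa using h37, rfl, hG⟩
      have : E 0 = fun _ => False := by ext v; simp [hE]
      rw [this]; exact h
    · rintro τ ρ hρ ⟨k', hk, S', rfl, h1, h2, h3, h4⟩
      exact ⟨⟨S', by omega, h1, h2, h3⟩, h4⟩
  refine (RunsIn.frame 37 [2, 3, 4, 5, 6, 7] goal ?_ ?_).mono
    fun τ ρ _ ⟨⟨h1, h2⟩, h3⟩ => ⟨h1, h3, h2⟩
  · rfl
  · rfl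

/-! ### Degree-split in memory -/

@[simp] theorem val_two (σ : Config) : (2 : Expr).val σ = 2 := rfl

theorem card_le_sq {n : ℕ} (A : Finset (Sym2 (Fin n))) : #A ≤ n * n := by
  rw [← card_map_eid, ← card_range (n * n)]
  exact card_le_card fun x hx => by
    obtain ⟨e, -, rfl⟩ := mem_image.1 hx
    exact mem_range.2 (eid_lt e)

theorem IsMatching.mono {V : Type*} {M M' : Finset (Sym2 V)} (h : IsMatching M) (h' : M' ⊆ M) :
    IsMatching M' := fun e he f hf => h e (h' he) f (h' hf)

theorem update_zero_subset {n : ℕ} {F : ℕ → Finset (Sym2 (Fin n))} {J : ℕ}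
    {X : Finset (Sym2 (Fin n))} (h : X ⊆ F J) : Function.update F J X 0 ⊆ F 0 := by
  rw [Function.update_apply]
  split_ifs with h0
  · rw [h0]; exact h
  · exact Subset.rfl

/-- Delete all edges of the layer in register `35`. -/
def clear : Cmd := .loop (.load 5 (R 35))
  (.seq (block [.assign 38 (.load 6 (R 35 * R 101)), .assign 20 (R 35), .assign 21 (R 38 / R 100),
    .assign 22 (R 38 % R 100)]) gDelM)

theorem clear_runs {B n HL J : ℕ} {F : ℕ → Finset (Sym2 (Fin n))} {E₀ : Finset (Sym2 (Fin n))}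
    {σ : Config} (hB : Room B n HL) (hJ : J ≤ HL) (hc : Ctx n HL σ) (h : Graphs F σ)
    (h35 : σ.reg 35 = J) (hne : ∀ u v, s(u, v) ∈ F J → u ≠ v) (hM : IsMatching (E₀ ∪ F 0))
    (hd : Disjoint E₀ (F 0)) (hs : Stores σ (E₀ ∪ F 0)) :
    Runs B clear σ (450 * #(F J) + 10) fun ρ => (Graphs (Function.update F J ∅) ρ ∧
      Stores ρ (E₀ ∪ Function.update F J ∅ 0) ∧ ρ.reg 35 = J) ∧
      Frame 39 [1, 2, 3, 4, 5, 6, 7] σ ρ := by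
  have hB2 := hB.two_le
  have hB1 := hB.1
  refine Runs.frame 39 _ ?_ (by rfl) (by rfl)
  -- The invariant allows any remaining subset `X` of the layer, because the program always deletes
  -- whichever edge is first in the list at that moment.
  refine Runs.loop hB2 (by decide)
    (fun k ρ => ∃ X, X ⊆ F J ∧ k = 450 * #X + 10 ∧ Ctx n HL ρ ∧ ρ.reg 35 = J ∧
      Graphs (Function.update F J X) ρ ∧ Stores ρ (E₀ ∪ Function.update F J X 0)) ?_ ?_
    ⟨F J, Subset.rfl, rfl, hc, h35, by simpa using h, by simpa using hs⟩
  · clear h hs h35 hc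
    rintro ρ k ⟨X, hX, rfl, hc, h35, hG, hS⟩ hρ hv
    simp only [val_load, val_reg, h35] at hv
    obtain ⟨e, he, hl⟩ := hG.2.lists J |>.2.1 0 (Nat.pos_of_ne_zero hv)
    rw [Function.update_self] at he
    obtain ⟨u, v, hu, hv', rfl⟩ := eid_decode e
    have hl' : ρ.arr 6 (J * (n * n)) = eid s(u, v) := hl
    have hid := eid_lt s(u, v)
    have hu2 := u.2
    have hv2 := v.2
    have hnn : n ≤ n * n := Nat.le_mul_self n
    have hJB : J < B := h35 ▸ hρ.1 35
    have hsub := update_zero_subset hX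
    refine ⟨40 + 360, Runs.quick_seq hB2 40 (by rfl) ?_⟩
    simp only [block, Cmd.wp, val_load, val_mul, val_div, val_mod, val_reg, reg_setReg,
        h35, hc.n_eq, hc.N_eq, reduceIte, Nat.reduceEqDiff, if_false, hl', hu, hv']
    refine ⟨by omega, by omega, by omega, by omega, ?_⟩
    refine (gDelM_runs (j := J) (u := u) (v := v) (F := Function.update F J X) (E₀ := E₀) hB hJ ?_
      ?_ ?_ ?_ ?_
      (hne u v (hX he)) (by rw [Function.update_self]; exact he)
      (hM.mono (union_subset_union_right hsub)) (hd.mono_right hsub) ?_).mono le_rfl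
      fun ρ' _ ⟨⟨h1, h2⟩, h3⟩ => ?_
    · exact (((hc.setReg (by norm_num)).setReg (by norm_num)).setReg (by norm_num)).setReg
        (by norm_num)
    · exact hG.congr fun _ _ _ => rfl
    · simp
    · simp
    · simp
    · exact hS.congr rfl
    · have hcard := card_erase_add_one he
      rw [Function.update_self, Function.update_idem] at h1 h2
      refine ⟨450 * #(X.erase s(u, v)) + 10, ?_, X.erase s(u, v), (erase_subset _ _).trans hX, rfl,
        ?_, ?_, h1, h2⟩
      · have : (Expr.load 5 (R 35)).time = 2 := rfl
        omega
      · refine Ctx.frame ?_ (by norm_num) h3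
        exact (((hc.setReg (by norm_num)).setReg (by norm_num)).setReg (by norm_num)).setReg
          (by norm_num)
      · rw [h3.1 35 (by norm_num)]; simpa using h35
  · rintro ρ k ⟨X, hX, rfl, hc, h35, hG, hS⟩ hρ hv
    simp only [val_load, val_reg, h35] at hv
    rw [Fam.edges_len hG.2, Function.update_self, card_eq_zero] at hv
    subst hv
    have : (Expr.load 5 (R 35)).time = 2 := rfl
    exact ⟨by omega, hG, hS, h35⟩

/-- The layer `HL` holds `H`, and array `13` lists the end points of its edges. -/
structure Work {n : ℕ} (F : ℕ → Finset (Sym2 (Fin n))) (J HL : ℕ) (D H : Finset (Sym2 (Fin n)))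
    (σ : Config) : Prop where
  graphs : Graphs (lay F J HL D H) σ
  count : σ.reg 37 = 2 * #H
  vert : ∀ i < 2 * #H, ∃ v : Fin n, σ.arr 13 i = v
  cover : ∀ e ∈ H, ∀ v ∈ e, ∃ i < 2 * #H, σ.arr 13 i = v

theorem Work.congr {n : ℕ} {F : ℕ → Finset (Sym2 (Fin n))} {J HL : ℕ} {D H : Finset (Sym2 (Fin n))}
    {σ ρ : Config} (h : Work F J HL D H σ) (ha : ρ.arr = σ.arr) (hr : ρ.reg 37 = σ.reg 37) :
    Work F J HL D H ρ :=
  ⟨h.graphs.congr fun _ _ _ => by rw [ha], hr.trans h.count, by rw [ha]; exact h.vert,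
    by rw [ha]; exact h.cover⟩

/-- Insert an edge into the layer in register `102`, and its end points into array `13`. -/
def push : Cmd := .seq (.assign 20 (R 102)) (.seq gIns
  (block [.store 13 (R 37) (R 21), .store 13 (R 37 + 1) (R 22), .assign 37 (R 37 + 2)]))

theorem push_runs {B n HL J : ℕ} {F : ℕ → Finset (Sym2 (Fin n))} {D H : Finset (Sym2 (Fin n))}
    {σ : Config} {u v : Fin n} (hB : Room B n HL) (hc : Ctx n HL σ)
    (h : Work F J HL D H σ) (hu : σ.reg 21 = u) (hv : σ.reg 22 = v) (huv : u ≠ v)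
    (he : s(u, v) ∉ H) :
    Runs B push σ 280 fun ρ => (Work F J HL D (insert s(u, v) H) ρ ∧ SameRows 5 (n * n) HL σ ρ ∧
      ρ.reg 35 = σ.reg 35) ∧ Frame 38 [2, 3, 4, 5, 6, 7, 13] σ ρ := by
  have hB2 := hB.two_le
  have hB1 := hB.1
  refine Runs.frame 38 _ (Runs.of_small fun hσ => ?_) (by rfl) (by rfl)
  have hu2 := u.2
  have hv2 := v.2
  have hnn : n ≤ n * n := Nat.le_mul_self n
  have hH : HL < B := hc.H_eq ▸ hσ.1 102
  have hci := card_insert_of_notMem he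
  have hcs := card_le_sq (insert s(u, v) H)
  refine Runs.mono_time (T := 2 + (250 + 20)) ?_ (by omega)
  refine Runs.quick_seq hB2 2 (by rfl) ?_
  simp only [Cmd.wp, val_reg, hc.H_eq]
  refine ⟨hH, Runs.call_seq (gIns_runs (j := HL) (u := u) (v := v) (F := lay F J HL D H) (by omega)
    (hB.row_le le_rfl) ?_ ?_ h.graphs (by simp) (by simpa using hu) (by simpa using hv) huv
    (by rwa [lay_HL])) fun ρ hρ ⟨⟨hg, hsr⟩, hf⟩ => ?_⟩
  · simpa using hc.n_eq
  · simpa using hc.N_eq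
  rw [lay_HL, update_lay_HL] at hg
  have r : ∀ r, 21 ≤ r → ρ.reg r = σ.reg r := by
    intro r hr
    rw [hf.1 r (by omega), reg_setReg, if_neg (by omega)]
  have a13 : ρ.arr 13 = σ.arr 13 := hf.2 13 (by decide)
  refine Runs.of_quick hB2 20 (by rfl) ?_
  simp only [block, Cmd.wp, val_reg, val_add, val_one, val_two, reg_setArr, reg_setReg,
    r 37 (by norm_num), r 21 (by norm_num), r 22 (by norm_num), h.count, hu, hv]
  refine ⟨by omega, by omega, by omega, ⟨?_, ?_, ?_, ?_⟩, ?_, ?_⟩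
  · refine hg.congr fun a h1 h2 => ?_
    simp only [arr_setReg, arr_setArr]
    rw [if_neg (by omega), if_neg (by omega)]
  · simp only [reg_setReg, reduceIte]; omega
  · intro i hi
    simp only [arr_setReg, arr_setArr, reduceIte, a13, Function.update_apply]
    split_ifs
    · exact ⟨v, rfl⟩
    · exact ⟨u, rfl⟩
    · exact h.vert i (by omega)
  · intro e he' w hw
    simp only [arr_setReg, arr_setArr, reduceIte, a13, Function.update_apply]
    rcases mem_insert.1 he' with rfl | he'
    · rcases Sym2.mem_iff.1 hw with rfl | rfl
      · exact ⟨2 * #H, by omega, by simp⟩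
      · exact ⟨2 * #H + 1, by omega, by simp⟩
    · obtain ⟨i, hi, hiw⟩ := h.cover e he' w hw
      exact ⟨i, by omega, by rw [if_neg (by omega), if_neg (by omega), hiw]⟩
  · intro r' hr'
    simpa using hsr r' hr'
  · simp [r 35 (by norm_num)]

/-- The sets `S j` are stored in the arrays `8`, `9`, `10`. -/
def Supps {n : ℕ} (S : ℕ → Finset (Sym2 (Fin n))) (σ : Config) : Prop :=
  Fam 8 (n * n) (fun j x => ∃ e ∈ S j, eid e = x) σ

theorem Supps.congr {n : ℕ} {S : ℕ → Finset (Sym2 (Fin n))} {σ ρ : Config} (h : Supps S σ)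
    (h' : ∀ a, 8 ≤ a → a ≤ 10 → ρ.arr a = σ.arr a) : Supps S ρ := by
  simp only [Supps, Fam] at h ⊢
  simpa [h'] using h

theorem Supps.mem_iff {n : ℕ} {S : ℕ → Finset (Sym2 (Fin n))} {σ : Config} (h : Supps S σ)
    (j : ℕ) (e : Sym2 (Fin n)) : σ.arr 10 (j * (n * n) + eid e) ≠ 0 ↔ e ∈ S j := by
  rw [FamRep.pos_iff h (eid_lt e), eid_mem]

/-- The state during the distribution of the edges of the layers `j` of `S` and `F`. -/
structure Loading {n : ℕ} (F S : ℕ → Finset (Sym2 (Fin n))) (J HL : ℕ) (σ₀ : Config)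
    (D H : Finset (Sym2 (Fin n))) (σ : Config) : Prop where
  ctx : Ctx n HL σ
  level : σ.reg 60 = J + 1
  target : σ.reg 35 = J
  work : Work F J HL D H σ
  supps : Supps S σ
  len : σ.arr 5 (J + 1) = σ₀.arr 5 (J + 1)
  list : ∀ k < n * n, σ.arr 6 ((J + 1) * (n * n) + k) = σ₀.arr 6 ((J + 1) * (n * n) + k)

theorem Loading.congr {n : ℕ} {F S : ℕ → Finset (Sym2 (Fin n))} {J HL : ℕ} {σ₀ : Config}
    {D H : Finset (Sym2 (Fin n))} {σ ρ : Config} (h : Loading F S J HL σ₀ D H σ)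
    (ha : ρ.arr = σ.arr)
    (hr : ∀ r, r ≠ 21 → r ≠ 22 → r ≠ 38 → r ≠ 50 → ρ.reg r = σ.reg r) :
    Loading F S J HL σ₀ D H ρ where
  ctx := ⟨by rw [hr] <;> simp [h.ctx.n_eq], by rw [hr] <;> simp [h.ctx.N_eq],
    by rw [hr] <;> simp [h.ctx.H_eq]⟩
  level := by rw [hr] <;> simp [h.level]
  target := by rw [hr] <;> simp [h.target]
  work := h.work.congr ha (by rw [hr] <;> simp)
  supps := h.supps.congr fun a _ _ => by rw [ha]
  len := by rw [ha]; exact h.len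
  list := by rw [ha]; exact h.list

/-- Distribute an edge of the layer `S j`. -/
def loadSupp : Cmd := .cond (.load 4 ((R 60 * R 100 + R 21) * R 100 + R 22))
  (.seq (.assign 20 (R 35)) gIns) push

/-- Distribute an edge of the layer `F j`. -/
def loadGraph : Cmd := .cond (.load 10 (R 60 * R 101 + R 38)) .skip push

theorem Loading.push_runs {B n HL J : ℕ} {F S : ℕ → Finset (Sym2 (Fin n))} {σ₀ : Config}
    {D H : Finset (Sym2 (Fin n))} {σ : Config} {u v : Fin n} (hB : Room B n HL) (hJ : J + 1 < HL)
    (h : Loading F S J HL σ₀ D H σ) (hu : σ.reg 21 = u) (hv : σ.reg 22 = v) (huv : u ≠ v)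
    (he : s(u, v) ∉ H) :
    Runs B push σ 280 (Loading F S J HL σ₀ D (insert s(u, v) H)) := by
  refine (DynRound.push_runs hB h.ctx h.work hu hv huv he).mono le_rfl
    fun ρ _ ⟨⟨h1, h2, h3⟩, h4⟩ => ⟨h.ctx.frame (by norm_num) h4, ?_, h3.trans h.target, h1, ?_, ?_, ?_⟩
  · rw [h4.1 60 (by norm_num), h.level]
  · exact h.supps.congr fun a h8 h10 => h4.2 a (by simp; omega)
  · rw [(h2 (J + 1) hJ.ne).1, h.len]
  · intro k hk
    rw [(h2 (J + 1) hJ.ne).2 k hk, h.list k hk]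

theorem Loading.ins_runs {B n HL J : ℕ} {F S : ℕ → Finset (Sym2 (Fin n))} {σ₀ : Config}
    {D H : Finset (Sym2 (Fin n))} {σ : Config} {u v : Fin n} (hB : Room B n HL) (hJ : J + 1 < HL)
    (h : Loading F S J HL σ₀ D H σ) (hu : σ.reg 21 = u) (hv : σ.reg 22 = v) (huv : u ≠ v)
    (he : s(u, v) ∉ D) :
    Runs B (.seq (.assign 20 (R 35)) gIns) σ 280 (Loading F S J HL σ₀ (insert s(u, v) D) H) := by
  have hB2 := hB.two_le
  have hB1 := hB.1
  have hJ' : J < HL := by omega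
  refine Runs.of_small fun hσ => Runs.mono_time (T := 2 + 250) ?_ (by omega)
  have hJB : J < B := h.target ▸ hσ.1 35
  refine Runs.quick_seq hB2 2 (by rfl) ?_
  simp only [Cmd.wp, val_reg, h.target]
  refine ⟨hJB, (gIns_runs (j := J) (u := u) (v := v) (F := lay F J HL D H) (by omega)
    (hB.row_le hJ'.le) ?_ ?_ (σ := σ.setReg 20 J) h.work.graphs (by simp) (by simpa using hu)
    (by simpa using hv) huv (by rwa [lay_J _ hJ'])).mono le_rfl fun ρ _ ⟨⟨hg, hsr⟩, hf⟩ => ?_⟩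
  · simpa using h.ctx.n_eq
  · simpa using h.ctx.N_eq
  rw [lay_J _ hJ', update_lay_J _ hJ'] at hg
  have r : ∀ r, 21 ≤ r → ρ.reg r = σ.reg r := by
    intro r hr
    rw [hf.1 r (by omega), reg_setReg, if_neg (by omega)]
  have a13 : ρ.arr 13 = σ.arr 13 := hf.2 13 (by decide)
  refine ⟨⟨by rw [r _ (by norm_num), h.ctx.n_eq], by rw [r _ (by norm_num), h.ctx.N_eq],
    by rw [r _ (by norm_num), h.ctx.H_eq]⟩, by rw [r _ (by norm_num), h.level],
    by rw [r _ (by norm_num), h.target], ⟨hg, by rw [r _ (by norm_num), h.work.count], ?_, ?_⟩,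
    ?_, ?_, ?_⟩
  · rw [a13]; exact h.work.vert
  · rw [a13]; exact h.work.cover
  · exact h.supps.congr fun a h8 h10 => hf.2 a (by simp; omega)
  · rw [(hsr (J + 1) (by omega)).1]; exact h.len
  · intro k hk
    rw [(hsr (J + 1) (by omega)).2 k hk]; exact h.list k hk

/-- Set the layer `j - 1`, where `j` is in register `60`, to the first part of a degree-split of the
layers `j` of the two families. -/
def split : Cmd := .seq (.assign 35 (R 60 - 1)) (.seq clear (.seq (.assign 37 0)
  (.seq (forEach 8 60 loadSupp) (.seq (forEach 5 60 loadGraph) (.seq (.assign 32 0)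
    (.seq (phase (.load 2 (R 102 * R 100 + R 30) % 2)) (phase 1)))))))

/-- Edges are inserted into the rows `J` and `HL` of the same arrays whose row `J + 1` is being
traversed. The family representation does not fix the order of a list, so the fields `len` and
`list` of `Loading` record separately that this row stays as it was. -/
theorem Loading.load_runs {B n HL J : ℕ} {F S : ℕ → Finset (Sym2 (Fin n))} {σ : Config}
    (hB : Room B n HL) (hJ : J + 1 < HL) (h : Loading F S J HL σ ∅ ∅ σ)
    (hne : ∀ u v, s(u, v) ∈ S (J + 1) ∪ F (J + 1) → u ≠ v) :
    Runs B (.seq (forEach 8 60 loadSupp) (forEach 5 60 loadGraph)) σ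
      (400 * #(S (J + 1)) + 20 + (400 * #(F (J + 1)) + 20))
      (Loading F S J HL σ (S (J + 1) ∩ F (J + 1))
        ((S (J + 1) \ F (J + 1)) ∪ (F (J + 1) \ S (J + 1)))) := by
  classical
  have hB2 := hB.two_le
  have hgF : ∀ {D H ρ}, Loading F S J HL σ D H ρ → ∀ u v : Fin n, ρ.arr 4 (((J + 1) * n + u) * n + v) ≠ 0 ↔
      s(u, v) ∈ F (J + 1) := by
    intro D H ρ h u v
    rw [h.work.graphs.mem_iff, lay_of_ne _ (by omega) (by omega)]
  have hlF : Lists (F (J + 1)) (σ.arr 5 (J + 1)) (fun k => σ.arr 6 ((J + 1) * (n * n) + k)) := by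
    have := h.work.graphs.2.lists (J + 1)
    rwa [lay_of_ne _ (by omega) (by omega)] at this
  have hlS := h.supps.lists (J + 1)
  refine Runs.call_seq (P := Loading F S J HL σ (S (J + 1) ∩ F (J + 1)) (S (J + 1) \ F (J + 1)))
    (T₁ := 400 * #(S (J + 1)) + 20) ?_ fun ρ hρ hl => ?_
  · refine (forEach_runs (T := 300) hB hlS (by rw [hlS.1]; exact card_le_sq _)
      (by rfl) (fun E ρ => Loading F S J HL σ (E ∩ F (J + 1)) (E \ F (J + 1)) ρ ∧
        ∀ a, 8 ≤ a → a ≤ 10 → ρ.arr a = σ.arr a)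
      (fun E ρ τ hE ha hr => ⟨hE.1.congr ha hr, by rw [ha]; exact hE.2⟩)
      (fun E ρ hE => ⟨hE.1.ctx, ?_, ?_⟩) ?_ ⟨?_, ?_⟩).mono (by omega) fun ρ _ h => h.1
    · rw [hE.1.level, hE.2 8 (by norm_num) (by norm_num)]
    · intro k hk
      rw [hE.1.level, hE.2 9 (by norm_num) (by norm_num)]
    · rintro E e ρ u v hEA he heE ⟨hI, ha⟩ rfl hu hv - hρ
      have huv : u ≠ v := hne u v (mem_union_left _ he)
      have key := hgF hI u v
      unfold loadSupp
      refine Runs.mono_time (Runs.cond (T := 280) hB2 ?_ (fun h1 => ?_) fun h1 => ?_)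
        (by decide)
      · decide
      · simp only [val_load, val_add, val_mul, val_reg, hI.level, hI.ctx.n_eq, hu, hv] at h1
        rw [insert_inter_of_mem (key.1 h1), insert_sdiff_of_mem _ (key.1 h1)]
        refine (Runs.frame 38 [2, 3, 4, 5, 6, 7] (hI.ins_runs hB hJ hu hv huv
          (fun h => heE (mem_inter.1 h).1)) (by rfl) (by rfl)).mono le_rfl fun ρ' _ ⟨g1, g2⟩ =>
            ⟨g1, fun a h8 h10 => ?_⟩
        rw [g2.2 a (by simp; omega), ha a h8 h10]
      · simp only [val_load, val_add, val_mul, val_reg, hI.level, hI.ctx.n_eq, hu, hv] at h1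
        have h2 : s(u, v) ∉ F (J + 1) := fun h => key.2 h h1
        rw [insert_inter_of_notMem h2, insert_sdiff_of_notMem _ h2]
        refine (Runs.frame 38 [2, 3, 4, 5, 6, 7, 13] (hI.push_runs hB hJ hu hv huv
          (fun h => heE (mem_sdiff.1 h).1)) (by rfl) (by rfl)).mono le_rfl fun ρ' _ ⟨g1, g2⟩ =>
            ⟨g1, fun a h8 h10 => ?_⟩
        rw [g2.2 a (by simp; omega), ha a h8 h10]
    · simpa using h
    · exact fun a _ _ => rfl
  · refine (forEach_runs (T := 300) hB hlF (by rw [hlF.1]; exact card_le_sq _)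
      (by rfl) (fun E ρ => Loading F S J HL σ (S (J + 1) ∩ F (J + 1))
        ((S (J + 1) \ F (J + 1)) ∪ (E \ S (J + 1))) ρ)
      (fun E ρ τ hE ha hr => hE.congr ha hr)
      (fun E ρ hE => ⟨hE.ctx, ?_, ?_⟩) ?_ ?_).mono (by omega) fun ρ _ h => h
    · rw [hE.level, hE.len]
    · intro k hk
      rw [hE.level]
      exact hE.list k (hk.trans_le (by rw [hlF.1]; exact card_le_sq _))
    · rintro E e ρ u v hEA he heE hI rfl hu hv h38 hρ
      have huv : u ≠ v := hne u v (mem_union_right _ he)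
      have key := hI.supps.mem_iff (J + 1) s(u, v)
      unfold loadGraph
      refine Runs.mono_time (Runs.cond (T := 280) hB2 ?_ (fun h1 => ?_) fun h1 => ?_)
        (by decide)
      · decide
      · simp only [val_load, val_add, val_mul, val_reg, hI.level, hI.ctx.N_eq, h38] at h1
        rw [insert_sdiff_of_mem _ (key.1 h1)]
        exact (Runs.skip hI).mono_time (by norm_num)
      · simp only [val_load, val_add, val_mul, val_reg, hI.level, hI.ctx.N_eq, h38] at h1
        have h2 : s(u, v) ∉ S (J + 1) := fun h => key.2 h h1
        rw [insert_sdiff_of_notMem _ h2, union_insert]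
        refine hI.push_runs hB hJ hu hv huv fun h => ?_
        rcases mem_union.1 h with h | h
        · exact h2 (mem_sdiff.1 h).1
        · exact heE (mem_sdiff.1 h).1
    · simpa using hl

theorem Runs.assoc {B : ℕ} {c d e : Cmd} {σ : Config} {T : ℕ} {Q : Config → Prop}
    (h : Runs B (.seq (.seq c d) e) σ T Q) : Runs B (.seq c (.seq d e)) σ T Q := by
  intro hσ
  obtain ⟨t, ρ, k1, k2⟩ := h hσ
  refine ⟨t, ρ, fun w hw => ?_, k2⟩
  cases k1 w hw with | seq _ _ _ σ₁ _ t₁ t₂ f1 f2 =>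
  cases f1 with | seq _ _ _ σ₂ _ t₃ t₄ f3 f4 =>
  rw [add_assoc]
  exact .seq _ _ _ _ _ _ _ f3 (.seq _ _ _ _ _ _ _ f4 f2)

/-- The array of mates loses the old edges of layer `J` when `J = 0` but does not yet receive the
new ones: while `E 0` is outdated, the union need not be a matching. Hence the empty layer in the
final `Stores`. -/
theorem split_runs {B n HL J : ℕ} {F S : ℕ → Finset (Sym2 (Fin n))} {E₀ : Finset (Sym2 (Fin n))}
    {side : Fin n → Bool} {σ : Config} (hB : Room B n HL) (hJ : J + 1 < HL) (hc : Ctx n HL σ)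
    (h60 : σ.reg 60 = J + 1) (hg : Graphs F σ) (hS : Supps S σ) (hF : F HL = ∅)
    (hside : ∀ u v, s(u, v) ∈ S (J + 1) ∪ F (J + 1) → side u ≠ side v)
    (hne : ∀ u v, s(u, v) ∈ F J → u ≠ v) (hM : IsMatching (E₀ ∪ F 0))
    (hd : Disjoint E₀ (F 0)) (hs : Stores σ (E₀ ∪ F 0)) :
    Runs B split σ (2000 * (#(S (J + 1)) + #(F (J + 1)) + #(F J)) + 200) fun ρ =>
      (∃ E₁ E₂, IsDegreeSplit (S (J + 1)) (F (J + 1)) E₁ E₂ ∧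
        Graphs (Function.update F J E₁) ρ ∧ Stores ρ (E₀ ∪ Function.update F J ∅ 0)) ∧
      Frame 51 [1, 2, 3, 4, 5, 6, 7, 13] σ ρ := by
  classical
  have hB2 := hB.two_le
  have hB1 := hB.1
  have hJ' : J < HL := by omega
  refine Runs.frame 51 _ (Runs.of_small fun hσ => ?_) (by rfl) (by rfl)
  have hJB : J < B := by have := hσ.1 60; omega
  set A := S (J + 1) with hA
  set C := F (J + 1) with hC
  set H₀ := (A \ C) ∪ (C \ A) with hH₀
  have hsub : H₀ ⊆ A ∪ C := by
    intro e; simp only [hH₀, mem_union, mem_sdiff]; tauto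
  have hcH : #H₀ ≤ #A + #C := (card_le_card hsub).trans (card_union_le _ _)
  have hne' : ∀ u v, s(u, v) ∈ A ∪ C → u ≠ v := fun u v h huv => hside u v h (by rw [huv])
  refine Runs.mono_time (T := 10 + (450 * #(F J) + 10 + (2 + ((400 * #A + 20 +
    (400 * #C + 20)) + (2 + (1200 * #H₀ + 60)))))) ?_ (by omega)
  refine Runs.quick_seq hB2 10 (by rfl) ?_
  simp only [Cmd.wp, val_reg, val_sub, val_one, h60, Nat.add_sub_cancel]
  refine ⟨hJB, Runs.call_seq (clear_runs (E₀ := E₀) hB hJ'.le (hc.setReg (by norm_num))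
    (hg.congr fun _ _ _ => rfl) (by simp) hne hM hd (hs.congr rfl))
    fun ρ₁ hρ₁ ⟨⟨g1, g2, g3⟩, g4⟩ => ?_⟩
  have c1 : Ctx n HL ρ₁ := (hc.setReg (by norm_num)).frame (by norm_num) g4
  -- The scratch layer `HL` is empty outside of a split, so emptying layer `J` already gives the
  -- form that the loading phase starts from.
  have hlay : lay F J HL ∅ ∅ = Function.update F J ∅ := by
    rw [lay, Function.update_eq_self_iff, Function.update_of_ne hJ'.ne', hF]
  refine Runs.quick_seq hB2 2 (by rfl) ?_
  simp only [Cmd.wp, val_zero]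
  refine ⟨by omega, ?_⟩
  have hload : Loading F S J HL (ρ₁.setReg 37 0) ∅ ∅ (ρ₁.setReg 37 0) := by
    refine ⟨c1.setReg (by norm_num), ?_, by simpa using g3,
      ⟨by rw [hlay]; exact g1.congr fun _ _ _ => rfl, by simp, by simp, by simp⟩, ?_, rfl,
      fun _ _ => rfl⟩
    · rw [reg_setReg, if_neg (by norm_num), g4.1 60 (by norm_num)]; simpa using h60
    · exact hS.congr fun a h8 h10 => by rw [arr_setReg, g4.2 a (by simp; omega)]; rfl
  refine Runs.assoc (Runs.call_seq (Runs.frame 51 [2, 3, 4, 5, 6, 7, 13] (hload.load_runs hB hJ hne')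
    (by rfl) (by rfl)) fun ρ₂ hρ₂ ⟨hl, hf₂⟩ => ?_)
  rw [← hA, ← hC, ← hH₀] at hl
  refine Runs.quick_seq hB2 2 (by rfl) ?_
  simp only [Cmd.wp, val_zero]
  refine ⟨by omega, ?_⟩
  have hD : Disjoint (A ∩ C) H₀ := by
    rw [disjoint_left]; intro e; simp only [hH₀, mem_union, mem_sdiff, mem_inter]; tauto
  have hsH : ∀ u v, s(u, v) ∈ H₀ → side u ≠ side v := fun u v h => hside u v (hsub h)
  have hnH : ∀ u v, s(u, v) ∈ H₀ → u ≠ v := fun u v h => hne' u v (hsub h)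
  have hb0 : Trail.Base H₀ ⟨H₀, ∅, ∅, 0⟩ := ⟨by simp, by simp, by simp⟩
  have hdeg0 : ∀ v : Fin n, deg (∅ : Finset (Sym2 (Fin n))) v = 0 := deg_empty
  refine RunsIn.runs (RunsIn.seq (phase_runs (F := F) (H₀ := H₀) (D := A ∩ C) (S := ⟨H₀, ∅, ∅, 0⟩)
    (wc := 2 * #H₀) hB hJ' hD hnH (Trail.Idle₁ H₀) (fun d => d % 2) (fun τ hτ => ?_)
    (by decide) (by decide) (fun X S s hI hgs => ?_) (fun X S s hI hgs => ?_)
    (hl.ctx.setReg (by norm_num)) ?_ (by simp) (by simpa using hl.target)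
    (by simpa using hl.work.count) hl.work.vert ?_)
    fun t₃ ρ₃ hρ₃ ⟨⟨S₃, k1, k2, k3, k4⟩, k5, k6⟩ => ?_)
  · simp [hτ.n_eq, hτ.H_eq]
  · refine ⟨_, fun S t h => h.1, fun S t w h he => h.step (hnH _ _ (h.1.notMem he).2.2) he,
      hI.start (Nat.odd_iff.2 (by omega)), fun S' t' h h0 => h.stuck h0⟩
  · exact hI.pass (Nat.even_iff.2 hgs)
  · rw [union_empty]; exact hl.work.graphs.congr fun _ _ _ => rfl
  · exact ⟨hb0, fun v => ⟨by simp [Trail.bal, hdeg0], by simp [Trail.bal, hdeg0], fun h => h.elim⟩⟩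
  · have c3 : Ctx n HL ρ₃ := (hl.ctx.setReg (by norm_num)).frame (by norm_num) k5
    have hcov : ∀ e ∈ H₀, ∀ v ∈ e, ∃ i < 2 * #H₀, (ρ₂.setReg 32 0).arr 13 i = v := hl.work.cover
    have a13 : ρ₃.arr 13 = ρ₂.arr 13 := k5.2 13 (by decide)
    refine (phase_runs (F := F) (H₀ := H₀) (D := A ∩ C) (S := S₃) (wc := 2 * #H₀) hB hJ' hD hnH
      (Trail.Idle₂ H₀) (fun _ => 1) (fun τ hτ => rfl)
      (by decide) (by decide) (fun X S s hI hgs => ?_) (fun X S s hI hgs => ?_)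
      c3 k4 k3 k6 ?_ ?_ (k2.idle₂ hcov)).mono
      fun t₄ ρ₄ hρ₄ ⟨⟨S₄, m1, m2, m3, m4⟩, m5, m6⟩ => ?_
    · exact ⟨_, fun S t h => h.1, fun S t w h he => h.step (hsH _ _ (h.1.notMem he).2.2) he,
        hI.start side s, fun S' t' h h0 => h.stuck h0⟩
    · exact absurd hgs (by norm_num)
    · rw [k5.1 37 le_rfl]; simpa using hl.work.count
    · rw [a13]; exact hl.work.vert
    · have hH : S₄.H = ∅ := m2.H_eq (by rw [a13]; exact hcov)
      refine ⟨?_, _, _, m2.1.isDegreeSplit hH fun v => (m2.2 v).1, ?_, ?_⟩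
      · simp only at k1; omega
      · have : lay F J HL (A ∩ C ∪ S₄.P) S₄.H = Function.update F J (A ∩ C ∪ S₄.P) := by
          rw [lay, hH, Function.update_eq_self_iff, Function.update_of_ne hJ'.ne', hF]
        rwa [this] at m4
      · refine g2.congr ?_
        rw [m5.2 1 (by decide), k5.2 1 (by decide), arr_setReg, hf₂.2 1 (by decide), arr_setReg]

/-! ### Rebuilding in memory -/

/-- The edge may already be stored. Writing it again is harmless, so whole sets can be written
without comparing them to the previous contents. -/
theorem Stores.insert {n : ℕ} {σ : Config} {M : Finset (Sym2 (Fin n))} (h : Stores σ M)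
    {u v : Fin n} (hM : IsMatching (insert s(u, v) M)) (huv : u ≠ v) :
    Stores ((σ.setArr 1 u (v + 1)).setArr 1 v (u + 1)) (insert s(u, v) M) := by
  have key : ∀ {w u' : Fin n}, s(u', w) ∈ Insert.insert s(u, v) M → w = u ∨ w = v →
      s(u', w) = s(u, v) := fun {w u'} h1 h2 =>
    hM _ h1 _ (mem_insert_self _ _) w (by simp) (by rcases h2 with rfl | rfl <;> simp)
  intro w
  have h1 := h w
  have hu2 := u.2
  have hv2 := v.2
  simp only [arr_setArr, reduceIte, Function.update_apply, ← Fin.ext_iff]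
  by_cases hv : w = v
  · subst hv
    rw [if_pos rfl]
    refine ⟨by omega, fun u' => ⟨fun h2 => ?_, fun h2 => ?_⟩⟩
    · rw [Sym2.congr_left.1 (key h2 (Or.inr rfl))]
    · rw [show u' = u from Fin.ext (by omega)]; exact mem_insert_self _ _
  · by_cases hu : w = u
    · subst hu
      rw [if_neg hv, if_pos rfl]
      refine ⟨by omega, fun u' => ⟨fun h2 => ?_, fun h2 => ?_⟩⟩
      · have := key h2 (Or.inl rfl)
        rw [Sym2.eq_swap] at this
        rw [Sym2.congr_right.1 this]
      · rw [show u' = v from Fin.ext (by omega), Sym2.eq_swap]; exact mem_insert_self _ _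
    · rw [if_neg hv, if_neg hu]
      refine ⟨h1.1, fun u' => ?_⟩
      rw [← h1.2 u', mem_insert, or_iff_right]
      intro heq
      have : w ∈ s(u, v) := by rw [← heq]; simp
      rcases Sym2.mem_iff.1 this with h | h
      · exact hu h
      · exact hv h

theorem Runs.assoc_symm {B : ℕ} {c d e : Cmd} {σ : Config} {T : ℕ} {Q : Config → Prop}
    (h : Runs B (.seq c (.seq d e)) σ T Q) : Runs B (.seq (.seq c d) e) σ T Q := by
  intro hσ
  obtain ⟨t, ρ, k1, k2⟩ := h hσ
  refine ⟨t, ρ, fun w hw => ?_, k2⟩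
  cases k1 w hw with | seq _ _ _ σ₁ _ t₁ t₂ f1 f2 =>
  cases f2 with | seq _ _ _ σ₂ _ t₃ t₄ f3 f4 =>
  rw [← add_assoc]
  exact .seq _ _ _ _ _ _ _ (.seq _ _ _ _ _ _ _ f1 f3) f4

theorem Runs.loop_step {B : ℕ} (hB : 2 ≤ B) {p : Expr} (hp : p.deg ≤ 16) {c : Cmd} {σ : Config}
    {T : ℕ} {Q : Config → Prop} (hv : p.val σ ≠ 0) (h : Runs B (.seq c (.loop p c)) σ T Q) :
    Runs B (.loop p c) σ (p.time + 1 + T) Q := by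
  intro hσ
  obtain ⟨t, ρ, h1, h2, h3, h4⟩ := h hσ
  refine ⟨p.time + 1 + t, ρ, fun w hw => ?_, by omega, h3, h4⟩
  cases h1 w hw with | seq _ _ _ σ₁ _ t₁ t₂ f1 f2 =>
  rw [← add_assoc]
  exact .loopTrue _ _ _ _ _ _ _ _ (p.eval_eq hσ hB hp hw) hv f1 f2

theorem Runs.loop_exit {B : ℕ} (hB : 2 ≤ B) {p : Expr} (hp : p.deg ≤ 16) {c : Cmd} {σ : Config}
    {Q : Config → Prop} (hv : p.val σ = 0) (h : Q σ) : Runs B (.loop p c) σ (p.time + 1) Q :=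
  fun hσ => ⟨_, σ, fun w hw => .loopFalse _ _ _ (by rw [p.eval_eq hσ hB hp hw, hv]), le_rfl, hσ, h⟩

/-- A bound for the time to rebuild the layers below `i`. -/
def costBelow {V : Type*} (F S : ℕ → Finset (Sym2 V)) (i : ℕ) : ℕ :=
  4000 * #(F i) + ∑ j ∈ range i, (4000 * #(S (j + 1)) + 2000 * #(F j) + 4000) + 20

/-- Split the layers from the one in register `60` down to `1`. -/
def splitAll : Cmd := .loop (R 60) (.seq (.store 12 (R 60) 0) (.seq split (.assign 60 (R 60 - 1))))

/-- `Y` is what the array of mates still shows of layer `0`: all of it if `i = 0`, since then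
nothing is split, and nothing otherwise. -/
theorem splitAll_runs {B n L : ℕ} {G : SimpleGraph (Fin n)} {side : Fin n → Bool}
    (hB : Room B n (L + 1)) (hside : ∀ u v, G.Adj u v → side u ≠ side v)
    {E₀ : Finset (Sym2 (Fin n))} (i : ℕ) (hi : i ≤ L) : ∀ (s : AlgState (Fin n)) (σ : Config),
    Ctx n (L + 1) σ → σ.reg 60 = i → Graphs s.F σ → Supps (suppDigit s.x) σ → s.F (L + 1) = ∅ →
    (∀ j, ∀ e ∈ suppDigit s.x j, e ∈ G.edgeSet) → (∀ j, ∀ e ∈ s.F j, e ∈ G.edgeSet) →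
    IsMatching (E₀ ∪ s.F 0) → Disjoint E₀ (s.F 0) → Stores σ (E₀ ∪ s.F 0) →
    (∀ j ≤ L, σ.arr 12 j = s.c j) →
    Runs B splitAll σ (costBelow s.F (suppDigit s.x) i) fun ρ => ∃ s' Y, Rebuild i s s' ∧
      s'.x = s.x ∧ s'.E 0 = suppDigit s.x 0 ∧ s'.c 0 = 0 ∧ Graphs s'.F ρ ∧
      (∀ j ≤ L, j ≠ 0 → ρ.arr 12 j = s'.c j) ∧ Stores ρ (E₀ ∪ Y) ∧ Y ⊆ s'.F 0 ∧
      2000 * #(s'.F 0) ≤ costBelow s.F (suppDigit s.x) i ∧ ρ.reg 60 = 0 ∧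
      (∀ e ∈ s'.F 0, e ∈ G.edgeSet) := by
  have hB2 := hB.two_le
  have hne : ∀ u v, s(u, v) ∈ G.edgeSet → u ≠ v := fun u v h => (G.mem_edgeSet.1 h).ne
  induction i with
  | zero =>
    intro s σ hc h60 hg hS hF hSG hFG hM hd hs hcnt
    refine (Runs.loop_exit hB2 (by decide) (by simpa using h60) ?_).mono_time
      (by simp only [costBelow, Expr.time]; omega)
    refine ⟨s.reload 0, s.F 0, .zero s, rfl, by simp [AlgState.reload], by simp [AlgState.reload],
      hg, fun j hj h0 => ?_, hs, Subset.rfl, ?_, h60, hFG 0⟩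
    · rw [hcnt j hj]; simp [AlgState.reload, h0]
    · simp only [costBelow, AlgState.reload]; omega
  | succ i ih =>
    intro s σ hc h60 hg hS hF hSG hFG hM hd hs hcnt
    set a := #(suppDigit s.x (i + 1)) + #(s.F (i + 1)) with ha
    set T := 4000 * ((a + 1) / 2) +
      ∑ j ∈ range i, (4000 * #(suppDigit s.x (j + 1)) + 2000 * #(s.F j) + 4000) + 20 with hT
    have hTcost : ∀ E₁ : Finset (Sym2 (Fin n)), #E₁ = (a + 1) / 2 →
        costBelow (Function.update s.F i E₁) (suppDigit s.x) i = T := by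
      intro E₁ hE
      have h1 : ∑ k ∈ range i, (4000 * #(suppDigit s.x (k + 1)) +
          2000 * #(Function.update s.F i E₁ k) + 4000) =
          ∑ k ∈ range i, (4000 * #(suppDigit s.x (k + 1)) + 2000 * #(s.F k) + 4000) :=
        sum_congr rfl fun k hk => by rw [Function.update_of_ne (mem_range.1 hk).ne]
      simp only [costBelow, Function.update_self, h1, hE, hT]
    -- The new layer has `(a + 1) / 2` edges, so its credit of `4000` per edge is at most `2000 * a
    -- + 2000`. Half of the credit `4000 * a` becomes the credit of the new layer and the other half
    -- pays for the split; the rounding is covered by the `4000` per level.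
    have hcost : 2000 * (a + #(s.F i)) + 1500 + T ≤ costBelow s.F (suppDigit s.x) (i + 1) := by
      simp only [costBelow, sum_range_succ, hT]
      omega
    refine Runs.of_small fun hσ => ?_
    refine (Runs.loop_step (T := 4 + ((2000 * (a + #(s.F i)) + 200) + (4 + T))) hB2 (by decide)
      (by simp [h60]) (Runs.assoc_symm (Runs.quick_seq hB2 4 (by rfl) ?_))).mono_time
      (by simp only [Expr.time]; omega)
    simp only [Cmd.wp, val_zero, val_reg, h60]
    refine ⟨by omega, Runs.assoc_symm (Runs.call_seq (split_runs (E₀ := E₀) (J := i) (side := side)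
      (S := suppDigit s.x) hB (by omega) (hc.setArr _ _ _)
      (by simpa using h60) (hg.congr fun a h2 h7 => ?_) (hS.congr fun a h2 h7 => ?_) hF
      (fun u v h => hside u v ?_) (fun u v h => hne u v (hFG _ _ h)) hM hd (hs.congr ?_))
      fun ρ hρ ⟨⟨E₁, E₂, k1, k2, k3⟩, k4⟩ => ?_)⟩
    · rw [arr_setArr, if_neg (by omega)]
    · rw [arr_setArr, if_neg (by omega)]
    · rw [← G.mem_edgeSet]
      rcases mem_union.1 h with h | h
      · exact hSG _ _ h
      · exact hFG _ _ h
    · simp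
    have r60 : ρ.reg 60 = i + 1 := by rw [k4.1 60 (by norm_num)]; simpa using h60
    have hiB : i + 1 < B := h60 ▸ hσ.1 60
    refine Runs.quick_seq hB2 4 (by rfl) ?_
    simp only [Cmd.wp, val_sub, val_one, val_reg, r60, Nat.add_sub_cancel]
    refine ⟨by omega, ?_⟩
    have hE₁ : E₁ ⊆ suppDigit s.x (i + 1) ∪ s.F (i + 1) := by
      intro e he
      have h1 : e ∈ E₁.val + E₂.val := Multiset.mem_add.2 (Or.inl he)
      rw [← k1.1, Multiset.mem_add] at h1
      exact mem_union.2 h1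
    have hcard : #E₁ = (a + 1) / 2 := k1.2.1
    have hsubG : ∀ e ∈ E₁, e ∈ G.edgeSet := fun e he => by
      rcases mem_union.1 (hE₁ he) with h | h
      · exact hSG _ _ h
      · exact hFG _ _ h
    set s₁ : AlgState (Fin n) := { s.reload (i + 1) with F := Function.update s.F i E₁ } with hs₁
    have hcnt₁ : ∀ j ≤ L, (ρ.setReg 60 i).arr 12 j = s₁.c j := by
      intro j hj
      rw [arr_setReg, k4.2 12 (by decide)]
      simp only [arr_setArr, reduceIte, hs₁, AlgState.reload, Function.update_apply]
      split_ifs with h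
      · rfl
      · exact hcnt j hj
    have c₁ : Ctx n (L + 1) (ρ.setReg 60 i) :=
      ((hc.setArr _ _ _).frame (by norm_num) k4).setReg (by norm_num)
    have hS₁ : Supps (suppDigit s.x) (ρ.setReg 60 i) := hS.congr fun a h8 h10 => by
      rw [arr_setReg, k4.2 a (by simp; omega), arr_setArr, if_neg (by omega)]
    -- At `i = 0` the induction hypothesis does not apply, as it expects the edges of `F 0` in the
    -- array of mates, where the split has left none.
    rcases Nat.eq_zero_or_pos i with rfl | hi0
    · refine (Runs.loop_exit hB2 (by decide) (by simp) ?_).mono_time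
        (by simp only [Expr.time]; omega)
      refine ⟨s₁.reload 0, ∅, .succ _ _ _ _ _ k1 (.zero _), rfl, by simp [AlgState.reload, hs₁],
        by simp [AlgState.reload], ?_, fun j hj h0 => ?_, ?_, empty_subset _, ?_, by simp, ?_⟩
      · exact k2.congr fun _ _ _ => rfl
      · rw [hcnt₁ j hj]; simp [AlgState.reload, h0]
      · rw [Function.update_self] at k3; exact k3.congr rfl
      · simp only [AlgState.reload, hs₁, Function.update_self]
        omega
      · simpa [AlgState.reload, hs₁] using hsubG
    · have h00 : Function.update s.F i E₁ 0 = s.F 0 := Function.update_of_ne hi0.ne _ _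
      have h01 : Function.update s.F i ∅ 0 = s.F 0 := Function.update_of_ne hi0.ne _ _
      rw [h01] at k3
      have := ih (by omega) s₁ (ρ.setReg 60 i) c₁ (by simp) (k2.congr fun _ _ _ => rfl) hS₁
        (by simp only [hs₁]; rwa [Function.update_of_ne (by omega)]) hSG (fun j e he => ?_)
        (by simp only [hs₁, h00]; exact hM) (by simp only [hs₁, h00]; exact hd)
        (by simp only [hs₁, h00]; exact k3.congr rfl) hcnt₁
      · simp only [hs₁, AlgState.reload, hTcost E₁ hcard] at this
        refine this.mono le_rfl fun ρ' _ ⟨s', Y, m1, m2, m3, m4, m5, m6, m7, m8, m9, m10⟩ =>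
          ⟨s', Y, .succ _ _ _ _ _ k1 m1, m2, m3, m4, m5, m6, m7, m8, by omega, m10⟩
      · simp only [hs₁, Function.update_apply] at he
        split_ifs at he
        · exact hsubG e he
        · exact hFG j e he

/-- Store the edge between the vertices in registers `21` and `22` in the array of mates. -/
def writeMates : Cmd := block [.store 1 (R 21) (R 22 + 1), .store 1 (R 22) (R 21 + 1)]

theorem forEach_writeMates_runs {B n HL a : ℕ} {A M₁ : Finset (Sym2 (Fin n))} {σ : Config}
    (ha : a ≠ 1 ∧ a + 1 ≠ 1) (hB : Room B n HL) (hc : Ctx n HL σ)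
    (hl : Lists A (σ.arr a (σ.reg 60)) fun k => σ.arr (a + 1) (σ.reg 60 * (n * n) + k))
    (hs : Stores σ M₁) (hM : IsMatching (M₁ ∪ A)) (hne : ∀ u v, s(u, v) ∈ A → u ≠ v) :
    Runs B (forEach a 60 writeMates) σ (80 * #A + 20) fun ρ => Stores ρ (M₁ ∪ A) ∧
      Frame 51 [1] σ ρ := by
  have hB2 := hB.two_le
  have hB1 := hB.1
  refine Runs.frame 51 _ ?_ (by rfl) (by rfl)
  refine (forEach_runs (T := 20) hB hl (by rw [hl.1]; exact card_le_sq _) (by rfl)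
    (fun E ρ => Stores ρ (M₁ ∪ E) ∧ Ctx n HL ρ ∧ ρ.reg 60 = σ.reg 60 ∧
      ∀ b, b ≠ 1 → ρ.arr b = σ.arr b) ?_ ?_ ?_ ⟨by simpa using hs, hc, rfl, fun _ _ => rfl⟩).mono
    (by omega) fun ρ _ h => h.1
  · rintro E ρ τ ⟨h1, h2, h3, h4⟩ ha hr
    exact ⟨h1.congr (by rw [ha]), ⟨by rw [hr] <;> simp [h2.n_eq], by rw [hr] <;> simp [h2.N_eq],
      by rw [hr] <;> simp [h2.H_eq]⟩, by rw [hr] <;> simp [h3], by rw [ha]; exact h4⟩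
  · rintro E ρ ⟨h1, h2, h3, h4⟩
    refine ⟨h2, by rw [h3, h4 _ ha.1], fun k _ => by rw [h3, h4 _ ha.2]⟩
  · rintro E e ρ u v hEA he heE ⟨h1, h2, h3, h4⟩ rfl hu hv - hρ
    have hu2 := u.2
    have hv2 := v.2
    have hnn : n ≤ n * n := Nat.le_mul_self n
    refine Runs.of_quick hB2 20 (by rfl) ?_
    simp only [writeMates, block, Cmd.wp, val_reg, val_add, val_one, reg_setArr, hu, hv]
    refine ⟨by omega, by omega, ?_, (h2.setArr _ _ _).setArr _ _ _, h3, fun b hb => ?_⟩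
    · rw [union_insert]
      refine h1.insert (hM.mono ?_) (hne u v he)
      rw [← union_insert]
      exact union_subset_union_right (insert_subset he hEA)
    · rw [arr_setArr, if_neg hb, arr_setArr, if_neg hb, h4 b hb]

/-- `rebuild(i)`, where `i` is in register `60`. -/
def rebuild : Cmd := .seq splitAll (.seq (.store 12 0 0)
  (.seq (forEach 5 60 writeMates) (forEach 8 60 writeMates)))

/-- The stored edges `E₀ ∪ Y` belong to the new output, so it suffices to write the edges of `F 0`
and `suppDigit s.x 0`. All sets that occur on the way are subsets of the final matching, which
`hfin` supplies from the invariant of the abstract algorithm. -/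
theorem rebuild_runs {B n L i : ℕ} {G : SimpleGraph (Fin n)} {side : Fin n → Bool}
    (hB : Room B n (L + 1)) (hside : ∀ u v, G.Adj u v → side u ≠ side v)
    {E₀ : Finset (Sym2 (Fin n))} (hi : i ≤ L) {s : AlgState (Fin n)} {σ : Config}
    (hc : Ctx n (L + 1) σ) (h60 : σ.reg 60 = i) (hg : Graphs s.F σ) (hS : Supps (suppDigit s.x) σ)
    (hF : s.F (L + 1) = ∅) (hSG : ∀ j, ∀ e ∈ suppDigit s.x j, e ∈ G.edgeSet)
    (hFG : ∀ j, ∀ e ∈ s.F j, e ∈ G.edgeSet) (hM : IsMatching (E₀ ∪ s.F 0))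
    (hd : Disjoint E₀ (s.F 0)) (hs : Stores σ (E₀ ∪ s.F 0)) (hcnt : ∀ j ≤ L, σ.arr 12 j = s.c j)
    (hE₀ : E₀ ⊆ suppDigit s.x 0) (hfin : ∀ s', Rebuild i s s' → IsMatching s'.M) :
    Runs B rebuild σ (2 * costBelow s.F (suppDigit s.x) i + 80 * #(suppDigit s.x 0) + 50) fun ρ =>
      (∃ s', Rebuild i s s' ∧ Graphs s'.F ρ ∧ s'.x = s.x ∧ (∀ j ≤ L, ρ.arr 12 j = s'.c j) ∧
        Stores ρ s'.M) ∧ Frame 61 [1, 2, 3, 4, 5, 6, 7, 12, 13] σ ρ := by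
  have hB2 := hB.two_le
  have hB1 := hB.1
  have hne : ∀ u v, s(u, v) ∈ G.edgeSet → u ≠ v := fun u v h => (G.mem_edgeSet.1 h).ne
  refine Runs.frame 61 _ ?_ (by rfl) (by rfl)
  set T := costBelow s.F (suppDigit s.x) i with hT
  refine Runs.mono_time (T := T + (3 + ((T + 20) + (80 * #(suppDigit s.x 0) + 20)))) ?_ (by omega)
  refine Runs.call_seq (Runs.frame 61 [1, 2, 3, 4, 5, 6, 7, 12, 13] (splitAll_runs (E₀ := E₀) hB
    hside i hi s σ hc h60 hg hS hF hSG hFG hM hd hs hcnt) (by rfl) (by rfl))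
    fun ρ hρ ⟨⟨s', Y, m1, m2, m3, m4, m5, m6, m7, m8, m9, m10, m11⟩, hf⟩ => ?_
  refine Runs.quick_seq hB2 3 (by rfl) ?_
  simp only [Cmd.wp, val_zero]
  refine ⟨by omega, ?_⟩
  set ρ₁ := ρ.setArr 12 0 0 with hρ₁
  have c₁ : Ctx n (L + 1) ρ₁ := (hc.frame (by norm_num) hf).setArr _ _ _
  have hm := hfin s' m1
  have hM' : s'.M = suppDigit s.x 0 ∪ s'.F 0 := by rw [AlgState.M, m3]
  rw [hM'] at hm
  have g₁ : Graphs s'.F ρ₁ := m5.congr fun a h2 h7 => by rw [hρ₁, arr_setArr, if_neg (by omega)]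
  have S₁ : Supps (suppDigit s.x) ρ₁ := hS.congr fun a h8 h10 => by
    rw [hρ₁, arr_setArr, if_neg (by omega), hf.2 a (by simp; omega)]
  have hs₁ : Stores ρ₁ (E₀ ∪ Y) := m7.congr (by rw [hρ₁]; simp)
  refine Runs.call_seq ((forEach_writeMates_runs (A := s'.F 0) (M₁ := E₀ ∪ Y) (by norm_num) hB c₁ ?_
    hs₁ (hm.mono ?_) fun u v h => hne u v (m11 _ h)).mono_time ?_) fun ρ₂ hρ₂ ⟨s₂, f₂⟩ => ?_
  · have := g₁.2.lists 0
    rw [show ρ₁.reg 60 = 0 from m10]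
    exact this
  · refine union_subset (union_subset (hE₀.trans subset_union_left)
      (m8.trans subset_union_right)) subset_union_right
  · omega
  refine (forEach_writeMates_runs (A := suppDigit s.x 0) (M₁ := E₀ ∪ Y ∪ s'.F 0) (by norm_num) hB
    (c₁.frame (by norm_num) f₂) ?_ s₂ (hm.mono ?_) fun u v h => hne u v (hSG _ _ h)).mono le_rfl
    fun ρ₃ hρ₃ ⟨s₃, f₃⟩ => ⟨s', m1, ?_, m2, ?_, ?_⟩
  · have := S₁.lists 0
    rw [show ρ₂.reg 60 = 0 from (f₂.1 60 (by norm_num)).trans m10, f₂.2 8 (by decide),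
      f₂.2 9 (by decide)]
    exact this
  · refine union_subset (union_subset (union_subset (hE₀.trans subset_union_left)
      (m8.trans subset_union_right)) subset_union_right) subset_union_left
  · exact g₁.congr fun a h2 h7 => by rw [f₃.2 a (by simp; omega), f₂.2 a (by simp; omega)]
  · intro j hj
    rw [f₃.2 12 (by decide), f₂.2 12 (by decide), hρ₁]
    simp only [arr_setArr, reduceIte, Function.update_apply]
    split_ifs with h
    · rw [h, m4]
    · exact m6 j hj h
  · rw [hM']
    convert s₃ using 1
    ext e
    have := @hE₀ e
    have := @m8 e
    simp only [mem_union]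
    tauto

/-! ### Fixed-point values -/

/-- The vector with the fixed-point values `X`. -/
noncomputable def ofFix {V : Type*} (L : ℕ) (X : Sym2 V → ℕ) : Sym2 V → ℝ := fun e => X e / 2 ^ L

theorem digit_ofFix {V : Type*} {L j : ℕ} (hj : j ≤ L) (X : Sym2 V → ℕ) (e : Sym2 V) :
    digit (ofFix L X e) j = X e / 2 ^ (L - j) % 2 := by
  have h : (2 : ℝ) ^ j * (X e / 2 ^ L) = ((X e : ℕ) : ℝ) / ((2 ^ (L - j) : ℕ) : ℝ) := by
    obtain ⟨k, rfl⟩ := Nat.exists_eq_add_of_le hj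
    rw [Nat.add_sub_cancel_left, pow_add]
    push_cast
    field_simp
  rw [digit, ofFix, h, Nat.floor_div_eq_div]

theorem digit_ofFix_of_lt {V : Type*} {L j : ℕ} (hj : L < j) (X : Sym2 V → ℕ) (e : Sym2 V) :
    digit (ofFix L X e) j = 0 := by
  obtain ⟨k, rfl⟩ := Nat.exists_eq_add_of_lt hj
  have h : (2 : ℝ) ^ (L + k + 1) * (X e / 2 ^ L) = ((2 ^ k * X e * 2 : ℕ) : ℝ) := by
    push_cast
    rw [pow_succ, pow_add]
    field_simp
  rw [digit, ofFix, h, Nat.floor_natCast, Nat.mul_mod_left]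

theorem ofFix_update {V : Type*} [DecidableEq V] (L : ℕ) (X : Sym2 V → ℕ) (e : Sym2 V) (f : ℕ) :
    ofFix L (Function.update X e f) = Function.update (ofFix L X) e (f / 2 ^ L) := by
  ext e'
  simp only [ofFix, Function.update_apply]
  split_ifs <;> rfl

theorem RunsIn.loop_step {B : ℕ} (hB : 2 ≤ B) {p : Expr} (hp : p.deg ≤ 16) {c : Cmd} {σ : Config}
    {Q : ℕ → Config → Prop} (hv : p.val σ ≠ 0)
    (h : RunsIn B c σ fun t ρ => RunsIn B (.loop p c) ρ fun t' ρ' => Q (p.time + 1 + t + t') ρ') :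
    RunsIn B (.loop p c) σ Q := by
  intro hσ
  obtain ⟨t, ρ, h1, h2, h3⟩ := h hσ
  obtain ⟨t', ρ', h1', h2', h3'⟩ := h3 h2
  exact ⟨_, ρ', fun w hw => .loopTrue _ _ _ _ _ _ _ _ (p.eval_eq hσ hB hp hw) hv (h1 w hw)
    (h1' w hw), h2', h3'⟩

theorem RunsIn.loop_exit {B : ℕ} (hB : 2 ≤ B) {p : Expr} (hp : p.deg ≤ 16) {c : Cmd} {σ : Config}
    {Q : ℕ → Config → Prop} (hv : p.val σ = 0) (h : Q (p.time + 1) σ) : RunsIn B (.loop p c) σ Q :=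
  fun hσ => ⟨_, σ, fun w hw => .loopFalse _ _ _ (by rw [p.eval_eq hσ hB hp hw, hv]), hσ, h⟩

/-! ### Changing a value in memory -/

/-- Bring the digit number (register `42`) of the edge in register `38` up to date, where the values
before and after are in registers `41` and `40`. -/
def setDigit : Cmd := .seq (block [.assign 44 (.load 14 (R 103 - R 42)),
    .assign 43 (R 40 / R 44 % 2), .assign 45 (R 41 / R 44 % 2), .assign 10 (R 42),
    .assign 11 (R 38), .assign 12 (R 101), .assign 42 (R 42 + 1)])
  (.cond ((R 43).eq (R 45)) .skip (.cond (R 43) (famIns 8) (famDel 8)))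

/-- Set the value of the edge between the vertices in registers `21` and `22` to the value in
register `40`. -/
def setValue : Cmd := .seq (block [.cond ((R 21).lt (R 22)) (.assign 38 (R 21 * R 100 + R 22))
    (.assign 38 (R 22 * R 100 + R 21)), .assign 41 (.load 11 (R 38)),
    .assign 80 (R 80 + R 40 - R 41), .store 11 (R 38) (R 40), .assign 42 0])
  (.loop ((R 42).lt (R 102)) setDigit)

/-- The values `X`, their sum and their digits are in memory. -/
structure Values {n : ℕ} (L : ℕ) (X : Sym2 (Fin n) → ℕ) (σ : Config) : Prop where
  supps : Supps (suppDigit (ofFix L X)) σ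
  vals : ∀ e, σ.arr 11 (eid e) = X e
  sum : σ.reg 80 = ∑ e, X e
  pow : ∀ i ≤ L, σ.arr 14 i = 2 ^ i
  L_eq : σ.reg 103 = L

theorem mem_suppDigit_ofFix {n L j : ℕ} (hj : j ≤ L) (X : Sym2 (Fin n) → ℕ) (e : Sym2 (Fin n)) :
    e ∈ suppDigit (ofFix L X) j ↔ X e / 2 ^ (L - j) % 2 = 1 := by
  rw [mem_suppDigit, digit_ofFix hj]

theorem suppDigit_ofFix_of_lt {n L j : ℕ} (hj : L < j) (X : Sym2 (Fin n) → ℕ) :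
    suppDigit (ofFix L X) j = ∅ := by
  rw [eq_empty_iff_forall_notMem]
  intro e
  rw [mem_suppDigit, digit_ofFix_of_lt hj]
  norm_num

theorem setDigit_runs {B n L j f x : ℕ} {S : ℕ → Finset (Sym2 (Fin n))} {e : Sym2 (Fin n)}
    {σ : Config} (hB : Room B n (L + 1)) (hc : Ctx n (L + 1) σ) (hS : Supps S σ) (hj : j ≤ L)
    (hpow : ∀ i ≤ L, σ.arr 14 i = 2 ^ i) (h103 : σ.reg 103 = L) (h42 : σ.reg 42 = j)
    (h38 : σ.reg 38 = eid e) (h40 : σ.reg 40 = f) (h41 : σ.reg 41 = x)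
    (hold : e ∈ S j ↔ x / 2 ^ (L - j) % 2 = 1) :
    Runs B setDigit σ 150 fun ρ => (Supps (Function.update S j
      (if f / 2 ^ (L - j) % 2 = 1 then insert e (S j) else (S j).erase e)) ρ ∧ ρ.reg 42 = j + 1 ∧
      ∀ r, 20 ≤ r → r ≠ 42 → r ≠ 43 → r ≠ 44 → r ≠ 45 → ρ.reg r = σ.reg r) ∧
      Frame 46 [8, 9, 10] σ ρ := by
  have hB2 := hB.two_le
  have hB1 := hB.1
  refine Runs.frame 46 _ (Runs.of_small fun hσ => ?_) (by rfl) (by rfl)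
  have hLB : L < B := h103 ▸ hσ.1 103
  have hLB' : L + 1 < B := hc.H_eq ▸ hσ.1 102
  have hpB : 2 ^ (L - j) < B := hpow (L - j) (by omega) ▸ hσ.2 14 (L - j)
  have hid := eid_lt e
  set d := 2 ^ (L - j) with hd
  refine Runs.mono_time (T := 50 + (3 + 1 + (1 + 1 + 80))) ?_ (by omega)
  refine Runs.quick_seq hB2 50 (by rfl) ?_
  simp only [block, Cmd.wp, val_load, val_sub, val_add, val_div, val_mod, val_reg, val_two, val_one,
    reg_setReg, h103, h42, h38, h40, h41, hc.N_eq, hpow (L - j) (by omega), ← hd,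
    reduceIte, Nat.reduceEqDiff, if_false]
  refine ⟨by omega, by omega, by omega, by omega, by omega, by omega, by omega, ?_⟩
  have heid : ∀ f' : Sym2 (Fin n), eid f' = eid e ↔ f' = e :=
    fun f' => ⟨fun h => eid_injective h, fun h => by rw [h]⟩
  have hupd : ∀ Y, Y = S j → Function.update S j Y = S := fun Y h => by simp [h]
  refine Runs.cond (T := 1 + 1 + 80) hB2 (by decide) (fun h1 => ?_) fun h1 => ?_
  · refine (Runs.skip ?_).mono_time (by norm_num)
    simp only [val_eq, val_reg, reg_setReg, reduceIte, Nat.reduceEqDiff, if_false, ne_eq,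
      ite_eq_right_iff, one_ne_zero, imp_false, not_not] at h1
    refine ⟨?_, by simp, fun r _ h2 h3 h4 h5 => ?_⟩
    · have : (if f / d % 2 = 1 then insert e (S j) else (S j).erase e) = S j := by
        rw [h1]
        split_ifs with h
        · exact insert_eq_of_mem (hold.2 h)
        · exact erase_eq_of_notMem fun h' => h (hold.1 h')
      rw [hupd _ this]
      exact hS.congr fun _ _ _ => rfl
    · simp only [reg_setReg]
      rw [if_neg h2, if_neg (by omega), if_neg (by omega), if_neg (by omega), if_neg h5, if_neg h3,
        if_neg h4]
  · simp only [val_eq, val_reg, reg_setReg, reduceIte, Nat.reduceEqDiff, if_false,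
      ite_eq_right_iff, one_ne_zero, imp_false] at h1
    refine Runs.cond (T := 80) hB2 (by decide) (fun h2 => ?_) fun h2 => ?_
    · simp only [val_reg, reg_setReg, reduceIte, Nat.reduceEqDiff, if_false] at h2
      have hf1 : f / d % 2 = 1 := by omega
      have hnm : e ∉ S j := fun h => by rw [hold] at h; omega
      refine (famIns_runs (a := 8) (r := j) (x := eid e) (N := n * n)
        (mem := fun j x => ∃ e ∈ S j, eid e = x) (by omega) ?_ ?_ ?_ ?_ hid
        (by rw [eid_mem]; exact hnm)).mono (by norm_num) fun ρ _ ⟨⟨k1, _⟩, k2⟩ => ⟨?_, ?_, ?_⟩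
      · exact hS.congr fun _ _ _ => rfl
      · simp
      · simp
      · simp
      · refine FamRep.congr k1 fun r y => ?_
        rw [if_pos hf1, Function.update_apply]
        split_ifs with h
        · subst h
          simp only [mem_insert, exists_eq_or_imp, true_and]
          rw [or_comm, eq_comm (a := y)]
        · simp [h]
      · rw [k2.1 42 (by norm_num)]; simp
      · intro r h0 h2 h3 h4 h5
        rw [k2.1 r h0]
        simp only [reg_setReg]
        rw [if_neg h2, if_neg (by omega), if_neg (by omega), if_neg (by omega), if_neg h5,
          if_neg h3, if_neg h4]
    · simp only [val_reg, reg_setReg, reduceIte, Nat.reduceEqDiff, if_false] at h2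
      have hf1 : ¬ f / d % 2 = 1 := by omega
      have hnm : e ∈ S j := by rw [hold]; omega
      refine (famDel_runs (a := 8) (r := j) (x := eid e) (N := n * n)
        (mem := fun j x => ∃ e ∈ S j, eid e = x) (by omega) ?_ ?_ ?_ ?_
        (by rw [eid_mem]; exact hnm)).mono (by norm_num) fun ρ _ ⟨⟨k1, _⟩, k2⟩ => ⟨?_, ?_, ?_⟩
      · exact hS.congr fun _ _ _ => rfl
      · simp
      · simp
      · simp
      · refine FamRep.congr k1 fun r y => ?_
        rw [if_neg hf1, Function.update_apply]
        split_ifs with h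
        · subst h
          simp only [mem_erase, true_and]
          constructor
          · rintro ⟨f', ⟨h3, h4⟩, rfl⟩
            exact ⟨⟨f', h4, rfl⟩, fun h5 => h3 ((heid f').1 h5)⟩
          · rintro ⟨⟨f', h4, rfl⟩, h5⟩
            exact ⟨f', ⟨fun h3 => h5 ((heid f').2 h3), h4⟩, rfl⟩
        · simp [h]
      · rw [k2.1 42 (by norm_num)]; simp
      · intro r h0 h2 h3 h4 h5
        rw [k2.1 r h0]
        simp only [reg_setReg]
        rw [if_neg h2, if_neg (by omega), if_neg (by omega), if_neg (by omega), if_neg h5,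
          if_neg h3, if_neg h4]

theorem setValue_runs {B n L f : ℕ} {X : Sym2 (Fin n) → ℕ} {u v : Fin n} {σ : Config}
    (hB : Room B n (L + 1)) (hc : Ctx n (L + 1) σ) (h : Values L X σ) (hu : σ.reg 21 = u)
    (hv : σ.reg 22 = v) (h40 : σ.reg 40 = f)
    (hsum : ∑ e, Function.update X s(u, v) f e < B) :
    Runs B setValue σ (200 * (L + 1) + 60) fun ρ =>
      (Values L (Function.update X s(u, v) f) ρ ∧ ρ.reg 21 = u ∧ ρ.reg 22 = v) ∧
      Frame 81 [8, 9, 10, 11] σ ρ := by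
  have hB2 := hB.two_le
  have hB1 := hB.1
  refine Runs.frame 81 _ (Runs.of_small fun hσ => ?_) (by rfl) (by rfl)
  set e : Sym2 (Fin n) := s(u, v) with he
  have hid := eid_lt e
  have hfB : f < B := h40 ▸ hσ.1 40
  have hXB : X e < B := h.vals e ▸ hσ.2 11 _
  have hsum' : ∑ e', X e' + f - X e = ∑ e', Function.update X e f e' := by
    rw [sum_update_of_mem (mem_univ e), ← add_sum_erase univ X (mem_univ e), sdiff_singleton_eq_erase]
    omega
  have heid : ∀ f' : Sym2 (Fin n), eid f' = eid e ↔ f' = e :=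
    fun f' => ⟨fun h => eid_injective h, fun h => by rw [h]⟩
  -- After `k` rounds the digits below `k` belong to the new vector and the others to the old one.
  set S : ℕ → ℕ → Finset (Sym2 (Fin n)) := fun k j =>
    if j < k then suppDigit (ofFix L (Function.update X e f)) j else suppDigit (ofFix L X) j with hS
  set goal : Config → Prop := fun ρ => Ctx n (L + 1) ρ ∧ ρ.reg 21 = u ∧ ρ.reg 22 = v ∧
    ρ.reg 38 = eid e ∧ ρ.reg 40 = f ∧ ρ.reg 41 = X e ∧ (∀ i ≤ L, ρ.arr 14 i = 2 ^ i) ∧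
    ρ.reg 103 = L ∧ (∀ e', ρ.arr 11 (eid e') = Function.update X e f e') ∧
    ρ.reg 80 = ∑ e', Function.update X e f e' with hgoal
  have main : ∀ ρ, goal ρ → Supps (S 0) ρ → ρ.reg 42 = 0 →
      Runs B (.loop ((R 42).lt (R 102)) setDigit) ρ (200 * (L + 1) + 10) fun ρ =>
      Values L (Function.update X s(u, v) f) ρ ∧ ρ.reg 21 = u ∧ ρ.reg 22 = v := by
    intro ρ hg hS0 h42
    refine Runs.loop hB2 (by decide) (fun b ρ => ∃ k, k ≤ L + 1 ∧ goal ρ ∧ Supps (S k) ρ ∧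
      ρ.reg 42 = k ∧ b = 200 * (L + 1 - k) + 10) ?_ ?_ ⟨0, by omega, hg, hS0, h42, by omega⟩
    · rintro τ b ⟨k, hk, ⟨g1, g2, g3, g4, g5, g6, g7, g8, g9, g10⟩, hSk, h42, rfl⟩ hτ hval
      have hkL : k ≤ L := by
        by_contra hlt
        have : ¬ k < L + 1 := by omega
        simp [h42, g1.H_eq, this] at hval
      refine ⟨150, (setDigit_runs (j := k) hB g1 hSk hkL g7 g8 h42 g4 g5 g6 ?_).mono le_rfl
        fun τ' hτ' ⟨⟨k1, k2, k3⟩, k4⟩ => ⟨200 * (L + 1 - (k + 1)) + 10, ?_, k + 1, by omega,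
          ⟨g1.frame (by norm_num) k4, ?_, ?_, ?_, ?_, ?_, ?_, ?_, ?_, ?_⟩, ?_, k2, rfl⟩⟩
      · simp only [hS, lt_irrefl, if_false]
        rw [mem_suppDigit_ofFix hkL]
      · have : ((R 42).lt (R 102)).time = 3 := rfl
        omega
      · rw [k3 21] <;> simp [g2]
      · rw [k3 22] <;> simp [g3]
      · rw [k3 38] <;> simp [g4]
      · rw [k3 40] <;> simp [g5]
      · rw [k3 41] <;> simp [g6]
      · rw [k4.2 14 (by decide)]; exact g7
      · rw [k3 103] <;> simp [g8]
      · rw [k4.2 11 (by decide)]; exact g9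
      · rw [k3 80] <;> simp [g10]
      · have : S (k + 1) = Function.update (S k) k (if f / 2 ^ (L - k) % 2 = 1 then
            insert e (S k k) else (S k k).erase e) := by
          ext j e'
          rw [Function.update_apply]
          by_cases hjk : j = k
          · subst hjk
            simp only [hS, Nat.lt_succ_self, if_true, lt_irrefl, if_false]
            rw [mem_suppDigit_ofFix hkL, Function.update_apply]
            by_cases hee : e' = e
            · subst hee
              simp only [if_true]
              split_ifs with h1 <;> simp [h1]
            · rw [if_neg hee, ← mem_suppDigit_ofFix hkL]
              split_ifs <;> simp [hee]
          · rw [if_neg hjk]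
            have hiff : j < k + 1 ↔ j < k := by omega
            simp only [hS, hiff]
        rw [this]; exact k1
    · rintro τ b ⟨k, hk, ⟨g1, g2, g3, g4, g5, g6, g7, g8, g9, g10⟩, hSk, h42, rfl⟩ hτ hval
      have hkL : k = L + 1 := by
        by_contra hlt
        have : k < L + 1 := by omega
        simp [h42, g1.H_eq, this] at hval
      subst hkL
      have : ((R 42).lt (R 102)).time = 3 := rfl
      refine ⟨by omega, ⟨?_, g9, g10, g7, g8⟩, g2, g3⟩
      have : S (L + 1) = suppDigit (ofFix L (Function.update X e f)) := by
        ext j e'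
        simp only [hS]
        split_ifs with h1
        · rfl
        · rw [suppDigit_ofFix_of_lt (by omega), suppDigit_ofFix_of_lt (by omega)]
      rwa [this] at hSk
  refine Runs.mono_time (T := 50 + (200 * (L + 1) + 10)) ?_ (by omega)
  refine Runs.quick_seq hB2 50 (by rfl) ?_
  have hS0 : S 0 = suppDigit (ofFix L X) := by ext j e'; simp [hS]
  have step : ∀ τ : Config, τ = (((((σ.setReg 38 (eid e)).setReg 41 (X e)).setReg 80
      (∑ e', Function.update X e f e')).setArr 11 (eid e) f).setReg 42 0) →
      Runs B (.loop ((R 42).lt (R 102)) setDigit) τ (200 * (L + 1) + 10) fun ρ =>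
      Values L (Function.update X s(u, v) f) ρ ∧ ρ.reg 21 = u ∧ ρ.reg 22 = v := by
    rintro τ rfl
    refine main _ ⟨?_, ?_, ?_, ?_, ?_, ?_, ?_, ?_, ?_, ?_⟩ ?_ (by simp)
    · exact ((((hc.setReg (by norm_num)).setReg (by norm_num)).setReg (by norm_num)).setArr _ _
        _).setReg (by norm_num)
    · simpa using hu
    · simpa using hv
    · simp
    · simpa using h40
    · simp
    · simpa using h.pow
    · simpa using h.L_eq
    · intro e'
      simp only [arr_setReg, arr_setArr, if_true, Function.update_apply, heid]
      split_ifs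
      · rfl
      · exact h.vals e'
    · simp
    · rw [hS0]
      exact h.supps.congr fun a h8 h10 => by
        simp only [arr_setReg, arr_setArr]; rw [if_neg (by omega)]
  simp only [block, Cmd.wp, val_load, val_sub, val_add, val_mul, val_reg, val_zero, val_lt,
    reg_setReg, arr_setReg, hu, hv, hc.n_eq, h40, h.sum,
    reduceIte, Nat.reduceEqDiff, if_false]
  refine ⟨fun hlt => ?_, fun hlt => ?_⟩
  · have hlt' : (u : ℕ) < v := by by_contra h0; simp [h0] at hlt
    have hide : (u : ℕ) * n + v = eid e := by rw [he, eid_mk, if_pos hlt']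
    rw [hide, h.vals, hsum']
    exact ⟨by omega, hXB, hsum, hfB, by omega, step _ rfl⟩
  · have hlt' : ¬ (u : ℕ) < v := by by_contra h0; simp [h0] at hlt
    have hide : (v : ℕ) * n + u = eid e := by rw [he, eid_mk, if_neg hlt']
    rw [hide, h.vals, hsum']
    exact ⟨by omega, hXB, hsum, hfB, by omega, step _ rfl⟩

/-! ### Removing edges in memory -/

/-- Remove an edge at the vertex in register `r` from the layer below the one in register `72`. -/
def removeAt (r : ℕ) : Cmd := .seq (block [.assign 20 (R 72 - 1), .assign 21 (R r)])
  (.cond (.load 2 (R 20 * R 100 + R 21))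
    (.seq (.assign 22 (.load 3 ((R 20 * R 100 + R 21) * R 100))) gDelM) .skip)

theorem removeAt_runs {B n HL J r : ℕ} {F : ℕ → Finset (Sym2 (Fin n))}
    {E₀ : Finset (Sym2 (Fin n))} {σ : Config} {u : Fin n} (hB : Room B n HL) (hJ : J ≤ HL)
    (hc : Ctx n HL σ) (h : Graphs F σ) (h72 : σ.reg 72 = J + 1) (hr : 23 ≤ r) (hu : σ.reg r = u)
    (hne : ∀ u v, s(u, v) ∈ F J → u ≠ v) (hM : IsMatching (E₀ ∪ F 0)) (hd : Disjoint E₀ (F 0))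
    (hs : Stores σ (E₀ ∪ F 0)) :
    Runs B (removeAt r) σ 400 fun ρ => (∃ F', RemoveAt u (F J) F' ∧
      Graphs (Function.update F J F') ρ ∧ Stores ρ (E₀ ∪ Function.update F J F' 0)) ∧
      Frame 23 [1, 2, 3, 4, 5, 6, 7] σ ρ := by
  have hB2 := hB.two_le
  have hB1 := hB.1
  refine Runs.frame 23 _ (Runs.of_small fun hσ => ?_) (by rfl) (by rfl)
  have hu2 := u.2
  have hnn : n ≤ n * n := Nat.le_mul_self n
  have hJB : J + 1 < B := h72 ▸ hσ.1 72
  refine Runs.mono_time (T := 20 + (6 + 1 + (10 + 360))) ?_ (by omega)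
  refine Runs.quick_seq hB2 20 (by rfl) ?_
  simp only [block, Cmd.wp, val_sub, val_one, val_reg, reg_setReg, h72, Nat.add_sub_cancel]
  rw [if_neg (by omega), hu]
  refine ⟨by omega, by omega, ?_⟩
  have hdeg := h.deg_eq J u
  have c' : Ctx n HL ((σ.setReg 20 J).setReg 21 u) :=
    (hc.setReg (by norm_num)).setReg (by norm_num)
  refine Runs.cond (T := 10 + 360) hB2 (by decide) (fun h1 => ?_) fun h1 => ?_
  · simp only [val_load, val_add, val_mul, val_reg, reg_setReg, arr_setReg, reduceIte,
      Nat.reduceEqDiff, if_false, hc.n_eq] at h1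
    obtain ⟨w, hw, hwe⟩ := h.neighbor (k := 0) (Nat.pos_of_ne_zero h1)
    rw [add_zero] at hw
    have hw2 := w.2
    refine Runs.quick_seq hB2 10 (by rfl) ?_
    simp only [Cmd.wp, val_load, val_add, val_mul, val_reg, reg_setReg, arr_setReg, reduceIte,
      Nat.reduceEqDiff, if_false, hc.n_eq, hw]
    refine ⟨by omega, (gDelM_runs (E₀ := E₀) (j := J) (u := u) (v := w) (F := F) hB hJ
      (c'.setReg (by norm_num)) (h.congr fun _ _ _ => rfl) ?_ ?_ ?_ (hne u w hwe) hwe hM hd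
      (hs.congr rfl)).mono le_rfl fun ρ _ ⟨⟨k1, k2⟩, _⟩ =>
        ⟨_, Or.inl ⟨s(u, w), hwe, by simp, rfl⟩, k1, k2⟩⟩
    · simp
    · simp
    · simp
  · simp only [val_load, val_add, val_mul, val_reg, reg_setReg, arr_setReg, reduceIte,
      Nat.reduceEqDiff, if_false, hc.n_eq] at h1
    refine (Runs.skip ?_).mono_time (by norm_num)
    refine ⟨F J, Or.inr ⟨fun f hf hmem => ?_, rfl⟩, ?_, ?_⟩
    · rw [hdeg, deg, card_eq_zero, filter_eq_empty_iff] at h1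
      exact h1 hf hmem
    · rw [Function.update_eq_self]; exact h.congr fun _ _ _ => rfl
    · rw [Function.update_eq_self]; exact hs.congr rfl

/-- Remove the edge between the vertices in registers `70` and `71` or edges at its end points from
the layer below the one in register `72`. -/
def remove : Cmd := .seq (block [.assign 20 (R 72 - 1), .assign 21 (R 70), .assign 22 (R 71)])
  (.cond (.load 4 ((R 20 * R 100 + R 21) * R 100 + R 22)) gDelM
    (.seq (removeAt 70) (removeAt 71)))

theorem remove_runs {B n HL J : ℕ} {F : ℕ → Finset (Sym2 (Fin n))}
    {E₀ : Finset (Sym2 (Fin n))} {σ : Config} {u v : Fin n} (hB : Room B n HL) (hJ : J ≤ HL)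
    (hc : Ctx n HL σ) (h : Graphs F σ) (h72 : σ.reg 72 = J + 1) (hu : σ.reg 70 = u)
    (hv : σ.reg 71 = v)
    (hne : ∀ u v, s(u, v) ∈ F J → u ≠ v) (hM : IsMatching (E₀ ∪ F 0)) (hd : Disjoint E₀ (F 0))
    (hs : Stores σ (E₀ ∪ F 0)) :
    Runs B remove σ 900 fun ρ => (∃ F', Remove s(u, v) (F J) F' ∧
      Graphs (Function.update F J F') ρ ∧ Stores ρ (E₀ ∪ Function.update F J F' 0)) ∧
      Frame 23 [1, 2, 3, 4, 5, 6, 7] σ ρ := by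
  have hB2 := hB.two_le
  have hB1 := hB.1
  refine Runs.frame 23 _ (Runs.of_small fun hσ => ?_) (by rfl) (by rfl)
  have hu2 := u.2
  have hv2 := v.2
  have hnn : n ≤ n * n := Nat.le_mul_self n
  have hJB : J + 1 < B := h72 ▸ hσ.1 72
  refine Runs.mono_time (T := 20 + (10 + 1 + (400 + 400))) ?_ (by omega)
  refine Runs.quick_seq hB2 20 (by rfl) ?_
  simp only [block, Cmd.wp, val_sub, val_one, val_reg, reg_setReg, h72, Nat.add_sub_cancel, hu, hv,
    Nat.reduceEqDiff, if_false]
  refine ⟨by omega, by omega, by omega, ?_⟩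
  have hmem := h.mem_iff J u v
  set τ := ((σ.setReg 20 J).setReg 21 u).setReg 22 v with hτ
  have c' : Ctx n HL τ :=
    ((hc.setReg (by norm_num)).setReg (by norm_num)).setReg (by norm_num)
  have g' : Graphs F τ := h.congr fun _ _ _ => rfl
  have s' : Stores τ (E₀ ∪ F 0) := hs.congr rfl
  refine Runs.mono_time (Runs.cond (T := 400 + 400) hB2 ?_ (fun h1 => ?_) fun h1 => ?_) (by decide)
  · decide
  · simp only [val_load, val_add, val_mul, val_reg, hτ, reg_setReg, arr_setReg, reduceIte,
      Nat.reduceEqDiff, if_false, hc.n_eq] at h1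
    have he := hmem.1 h1
    refine (gDelM_runs (E₀ := E₀) (j := J) (u := u) (v := v) (F := F) hB hJ c' g' ?_ ?_ ?_
      (hne u v he) he hM hd s').mono (by norm_num) fun ρ _ ⟨⟨k1, k2⟩, _⟩ =>
        ⟨_, Or.inl ⟨he, rfl⟩, k1, k2⟩
    · simp [hτ]
    · simp [hτ]
    · simp [hτ]
  · simp only [val_load, val_add, val_mul, val_reg, hτ, reg_setReg, arr_setReg, reduceIte,
      Nat.reduceEqDiff, if_false, hc.n_eq] at h1
    have he : s(u, v) ∉ F J := fun h => hmem.2 h h1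
    refine Runs.call_seq (removeAt_runs (E₀ := E₀) (u := u) hB hJ c' g' (by simpa [hτ] using h72)
      (by norm_num) (by simpa [hτ] using hu) hne hM hd s') fun ρ hρ ⟨⟨F₁, k1, k2, k3⟩, k4⟩ => ?_
    have hF₁ : F₁ ⊆ F J := by
      rcases k1 with ⟨f, _, _, rfl⟩ | ⟨_, rfl⟩
      · exact erase_subset _ _
      · exact Subset.rfl
    have hsub := update_zero_subset hF₁
    refine (removeAt_runs (E₀ := E₀) (u := v) (J := J) (F := Function.update F J F₁) hB hJ
      (c'.frame (by norm_num) k4) k2 ?_ (by norm_num) ?_ (fun a b h => hne a b (hF₁ ?_))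
      (hM.mono (union_subset_union_right hsub)) (hd.mono_right hsub) k3).mono le_rfl
      fun ρ' _ ⟨⟨F', m1, m2, m3⟩, _⟩ => ⟨F', Or.inr ⟨he, u, v, F₁, rfl, k1, ?_⟩, ?_, ?_⟩
    · rw [k4.1 72 (by norm_num)]; simpa [hτ] using h72
    · rw [k4.1 71 (by norm_num)]; simpa [hτ] using hv
    · simpa using h
    · simpa using m1
    · simpa using m2
    · simpa using m3

/-! ### The loop of an update in memory -/

section Abstract

variable {V : Type*} [Fintype V] [DecidableEq V]

/-- Unlike `Rebuild.spec`, this needs no hypothesis on the graph or the vector, so the time analysis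
can use it freely. -/
theorem Rebuild.c_eq {i : ℕ} {s s' : AlgState V} (h : Rebuild i s s') :
    (∀ j ≤ i, s'.c j = 0) ∧ ∀ j > i, s'.c j = s.c j := by
  induction h with
  | zero s =>
    refine ⟨fun j hj => ?_, fun j hj => ?_⟩
    · obtain rfl : j = 0 := by omega
      simp [AlgState.reload]
    · simp [AlgState.reload, Function.update_of_ne (show j ≠ 0 by omega)]
  | succ i s s' E₁ E₂ _ h ih =>
    refine ⟨fun j hj => ?_, fun j hj => ?_⟩
    · rcases Nat.lt_or_ge i j with h1 | h1
      · obtain rfl : j = i + 1 := by omega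
        rw [ih.2 _ h1]; simp [AlgState.reload]
      · exact ih.1 j h1
    · rw [ih.2 j (by omega)]
      simp [AlgState.reload, Function.update_of_ne (show j ≠ i + 1 by omega)]

theorem Remove.subset {e : Sym2 V} {F F' : Finset (Sym2 V)} (h : Remove e F F') : F' ⊆ F :=
  h.spec.1.trans (erase_subset _ _)

theorem Visit.spec {e : Sym2 V} {i : ℕ} {s s' : AlgState V} (h : Visit e i s s') :
    s'.x = s.x ∧ (∀ j, s'.F j ⊆ s.F j) ∧ s'.c = Function.update s.c i (s.c i + 1) := by
  cases h with
  | zero => exact ⟨rfl, fun _ => Subset.rfl, rfl⟩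
  | succ j _ F' hr =>
    refine ⟨rfl, fun k => ?_, rfl⟩
    simp only [Function.update_apply]
    split_ifs with h
    · rw [h]; exact hr.subset
    · exact Subset.rfl

theorem costBelow_mono {F F' S : ℕ → Finset (Sym2 V)} (h : ∀ j, F' j ⊆ F j) (i : ℕ) :
    costBelow F' S i ≤ costBelow F S i := by
  have h1 := card_le_card (h i)
  have h2 : ∑ j ∈ range i, (4000 * #(S (j + 1)) + 2000 * #(F' j) + 4000) ≤
      ∑ j ∈ range i, (4000 * #(S (j + 1)) + 2000 * #(F j) + 4000) :=
    sum_le_sum fun j _ => by have := card_le_card (h j); omega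
  unfold costBelow
  omega

theorem total_ofFix (L : ℕ) (X : Sym2 V → ℕ) : total (ofFix L X) = (∑ e, X e : ℕ) / 2 ^ L := by
  simp only [total, ofFix]
  rw [← sum_div]
  push_cast
  rfl

/-- Clearing denominators turns the test into a comparison of integers; the factor `4 * K * L * 2 ^
L` is kept in a register. -/
theorem due_iff {K L i : ℕ} (hK : 1 ≤ K) (hL : 1 ≤ L) {s : AlgState V} {X : Sym2 V → ℕ}
    (hx : s.x = ofFix L X) :
    Due (1 / K) L s i ↔ (∑ e, X e) * 2 ^ i < s.c i * (4 * K * L * 2 ^ L) := by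
  have hK' : (0 : ℝ) < K := by exact_mod_cast hK
  have hL' : (0 : ℝ) < L := by exact_mod_cast hL
  rw [Due, hx, total_ofFix, zpow_sub₀ (by norm_num), zpow_natCast]
  rw [← Nat.cast_lt (α := ℝ)]
  push_cast
  have : (2 : ℝ) ^ i / 2 ^ (2 : ℤ) * (1 / K * ((∑ e, (X e : ℝ)) / 2 ^ L) / L) =
      (∑ e, (X e : ℝ)) * 2 ^ i / (4 * K * L * 2 ^ L) := by
    norm_num
    field_simp
  rw [this, div_lt_iff₀ (by positivity)]

/-- A sweep over the levels from `i` on that takes time `t` either does not rebuild, or the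
drop of the counters pays for the rebuilding. -/
def SweepCost (η : ℝ) (L i : ℕ) (s s' : AlgState V) (t : ℕ) : Prop :=
  ∃ extra drop : ℕ, t ≤ 1100 * (i + 1) + 20 + extra ∧
    ∑ j ∈ range (i + 1), s'.c j + drop ≤ ∑ j ∈ range (i + 1), s.c j + (i + 1) ∧
    (∀ j > i, s'.c j = s.c j) ∧ (extra = 0 ∨ ∃ k ≤ i,
      (2 : ℝ) ^ ((k : ℤ) - 2) * (η * total s.x / L) < drop ∧
      extra ≤ 2 * costBelow s.F (suppDigit s.x) k + 80 * #(suppDigit s.x 0) + 50)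

theorem SweepCost.next {η : ℝ} {L i : ℕ} {e : Sym2 V} {s s₁ s' : AlgState V} {t t' : ℕ}
    (hv : Visit e (i + 1) s s₁) (h : SweepCost η L i s₁ s' t') (ht : t ≤ 1100 + t') :
    SweepCost η L (i + 1) s s' t := by
  obtain ⟨h1, h2, h3⟩ := hv.spec
  obtain ⟨extra, drop, g1, g2, g3, g4⟩ := h
  have e1 : ∑ j ∈ range (i + 1), s₁.c j = ∑ j ∈ range (i + 1), s.c j :=
    sum_congr rfl fun j hj => by rw [h3, Function.update_of_ne (mem_range.1 hj).ne]
  have e2 : s'.c (i + 1) = s.c (i + 1) + 1 := by rw [g3 _ (by omega), h3, Function.update_self]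
  refine ⟨extra, drop, by omega, ?_, fun j hj => ?_, ?_⟩
  · rw [sum_range_succ _ (i + 1), sum_range_succ _ (i + 1), e2]
    omega
  · rw [g3 j (by omega), h3, Function.update_of_ne (by omega)]
  · rcases g4 with g4 | ⟨k, hk, k1, k2⟩
    · exact Or.inl g4
    · refine Or.inr ⟨k, by omega, by rwa [h1] at k1, k2.trans ?_⟩
      rw [h1]
      have := costBelow_mono (S := suppDigit s.x) h2 k
      omega

/-- All counters up to `i` are reset, among them `c i`, which has just passed its threshold. Its
value is the drop that pays for the rebuilding. -/
theorem SweepCost.rebuild {η : ℝ} {L i : ℕ} {e : Sym2 V} {s s₁ s' : AlgState V} {t extra : ℕ}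
    (hv : Visit e i s s₁) (hd : Due η L s₁ i) (hr : Rebuild i s₁ s')
    (he : extra = 2 * costBelow s₁.F (suppDigit s₁.x) i + 80 * #(suppDigit s₁.x 0) + 50)
    (ht : t ≤ 1100 * (i + 1) + 20 + extra) : SweepCost η L i s s' t := by
  obtain ⟨h1, h2, h3⟩ := hv.spec
  obtain ⟨r1, r2⟩ := hr.c_eq
  have e1 : ∑ j ∈ range (i + 1), s'.c j = 0 :=
    sum_eq_zero fun j hj => r1 j (by have := mem_range.1 hj; omega)
  have e2 : s.c i ≤ ∑ j ∈ range (i + 1), s.c j :=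
    single_le_sum (f := s.c) (fun _ _ => Nat.zero_le _) (by simp)
  have e3 : s₁.c i = s.c i + 1 := by rw [h3, Function.update_self]
  refine ⟨extra, s₁.c i, ht, by omega, fun j hj => ?_, Or.inr ⟨i, le_rfl, ?_, ?_⟩⟩
  · rw [r2 j hj, h3, Function.update_of_ne (by omega)]
  · rw [Due, h1] at hd; exact hd
  · rw [he, h1]
    have := costBelow_mono (S := suppDigit s.x) h2 i
    omega

theorem SweepCost.done {η : ℝ} {L : ℕ} {e : Sym2 V} {s s₁ : AlgState V} {t : ℕ}
    (hv : Visit e 0 s s₁) (ht : t ≤ 1100) : SweepCost η L 0 s s₁ t := by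
  obtain ⟨h1, h2, h3⟩ := hv.spec
  refine ⟨0, 0, by omega, ?_, fun j hj => ?_, Or.inl rfl⟩
  · simp [h3]
  · rw [h3, Function.update_of_ne (by omega)]

end Abstract

/-- The state `s` in the course of an update of the edge `s(u, v)` is in memory; `E₀` is the
part of the matching that does not come from the layer `0`. -/
structure SweepMem {n : ℕ} (L K : ℕ) (X : Sym2 (Fin n) → ℕ) (u v : Fin n)
    (E₀ : Finset (Sym2 (Fin n))) (s : AlgState (Fin n)) (σ : Config) : Prop where
  ctx : Ctx n (L + 1) σ
  values : Values L X σ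
  x_eq : s.x = ofFix L X
  graphs : Graphs s.F σ
  counts : ∀ j ≤ L, σ.arr 12 j = s.c j
  mates : Stores σ (E₀ ∪ s.F 0)
  thr : σ.reg 104 = 4 * K * L * 2 ^ L
  fst : σ.reg 70 = u
  snd : σ.reg 71 = v

/-- The state `s` between two operations is in memory. -/
structure Mem {n : ℕ} (L K : ℕ) (X : Sym2 (Fin n) → ℕ) (s : AlgState (Fin n)) (σ : Config) :
    Prop where
  ctx : Ctx n (L + 1) σ
  values : Values L X σ
  x_eq : s.x = ofFix L X
  graphs : Graphs s.F σ
  counts : ∀ j ≤ L, σ.arr 12 j = s.c j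
  mates : Stores σ s.M
  thr : σ.reg 104 = 4 * K * L * 2 ^ L

theorem Values.frame {n L : ℕ} {X : Sym2 (Fin n) → ℕ} {σ ρ : Config} (h : Values L X σ) {b : ℕ}
    {A : List ℕ} (hb : b ≤ 80) (hA : 8 ∉ A ∧ 9 ∉ A ∧ 10 ∉ A ∧ 11 ∉ A ∧ 14 ∉ A)
    (hf : Frame b A σ ρ) : Values L X ρ := by
  obtain ⟨h8, h9, h10, h11, h14⟩ := hA
  refine ⟨h.supps.congr fun a g8 g10 => hf.2 a ?_, ?_, by rw [hf.1 80 hb, h.sum],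
    by rw [hf.2 14 h14]; exact h.pow, by rw [hf.1 103 (by omega), h.L_eq]⟩
  · rcases (by omega : a = 8 ∨ a = 9 ∨ a = 10) with rfl | rfl | rfl <;> assumption
  · rw [hf.2 11 h11]; exact h.vals

/-- The body of the loop at the level in register `72`, without the rebuilding. -/
def visit : Cmd := .seq (.cond (R 72) remove .skip) (.store 12 (R 72) (.load 12 (R 72) + 1))

/-- The sets `E i` are not in memory, so their shrinking has no counterpart in the program; only the
layer below and the counter are written. -/
theorem visit_runs {B n L K i : ℕ} {X : Sym2 (Fin n) → ℕ} {u v : Fin n}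
    {E₀ : Finset (Sym2 (Fin n))} {s : AlgState (Fin n)} {σ : Config} (hB : Room B n (L + 1))
    (hi : i ≤ L) (h : SweepMem L K X u v E₀ s σ) (h72 : σ.reg 72 = i)
    (hne : ∀ j, ∀ u v, s(u, v) ∈ s.F j → u ≠ v) (hM : IsMatching (E₀ ∪ s.F 0))
    (hd : Disjoint E₀ (s.F 0)) (hcB : s.c i + 1 < B) :
    Runs B visit σ 950 fun ρ => (∃ s₁, Visit s(u, v) i s s₁ ∧ SweepMem L K X u v E₀ s₁ ρ) ∧
      Frame 23 [1, 2, 3, 4, 5, 6, 7, 12] σ ρ := by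
  have hB2 := hB.two_le
  refine Runs.frame 23 _ ?_ (by rfl) (by rfl)
  refine Runs.mono_time (T := (1 + 1 + 900) + 10) ?_ (by omega)
  refine Runs.call_seq (P := fun ρ => (∃ F' s₁, Visit s(u, v) i s s₁ ∧ s₁.F = F' ∧
    Graphs F' ρ ∧ Stores ρ (E₀ ∪ F' 0)) ∧ Frame 23 [1, 2, 3, 4, 5, 6, 7] σ ρ)
    (Runs.cond (T := 900) hB2 (by decide) (fun h1 => ?_) fun h1 => ?_)
    fun ρ hρ ⟨⟨F', s₁, k1, k2, k3, k4⟩, hf⟩ => ?_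
  · simp only [val_reg, h72] at h1
    obtain ⟨j, rfl⟩ := Nat.exists_eq_succ_of_ne_zero h1
    refine (remove_runs (E₀ := E₀) (J := j) hB (by omega) h.ctx h.graphs h72 h.fst h.snd (hne j)
      hM hd h.mates).mono le_rfl fun ρ _ ⟨⟨F', k1, k2, k3⟩, k4⟩ =>
        ⟨⟨_, _, Visit.succ j s F' k1, rfl, k2, k3⟩, k4⟩
  · simp only [val_reg, h72] at h1
    subst h1
    exact (Runs.skip ⟨⟨_, _, Visit.zero s, rfl, h.graphs, h.mates⟩, Frame.refl _ _ _⟩).mono_time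
      (by norm_num)
  · obtain ⟨v1, v2, v3⟩ := k1.spec
    subst k2
    refine Runs.of_quick hB2 10 (by rfl) ?_
    have h72' : ρ.reg 72 = i := by rw [hf.1 72 (by norm_num), h72]
    have h12 : ρ.arr 12 = σ.arr 12 := hf.2 12 (by decide)
    simp only [Cmd.wp, val_reg, val_load, val_add, val_one, h72', h12, h.counts i hi]
    refine ⟨hcB, s₁, k1, (h.ctx.frame (by norm_num) hf).setArr _ _ _, ?_, v1.trans h.x_eq,
      k3.congr fun a h2 h7 => ?_, fun j hj => ?_, k4.congr ?_, ?_, ?_, ?_⟩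
    · have := h.values.frame (by norm_num) (by decide) hf
      exact ⟨this.supps.congr fun a h2 h7 => by rw [arr_setArr, if_neg (by omega)],
        by simpa using this.vals, this.sum, by simpa using this.pow, this.L_eq⟩
    · rw [arr_setArr, if_neg (by omega)]
    · simp only [arr_setArr, reduceIte, h12, v3, Function.update_apply]
      split_ifs
      · rfl
      · exact h.counts j hj
    · rw [arr_setArr, if_neg (by norm_num)]
    · exact (hf.1 104 (by norm_num)).trans h.thr
    · exact (hf.1 70 (by norm_num)).trans h.fst
    · exact (hf.1 71 (by norm_num)).trans h.snd

/-- The loop over the levels from the one in register `72` on, which is active as long as register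
`73` is not zero. -/
def sweep : Cmd := .loop (R 73) (.seq visit
  (.cond ((R 80 * .load 14 (R 72)).lt (.load 12 (R 72) * R 104))
    (.seq (.assign 60 (R 72)) (.seq rebuild (.assign 73 0)))
    (.cond (R 72) (.assign 72 (R 72 - 1)) (.assign 73 0))))

/-- The machine removes the updated edge from the stored part of `E 0` before the loop, the abstract
algorithm only at level `0`. The set `E₀` bridges this difference, and until then the sweep does not
read `E 0`. One level is treated in `step`, with the continuation as the hypothesis `hnext`, which
the induction then supplies. -/
theorem sweep_runs {B n L K : ℕ} {G : SimpleGraph (Fin n)} {side : Fin n → Bool}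
    {X : Sym2 (Fin n) → ℕ} {u v : Fin n} {ν : ℝ} {s₀ : AlgState (Fin n)}
    (hB : Room B n (L + 1)) (hside : ∀ u v, G.Adj u v → side u ≠ side v) (hG : G.IsBipartite)
    (hK : 1 ≤ K) (hL : 1 ≤ L) (h0 : Inv (1 / K) L s₀) (hx₀ : IsFractionalMatching G s₀.x)
    (hx : IsFractionalMatching G (Function.update s₀.x s(u, v) ν))
    (hcB : ∀ j ≤ L, s₀.c j + 1 < B) (i : ℕ) (hi : i ≤ L) : ∀ (s : AlgState (Fin n)) (σ : Config),
    SweepMem L K X u v ((s₀.E 0).erase s(u, v)) s σ → σ.reg 72 = i → σ.reg 73 = 1 →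
    Mid (1 / K) L s(u, v) ν s₀ i s → (∀ j, s.F j ⊆ s₀.F j) →
    RunsIn B sweep σ fun t ρ => ∃ s', Sweep (1 / K) L s(u, v) i s s' ∧ Mem L K X s' ρ ∧
      SweepCost (1 / K) L i s s' t := by
  have hB2 := hB.two_le
  set e : Sym2 (Fin n) := s(u, v) with he
  set E₀ := (s₀.E 0).erase e with hE₀
  have hFG₀ : ∀ j, ∀ f ∈ s₀.F j, f ∈ G.edgeSet := fun j f hf => hx₀.supp_subset (h0.F_supp j hf)
  obtain ⟨hm1, hm2⟩ := h0.matching hx₀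
  have hE₀s : E₀ ⊆ s₀.E 0 := erase_subset _ _
  have step : ∀ (i : ℕ), i ≤ L → ∀ (s : AlgState (Fin n)) (σ : Config),
      SweepMem L K X u v E₀ s σ → σ.reg 72 = i → σ.reg 73 = 1 →
      Mid (1 / K) L e ν s₀ i s → (∀ j, s.F j ⊆ s₀.F j) →
      (∀ s₁ σ₁, Visit e i s s₁ → ¬ Due (1 / K) L s₁ i → i ≠ 0 → SweepMem L K X u v E₀ s₁ σ₁ →
        σ₁.reg 72 = i - 1 → σ₁.reg 73 = 1 → (∀ j, s₁.F j ⊆ s₀.F j) →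
        RunsIn B sweep σ₁ fun t ρ => ∃ s', Sweep (1 / K) L e i s s' ∧ Mem L K X s' ρ ∧
          ∀ t', t' ≤ 1100 + t → SweepCost (1 / K) L i s s' t') →
      RunsIn B sweep σ fun t ρ => ∃ s', Sweep (1 / K) L e i s s' ∧ Mem L K X s' ρ ∧
        SweepCost (1 / K) L i s s' t := by
    intro i hi s σ h h72 h73 hmid hFs hnext
    have hFG : ∀ j, ∀ f ∈ s.F j, f ∈ G.edgeSet := fun j f hf => hFG₀ j f (hFs j hf)
    have hMs : IsMatching (E₀ ∪ s.F 0) := hm1.mono (union_subset_union hE₀s (hFs 0))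
    have hds : Disjoint E₀ (s.F 0) := hm2.mono hE₀s (hFs 0)
    have hxs : IsFractionalMatching G s.x := by rw [hmid.x_eq]; exact hx
    refine RunsIn.loop_step hB2 (by decide) (by simp [h73]) (RunsIn.seq
      (visit_runs hB hi h h72 (fun j a b hab => (G.mem_edgeSet.1 (hFG j _ hab)).ne) hMs hds
        (by rw [hmid.c_low i le_rfl]; exact hcB i hi)).runsIn
      fun t₁ ρ₁ hρ₁ ⟨ht₁, ⟨s₁, hv, h₁⟩, hf⟩ => ?_)
    obtain ⟨v1, v2, v3⟩ := hv.spec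
    have h72₁ : ρ₁.reg 72 = i := by rw [hf.1 72 (by norm_num), h72]
    have h73₁ : ρ₁.reg 73 = 1 := by rw [hf.1 73 (by norm_num), h73]
    have hFs₁ : ∀ j, s₁.F j ⊆ s₀.F j := fun j => (v2 j).trans (hFs j)
    have htest : ((R 80 * .load 14 (R 72)).lt (.load 12 (R 72) * R 104)).val ρ₁ ≠ 0 ↔
        Due (1 / K) L s₁ i := by
      rw [due_iff hK hL h₁.x_eq]
      simp [h72₁, h₁.values.sum, h₁.values.pow i hi, h₁.counts i hi, h₁.thr]
    have hiB : i < B := h72₁ ▸ hρ₁.1 72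
    have htime : ((R 80 * .load 14 (R 72)).lt (.load 12 (R 72) * R 104)).time = 9 := rfl
    have htime' : (R 73).time = 1 := rfl
    refine RunsIn.cond hB2 (by decide) (fun hdue => ?_) fun hdue => ?_
    · rw [htest] at hdue
      set T := 2 * costBelow s₁.F (suppDigit s₁.x) i + 80 * #(suppDigit s₁.x 0) + 50 with hT
      -- The edges in `E₀` differ from the updated edge, so their digits are still those of the
      -- previous vector.
      have hE₀x : E₀ ⊆ suppDigit s₁.x 0 := by
        intro f hf
        rw [hE₀, mem_erase] at hf
        have := h0.E_zero hf.2
        rw [mem_suppDigit] at this ⊢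
        rwa [v1, hmid.x_eq, Function.update_of_ne hf.1]
      have hrun : Runs B (.seq (.assign 60 (R 72)) (.seq rebuild (.assign 73 0))) ρ₁ (2 + (T + 2))
          fun ρ => ρ.reg 73 = 0 ∧ ∃ s', Rebuild i s₁ s' ∧ Mem L K X s' ρ := by
        refine Runs.quick_seq hB2 2 (by rfl) ?_
        simp only [Cmd.wp, val_reg, h72₁]
        refine ⟨hiB, Runs.call_seq (rebuild_runs (G := G) (side := side) (E₀ := E₀) (i := i)
          (s := s₁) hB hside hi (h₁.ctx.setReg (by norm_num)) (by simp)
          (h₁.graphs.congr fun _ _ _ => rfl) ?_ ?_ ?_ (fun j f hf => hFG₀ j f (hFs₁ j hf))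
          (hm1.mono (union_subset_union hE₀s (hFs₁ 0))) (hm2.mono hE₀s (hFs₁ 0))
          (h₁.mates.congr rfl) h₁.counts hE₀x ?_)
          fun ρ₂ hρ₂ ⟨⟨s', m1, m2, m3, m4, m5⟩, m6⟩ => ?_⟩
        · rw [h₁.x_eq]; exact h₁.values.supps.congr fun _ _ _ => rfl
        · exact subset_empty.1 ((v2 _).trans_eq (hmid.F_high _ (by omega)))
        · intro j f hf
          rw [v1] at hf
          exact hxs.supp_subset (suppDigit_subset _ _ hf)
        · intro s' hr
          have := hmid.rebuild hG (by positivity) hx hi hv hr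
          exact (this.1.matching (by rw [this.2]; exact hxs)).1
        · refine Runs.of_quick hB2 2 (by rfl) ?_
          simp only [Cmd.wp, val_zero]
          have hctx : Ctx n (L + 1) ρ₂ := (h₁.ctx.setReg (by norm_num)).frame (by norm_num) m6
          have hval : Values L X ρ₂ := by
            refine Values.frame (σ := ρ₁.setReg 60 i) ⟨?_, ?_, ?_, ?_, ?_⟩ (by norm_num)
              (by decide) m6
            · exact h₁.values.supps.congr fun _ _ _ => rfl
            · exact h₁.values.vals
            · simpa using h₁.values.sum
            · exact h₁.values.pow
            · simpa using h₁.values.L_eq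
          refine ⟨by omega, by simp, s', m1, hctx.setReg (by norm_num), ⟨?_, hval.vals, ?_,
            hval.pow, ?_⟩, by rw [m3, h₁.x_eq], m2.congr fun _ _ _ => rfl, m4, m5.congr rfl, ?_⟩
          · exact hval.supps.congr fun _ _ _ => rfl
          · simpa using hval.sum
          · simpa using hval.L_eq
          · rw [reg_setReg, if_neg (by norm_num), m6.1 104 (by norm_num)]
            simpa using h₁.thr
      refine hrun.runsIn.mono fun t₂ ρ₂ _ ⟨ht₂, h73₂, s', hr, hmem⟩ =>
        RunsIn.loop_exit hB2 (by decide) (by simpa using h73₂)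
          ⟨s', .rebuild i s s₁ s' hv hdue hr, hmem, SweepCost.rebuild hv hdue hr hT ?_⟩
      rw [htime, htime']
      omega
    · have hdue' : ¬ Due (1 / K) L s₁ i := fun h => htest.2 h hdue
      rcases Nat.eq_zero_or_pos i with rfl | hi0
      · have hrun : Runs B (.cond (R 72) (.assign 72 (R 72 - 1)) (.assign 73 0)) ρ₁ 10
            fun ρ => ρ = ρ₁.setReg 73 0 := by
          refine Runs.of_quick hB2 10 (by rfl) ?_
          simp only [Cmd.wp, val_reg, val_zero, h72₁]
          exact ⟨fun h => absurd rfl h, fun _ => ⟨by omega, trivial⟩⟩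
        refine hrun.runsIn.mono fun t₂ ρ₂ _ ⟨ht₂, hρ₂⟩ =>
          RunsIn.loop_exit hB2 (by decide) (by simp [hρ₂])
            ⟨s₁, .done s s₁ hv hdue', ?_, SweepCost.done hv ?_⟩
        · rw [hρ₂]
          refine ⟨h₁.ctx.setReg (by norm_num), ⟨?_, h₁.values.vals, ?_, h₁.values.pow, ?_⟩, h₁.x_eq,
            h₁.graphs.congr fun _ _ _ => rfl, h₁.counts, ?_, ?_⟩
          · exact h₁.values.supps.congr fun _ _ _ => rfl
          · simpa using h₁.values.sum
          · simpa using h₁.values.L_eq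
          · have : s₁.M = E₀ ∪ s₁.F 0 := by
              cases hv
              simp only [AlgState.M, Function.update_self, hE₀, hmid.E_low, he]
            rw [this]; exact h₁.mates.congr rfl
          · simpa using h₁.thr
        · rw [htime, htime']; omega
      · have hrun : Runs B (.cond (R 72) (.assign 72 (R 72 - 1)) (.assign 73 0)) ρ₁ 10
            fun ρ => ρ = ρ₁.setReg 72 (i - 1) := by
          refine Runs.of_quick hB2 10 (by rfl) ?_
          simp only [Cmd.wp, val_reg, val_zero, val_one, val_sub, h72₁]
          exact ⟨fun _ => ⟨by omega, trivial⟩, fun h => by omega⟩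
        refine hrun.runsIn.mono fun t₂ ρ₂ _ ⟨ht₂, hρ₂⟩ => ?_
        refine (hnext s₁ ρ₂ hv hdue' hi0.ne' ?_ ?_ ?_ hFs₁).mono fun t₃ ρ₃ _ ⟨s', k1, k2, k3⟩ =>
          ⟨s', k1, k2, k3 _ ?_⟩
        · rw [hρ₂]
          refine ⟨h₁.ctx.setReg (by norm_num), ⟨?_, h₁.values.vals, ?_, h₁.values.pow, ?_⟩, h₁.x_eq,
            h₁.graphs.congr fun _ _ _ => rfl, h₁.counts, h₁.mates.congr rfl, ?_, ?_, ?_⟩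
          · exact h₁.values.supps.congr fun _ _ _ => rfl
          · simpa using h₁.values.sum
          · simpa using h₁.values.L_eq
          · simpa using h₁.thr
          · simpa using h₁.fst
          · simpa using h₁.snd
        · rw [hρ₂]; simp
        · rw [hρ₂]; simpa using h73₁
        · rw [htime, htime']; omega
  induction i with
  | zero =>
    intro s σ h h72 h73 hmid hFs
    exact step 0 hi s σ h h72 h73 hmid hFs fun _ _ _ _ h => absurd rfl h
  | succ i ih =>
    intro s σ h h72 h73 hmid hFs
    refine step (i + 1) hi s σ h h72 h73 hmid hFs fun s₁ σ₁ hv hdue _ h₁ k72 k73 hFs₁ => ?_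
    refine (ih (by omega) s₁ σ₁ h₁ (by simpa using k72) k73 (hmid.visit h0 hi hv hdue) hFs₁).mono
      fun t ρ _ ⟨s', k1, k2, k3⟩ => ⟨s', .next i s s₁ s' hv hdue k1, k2, fun t' ht' => k3.next hv ht'⟩

/-! ### The two programs -/

theorem Mem.congr {n L K : ℕ} {X : Sym2 (Fin n) → ℕ} {s : AlgState (Fin n)} {σ ρ : Config}
    (h : Mem L K X s σ) (ha : ρ.arr = σ.arr) (hr : ∀ r, 80 ≤ r → ρ.reg r = σ.reg r) :
    Mem L K X s ρ :=
  ⟨h.ctx.frame (b := 80) (A := []) (by norm_num) ⟨hr, fun _ _ => by rw [ha]⟩,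
    h.values.frame (b := 80) (A := []) le_rfl (by decide) ⟨hr, fun _ _ => by rw [ha]⟩, h.x_eq,
    h.graphs.congr fun _ _ _ => by rw [ha], by rw [ha]; exact h.counts,
    h.mates.congr (by rw [ha]), by rw [hr _ (by norm_num), h.thr]⟩

/-- Remove the edge between the vertices in registers `21` and `22` from the array of mates unless
it belongs to the layer `0`. -/
def clearMate : Cmd := .cond (.load 4 (R 21 * R 100 + R 22)) .skip
  (.cond ((Expr.load 1 (R 21)).eq (R 22 + 1)) (block [.store 1 (R 21) 0, .store 1 (R 22) 0]) .skip)

/-- The program for updates. -/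
def updateCmd : Cmd := .seq (block [.assign 21 (R 0), .assign 22 (R 1), .assign 40 (R 2)])
  (.seq setValue (.seq clearMate
    (.seq (block [.assign 70 (R 21), .assign 71 (R 22), .assign 72 (R 103), .assign 73 1]) sweep)))

/-- By disjointness, an edge lies in `E₀` exactly if it is mated and not in `F 0`. This replaces a
stored copy of that set. -/
theorem clearMate_runs {B n : ℕ} {F : ℕ → Finset (Sym2 (Fin n))} {E₀ : Finset (Sym2 (Fin n))}
    {u v : Fin n} {σ : Config} (hB : 2 ≤ B) (h100 : σ.reg 100 = n) (hg : Graphs F σ)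
    (hu : σ.reg 21 = u) (hv : σ.reg 22 = v) (hM : IsMatching (E₀ ∪ F 0)) (hd : Disjoint E₀ (F 0))
    (hs : Stores σ (E₀ ∪ F 0)) :
    Runs B clearMate σ 40 fun ρ => Stores ρ (E₀.erase s(u, v) ∪ F 0) ∧ ρ.reg = σ.reg ∧
      ∀ a, a ≠ 1 → ρ.arr a = σ.arr a := by
  have hmem := hg.mem_iff 0 u v
  rw [zero_mul, zero_add] at hmem
  have hmate := (hs u).2 v
  rw [Sym2.eq_swap] at hmate
  refine Runs.of_quick hB 40 (by rfl) ?_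
  simp only [clearMate, block, Cmd.wp, val_load, val_add, val_mul, val_reg, val_one, val_zero,
    val_eq, reg_setArr, hu, hv, h100]
  refine ⟨fun h1 => ?_, fun h1 => ⟨fun h2 => ?_, fun h2 => ?_⟩⟩
  · have he := disjoint_right.1 hd (hmem.1 h1)
    rw [erase_eq_of_notMem he]
    exact ⟨hs, by trivial, fun _ _ => by trivial⟩
  · have h3 : σ.arr 1 u = v + 1 := by by_contra h; simp [h] at h2
    have h4 : s(u, v) ∉ F 0 := fun h => hmem.2 h h1
    refine ⟨by omega, by omega, ?_, by trivial, fun a ha => ?_⟩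
    · have := hs.erase hM (hmate.2 h3)
      rwa [erase_union_distrib, erase_eq_of_notMem h4] at this
    · rw [arr_setArr, if_neg ha, arr_setArr, if_neg ha]
  · have h3 : ¬ σ.arr 1 u = v + 1 := by intro h; simp [h] at h2
    have h4 : s(u, v) ∉ E₀ := fun h => h3 (hmate.1 (mem_union_left _ h))
    rw [erase_eq_of_notMem h4]
    exact ⟨hs, by trivial, fun _ _ => by trivial⟩

theorem updateCmd_runs {B n L K f : ℕ} {G : SimpleGraph (Fin n)} {side : Fin n → Bool}
    {X : Sym2 (Fin n) → ℕ} {u v : Fin n} {s : AlgState (Fin n)} {σ : Config}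
    (hB : Room B n (L + 1)) (hside : ∀ u v, G.Adj u v → side u ≠ side v) (hG : G.IsBipartite)
    (hK : 1 ≤ K) (hL : 1 ≤ L) (h0 : Inv (1 / K) L s) (hx₀ : IsFractionalMatching G s.x)
    (hx : IsFractionalMatching G (ofFix L (Function.update X s(u, v) f)))
    (hcB : ∀ j ≤ L, s.c j + 1 < B) (hsum : ∑ e, Function.update X s(u, v) f e < B)
    (h : Mem L K X s σ) (hu : σ.reg 0 = u) (hv : σ.reg 1 = v) (hf : σ.reg 2 = f) :
    RunsIn B updateCmd σ fun t ρ => ∃ s', UpdateStep (1 / K) L s(u, v) (f / 2 ^ L) s s' ∧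
      Mem L K (Function.update X s(u, v) f) s' ρ ∧ ∃ t', t ≤ t' + 200 * (L + 1) + 150 ∧
        SweepCost (1 / K) L L { s with x := ofFix L (Function.update X s(u, v) f) } s' t' := by
  have hB2 := hB.two_le
  have hB1 := hB.1
  intro hσ
  have hu2 := u.2
  have hv2 := v.2
  have hnn : n ≤ n * n := Nat.le_mul_self n
  have hfB : f < B := hf ▸ hσ.1 2
  have hLB : L < B := h.values.L_eq ▸ hσ.1 103
  set X' := Function.update X s(u, v) f with hX'
  have hxX : ofFix L X' = Function.update s.x s(u, v) (f / 2 ^ L) := by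
    rw [hX', ofFix_update, h.x_eq]
  set s₁ : AlgState (Fin n) := { s with x := ofFix L X' } with hs₁
  obtain ⟨hm1, hm2⟩ := h0.matching hx₀
  set σ₁ := ((σ.setReg 21 u).setReg 22 v).setReg 40 f with hσ₁
  have hsetup : Runs B (block [.assign 21 (R 0), .assign 22 (R 1), .assign 40 (R 2)]) σ 10
      fun ρ => ρ = σ₁ := by
    refine Runs.of_quick hB2 10 (by rfl) ?_
    simp only [block, Cmd.wp, val_reg, reg_setReg, hu, hv, hf, Nat.reduceEqDiff, if_false]
    exact ⟨by omega, by omega, by omega, by trivial⟩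
  have mem₁ : Mem L K X s σ₁ := h.congr rfl fun r hr => by
    simp only [hσ₁, reg_setReg]
    rw [if_neg (by omega), if_neg (by omega), if_neg (by omega)]
  refine RunsIn.seq hsetup.runsIn (fun t₁ ρ₁ hρ₁ ⟨ht₁, e₁⟩ => ?_) hσ
  subst e₁
  refine RunsIn.seq (setValue_runs (f := f) hB mem₁.ctx mem₁.values (by simp [hσ₁]) (by simp [hσ₁])
    (by simp [hσ₁]) hsum).runsIn fun t₂ ρ₂ hρ₂ ⟨ht₂, ⟨hval₂, hu₂, hv₂⟩, hf₂⟩ => ?_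
  have ctx₂ : Ctx n (L + 1) ρ₂ := mem₁.ctx.frame (by norm_num) hf₂
  have gr₂ : Graphs s.F ρ₂ := mem₁.graphs.congr fun a h2 h7 => hf₂.2 a (by simp; omega)
  refine RunsIn.seq (clearMate_runs (E₀ := s.E 0) (F := s.F) hB2 ctx₂.n_eq gr₂ hu₂ hv₂ hm1 hm2
    (mem₁.mates.congr (hf₂.2 1 (by decide)))).runsIn fun t₃ ρ₃ hρ₃ ⟨ht₃, st₃, hr₃, ha₃⟩ => ?_
  set σ₄ := (((ρ₃.setReg 70 u).setReg 71 v).setReg 72 L).setReg 73 1 with hσ₄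
  have hr₃' : ∀ r, ρ₃.reg r = ρ₂.reg r := fun r => by rw [hr₃]
  have hsetup₄ : Runs B (block [.assign 70 (R 21), .assign 71 (R 22), .assign 72 (R 103),
      .assign 73 1]) ρ₃ 10 fun ρ => ρ = σ₄ := by
    refine Runs.of_quick hB2 10 (by rfl) ?_
    simp only [block, Cmd.wp, val_reg, val_one, reg_setReg, hr₃, hu₂, hv₂, hval₂.L_eq,
      Nat.reduceEqDiff, if_false]
    exact ⟨by omega, by omega, by omega, by omega, by trivial⟩
  refine RunsIn.seq hsetup₄.runsIn fun t₄ ρ₄ hρ₄ ⟨ht₄, e₄⟩ => ?_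
  subst e₄
  have r₄ : ∀ r, 80 ≤ r → σ₄.reg r = ρ₂.reg r := by
    intro r hr
    simp only [hσ₄, reg_setReg, hr₃']
    rw [if_neg (by omega), if_neg (by omega), if_neg (by omega), if_neg (by omega)]
  have a₄ : ∀ a, a ≠ 1 → σ₄.arr a = ρ₂.arr a := ha₃
  have fr₄ : Frame 80 [1] ρ₂ σ₄ := ⟨r₄, fun a ha => a₄ a (by simpa using ha)⟩
  have hmem₄ : SweepMem L K X' u v ((s.E 0).erase s(u, v)) s₁ σ₄ := by
    refine ⟨ctx₂.frame (by norm_num) fr₄, hval₂.frame le_rfl (by decide) fr₄, rfl,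
      gr₂.congr fun a h2 h7 => a₄ a (by omega), fun j hj => ?_, st₃.congr rfl, ?_, ?_, ?_⟩
    · rw [a₄ 12 (by norm_num), hf₂.2 12 (by decide)]; exact mem₁.counts j hj
    · rw [r₄ 104 (by norm_num), hf₂.1 104 (by norm_num)]; exact mem₁.thr
    · simp [hσ₄]
    · simp [hσ₄]
  have hmid := h0.mid s(u, v) ((f : ℝ) / 2 ^ L)
  rw [← hxX] at hmid
  refine (sweep_runs hB hside hG hK hL h0 hx₀ (ν := f / 2 ^ L) (by rw [← hxX]; exact hx) hcB L
    le_rfl s₁ σ₄ hmem₄ (by simp [hσ₄]) (by simp [hσ₄]) hmid fun j => Subset.rfl).mono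
    fun t ρ _ ⟨s', k1, k2, k3⟩ => ⟨s', ?_, k2, t, by omega, k3⟩
  rw [UpdateStep, ← hxX]
  exact k1

/-- The vector with the first `k` entries of a list, and zero elsewhere. -/
noncomputable def firstEntries {n : ℕ} (X : Sym2 (Fin n) → ℕ) (l : List (Fin n × Fin n)) (k : ℕ) :
    Sym2 (Fin n) → ℕ := by
  classical
  exact fun e => if e ∈ (l.take k).map (fun p => s(p.1, p.2)) then X e else 0

theorem firstEntries_succ {n : ℕ} (X : Sym2 (Fin n) → ℕ) (l : List (Fin n × Fin n)) {k : ℕ}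
    (hk : k < l.length) : firstEntries X l (k + 1) =
      Function.update (firstEntries X l k) s(l[k].1, l[k].2) (X s(l[k].1, l[k].2)) := by
  ext e
  rw [Function.update_apply]
  simp only [firstEntries, List.take_succ_eq_append_getElem hk, List.map_append, List.map_cons,
    List.map_nil, List.mem_append, List.mem_singleton]
  by_cases h : e = s(l[k].1, l[k].2)
  · simp [h]
  · simp only [h, or_false, if_false]

theorem sum_firstEntries_le {n : ℕ} (X : Sym2 (Fin n) → ℕ) (l : List (Fin n × Fin n)) (k : ℕ) :
    ∑ e, firstEntries X l k e ≤ ∑ e, X e :=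
  sum_le_sum fun e _ => by
    unfold firstEntries
    split_ifs <;> simp

/-- Compute the constants. -/
def setup : Cmd := .seq (block [.assign 100 (R 0), .assign 101 (R 0 * R 0), .assign 92 (R 1 * R 2),
    .assign 103 0, .assign 91 1, .assign 93 (R 3)])
  (.seq (.loop ((R 91).lt (R 92)) (block [.assign 91 (R 91 * 2), .assign 103 (R 103 + 1)]))
    (.seq (block [.assign 103 (R 103 + 1), .assign 102 (R 103 + 1), .assign 42 0, .assign 91 1])
      (.seq (.loop ((R 42).lt (R 102))
          (block [.store 14 (R 42) (R 91), .assign 91 (R 91 * 2), .assign 42 (R 42 + 1)]))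
        (.assign 104 (4 * R 1 * R 103 * .load 14 (R 103))))))

@[simp] theorem val_four (σ : Config) : (4 : Expr).val σ = 4 := rfl
@[simp] theorem val_three (σ : Config) : (3 : Expr).val σ = 3 := rfl

/-- Doubling from one until `K * D` is reached takes `Nat.clog 2 (K * D)` rounds, which determines
`L` without computing a logarithm. -/
theorem setup_runs {B n K D L : ℕ} {σ : Config} (hB : Room B n (L + 1))
    (hL : L = 1 + Nat.clog 2 (K * D)) (hKD : K * D < B) (hpow : 2 ^ (L + 1) < B)
    (hthr : 4 * K * L * 2 ^ L < B) (h0 : σ.reg 0 = n) (h1 : σ.reg 1 = K) (h2 : σ.reg 2 = D) :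
    Runs B setup σ (40 * L + 100) fun ρ => (Ctx n (L + 1) ρ ∧ ρ.reg 103 = L ∧
      (∀ i ≤ L, ρ.arr 14 i = 2 ^ i) ∧ ρ.reg 104 = 4 * K * L * 2 ^ L) ∧
      ρ.reg 93 = σ.reg 3 ∧ ρ.reg 80 = σ.reg 80 ∧ ∀ a, a ≠ 14 → ρ.arr a = σ.arr a := by
  have hB2 := hB.two_le
  have hB1 := hB.1
  have hnn : n ≤ n * n := Nat.le_mul_self n
  set c := Nat.clog 2 (K * D) with hc
  have hLlt : L + 1 < 2 ^ (L + 1) := Nat.lt_two_pow_self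
  have hpowle : ∀ k, k ≤ L + 1 → 2 ^ k < B := fun k hk =>
    (Nat.pow_le_pow_right (by norm_num) hk).trans_lt hpow
  set I : Config → Prop := fun ρ => ρ.reg 1 = K ∧ ρ.reg 93 = σ.reg 3 ∧ ρ.reg 80 = σ.reg 80 ∧
    (∀ a, a ≠ 14 → ρ.arr a = σ.arr a) ∧ ρ.reg 100 = n ∧ ρ.reg 101 = n * n with hI
  have Ireg : ∀ ρ r k, I ρ → r ≠ 1 → r ≠ 93 → r ≠ 80 → r ≠ 100 → r ≠ 101 → I (ρ.setReg r k) := by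
    rintro ρ r k ⟨i1, i0, i2, i3, i4, i5⟩ k0 k1 k2 k3 k4
    refine ⟨?_, ?_, ?_, i3, ?_, ?_⟩ <;> rw [reg_setReg, if_neg (by omega)]
    exacts [i1, i0, i2, i4, i5]
  have Iarr : ∀ ρ i k, I ρ → I (ρ.setArr 14 i k) := by
    rintro ρ i k ⟨i1, i0, i2, i3, i4, i5⟩
    refine ⟨i1, i0, i2, fun a ha => ?_, i4, i5⟩
    rw [arr_setArr, if_neg ha, i3 a ha]
  refine Runs.of_small fun hσ => ?_
  have h3B := hσ.1 3
  refine Runs.mono_time (T := 20 + ((20 * c + 10) + (20 + ((20 * (L + 1) + 10) + 10)))) ?_ (by omega)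
  refine Runs.quick_seq hB2 20 (by rfl) ?_
  simp only [block, Cmd.wp, val_reg, val_mul, val_zero, val_one, reg_setReg, h0,
    OfNat.one_ne_ofNat, OfNat.zero_ne_ofNat, if_false, h1,
    Nat.reduceEqDiff, h2]
  refine ⟨by omega, by omega, hKD, by omega, by omega, h3B, ?_⟩
  refine Runs.call_seq (P := fun ρ => I ρ ∧ ρ.reg 103 = c) (Runs.loop hB2 (by decide)
    (fun b ρ => ∃ k ≤ c, I ρ ∧ ρ.reg 92 = K * D ∧ ρ.reg 103 = k ∧ ρ.reg 91 = 2 ^ k ∧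
      b = 20 * (c - k) + 10) ?_ ?_ ⟨0, by omega, ⟨by simp [h1], by simp, by simp, fun a _ => rfl,
        by simp, by simp⟩, by simp, by simp, by simp, by simp⟩) ?_
  · rintro ρ b ⟨k, hk, hIρ, h92, h103, h91, rfl⟩ hρ hv
    have hlt : 2 ^ k < K * D := by by_contra h; simp [h92, h91, h] at hv
    have hkc : k < c := by
      by_contra h
      have h3 : c ≤ k := by omega
      have h4 := Nat.le_pow_clog (b := 2) (by norm_num) (K * D)
      have h5 := Nat.pow_le_pow_right (n := 2) (by norm_num) h3
      rw [← hc] at h4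
      omega
    refine ⟨10, Runs.of_quick hB2 10 (by rfl) ?_⟩
    simp only [Cmd.wp, val_reg, val_mul, val_add, val_two, val_one, reg_setReg,
      Nat.reduceEqDiff, if_false, h91, h103]
    have hp : 2 ^ k * 2 = 2 ^ (k + 1) := (pow_succ 2 k).symm
    have htime : ((R 91).lt (R 92)).time = 3 := rfl
    refine ⟨by rw [hp]; exact hpowle _ (by omega), by omega, 20 * (c - (k + 1)) + 10, by omega,
      k + 1, hkc, Ireg _ _ _ (Ireg _ _ _ hIρ (by norm_num) (by norm_num) (by norm_num) (by norm_num) (by norm_num)) (by norm_num) (by norm_num) (by norm_num) (by norm_num) (by norm_num), by simp [h92],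
      by simp, by simp [hp], rfl⟩
  · rintro ρ b ⟨k, hk, hIρ, h92, h103, h91, rfl⟩ hρ hv
    have hlt : ¬ 2 ^ k < K * D := by intro h; simp [h92, h91, h] at hv
    have hkc : c ≤ k := (Nat.clog_le_iff_le_pow (by norm_num)).2 (by omega)
    have htime : ((R 91).lt (R 92)).time = 3 := rfl
    exact ⟨by omega, hIρ, by omega⟩
  · rintro ρ hρ ⟨hIρ, h103⟩
    refine Runs.quick_seq hB2 20 (by rfl) ?_
    simp only [Cmd.wp, val_reg, val_add, val_zero, val_one, reg_setReg, reduceIte, h103]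
    have hLc : c + 1 = L := by omega
    rw [hLc]
    refine ⟨by omega, by omega, by omega, by omega, ?_⟩
    refine Runs.call_seq (P := fun ρ => I ρ ∧ ρ.reg 103 = L ∧ ρ.reg 102 = L + 1 ∧
      ∀ i ≤ L, ρ.arr 14 i = 2 ^ i) (Runs.loop hB2 (by decide)
      (fun b ρ => ∃ k ≤ L + 1, I ρ ∧ ρ.reg 103 = L ∧ ρ.reg 102 = L + 1 ∧ ρ.reg 42 = k ∧
        ρ.reg 91 = 2 ^ k ∧ (∀ i < k, ρ.arr 14 i = 2 ^ i) ∧ b = 20 * (L + 1 - k) + 10) ?_ ?_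
        ⟨0, by omega, ?_, by simp, by simp, by simp, by simp, by simp, by simp⟩) ?_
    · rintro τ b ⟨k, hk, hIτ, k103, k102, k42, k91, k14, rfl⟩ hτ hv
      have hlt : k < L + 1 := by by_contra h; simp [k42, k102, h] at hv
      refine ⟨13, Runs.of_quick hB2 13 (by rfl) ?_⟩
      simp only [Cmd.wp, val_reg, val_mul, val_add, val_two, val_one, reg_setReg, reg_setArr,
        Nat.reduceEqDiff, if_false, k42, k91]
      have hp : 2 ^ k * 2 = 2 ^ (k + 1) := (pow_succ 2 k).symm
      have htime : ((R 42).lt (R 102)).time = 3 := rfl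
      refine ⟨hpowle _ (by omega), by rw [hp]; exact hpowle _ (by omega), by omega,
        20 * (L + 1 - (k + 1)) + 10, by omega, k + 1, hlt, Ireg _ _ _ (Ireg _ _ _ (Iarr _ _ _ hIτ)
          (by norm_num) (by norm_num) (by norm_num) (by norm_num) (by norm_num)) (by norm_num) (by norm_num) (by norm_num) (by norm_num) (by norm_num), by simp [k103], by simp [k102], by simp, by simp [hp],
        fun i hi => ?_, rfl⟩
      simp only [arr_setReg, arr_setArr, reduceIte, Function.update_apply]
      split_ifs with h
      · rw [h]
      · exact k14 i (by omega)
    · rintro τ b ⟨k, hk, hIτ, k103, k102, k42, k91, k14, rfl⟩ hτ hv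
      have hlt : ¬ k < L + 1 := by intro h; simp [k42, k102, h] at hv
      have htime : ((R 42).lt (R 102)).time = 3 := rfl
      exact ⟨by omega, hIτ, k103, k102, fun i hi => k14 i (by omega)⟩
    · exact Ireg _ _ _ (Ireg _ _ _ (Ireg _ _ _ (Ireg _ _ _ hIρ (by norm_num) (by norm_num) (by norm_num) (by norm_num) (by norm_num)) (by norm_num) (by norm_num) (by norm_num) (by norm_num) (by norm_num))
        (by norm_num) (by norm_num) (by norm_num) (by norm_num) (by norm_num)) (by norm_num) (by norm_num) (by norm_num) (by norm_num) (by norm_num)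
    · rintro τ hτ ⟨hIτ, k103, k102, k14⟩
      refine Runs.of_quick hB2 10 (by rfl) ?_
      simp only [Cmd.wp, val_mul, val_reg, val_four, val_load, k103, k14 L le_rfl,
        hIτ.1]
      obtain ⟨-, i1, i2, i3, i4, i5⟩ := Ireg τ 104 (4 * K * L * 2 ^ L) hIτ (by norm_num) (by norm_num) (by norm_num) (by norm_num) (by norm_num)
      exact ⟨hthr, ⟨⟨i4, i5, by simpa using k102⟩, by simpa using k103, k14, by simp⟩, i1, i2, i3⟩

/-- Read the values from array `0`. -/
def readInput : Cmd := .seq (.assign 90 0) (.loop ((R 90).lt (R 93))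
  (.seq (block [.assign 21 (.load 0 (R 90 * 3)), .assign 22 (.load 0 (R 90 * 3 + 1)),
      .assign 40 (.load 0 (R 90 * 3 + 2))])
    (.seq setValue (.assign 90 (R 90 + 1)))))

/-- The entries enter one by one as changes of the zero vector. Their partial sums are bounded by
the full sum, so the register with the total value never exceeds its capacity. -/
theorem readInput_runs {B n L : ℕ} {X : Sym2 (Fin n) → ℕ} {l : List (Fin n × Fin n)} {σ : Config}
    (hB : Room B n (L + 1)) (hc : Ctx n (L + 1) σ) (h : Values L (fun _ : Sym2 (Fin n) => 0) σ)
    (h93 : σ.reg 93 = l.length) (hX : ∑ e, X e < B)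
    (hin : ∀ (k : ℕ) (hk : k < l.length), σ.arr 0 (k * 3) = l[k].1 ∧ σ.arr 0 (k * 3 + 1) = l[k].2 ∧
      σ.arr 0 (k * 3 + 2) = X s(l[k].1, l[k].2)) :
    Runs B readInput σ ((200 * (L + 1) + 100) * l.length + 20) fun ρ =>
      Values L (firstEntries X l l.length) ρ ∧ Frame 91 [8, 9, 10, 11] σ ρ := by
  have hB2 := hB.two_le
  have hB1 := hB.1
  refine Runs.frame 91 _ (Runs.of_small fun hσ => ?_) (by rfl) (by rfl)
  have hnn : n ≤ n * n := Nat.le_mul_self n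
  have hlB : l.length < B := h93 ▸ hσ.1 93
  refine Runs.mono_time (T := 2 + ((200 * (L + 1) + 100) * l.length + 10)) ?_ (by omega)
  refine Runs.quick_seq hB2 2 (by rfl) ?_
  simp only [Cmd.wp, val_zero]
  refine ⟨by omega, Runs.loop hB2 (by decide)
    (fun b ρ => ∃ k ≤ l.length, Ctx n (L + 1) ρ ∧ Values L (firstEntries X l k) ρ ∧
      ρ.reg 93 = l.length ∧ ρ.arr 0 = σ.arr 0 ∧ ρ.reg 90 = k ∧
      b = (200 * (L + 1) + 100) * (l.length - k) + 10) ?_ ?_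
      ⟨0, Nat.zero_le _, hc.setReg (by norm_num), ⟨?_, ?_, ?_, h.pow, ?_⟩, ?_, rfl, by simp, by simp⟩⟩
  · rintro ρ b ⟨k, hk, kc, kv, k93, k0, k90, rfl⟩ hρ hv
    have hkl : k < l.length := by by_contra h; simp [k90, k93, h] at hv
    obtain ⟨in1, in2, in3⟩ := hin k hkl
    have hu2 := l[k].1.2
    have hv2 := l[k].2.2
    have hXe : X s(l[k].1, l[k].2) ≤ ∑ e, X e :=
      single_le_sum (f := X) (fun _ _ => Nat.zero_le _) (mem_univ _)
    have hstep := firstEntries_succ X l hkl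
    have hsum := (sum_firstEntries_le X l (k + 1)).trans_lt hX
    have hrun : Runs B (.seq (block [.assign 21 (.load 0 (R 90 * 3)),
        .assign 22 (.load 0 (R 90 * 3 + 1)), .assign 40 (.load 0 (R 90 * 3 + 2))])
        (.seq setValue (.assign 90 (R 90 + 1)))) ρ (25 + ((200 * (L + 1) + 60) + 4)) fun ρ' =>
        Ctx n (L + 1) ρ' ∧ Values L (firstEntries X l (k + 1)) ρ' ∧ ρ'.reg 93 = l.length ∧
        ρ'.arr 0 = σ.arr 0 ∧ ρ'.reg 90 = k + 1 := by
      refine Runs.quick_seq hB2 25 (by rfl) ?_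
      simp only [block, Cmd.wp, val_load, val_add, val_mul, val_reg, val_one, val_two, val_three,
        reg_setReg, arr_setReg, Nat.reduceEqDiff, if_false, k90, k0, in1, in2, in3]
      refine ⟨by omega, by omega, by omega, Runs.call_seq (setValue_runs (X := firstEntries X l k)
        (u := l[k].1) (v := l[k].2) (f := X s(l[k].1, l[k].2)) hB
        (((kc.setReg (by norm_num)).setReg (by norm_num)).setReg (by norm_num)) ⟨?_, ?_, ?_, ?_, ?_⟩
        (by simp) (by simp) (by simp) (by rw [← hstep]; exact hsum)) fun ρ' hρ' ⟨⟨m1, m2, m3⟩, m4⟩ => ?_⟩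
      · exact kv.supps.congr fun _ _ _ => rfl
      · exact kv.vals
      · simpa using kv.sum
      · exact kv.pow
      · simpa using kv.L_eq
      · have k90' : ρ'.reg 90 = k := by rw [m4.1 90 (by norm_num)]; simpa using k90
        refine Runs.of_quick hB2 4 (by rfl) ?_
        simp only [Cmd.wp, val_add, val_reg, val_one, k90']
        rw [← hstep] at m1
        refine ⟨by omega, Ctx.setReg (Ctx.frame (b := 81) ?_ (by norm_num) m4) (by norm_num),
          ⟨?_, m1.vals, ?_, m1.pow, ?_⟩, ?_, ?_, by simp⟩
        · exact ((kc.setReg (by norm_num)).setReg (by norm_num)).setReg (by norm_num)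
        · exact m1.supps.congr fun _ _ _ => rfl
        · simpa using m1.sum
        · simpa using m1.L_eq
        · rw [reg_setReg, if_neg (by norm_num), m4.1 93 (by norm_num)]; simpa using k93
        · rw [arr_setReg, m4.2 0 (by decide)]; exact k0
    have htime : ((R 90).lt (R 93)).time = 3 := rfl
    refine ⟨_, hrun.mono le_rfl fun ρ' _ ⟨m1, m2, m3, m4, m5⟩ =>
      ⟨_, ?_, k + 1, hkl, m1, m2, m3, m4, m5, rfl⟩⟩
    have : l.length - k = l.length - (k + 1) + 1 := by omega
    have e := Nat.mul_succ (200 * (L + 1) + 100) (l.length - (k + 1))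
    rw [htime, this, ← Nat.succ_eq_add_one (l.length - (k + 1)), e]
    omega
  · rintro ρ b ⟨k, hk, kc, kv, k93, k0, k90, rfl⟩ hρ hv
    have hkl : k = l.length := by
      by_contra h
      have : k < l.length := by omega
      simp [k90, k93, this] at hv
    have htime : ((R 90).lt (R 93)).time = 3 := rfl
    rw [hkl] at kv
    exact ⟨by omega, kv⟩
  · have : (firstEntries X l 0) = fun _ => 0 := by ext e; simp [firstEntries]
    rw [this]; exact h.supps.congr fun _ _ _ => rfl
  · intro e; simpa [firstEntries] using h.vals e
  · simpa [firstEntries] using h.sum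
  · simpa using h.L_eq
  · simpa using h93

/-- The program for the initialization. -/
def initCmd : Cmd := .seq setup (.seq readInput (.seq (.assign 60 (R 103)) rebuild))

/-- Positions are counted from one, so zeroed memory already represents empty sets and no time goes
into clearing arrays. -/
theorem famRep_zero (N : ℕ) {arr : ℕ → ℕ} (h : ∀ i, arr i = 0) {mem : ℕ → ℕ → Prop}
    (hm : ∀ r x, ¬ mem r x) : FamRep N arr arr arr mem :=
  ⟨fun h' => (hm _ _ h').elim, fun _ => by simp [h, hm], fun h' => (hm _ _ h').elim,
    fun h' => (hm _ _ h').elim, fun h' => by simp [h] at h', fun h' => by simp [h] at h'⟩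

theorem initCmd_runs {B n K D L : ℕ} {G : SimpleGraph (Fin n)} {side : Fin n → Bool}
    {X : Sym2 (Fin n) → ℕ} {l : List (Fin n × Fin n)} {σ : Config}
    (hB : Room B n (L + 1)) (hside : ∀ u v, G.Adj u v → side u ≠ side v) (hG : G.IsBipartite)
    (hL : L = 1 + Nat.clog 2 (K * D)) (hKD : K * D < B) (hpow : 2 ^ (L + 1) < B)
    (hthr : 4 * K * L * 2 ^ L < B) (hX : ∑ e, X e < B)
    (hx : IsFractionalMatching G (ofFix L X)) (h0 : σ.reg 0 = n) (h1 : σ.reg 1 = K)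
    (h2 : σ.reg 2 = D) (h3 : σ.reg 3 = l.length) (h80 : σ.reg 80 = 0)
    (harr : ∀ a, a ≠ 0 → ∀ i, σ.arr a i = 0)
    (hin : ∀ (k : ℕ) (hk : k < l.length), σ.arr 0 (k * 3) = l[k].1 ∧ σ.arr 0 (k * 3 + 1) = l[k].2 ∧
      σ.arr 0 (k * 3 + 2) = X s(l[k].1, l[k].2))
    (hl : ∀ e, X e ≠ 0 → e ∈ l.map fun p => s(p.1, p.2)) :
    Runs B initCmd σ (40 * L + 200 + (200 * (L + 1) + 100) * l.length +
        (2 * costBelow (fun _ => (∅ : Finset (Sym2 (Fin n)))) (suppDigit (ofFix L X)) L +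
          80 * #(suppDigit (ofFix L X) 0))) fun ρ =>
      ∃ s, InitStep L (ofFix L X) s ∧ Mem L K X s ρ := by
  have hB2 := hB.two_le
  set T := 2 * costBelow (fun _ => (∅ : Finset (Sym2 (Fin n)))) (suppDigit (ofFix L X)) L +
    80 * #(suppDigit (ofFix L X) 0) + 50 with hT
  refine Runs.mono_time (T := (40 * L + 100) + (((200 * (L + 1) + 100) * l.length + 20) +
    (2 + T))) ?_ (by omega)
  refine Runs.call_seq (setup_runs hB hL hKD hpow hthr h0 h1 h2)
    fun ρ₁ hρ₁ ⟨⟨c₁, L₁, p₁, t₁⟩, r93, r80, a₁⟩ => ?_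
  have z₁ : ∀ a, a ≠ 0 → a ≠ 14 → ∀ i, ρ₁.arr a i = 0 := fun a h h' i => by
    rw [a₁ a h', harr a h]
  have zero_arr : ∀ a, a ≠ 0 → a ≠ 14 → ρ₁.arr a = fun _ => 0 := fun a h h' => funext (z₁ a h h')
  have v₁ : Values L (fun _ : Sym2 (Fin n) => 0) ρ₁ := by
    refine ⟨?_, fun e => z₁ 11 (by norm_num) (by norm_num) _, by simp [r80, h80], p₁, L₁⟩
    simp only [Supps, Fam, zero_arr 8 (by norm_num) (by norm_num),
      zero_arr 9 (by norm_num) (by norm_num), zero_arr 10 (by norm_num) (by norm_num)]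
    refine famRep_zero _ (fun _ => rfl) fun r x => ?_
    rintro ⟨e, he, -⟩
    rw [mem_suppDigit] at he
    simp [digit, ofFix] at he
  refine Runs.call_seq (readInput_runs (X := X) (l := l) hB c₁ v₁ (by rw [r93, h3]) hX
    fun k hk => by rw [a₁ 0 (by norm_num)]; exact hin k hk) fun ρ₂ hρ₂ ⟨v₂, f₂⟩ => ?_
  have hfull : firstEntries X l l.length = X := by
    ext e
    unfold firstEntries
    rw [List.take_length]
    split_ifs with h
    · rfl
    · by_contra h'
      exact h (hl e (Ne.symm h'))
  rw [hfull] at v₂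
  have c₂ : Ctx n (L + 1) ρ₂ := c₁.frame (by norm_num) f₂
  have hLB : L < B := v₂.L_eq ▸ hρ₂.1 103
  refine Runs.quick_seq hB2 2 (by rfl) ?_
  simp only [Cmd.wp, val_reg, v₂.L_eq]
  set s₀ : AlgState (Fin n) := { x := ofFix L X, E := fun _ => ∅, F := fun _ => ∅, c := fun _ => 0 }
    with hs₀
  have z₂ : ∀ a, a ≠ 0 → a ≠ 14 → (a < 8 ∨ 11 < a) → ρ₂.arr a = fun _ => 0 := fun a h h' h'' => by
    rw [f₂.2 a (by simp; omega), zero_arr a h h']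
  have hfr : Frame 61 [] ρ₂ (ρ₂.setReg 60 L) :=
    ⟨fun r hr => by rw [reg_setReg, if_neg (by omega)], fun _ _ => rfl⟩
  refine ⟨hLB, (rebuild_runs (G := G) (side := side) (E₀ := ∅) (i := L) (s := s₀) hB hside le_rfl
    (c₂.frame (by norm_num) hfr) (by simp) ?_ ?_ rfl ?_ (by simp [hs₀]) ?_ (by simp) ?_ ?_
    (by simp) ?_).mono le_rfl fun ρ₃ _ ⟨⟨s', m1, m2, m3, m4, m5⟩, m6⟩ =>
      ⟨s', m1, (c₂.frame (by norm_num) hfr).frame (by norm_num) m6,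
        (v₂.frame (by norm_num) (by decide) hfr).frame (by norm_num) (by decide) m6, m3, m2, m4, m5,
        ?_⟩⟩
  · have w : ∀ a, 2 ≤ a → a ≤ 7 → (ρ₂.setReg 60 L).arr a = fun _ => 0 := fun a h h' =>
      z₂ a (by omega) (by omega) (by omega)
    refine ⟨?_, ?_⟩
    · simp only [Fam, w 2 (by norm_num) (by norm_num), w 3 (by norm_num) (by norm_num),
        w 4 (by norm_num) (by norm_num)]
      exact famRep_zero _ (fun _ => rfl) fun r x => by simp [hs₀]
    · simp only [Fam, w 5 (by norm_num) (by norm_num), w 6 (by norm_num) (by norm_num),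
        w 7 (by norm_num) (by norm_num)]
      exact famRep_zero _ (fun _ => rfl) fun r x => by simp [hs₀]
  · exact v₂.supps.congr fun _ _ _ => rfl
  · exact fun j e he => hx.supp_subset (suppDigit_subset _ _ he)
  · intro e he; simp [hs₀] at he
  · intro w
    have : (ρ₂.setReg 60 L).arr 1 = fun _ => 0 :=
      z₂ 1 (by norm_num) (by norm_num) (by norm_num)
    rw [this]
    simp [hs₀]
  · intro j _
    have : (ρ₂.setReg 60 L).arr 12 = fun _ => 0 :=
      z₂ 12 (by norm_num) (by norm_num) (by norm_num)
    rw [this]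
  · intro s' hr
    have := InitStep.inv hG (η := 1 / K) (by positivity) hx hr
    exact (this.1.matching (by rw [this.2]; exact hx)).1
  · rw [m6.1 104 (by norm_num), reg_setReg, if_neg (by norm_num), f₂.1 104 (by norm_num), t₁]

/-! ### The sizes of the layers -/

section Sizes

variable {V : Type*} [Fintype V] [DecidableEq V]

theorem card_suppDigit_le {G : SimpleGraph V} {x : Sym2 V → ℝ} (hx : IsFractionalMatching G x)
    (i : ℕ) : (#(suppDigit x i) : ℝ) ≤ 2 ^ i * total x := by
  have h1 := sum_card_suppDigit hx i
  have h2 : (#(suppDigit x i) : ℝ) / 2 ^ i ≤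
      ∑ j ∈ range (i + 1), (#(suppDigit x j) : ℝ) / 2 ^ j :=
    single_le_sum (f := fun j => (#(suppDigit x j) : ℝ) / 2 ^ j) (fun j _ => by positivity)
      (by simp)
  have h3 : 0 ≤ (∑ e, Int.fract ((2 : ℝ) ^ i * x e)) / 2 ^ i :=
    div_nonneg (sum_nonneg fun e _ => Int.fract_nonneg _) (by positivity)
  rw [mul_comm, ← div_le_iff₀ (by positivity)]
  linarith

/-- Telescoping `upper` from level `L` downwards bounds `#(F i) / 2 ^ i` by the value of the digits,
at most `‖x‖`, plus rounding errors adding up to at most `1 ≤ 2 * ‖x‖`, plus counters of weight at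
most `3 / 4 * ‖x‖`. The bound `1 / 2 ≤ total s.x` is what absorbs the rounding errors. -/
theorem Inv.card_F_le {G : SimpleGraph V} {η : ℝ} (hη : 0 ≤ η) (hη1 : η ≤ 1) {L : ℕ} (hL : 1 ≤ L)
    {s : AlgState V} (h : Inv η L s) (hx : IsFractionalMatching G s.x) (hT : 1 / 2 ≤ total s.x)
    (i : ℕ) : (#(s.F i) : ℝ) ≤ 4 * 2 ^ i * total s.x := by
  have hT0 : 0 ≤ total s.x := by linarith
  rcases Nat.lt_or_ge L i with hi | hi
  · rw [h.F_high i hi.le, card_empty, Nat.cast_zero]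
    positivity
  have hL' : (1 : ℝ) ≤ L := by exact_mod_cast hL
  set q := η * total s.x / (4 * L) with hq
  have hq0 : 0 ≤ q := by positivity
  have hql : q * L = η * total s.x / 4 := by rw [hq]; field_simp
  have key : ∀ k ≤ L, (#(s.F (L - k)) : ℝ) / 2 ^ (L - k) ≤ total s.x -
      ∑ j ∈ range (L - k + 1), (#(suppDigit s.x j) : ℝ) / 2 ^ j + 1 / 2 ^ (L - k) + 3 * q * k := by
    intro k hk
    induction k with
    | zero =>
      have h1 := sum_card_suppDigit hx L
      have h3 : 0 ≤ (∑ e, Int.fract ((2 : ℝ) ^ L * s.x e)) / 2 ^ L :=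
        div_nonneg (sum_nonneg fun e _ => Int.fract_nonneg _) (by positivity)
      have h4 : (0 : ℝ) ≤ 1 / 2 ^ L := by positivity
      simp only [Nat.sub_zero, h.F_high L le_rfl, card_empty, Nat.cast_zero, zero_div, mul_zero]
      linarith
    | succ k ih =>
      obtain ⟨m, hm⟩ : ∃ m, m + 1 = L - k := ⟨L - k - 1, by omega⟩
      have ih := ih (by omega)
      rw [← hm] at ih
      rw [show L - (k + 1) = m by omega]
      have hu := h.upper m (by omega)
      have hc := h.c_le (i := m + 1) (by omega)
      rw [← hq] at hc
      have hu' : 2 * (#(s.F m) : ℝ) ≤ #(suppDigit s.x (m + 1)) + #(s.F (m + 1)) + 1 +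
          3 * s.c (m + 1) := by exact_mod_cast hu
      rw [sum_range_succ] at ih
      have hp : (2 : ℝ) ^ (m + 1) = 2 * 2 ^ m := by ring
      have e1 : (#(s.F m) : ℝ) / 2 ^ m ≤ (#(suppDigit s.x (m + 1)) : ℝ) / 2 ^ (m + 1) +
          (#(s.F (m + 1)) : ℝ) / 2 ^ (m + 1) + 1 / 2 ^ (m + 1) +
          3 * ((s.c (m + 1) : ℝ) / 2 ^ (m + 1)) := by
        rw [hp]
        have : (0 : ℝ) < 2 ^ m := by positivity
        rw [← sub_nonneg]
        have e2 : (#(suppDigit s.x (m + 1)) : ℝ) / (2 * 2 ^ m) +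
          (#(s.F (m + 1)) : ℝ) / (2 * 2 ^ m) + 1 / (2 * 2 ^ m) +
          3 * ((s.c (m + 1) : ℝ) / (2 * 2 ^ m)) - (#(s.F m) : ℝ) / 2 ^ m =
          (#(suppDigit s.x (m + 1)) + #(s.F (m + 1)) + 1 + 3 * s.c (m + 1) - 2 * (#(s.F m) : ℝ)) /
            (2 * 2 ^ m) := by field_simp
        rw [e2]
        exact div_nonneg (by linarith) (by positivity)
      have e3 : (1 : ℝ) / 2 ^ m = 1 / 2 ^ (m + 1) + 1 / 2 ^ (m + 1) := by
        rw [hp]; field_simp; norm_num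
      push_cast
      linarith
  have := key (L - i) (by omega)
  rw [show L - (L - i) = i by omega] at this
  have hS : (0 : ℝ) ≤ ∑ j ∈ range (i + 1), (#(suppDigit s.x j) : ℝ) / 2 ^ j :=
    sum_nonneg fun _ _ => by positivity
  have hk : ((L - i : ℕ) : ℝ) ≤ L := by exact_mod_cast Nat.sub_le _ _
  have h1 : 3 * q * ((L - i : ℕ) : ℝ) ≤ 3 / 4 * total s.x := by
    have : q * ((L - i : ℕ) : ℝ) ≤ q * L := by gcongr
    nlinarith
  have h2 : (1 : ℝ) / 2 ^ i ≤ 1 := by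
    rw [div_le_one (by positivity)]; exact one_le_pow₀ (by norm_num)
  have h4 : (#(s.F i) : ℝ) / 2 ^ i ≤ 4 * total s.x := by linarith
  rw [div_le_iff₀ (by positivity)] at h4
  linarith

/-- The sizes grow geometrically with the level, so the sum is of the order of its last term. -/
theorem costBelow_le {F S : ℕ → Finset (Sym2 V)} {a : ℝ} (ha : 1 ≤ a)
    (hF : ∀ j, (#(F j) : ℝ) ≤ a * 2 ^ j) (hS : ∀ j, (#(S j) : ℝ) ≤ a * 2 ^ j) (k : ℕ) :
    (2 * costBelow F S k + 80 * #(S 0) + 50 : ℕ) ≤ 40000 * a * 2 ^ k := by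
  have h1 : ∑ j ∈ range k, (4000 * (#(S (j + 1)) : ℝ) + 2000 * #(F j) + 4000) ≤
      14000 * a * 2 ^ k := by
    induction k with
    | zero => simp; positivity
    | succ k ih =>
      rw [sum_range_succ]
      have h2 := hS (k + 1)
      have h3 := hF k
      have h4 : (1 : ℝ) ≤ 2 ^ k := one_le_pow₀ (by norm_num)
      have h5 : (1 : ℝ) ≤ a * 2 ^ k := by nlinarith
      rw [pow_succ] at h2 ⊢
      linarith
  have h2 := hF k
  have h3 := hS 0
  have h4 : (1 : ℝ) ≤ 2 ^ k := one_le_pow₀ (by norm_num)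
  have h5 : a ≤ a * 2 ^ k := by nlinarith
  unfold costBelow
  push_cast
  rw [pow_zero] at h3
  linarith

theorem total_update (x : Sym2 V → ℝ) (e : Sym2 V) (ν : ℝ) :
    total (Function.update x e ν) + x e = total x + ν := by
  simp only [total]
  rw [sum_update_of_mem (mem_univ e), ← add_sum_erase univ x (mem_univ e), sdiff_singleton_eq_erase]
  ring

/-- The time of an update is bounded by the drop of the potential and an amortized cost. -/
theorem SweepCost.amortized {G : SimpleGraph V} {K L t : ℕ} (hK : 1 ≤ K) (hL : 1 ≤ L)
    {s s' : AlgState V} {e : Sym2 V} {ν : ℝ} (h0 : Inv (1 / K) L s)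
    (hx₀ : IsFractionalMatching G s.x) (hx : IsFractionalMatching G (Function.update s.x e ν))
    (hT₀ : 1 / 2 ≤ total s.x) (hT : 1 / 2 ≤ total (Function.update s.x e ν))
    (h : SweepCost (1 / K) L L { s with x := Function.update s.x e ν } s' t) :
    t + 200 * (L + 1) + 150 + 1920000 * K * L * ∑ j ∈ range (L + 1), s'.c j ≤
      1920000 * K * L * ∑ j ∈ range (L + 1), s.c j + 4000000 * (K * L ^ 2) := by
  obtain ⟨extra, drop, h1, h2, -, h3⟩ := h
  have hK' : (1 : ℝ) ≤ K := by exact_mod_cast hK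
  have hL' : (1 : ℝ) ≤ L := by exact_mod_cast hL
  -- With `T` the new value, the rebuilding costs at most `40000 * 12 * T * 2 ^ k`, and the
  -- threshold gives `2 ^ k * T ≤ 4 * K * L * drop`. The potential per counter is the product `40000
  -- * 12 * 4 * K * L`.
  have hextra : extra ≤ 1920000 * K * L * drop := by
    rcases h3 with rfl | ⟨k, -, h4, h5⟩
    · exact Nat.zero_le _
    simp only at h4 h5
    set T := total (Function.update s.x e ν) with hTdef
    have hνe : ν ≥ 0 := by simpa using hx.1 e
    -- The layers are bounded by the old value, the threshold by the new one. One update lowers the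
    -- value by at most `1 ≤ 2 * T`.
    have hT' : total s.x ≤ 3 * T := by
      have := total_update s.x e ν
      have := hx₀.le_one e
      linarith
    have hF : ∀ j, (#(s.F j) : ℝ) ≤ 12 * T * 2 ^ j := fun j => by
      have h6 := h0.card_F_le (G := G) (by positivity)
        (by rw [div_le_one (by positivity)]; exact hK') hL hx₀ hT₀ j
      have h7 : (0 : ℝ) < 2 ^ j := by positivity
      nlinarith
    have hS : ∀ j, (#(suppDigit (Function.update s.x e ν) j) : ℝ) ≤ 12 * T * 2 ^ j := fun j => by
      have h6 := card_suppDigit_le hx j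
      have h7 : (0 : ℝ) < 2 ^ j := by positivity
      nlinarith
    have h6 := costBelow_le (a := 12 * T) (by linarith) hF hS k
    have h7 : (extra : ℝ) ≤ 40000 * (12 * T) * 2 ^ k := le_trans (by exact_mod_cast h5) h6
    rw [zpow_sub₀ (by norm_num), zpow_natCast] at h4
    have h8 : (2 : ℝ) ^ k * T ≤ 4 * K * L * drop := by
      have e1 : (2 : ℝ) ^ k / 2 ^ (2 : ℤ) * (1 / K * T / L) = 2 ^ k * T / (4 * K * L) := by
        norm_num; field_simp
      rw [e1, div_lt_iff₀ (by positivity)] at h4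
      linarith
    have h9 : (extra : ℝ) ≤ 1920000 * K * L * drop := by linarith
    exact_mod_cast h9
  -- Raising `L + 1` counters costs at most `3840000 * (K * L ^ 2)` of potential; the remainder of
  -- `4000000 * (K * L ^ 2)` covers the work at each level.
  have h4 : 1920000 * K * L * (∑ j ∈ range (L + 1), s'.c j + drop) ≤
      1920000 * K * L * (∑ j ∈ range (L + 1), s.c j + (L + 1)) := Nat.mul_le_mul_left _ h2
  have h5 : L ≤ K * L ^ 2 := by nlinarith
  have h6 : K * L ≤ K * L ^ 2 := by nlinarith
  have h7 : K * L * (L + 1) ≤ 2 * (K * L ^ 2) := by nlinarith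
  nlinarith

end Sizes

/-! ### Truncation -/

section Truncation

variable {V : Type*} [Fintype V] [DecidableEq V]

theorem fix_div_le {y : ℝ} (hy : 0 ≤ y) (L : ℕ) : trunc L y ≤ y := by
  rw [trunc, fix, div_le_iff₀ (by positivity), mul_comm y]
  exact Nat.floor_le (by positivity)

theorem fix_le {y : ℝ} (hy : y ≤ 1) (L : ℕ) : fix L y ≤ 2 ^ L := by
  refine Nat.floor_le_of_le ?_
  push_cast
  exact mul_le_of_le_one_right (by positivity) hy

theorem sub_trunc {y : ℝ} (hy : 0 ≤ y) (L : ℕ) :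
    y - trunc L y = Int.fract ((2 : ℝ) ^ L * y) / 2 ^ L := by
  rw [trunc, fix, Int.fract, ← natCast_floor_eq_intCast_floor (by positivity)]
  field_simp

/-- Truncation preserves fractional matchings but may push entries below the known lower bound. The
implementation is therefore analysed through `Inv`, whose preservation only needs a fractional
matching. -/
theorem IsFractionalMatching.trunc {G : SimpleGraph V} {x : Sym2 V → ℝ}
    (hx : IsFractionalMatching G x) (L : ℕ) :
    IsFractionalMatching G fun e => trunc L (x e) := by
  refine ⟨fun e => by unfold DynRound.trunc; positivity, fun e he => ?_, fun v => ?_⟩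
  · simp [DynRound.trunc, fix, hx.2.1 e he]
  · exact (sum_le_sum fun e _ => fix_div_le (hx.1 e) L).trans (hx.2.2 v)

theorem supp_trunc_subset {G : SimpleGraph V} {x : Sym2 V → ℝ}
    (hx : IsFractionalMatching G x) (L : ℕ) : supp (fun e => trunc L (x e)) ⊆ supp x := by
  intro e he
  rw [mem_supp] at he ⊢
  exact he.trans_le (fix_div_le (hx.1 e) L)

theorem total_trunc {G : SimpleGraph V} {η δ : ℝ} (hη : 0 < η) (hδ : 0 < δ) {x : Sym2 V → ℝ}
    (hx : Promise G δ x) :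
    (1 - η / 2) * total x ≤ total fun e => trunc (layers η δ) (x e) := by
  have h1 := fract_loss_le hη hδ hx
  have h2 : total x - total (fun e => trunc (layers η δ) (x e)) =
      (∑ e, Int.fract ((2 : ℝ) ^ layers η δ * x e)) / 2 ^ layers η δ := by
    rw [total, total, ← sum_sub_distrib, sum_div]
    exact sum_congr rfl fun e _ => sub_trunc (hx.1.1 e) _
  linarith

/-- A state for the truncated vector holds a rounding of the vector itself. -/
theorem Inv.isRounding_trunc {G : SimpleGraph V} {η δ ε : ℝ} (hη : 0 < η) (hδ : 0 < δ)
    (hηε : 2 * η ≤ ε) {x : Sym2 V → ℝ} (hx : Promise G δ x) {s : AlgState V}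
    (h : Inv η (layers η δ) s) (hs : s.x = fun e => trunc (layers η δ) (x e)) :
    IsRounding ε x s.M := by
  have hy : IsFractionalMatching G s.x := hs ▸ hx.1.trunc _
  refine ⟨?_, (h.matching hy).1, ?_⟩
  · refine h.M_subset.trans ?_
    rw [hs]
    exact supp_trunc_subset hx.1 _
  have h3 := h.card_M hη.le (by unfold layers; omega) hy
  rw [sum_card_suppDigit hy] at h3
  -- A truncated vector has no digits beyond `L`, so the loss by truncation is incurred only once,
  -- in passing from `x` to `s.x`.
  have h4 : ∑ e, Int.fract ((2 : ℝ) ^ layers η δ * s.x e) = 0 := by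
    refine sum_eq_zero fun e _ => ?_
    have : s.x e = (fix (layers η δ) (x e) : ℝ) / 2 ^ layers η δ := congrFun hs e
    rw [this, mul_div_cancel₀ _ (by positivity), Int.fract_natCast]
  rw [h4, zero_div, sub_zero] at h3
  have h5 := total_trunc hη hδ hx
  rw [← hs] at h5
  have h6 := total_nonneg hx.1.1
  have h7 := total_nonneg hy.1
  have h8 : total s.x ≤ total x := by
    rw [hs]
    exact sum_le_sum fun e _ => fix_div_le (hx.1.1 e) _
  nlinarith

/-- Summing the constraints of all vertices counts every edge at least once. -/
theorem total_le_card {G : SimpleGraph V} {x : Sym2 V → ℝ} (hx : IsFractionalMatching G x) :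
    total x ≤ Fintype.card V := by
  calc total x ≤ ∑ e, ∑ v : V, if v ∈ e then x e else 0 := by
        refine sum_le_sum fun e _ => ?_
        induction e with | _ u w =>
        refine le_trans ?_ (single_le_sum (f := fun v => if v ∈ s(u, w) then x s(u, w) else 0)
          (fun v _ => ?_) (mem_univ u))
        · simp
        · split_ifs
          exacts [hx.1 _, le_rfl]
    _ = ∑ v : V, ∑ e with v ∈ e, x e := by
        rw [sum_comm]
        simp_rw [sum_filter]
    _ ≤ ∑ _v : V, 1 := sum_le_sum fun v _ => hx.2.2 v
    _ = _ := by simp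

theorem sum_le_of_isFractionalMatching {G : SimpleGraph V} {L : ℕ} {X : Sym2 V → ℕ}
    (hx : IsFractionalMatching G (ofFix L X)) : ∑ e, X e ≤ 2 ^ L * Fintype.card V := by
  have := total_le_card hx
  rw [total_ofFix, div_le_iff₀ (by positivity), mul_comm] at this
  exact_mod_cast this

/-- The thresholds keep the counters so small that they fit into memory cells. -/
theorem Inv.c_le_card {G : SimpleGraph V} {K L : ℕ} (hK : 1 ≤ K) (hL : 1 ≤ L) {s : AlgState V}
    (h : Inv (1 / K) L s) (hx : IsFractionalMatching G s.x) {j : ℕ} (hj : j ≤ L) :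
    s.c j ≤ 2 ^ L * Fintype.card V := by
  have h1 := h.c_le hj
  have h2 := total_le_card hx
  have h0 := total_nonneg hx.1
  have hK' : (1 : ℝ) ≤ K := by exact_mod_cast hK
  have hL' : (1 : ℝ) ≤ L := by exact_mod_cast hL
  have h3 : 1 / (K : ℝ) * total s.x / (4 * L) ≤ Fintype.card V := by
    refine le_trans ?_ h2
    rw [div_le_iff₀ (by positivity)]
    have : 1 / (K : ℝ) ≤ 1 := by rw [div_le_one (by positivity)]; exact hK'
    nlinarith
  have h4 : (s.c j : ℝ) ≤ 2 ^ L * Fintype.card V := by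
    rw [div_le_iff₀ (by positivity)] at h1
    refine h1.trans ?_
    rw [mul_comm]
    have : (2 : ℝ) ^ j ≤ 2 ^ L := pow_le_pow_right₀ (by norm_num) hj
    gcongr
  exact_mod_cast h4

end Truncation

/-! ### The input of the machine -/

theorem getD_flatMap_triple {α : Type*} (f g h : α → ℕ) (l : List α) (k : ℕ) (hk : k < l.length) :
    (l.flatMap fun p => [f p, g p, h p]).getD (k * 3) 0 = f l[k] ∧
    (l.flatMap fun p => [f p, g p, h p]).getD (k * 3 + 1) 0 = g l[k] ∧
    (l.flatMap fun p => [f p, g p, h p]).getD (k * 3 + 2) 0 = h l[k] := by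
  induction l generalizing k with
  | nil => simp at hk
  | cons a l ih =>
    cases k with
    | zero => simp
    | succ k =>
      have := ih k (by simpa using hk)
      simpa [add_mul, add_assoc] using this

theorem getD_lt {B : ℕ} (hB : 0 < B) {l : List ℕ} (h : ∀ a ∈ l, a < B) (i : ℕ) :
    l.getD i 0 < B := by
  rcases Nat.lt_or_ge i l.length with hi | hi
  · rw [List.getD_eq_getElem _ _ hi]
    exact h _ (List.getElem_mem _)
  · rwa [List.getD_eq_default _ _ hi]

theorem layers_one_div (K D : ℕ) : layers (1 / K) (1 / D) = 1 + Nat.clog 2 (K * D) := by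
  rw [layers, one_div, one_div, inv_inv, inv_inv, ← Real.natCeil_logb_natCast]
  push_cast
  rfl

/-- The bound for the contents of the cells. -/
theorem capacity {n K D L B : ℕ} (hn : 2 ≤ n) (hK : 3 ≤ K) (hD : 1 ≤ D)
    (hL : L = 1 + Nat.clog 2 (K * D)) (hB : B = 2 ^ (8 * Nat.clog 2 (n * K * D))) :
    Room B n (L + 1) ∧ K < B ∧ D < B ∧ K * D < B ∧ 2 ^ (L + 1) < B ∧ 4 * K * L * 2 ^ L < B ∧
      2 ^ L * n + 1 < B := by
  have hq : n * K * D ≤ 2 ^ Nat.clog 2 (n * K * D) := Nat.le_pow_clog (by norm_num) _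
  have hm : Nat.clog 2 (K * D) ≤ Nat.clog 2 (n * K * D) := by
    refine Nat.clog_mono_right 2 ?_
    rw [mul_assoc]
    exact Nat.le_mul_of_pos_left _ (by omega)
  have hp : 2 ^ L ≤ 2 * 2 ^ Nat.clog 2 (n * K * D) := by
    rw [hL, pow_add, pow_one]
    exact Nat.mul_le_mul_left _ (Nat.pow_le_pow_right (by norm_num) hm)
  have hLlt : L < 2 ^ L := Nat.lt_two_pow_self
  rw [mul_comm 8, pow_mul] at hB
  set Q := 2 ^ Nat.clog 2 (n * K * D) with hQ
  have hKD : K * D ≤ Q := by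
    refine le_trans ?_ hq
    rw [mul_assoc]
    exact Nat.le_mul_of_pos_left _ (by omega)
  have hKQ : K ≤ Q := (Nat.le_mul_of_pos_right _ (by omega)).trans hKD
  have hDQ : D ≤ Q := (Nat.le_mul_of_pos_left _ (by omega)).trans hKD
  have hnQ : n ≤ Q := by
    refine le_trans ?_ hq
    rw [mul_assoc]
    exact Nat.le_mul_of_pos_right _ (Nat.mul_pos (by omega) (by omega))
  have h6 : 6 ≤ Q := by
    refine le_trans ?_ hq
    calc 6 = 2 * 3 * 1 := rfl
      _ ≤ _ := Nat.mul_le_mul (Nat.mul_le_mul hn hK) hD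
  -- All quantities to be stored are `O(Q ^ 3)`, and `B = Q ^ 8`. Since `6 ^ 5 = 7776`, five of the
  -- eight factors already swallow every constant.
  have hB3 : 7000 * (Q * (Q * Q)) ≤ B := by
    rw [hB]
    calc 7000 * (Q * (Q * Q)) ≤ 6 ^ 5 * (Q * (Q * Q)) := Nat.mul_le_mul_right _ (by norm_num)
      _ ≤ Q ^ 5 * (Q * (Q * Q)) := Nat.mul_le_mul_right _ (Nat.pow_le_pow_left h6 5)
      _ = Q ^ 8 := by ring
  have hB2 : 6 * (Q * Q) ≤ Q * (Q * Q) := Nat.mul_le_mul_right _ h6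
  have hB1 : 6 * Q ≤ Q * Q := Nat.mul_le_mul_right _ h6
  have e1 : n * n ≤ Q * Q := Nat.mul_le_mul hnQ hnQ
  have e2 : (L + 1 + 1) * n ≤ (4 * Q) * Q := Nat.mul_le_mul (by omega) hnQ
  have e3 : K * L * 2 ^ L ≤ Q * (2 * Q) * (2 * Q) :=
    Nat.mul_le_mul (Nat.mul_le_mul hKQ (by omega)) hp
  have e4 : 2 ^ L * n ≤ 2 * Q * Q := Nat.mul_le_mul hp hnQ
  have e5 : 4 * Q * Q = 4 * (Q * Q) := by ring
  have e6 : Q * (2 * Q) * (2 * Q) = 4 * (Q * (Q * Q)) := by ring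
  have e7 : 2 * Q * Q = 2 * (Q * Q) := by ring
  have e8 : 4 * K * L * 2 ^ L = 4 * (K * L * 2 ^ L) := by ring
  rw [pow_succ]
  exact ⟨⟨by omega, by omega⟩, by omega, by omega, by omega, by omega, by omega, by omega⟩

theorem small_initInput {B n K D L : ℕ} {x : Sym2 (Fin n) → ℝ} {l : List (Fin n × Fin n)}
    (hn : n < B) (hK : K < B) (hD : D < B) (hl : l.length < B) (hx : ∀ e, x e ≤ 1)
    (hL : 2 ^ L < B) : Small B (initInput K D L x l) := by
  refine ⟨fun r => ?_, fun a i => ?_⟩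
  · simp only [initInput]
    split_ifs <;> omega
  · simp only [initInput]
    split_ifs
    · refine getD_lt (by omega) (fun a ha => ?_) i
      obtain ⟨p, -, hp⟩ := List.mem_flatMap.1 ha
      simp only [List.mem_cons, List.not_mem_nil, or_false] at hp
      have h1 := p.1.2
      have h2 := p.2.2
      have h3 := fix_le (hx s(p.1, p.2)) L
      rcases hp with rfl | rfl | rfl <;> omega
    · omega

/-- Dependent choice: one operation at a time yields a whole run in which each step is tied to its
predecessor. -/
theorem exists_sequence {α : Type*} {P : ℕ → α → Prop} {Q : ℕ → α → α → Prop} {a : α}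
    (h0 : P 0 a) (h : ∀ t a, P t a → ∃ b, P (t + 1) b ∧ Q t a b) :
    ∃ f : ℕ → α, f 0 = a ∧ ∀ t, P t (f t) ∧ Q t (f t) (f (t + 1)) := by
  choose g hg using h
  let f : ∀ t, {a // P t a} := fun t => Nat.rec (motive := fun t => {a // P t a}) ⟨a, h0⟩
    (fun t b => ⟨g t b.1 b.2, (hg t b.1 b.2).1⟩) t
  exact ⟨fun t => (f t).1, rfl, fun t => ⟨(f t).2, (hg t (f t).1 (f t).2).2⟩⟩

/-- A proper two-colouring. -/
theorem exists_side {V : Type*} {G : SimpleGraph V} (hG : G.IsBipartite) :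
    ∃ side : V → Bool, ∀ u v, G.Adj u v → side u ≠ side v := by
  obtain ⟨C⟩ := hG
  refine ⟨fun u => decide (C u = 0), fun u v h => ?_⟩
  have := C.valid h
  simp only [ne_eq, decide_eq_decide]
  omega

/-! ### The size of the parameters -/

/-- From `K ≤ 3 / ε` and `D ≤ 2 / δ` follows `K * D ≤ 4 * (2 / (ε * δ))`, whose logarithm is `2 + ℓ`
with `ℓ = Real.logb 2 (2 / (ε * δ))`. Two further units come from rounding up and from the extra
layer, and `ℓ ≥ 1` turns `4 + ℓ` into `5 * ℓ`. -/
theorem parameters_le {ε δ : ℝ} (hε : 0 < ε) (hε1 : ε < 1) (hδ : 0 < δ) (hδ1 : δ ≤ 1) :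
    (⌈2 / ε⌉₊ : ℝ) ≤ 3 * ε⁻¹ ∧
    ((1 + Nat.clog 2 (⌈2 / ε⌉₊ * ⌈1 / δ⌉₊) : ℕ) : ℝ) ≤ 5 * Real.logb 2 (2 / (ε * δ)) := by
  have h1 : (⌈2 / ε⌉₊ : ℝ) < 2 / ε + 1 := Nat.ceil_lt_add_one (by positivity)
  have h2 : (⌈1 / δ⌉₊ : ℝ) < 1 / δ + 1 := Nat.ceil_lt_add_one (by positivity)
  have h3 : 1 ≤ ε⁻¹ := (one_le_inv₀ hε).2 hε1.le
  have h4 : 1 ≤ δ⁻¹ := (one_le_inv₀ hδ).2 hδ1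
  have h5 : (⌈2 / ε⌉₊ : ℝ) ≤ 3 * ε⁻¹ := by
    have : 2 / ε = 2 * ε⁻¹ := div_eq_mul_inv _ _
    linarith
  have h6 : (⌈1 / δ⌉₊ : ℝ) ≤ 2 * δ⁻¹ := by
    have : 1 / δ = δ⁻¹ := one_div _
    linarith
  refine ⟨h5, ?_⟩
  have h0 : 0 < (⌈2 / ε⌉₊ * ⌈1 / δ⌉₊ : ℝ) := by
    have h7 : 0 < ⌈2 / ε⌉₊ := Nat.ceil_pos.2 (by positivity)
    have h8 : 0 < ⌈1 / δ⌉₊ := Nat.ceil_pos.2 (by positivity)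
    positivity
  have h7 : (⌈2 / ε⌉₊ * ⌈1 / δ⌉₊ : ℝ) ≤ 4 * (2 / (ε * δ)) := by
    calc (⌈2 / ε⌉₊ * ⌈1 / δ⌉₊ : ℝ) ≤ (3 * ε⁻¹) * (2 * δ⁻¹) := by gcongr
      _ = 6 * (ε⁻¹ * δ⁻¹) := by ring
      _ ≤ 8 * (ε⁻¹ * δ⁻¹) := by gcongr; norm_num
      _ = _ := by rw [div_eq_mul_inv, mul_inv]; ring
  have hpos : 0 < 2 / (ε * δ) := by positivity
  have hl : 1 ≤ Real.logb 2 (2 / (ε * δ)) := by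
    rw [Real.le_logb_iff_rpow_le (by norm_num) hpos, Real.rpow_one, le_div_iff₀ (by positivity)]
    nlinarith
  have h8 : Real.logb 2 (⌈2 / ε⌉₊ * ⌈1 / δ⌉₊ : ℝ) ≤ 2 + Real.logb 2 (2 / (ε * δ)) := by
    refine (Real.logb_le_logb_of_le (by norm_num) h0 h7).trans (le_of_eq ?_)
    rw [Real.logb_mul (by norm_num) hpos.ne']
    congr 1
    rw [Real.logb_eq_iff_rpow_eq (by norm_num) (by norm_num) (by norm_num)]
    norm_num
  have h9 : ((Nat.clog 2 (⌈2 / ε⌉₊ * ⌈1 / δ⌉₊) : ℕ) : ℝ) <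
      Real.logb 2 (⌈2 / ε⌉₊ * ⌈1 / δ⌉₊ : ℝ) + 1 := by
    rw [← Real.natCeil_logb_natCast]
    push_cast
    refine Nat.ceil_lt_add_one (Real.logb_nonneg (by norm_num) ?_)
    have h7 : 1 ≤ ⌈2 / ε⌉₊ := Nat.ceil_pos.2 (by positivity)
    have h8 : 1 ≤ ⌈1 / δ⌉₊ := Nat.ceil_pos.2 (by positivity)
    exact_mod_cast Nat.mul_le_mul h7 h8
  push_cast
  linarith

/-! ### Running the two programs -/

theorem fix_update {V : Type*} [DecidableEq V] (L : ℕ) (x : Sym2 V → ℝ) (e : Sym2 V) (ν : ℝ) :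
    (fun e' => fix L (Function.update x e ν e')) =
      Function.update (fun e' => fix L (x e')) e (fix L ν) := by
  ext e'
  simp only [Function.update_apply]
  split_ifs <;> rfl

/-- The memory between two operations. -/
structure Between {n : ℕ} (B L K : ℕ) (x : Sym2 (Fin n) → ℝ) (s : AlgState (Fin n)) (σ : Config) :
    Prop where
  small : Small B σ
  mem : Mem L K (fun e => fix L (x e)) s σ
  inv : Inv (1 / K) L s

theorem exec_init {n K D L B : ℕ} {G : SimpleGraph (Fin n)} {x : Sym2 (Fin n) → ℝ}
    {l : List (Fin n × Fin n)} (hG : G.IsBipartite) (hn : 2 ≤ n) (hK : 3 ≤ K) (hD : 1 ≤ D)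
    (hL : L = 1 + Nat.clog 2 (K * D)) (hB : B = 2 ^ (8 * Nat.clog 2 (n * K * D)))
    (hx : IsFractionalMatching G x) (hnd : (l.map fun p => s(p.1, p.2)).Nodup)
    (hl : ∀ e, e ∈ (l.map fun p => s(p.1, p.2)) ↔ e ∈ supp x) :
    ∃ τ σ s, (∀ w, B ^ 16 ≤ 2 ^ w → Exec w initCmd (initInput K D L x l) τ σ) ∧
      Between B L K x s σ ∧ InitStep L (fun e => trunc L (x e)) s ∧
      τ ≤ 20000 * (L * (#(supp x) + 1)) := by
  obtain ⟨c1, c2, c3, c4, c5, c6, c7⟩ := capacity hn hK hD hL hB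
  obtain ⟨side, hside⟩ := exists_side hG
  have hlen : l.length = #(supp x) := by
    have : (l.map fun p => s(p.1, p.2)).toFinset = supp x := by
      ext e; rw [List.mem_toFinset, hl]
    rw [← this, List.toFinset_card_of_nodup hnd, List.length_map]
  have hnn := card_le_sq (supp x)
  have hB1 := c1.1
  have hn1 : n ≤ n * n := Nat.le_mul_self n
  have hsm : Small B (initInput K D L x l) := small_initInput (by omega) c2 c3 (by omega) hx.le_one
    ((Nat.pow_lt_pow_right (by norm_num) (Nat.lt_succ_self L)).trans c5)
  have hfm : IsFractionalMatching G (ofFix L fun e => fix L (x e)) := hx.trunc L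
  have hsum := sum_le_of_isFractionalMatching hfm
  rw [Fintype.card_fin] at hsum
  obtain ⟨τ, σ, h1, h2, h3, s, h4, h5⟩ := initCmd_runs (l := l) (X := fun e => fix L (x e))
    (σ := initInput K D L x l) c1 hside hG hL c4
    c5 c6 (by omega) hfm (by simp [initInput]) (by simp [initInput]) (by simp [initInput])
    (by simp [initInput]) (by simp [initInput]) (fun a ha i => by simp [initInput, ha])
    (fun k hk => by
      simp only [initInput, if_true]
      exact getD_flatMap_triple _ _ _ l k hk)
    (fun e he => by
      rw [hl, mem_supp]
      by_contra h
      exact he (by simp [fix, le_antisymm (not_lt.1 h) (hx.1 e)])) hsm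
  refine ⟨τ, σ, s, h1, ⟨h3, h5, (InitStep.inv hG (by positivity) hfm h4).1⟩, h4, h2.trans ?_⟩
  have hS : ∀ j, #(suppDigit (ofFix L fun e => fix L (x e)) j) ≤ #(supp x) := fun j =>
    card_le_card ((suppDigit_subset _ _).trans (supp_trunc_subset hx L))
  have hc : costBelow (fun _ => (∅ : Finset (Sym2 (Fin n))))
      (suppDigit (ofFix L fun e => fix L (x e))) L ≤ 4000 * (L * (#(supp x) + 1)) + 20 := by
    have : ∑ j ∈ range L, (4000 * #(suppDigit (ofFix L fun e => fix L (x e)) (j + 1)) + 4000) ≤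
        ∑ _j ∈ range L, 4000 * (#(supp x) + 1) := sum_le_sum fun j _ => by
      have := hS (j + 1); omega
    rw [sum_const, card_range, smul_eq_mul, mul_left_comm] at this
    simp only [costBelow, card_empty, mul_zero, zero_add, add_zero]
    omega
  have h0 := hS 0
  have hL1 : 1 ≤ L := by omega
  rw [hlen]
  have e1 : #(supp x) + 1 ≤ L * (#(supp x) + 1) := Nat.le_mul_of_pos_left _ hL1
  have e2 : (200 * (L + 1) + 100) * #(supp x) ≤ 500 * (L * (#(supp x) + 1)) := by nlinarith
  have e3 : L ≤ L * (#(supp x) + 1) := Nat.le_mul_of_pos_right _ (by omega)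
  omega

theorem exec_update {n K D L B : ℕ} {G : SimpleGraph (Fin n)} {x : Sym2 (Fin n) → ℝ}
    {u v : Fin n} {ν : ℝ} {σ : Config} {s : AlgState (Fin n)} (hG : G.IsBipartite) (hn : 2 ≤ n)
    (hK : 3 ≤ K) (hD : 1 ≤ D) (hL : L = 1 + Nat.clog 2 (K * D))
    (hB : B = 2 ^ (8 * Nat.clog 2 (n * K * D))) (hx : IsFractionalMatching G x)
    (hx' : IsFractionalMatching G (Function.update x s(u, v) ν))
    (hT : 1 / 2 ≤ total fun e => trunc L (x e))
    (hT' : 1 / 2 ≤ total fun e => trunc L (Function.update x s(u, v) ν e))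
    (h : Between B L K x s σ) :
    ∃ τ σ' s', (∀ w, B ^ 16 ≤ 2 ^ w → Exec w updateCmd (updateInput L σ u v ν) τ σ') ∧
      Between B L K (Function.update x s(u, v) ν) s' σ' ∧
      UpdateStep (1 / K) L s(u, v) (trunc L ν) s s' ∧
      τ + 1920000 * K * L * ∑ j ∈ range (L + 1), s'.c j ≤
        1920000 * K * L * ∑ j ∈ range (L + 1), s.c j + 4000000 * (K * L ^ 2) := by
  obtain ⟨c1, -, -, -, c5, -, c7⟩ := capacity hn hK hD hL hB
  obtain ⟨side, hside⟩ := exists_side hG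
  have hB1 := c1.1
  have hn1 : n ≤ n * n := Nat.le_mul_self n
  have hL1 : 1 ≤ L := by omega
  have hν : ν ≤ 1 := by simpa using hx'.le_one s(u, v)
  have hpow : 2 ^ L < B := (Nat.pow_lt_pow_right (by norm_num) (Nat.lt_succ_self L)).trans c5
  have hsm : Small B (updateInput L σ u v ν) :=
    ((h.small.setReg (u.2.trans (by omega))).setReg (v.2.trans (by omega))).setReg
      ((fix_le hν L).trans_lt hpow)
  have hfm : IsFractionalMatching G s.x := h.mem.x_eq ▸ hx.trunc L
  have hfm' : IsFractionalMatching G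
      (ofFix L (Function.update (fun e => fix L (x e)) s(u, v) (fix L ν))) := by
    rw [← fix_update]; exact hx'.trunc L
  have hsum := sum_le_of_isFractionalMatching hfm'
  have hc : ∀ j ≤ L, s.c j + 1 < B := fun j hj => by
    have := h.inv.c_le_card (G := G) (by omega) hL1 hfm hj
    rw [Fintype.card_fin] at this
    omega
  rw [Fintype.card_fin] at hsum
  obtain ⟨τ, σ', h1, h2, s', h3, h4, t', h5, h6⟩ := updateCmd_runs (G := G) (f := fix L ν) (u := u)
    (v := v) (σ := updateInput L σ u v ν) c1 hside hG (by omega) hL1 h.inv hfm hfm' hc (by omega)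
    (h.mem.congr rfl fun r hr => by
      simp only [updateInput, reg_setReg]
      rw [if_neg (by omega), if_neg (by omega), if_neg (by omega)])
    (by simp [updateInput, reg_setReg]) (by simp [updateInput, reg_setReg])
    (by simp [updateInput, reg_setReg]) hsm
  have hxe : ofFix L (Function.update (fun e => fix L (x e)) s(u, v) (fix L ν)) =
      Function.update s.x s(u, v) (trunc L ν) := by
    rw [ofFix_update, h.mem.x_eq]; rfl
  have hfm'' : IsFractionalMatching G (Function.update s.x s(u, v) (trunc L ν)) := hxe ▸ hfm'
  refine ⟨τ, σ', s', h1, ⟨h2, by rw [fix_update]; exact h4,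
    (h3.inv hG (by positivity) h.inv hfm'').1⟩, h3, ?_⟩
  rw [hxe] at h6
  have h7 := SweepCost.amortized (by omega) hL1 h.inv hfm hfm'' (by rw [h.mem.x_eq]; exact hT)
    (by rw [← hxe, ← fix_update]; exact hT') h6
  omega

end DynRound

/-! ### The main theorem -/

theorem theorem3p2 :
    -- The algorithm is a dynamic bipartite matching rounding algorithm.
    (∀ (V : Type*) [Fintype V] [DecidableEq V] (G : SimpleGraph V) (ε δ : ℝ),
      G.IsBipartite → 0 < ε → ε < 1 → 0 < δ → δ ≤ 1 →
      ∀ s : AlgState V, Reachable G (ε / 2) δ s → IsRounding ε s.x s.M) ∧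
    -- It has a deterministic implementation with the claimed running times.
    ∃ (initProg updateProg : Cmd) (b : ℕ) (C : ℝ),
      ∀ (n : ℕ) (G : SimpleGraph (Fin n)) (ε δ : ℝ),
        G.IsBipartite → 0 < ε → ε < 1 → 0 < δ → δ ≤ 1 →
        ∀ (x : ℕ → Sym2 (Fin n) → ℝ) (u v : ℕ → Fin n) (ν : ℕ → ℝ),
          (∀ t, Promise G δ (x t) ∧ 1 ≤ total (x t)) →
          (∀ t, G.Adj (u t) (v t) ∧ x (t + 1) = Function.update (x t) s(u t, v t) (ν t)) →
          ∀ l : List (Fin n × Fin n),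
            (l.map fun p => s(p.1, p.2)).Nodup →
            (∀ e, e ∈ (l.map fun p => s(p.1, p.2)) ↔ e ∈ supp (x 0)) →
            ∀ K D L w : ℕ, K = ⌈2 / ε⌉₊ → D = ⌈1 / δ⌉₊ → L = layers (1 / K) (1 / D) →
              w = b * Nat.clog 2 (n * K * D) →
              ∃ (σ : ℕ → Config) (τ : ℕ → ℕ) (s : ℕ → AlgState (Fin n)),
                Exec w initProg (initInput K D L (x 0) l) (τ 0) (σ 0) ∧
                (∀ t, Exec w updateProg (updateInput L (σ t) (u t) (v t) (ν t))
                  (τ (t + 1)) (σ (t + 1))) ∧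
                InitStep L (fun e => trunc L (x 0 e)) (s 0) ∧
                (∀ t, UpdateStep (1 / K) L s(u t, v t) (trunc L (ν t)) (s t) (s (t + 1))) ∧
                (∀ t, Stores (σ t) (s t).M ∧ IsRounding ε (x t) (s t).M) ∧
                (τ 0 : ℝ) ≤ C * ((supp (x 0)).card * Real.logb 2 (2 / (ε * δ))) ∧
                ∀ t, ∑ k ∈ range t, (τ (k + 1) : ℝ) ≤
                  t * (C * (ε⁻¹ * Real.logb 2 (2 / (ε * δ)) ^ 2)) := by
  -- Cells have `8 * Nat.clog 2 (n * K * D)` bits and expressions have degree at most `16`, hence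
  -- words of `8 * 16 = 128` times the logarithm.
  refine ⟨fun V _ _ G ε δ hG hε _ hδ _ s hs => hs.isRounding hG hε hδ,
    initCmd, updateCmd, 128, 1000000000, ?_⟩
  intro n G ε δ hG hε hε1 hδ hδ1 x u v ν hx hupd l hnd hl K D L w hK hD hL hw
  have hn : 2 ≤ n := by
    have h1 := (u 0).2
    have h2 := (v 0).2
    have h3 : (u 0 : ℕ) ≠ v 0 := fun h => (hupd 0).1.ne (Fin.ext h)
    omega
  have hK3 : 3 ≤ K := by
    rw [hK]
    refine Nat.succ_le_of_lt (Nat.lt_ceil.2 ?_)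
    rw [lt_div_iff₀ hε]
    push_cast
    linarith
  have hD1 : 1 ≤ D := by rw [hD]; exact Nat.ceil_pos.2 (by positivity)
  obtain ⟨hKε, hLε⟩ := parameters_le hε hε1 hδ hδ1
  rw [← hK, ← hD] at hLε
  rw [← hK] at hKε
  have hL' := hL
  rw [layers_one_div] at hL'
  rw [← hL'] at hLε
  have hK0 : (0 : ℝ) < K := by exact_mod_cast (by omega : 0 < K)
  have hD0 : (0 : ℝ) < D := by exact_mod_cast (by omega : 0 < D)
  have hKε2 : 2 * (1 / (K : ℝ)) ≤ ε := by
    have : 2 / ε ≤ K := hK ▸ Nat.le_ceil _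
    rw [div_le_iff₀ hε] at this
    rw [mul_one_div, div_le_iff₀ hK0]
    linarith
  have hDδ : 1 / (D : ℝ) ≤ δ := by
    have : 1 / δ ≤ D := hD ▸ Nat.le_ceil _
    rw [div_le_iff₀ hδ] at this
    rw [div_le_iff₀ hD0]
    linarith
  have hprom : ∀ t, Promise G (1 / D) (x t) := fun t =>
    ⟨(hx t).1.1, fun e he => hDδ.trans ((hx t).1.2 e he)⟩
  -- Truncation keeps at least half of a value that is at least one; this is the form in which the
  -- promise `1 ≤ total (x t)` enters the time analysis.
  have hT : ∀ t, 1 / 2 ≤ total fun e => trunc L (x t e) := fun t => by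
    have h1 := total_trunc (η := 1 / K) (by positivity) (show (0 : ℝ) < 1 / D by positivity)
      (hprom t)
    rw [← hL] at h1
    have h2 := (hx t).2
    nlinarith
  obtain ⟨B, hB⟩ : ∃ B, B = 2 ^ (8 * Nat.clog 2 (n * K * D)) := ⟨_, rfl⟩
  have hBw : B ^ 16 ≤ 2 ^ w := by
    rw [hB, hw, ← pow_mul]
    exact Nat.pow_le_pow_right (by norm_num) (by omega)
  obtain ⟨τ₀, σ₀, s₀, i1, i2, i3, i4⟩ := exec_init hG hn hK3 hD1 hL' hB (hx 0).1.1 hnd hl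
  obtain ⟨f, hf0, hf⟩ := exists_sequence (α := Config × ℕ × AlgState (Fin n))
    (P := fun t a => Between B L K (x t) a.2.2 a.1)
    (Q := fun t a b => Exec w updateCmd (updateInput L a.1 (u t) (v t) (ν t)) b.2.1 b.1 ∧
      UpdateStep (1 / K) L s(u t, v t) (trunc L (ν t)) a.2.2 b.2.2 ∧
      b.2.1 + 1920000 * K * L * ∑ j ∈ range (L + 1), b.2.2.c j ≤
        1920000 * K * L * ∑ j ∈ range (L + 1), a.2.2.c j + 4000000 * (K * L ^ 2))
    (a := (σ₀, τ₀, s₀)) i2 fun t a ha => by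
      have e := (hupd t).2
      obtain ⟨τ', σ', s', g1, g2, g3, g4⟩ := exec_update (u := u t) (v := v t) (ν := ν t) hG hn hK3
        hD1 hL' hB (hx t).1.1 (e ▸ (hx (t + 1)).1.1) (hT t) (e ▸ hT (t + 1)) ha
      exact ⟨(σ', τ', s'), e ▸ g2, g1 w hBw, g3, g4⟩
  have hℓ : 0 ≤ Real.logb 2 (2 / (ε * δ)) := by
    have : (0 : ℝ) ≤ L := Nat.cast_nonneg _
    linarith
  refine ⟨fun t => (f t).1, fun t => (f t).2.1, fun t => (f t).2.2, ?_, fun t => (hf t).2.1, ?_,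
    fun t => (hf t).2.2.1, fun t => ⟨(hf t).1.mem.mates, ?_⟩, ?_, fun t => ?_⟩
  · simp only [hf0]; exact i1 w hBw
  · simp only [hf0]; exact i3
  · have := (hf t).1.inv
    rw [hL] at this
    exact this.isRounding_trunc (by positivity) (by positivity) hKε2 (hprom t)
      (by rw [(hf t).1.mem.x_eq, ← hL]; rfl)
  · simp only [hf0]
    -- The support is nonempty because the value is at least one, so the additive `1` in the time of
    -- `exec_init` can be absorbed.
    have hS : 1 ≤ #(supp (x 0)) := by
      by_contra h
      have h0 : supp (x 0) = ∅ := card_eq_zero.1 (by omega)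
      have h1 : total (x 0) ≤ 0 := sum_nonpos fun e _ => by
        by_contra h2
        have : e ∈ supp (x 0) := mem_supp.2 (not_le.1 h2)
        simp [h0] at this
      linarith [(hx 0).2]
    have h1 : (τ₀ : ℝ) ≤ 20000 * (L * (#(supp (x 0)) + 1)) := by exact_mod_cast i4
    have h2 : (1 : ℝ) ≤ #(supp (x 0)) := by exact_mod_cast hS
    calc (τ₀ : ℝ) ≤ 20000 * (L * (#(supp (x 0)) + 1)) := h1
      _ ≤ 20000 * (5 * Real.logb 2 (2 / (ε * δ)) * (#(supp (x 0)) + #(supp (x 0)))) := by gcongr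
      _ = 200000 * (#(supp (x 0)) * Real.logb 2 (2 / (ε * δ))) := by ring
      _ ≤ _ := by gcongr; norm_num
  -- The amortized inequalities telescope, and the potential starts at zero because the
  -- initialization resets all counters.
  · have key : ∑ k ∈ range t, (f (k + 1)).2.1 +
        1920000 * K * L * ∑ j ∈ range (L + 1), (f t).2.2.c j ≤ t * (4000000 * (K * L ^ 2)) := by
      induction t with
      | zero =>
        have : ∑ j ∈ range (L + 1), s₀.c j = 0 := sum_eq_zero fun j hj =>
          (Rebuild.c_eq i3).1 j (by have := mem_range.1 hj; omega)
        simp [hf0, this]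
      | succ t ih =>
        have := (hf t).2.2.2
        rw [sum_range_succ, add_mul, one_mul]
        omega
    have h1 : (∑ k ∈ range t, ((f (k + 1)).2.1 : ℝ)) ≤ t * (4000000 * (K * L ^ 2)) := by
      exact_mod_cast (Nat.le_add_right _ _).trans key
    calc _ ≤ (t : ℝ) * (4000000 * (K * L ^ 2)) := h1
      _ ≤ t * (4000000 * (3 * ε⁻¹ * (5 * Real.logb 2 (2 / (ε * δ))) ^ 2)) := by gcongr
      _ = t * (300000000 * (ε⁻¹ * Real.logb 2 (2 / (ε * δ)) ^ 2)) := by ring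
      _ ≤ _ := by gcongr; norm_num
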